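/- **Setting.** Let $\Theta\subseteq\mathbb R^m$ be open and convex. Let $\rho^{\mathfrak a}_\theta,\rho^{\mathfrak b}_\theta$ ($\theta\in\Theta$) be density operators on separable Hilbert spaces $\mathcal H_{\mathfrak a},\mathcal H_{\mathfrak b}$, and $\rho_\theta=\rho^{\mathfrak a}_\theta\otimes\rho^{\mathfrak b}_\theta$ on $\mathcal H=\mathcal H_{\mathfrak a}\otimes\mathcal H_{\mathfrak b}$. Assume that $\partial_i\rho_\theta$ and $\partial_i\partial_j\rho_\theta$ exist in trace norm, are locally uniformly continuous on $\Theta$ in trace norm, and have trace norms bounded on $\Theta$. Let $G$ be a real symmetric positive semidefinite $m\times m$ matrix. **Estimators.** For a model $\sigma=\{\sigma_\theta\}_{\theta\in\Theta}$ of states on a Hilbert space, an estimator $\mathcal E$ is a POVM $M$ with data $\omega$ in some $\mathbb R^l$ together with a measurable function $T$ of the data with values in $\mathbb R^m$. Under $\theta$ the data have the law $\operatorname{tr}\sigma_\theta M(d\omega)$, and $\mathrm E_\theta$ is the expectation. Put $$\mathrm{MSE}_\theta[\mathcal E]_{ij}=\mathrm E_\theta(T^i-\theta^i)(T^j-\theta^j),\quad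 \mathrm V_\theta[\mathcal E]_{ij}=\mathrm E_\theta(T^i-\mathrm E_\theta T^i)(T^j-\mathrm E_\theta T^j),\quad B_\theta[\mathcal E]^i_j=\partial_j\mathrm E_\theta[T^i].$$ The estimator satisfies (E) if for every $\theta\in\Theta$: (i) $\int\|T-\theta\|^2\operatorname{tr}\sigma_\theta M(d\omega)<\infty$; (ii) for every $i$ there are $\delta>0$ and a positive trace class operator $\Diamond$ with $-\Diamond\le\partial_i\sigma_{\theta'}\le\Diamond$ for all $\theta'=\theta+te_i\in\Theta$ with $|t|<\delta$, and $\int\|T-\theta\|\operatorname{tr}\Diamond M(d\omega)<\infty$. **Measurements.** An LOCC measurement on $\mathcal H^{\otimes n}$ consists of finitely many steps. In each step either Alice, who holds $\mathcal H_{\mathfrak a}^{\otimes n}$, or Bob, who holds $\mathcal H_{\mathfrak b}^{\otimes n}$, applies to her or his own system an instrument (with data in some $\mathbb R^l$) that depends measurably on all data obtained before. A semi-classical LOCC measurement is defined in the same way with $2n$ parties: each step acts only on Alice's share or only on Bob's share of a single one of the $n$ samples. **Bounds.** Let $C^{Q,L}_\theta(G)$ be the infimum of $\limsup_{n\to\infty}n\operatorname{Tr}G\,\mathrm{MSE}_\theta[\mathcal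 E_n]$ over all sequences of estimators $\mathcal E_n$ of $\{\rho_\eta^{\otimes n}\}_{\eta\in\Theta}$ with LOCC measurements that satisfy (E) for all $n$ and are asymptotically unbiased, i.e. $\mathrm E_\eta[T_n]\to\eta$ and $B_\eta[\mathcal E_n]\to\mathbf 1$ for all $\eta\in\Theta$. Let $C^L_\theta(G)$ be the same infimum over the sequences with semi-classical LOCC measurements. (Infima over the empty set are $+\infty$.) **Marginal models.** For $x=\mathfrak a,\mathfrak b$ let $\Pi^x_\theta$ be the orthogonal projector of $\mathbb R^m$ onto the orthogonal complement of $\{v:\sum_i v^i\partial_i\rho^x_\theta=0\}$, and let $\mathcal V^x_{\theta,n}$ be the set of all $\mathrm V_\theta[\mathcal E]$, where $\mathcal E$ is an estimator of $\{(\rho^x_\eta)^{\otimes n}\}_{\eta\in\Theta}$ with (E) and $B_\theta[\mathcal E]=\Pi^x_\theta$. **Theorem.** For every $\theta\in\Theta$, with $(\cdot)^{-1}$ denoting the Moore–Penrose generalized inverse, $$C^L_\theta(G)\ \ge\ \inf\Big\{\operatorname{Tr}G\big(\Pi^{\mathfrak a}_\theta V_{\mathfrak a}^{-1}\Pi^{\mathfrak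 a}_\theta+\Pi^{\mathfrak b}_\theta V_{\mathfrak b}^{-1}\Pi^{\mathfrak b}_\theta\big)^{-1}:\ V_x\in\mathcal V^x_{\theta,1},\ x=\mathfrak a,\mathfrak b\Big\},$$ and the following limit exists in $[0,\infty]$ and satisfies $$C^{Q,L}_\theta(G)\ \ge\ \lim_{n\to\infty}\inf\Big\{n\operatorname{Tr}G\big(\Pi^{\mathfrak a}_\theta V_{\mathfrak a}^{-1}\Pi^{\mathfrak a}_\theta+\Pi^{\mathfrak b}_\theta V_{\mathfrak b}^{-1}\Pi^{\mathfrak b}_\theta\big)^{-1}:\ V_x\in\mathcal V^x_{\theta,n},\ x=\mathfrak a,\mathfrak b\Big\}.$$ -/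

import Mathlib

open Filter Topology MeasureTheory
open scoped Matrix Kronecker ENNReal ComplexOrder

noncomputable section

namespace QEst

/-! ### Operators on separable Hilbert spaces

A separable Hilbert space with a fixed complete orthonormal basis indexed by the countable type `I`
is `ℓ²(I)`; operators are identified with their (possibly infinite) matrices in that basis.
The tensor product of `ℓ²(I)` and `ℓ²(J)` is `ℓ²(I × J)`, the `n`-th tensor power of `ℓ²(I)` is
`ℓ²(Fin n → I)`. -/

/-- Matrices of operators on `ℓ²(I)`. -/
abbrev Op (I : Type) := Matrix I I ℂ

/-- Positive trace class operators: positive semidefinite with summable diagonal. -/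
def IsPosTC {I : Type} (A : Op I) : Prop := A.PosSemidef ∧ Summable fun i => A i i

/-- The trace class `τc(ℓ²(I))`: the linear span of the positive trace class operators. -/
def TC (I : Type) : Submodule ℂ (Op I) := Submodule.span ℂ {A | IsPosTC A}

/-- The trace. -/
def tr {I : Type} (A : Op I) : ℂ := ∑' i, A i i

/-- Density operators. -/
def IsState {I : Type} (A : Op I) : Prop := A.PosSemidef ∧ HasSum (fun i => A i i) 1

/-- The trace `tr (A M) = ∑ᵢ (A M)ᵢᵢ`, for `A` trace class and `M` bounded. -/
def trMul {I : Type} (A M : Op I) : ℂ := ∑' i, ∑' j, A i j * M j i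

/-- The trace norm of a self-adjoint operator: the least `tr P + tr N` over all decompositions
`A = P - N` into positive trace class operators. The minimum is attained by the positive and the
negative part of `A`, so that this is `tr |A|`; it is `∞` if `A` is not trace class. -/
def traceNorm {I : Type} (A : Op I) : ℝ≥0∞ :=
  ⨅ (P : Op I) (N : Op I) (_ : IsPosTC P) (_ : IsPosTC N) (_ : A = P - N),
    ENNReal.ofReal (tr P + tr N).re

/-- The `n`-th tensor power of an operator. -/
def tensorPow {I : Type} (A : Op I) (n : ℕ) : Op (Fin n → I) :=
  Matrix.of fun i j => ∏ k, A (i k) (j k)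

/-- For a splitting `ℓ²(K) = ℓ²(L) ⊗ ℓ²(E)`, the block `(a, b)` of `X`, an operator on `ℓ²(L)`. -/
def block {K L E : Type} (e : K ≃ L × E) (X : Op K) (a b : E) : Op L :=
  Matrix.of fun i j => X (e.symm (i, a)) (e.symm (j, b))

theorem posSemidef_of_finite {L : Type} {Y : Op L}
    (h : ∀ s : Finset L, (Y.submatrix (Subtype.val : s → L) Subtype.val).PosSemidef) :
    Y.PosSemidef := by
  classical
  constructor
  · ext i j
    have := (h {i, j}).1.apply ⟨i, by simp⟩ ⟨j, by simp⟩
    simpa [Matrix.conjTranspose_apply] using this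
  · intro x
    have h2 := (h x.support).dotProduct_mulVec_nonneg (fun i : x.support => x i)
    have : (x.sum fun i xi => x.sum fun j xj => star xi * Y i j * xj) =
        star (fun i : x.support => x (i : L)) ⬝ᵥ
          ((Y.submatrix (Subtype.val : x.support → L) Subtype.val) *ᵥ fun i : x.support => x (i : L)) := by
      simp only [Finsupp.sum, dotProduct, Matrix.mulVec, Matrix.submatrix_apply, Pi.star_apply,
        Finset.mul_sum]
      rw [← Finset.sum_coe_sort x.support]
      refine Finset.sum_congr rfl fun i _ => ?_
      rw [← Finset.sum_coe_sort x.support]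
      exact Finset.sum_congr rfl fun j _ => by ring
    rw [this]
    exact h2

/-- The compression of `X` to the vectors `φ ⊗ (e_a + c e_b)`. -/
theorem isPosTC_compress {K L E : Type} (e : K ≃ L × E) {X : Op K} (hX : IsPosTC X) (a b : E)
    (c : ℂ) :
    IsPosTC (block e X a a + c • block e X a b + star c • block e X b a
      + (star c * c) • block e X b b) := by
  classical
  constructor
  · refine posSemidef_of_finite fun s => ?_
    let f : s × Fin 2 → K := fun p => e.symm (p.1, if p.2 = 0 then a else b)
    let C : Matrix (s × Fin 2) s ℂ :=
      Matrix.of fun p j => if p.1 = j then (if p.2 = 0 then 1 else c) else 0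
    have h := (hX.1.submatrix f).conjTranspose_mul_mul_same C
    convert h using 1
    ext i j
    simp only [Matrix.mul_apply, Fintype.sum_prod_type, Fin.sum_univ_two, C, f, block,
      Matrix.conjTranspose_apply, Matrix.submatrix_apply, Matrix.of_apply, Matrix.add_apply,
      Matrix.smul_apply, smul_eq_mul]
    simp [Finset.sum_add_distrib, apply_ite star, ite_mul, mul_ite]
    ring
  · have hd : ∀ u : E, Summable fun i => block e X u u i i := fun u =>
      hX.2.comp_injective (i := fun i : L => e.symm (i, u)) fun i j h => by simpa using h
    have key : ∀ i, ‖block e X a b i i‖ ≤ ‖block e X a a i i‖ + ‖block e X b b i i‖ ∧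
        ‖block e X b a i i‖ ≤ ‖block e X a a i i‖ + ‖block e X b b i i‖ := by
      intro i
      have h2 := hX.1.submatrix (fun p : Fin 2 => e.symm (i, if p = 0 then a else b))
      have hdet := h2.det_nonneg
      rw [Matrix.det_fin_two] at hdet
      have hh := hX.1.1.apply (e.symm (i, b)) (e.symm (i, a))
      have p0 : 0 ≤ X (e.symm (i, a)) (e.symm (i, a)) := hX.1.diag_nonneg
      have p1 : 0 ≤ X (e.symm (i, b)) (e.symm (i, b)) := hX.1.diag_nonneg
      simp only [Matrix.submatrix_apply] at hdet
      simp only [block, Matrix.of_apply]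
      simp at hdet
      set u := X (e.symm (i, a)) (e.symm (i, a))
      set v := X (e.symm (i, b)) (e.symm (i, b))
      set z := X (e.symm (i, a)) (e.symm (i, b))
      set w := X (e.symm (i, b)) (e.symm (i, a))
      have hw : w = star z := hh.symm
      have hzn : ‖w‖ = ‖z‖ := by rw [hw, norm_star]
      have hu : u = (‖u‖ : ℂ) := by
        rw [Complex.norm_of_nonneg' p0]
      have hv : v = (‖v‖ : ℂ) := by
        rw [Complex.norm_of_nonneg' p1]
      have hz : z * w = ((‖z‖ ^ 2 : ℝ) : ℂ) := by
        rw [hw]; simpa using Complex.mul_conj' z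
      rw [hz, hu, hv] at hdet
      have hre : ‖z‖ ^ 2 ≤ ‖u‖ * ‖v‖ := by exact_mod_cast hdet
      rw [hzn]
      have : ‖z‖ ≤ ‖u‖ + ‖v‖ := by
        nlinarith [norm_nonneg u, norm_nonneg v, norm_nonneg z]
      exact ⟨this, this⟩
    have hn : Summable fun i => ‖block e X a a i i‖ + ‖block e X b b i i‖ :=
      (hd a).norm.add (hd b).norm
    have hab : Summable fun i => block e X a b i i :=
      Summable.of_norm_bounded hn fun i => (key i).1
    have hba : Summable fun i => block e X b a i i :=
      Summable.of_norm_bounded hn fun i => (key i).2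
    simpa using (((hd a).add (hab.mul_left c)).add (hba.mul_left (star c))).add
      ((hd b).mul_left (star c * c))

/-- Blocks of trace class operators are trace class. -/
theorem block_mem {K L E : Type} (e : K ≃ L × E) {X : Op K} (hX : X ∈ TC K) (a b : E) :
    block e X a b ∈ TC L := by
  induction hX using Submodule.span_induction with
  | mem X hX =>
    have hc : ∀ c : ℂ, block e X a a + c • block e X a b + star c • block e X b a
        + (star c * c) • block e X b b ∈ TC L := fun c =>
      Submodule.subset_span (isPosTC_compress e hX a b c)
    have h1 := hc 1
    have h2 := hc (-1)
    have h3 := hc Complex.I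
    have h4 := hc (-Complex.I)
    have := (TC L).smul_mem (1 / 4 : ℂ) ((TC L).add_mem ((TC L).sub_mem h1 h2)
      ((TC L).smul_mem (-Complex.I) ((TC L).sub_mem h3 h4)))
    convert this using 1
    ext i j
    simp
    linear_combination ((1 / 2 : ℂ) * block e X a b i j
      - (1 / 2 : ℂ) * block e X b a i j) * Complex.I_mul_I
  | zero => exact (TC L).zero_mem
  | add X Y _ _ h1 h2 => exact (TC L).add_mem h1 h2
  | smul c X _ h => exact (TC L).smul_mem c h

/-! ### Measurements -/

/-- `Φ ⊗ id` on `ℓ²(K) = ℓ²(L) ⊗ ℓ²(E)` for a linear map `Φ` of `τc(ℓ²(L))`: it acts block by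
block. -/
def ampl {K L E : Type} (e : K ≃ L × E) (Φ : TC L →ₗ[ℂ] TC L) (X : TC K) : Op K :=
  Matrix.of fun p q =>
    (Φ ⟨block e X.1 (e p).2 (e q).2, block_mem e X.2 _ _⟩ : Op L) (e p).1 (e q).1

/-- Complete positivity. -/
def IsCP {L : Type} (Φ : TC L →ₗ[ℂ] TC L) : Prop :=
  ∀ (k : ℕ) (X : TC (L × Fin k)), IsPosTC (X : Op (L × Fin k)) →
    (ampl (Equiv.refl (L × Fin k)) Φ X).PosSemidef

/-- Instruments on `ℓ²(L)` with data in `Ω`: maps from measurable sets to completely positive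
maps of the trace class, strongly `σ`-additive, and trace preserving on the whole space.
(It is enough to require strong `σ`-additivity on positive operators, which span.) -/
structure Instrument (L Ω : Type) [MeasurableSpace Ω] where
  map : Set Ω → TC L →ₗ[ℂ] TC L
  cp : ∀ Δ, MeasurableSet Δ → IsCP (map Δ)
  trace_preserving : ∀ A : TC L, tr (map Set.univ A : Op L) = tr (A : Op L)
  sigma_additive : ∀ f : ℕ → Set Ω, (∀ k, MeasurableSet (f k)) →
    Pairwise (fun j k => Disjoint (f j) (f k)) → ∀ A : TC L, IsPosTC (A : Op L) →
    Tendsto (fun n => traceNorm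
      ((map (⋃ k, f k) A : Op L) - ∑ k ∈ Finset.range n, (map (f k) A : Op L))) atTop (𝓝 0)

/-- Positive operator valued measures on `ℓ²(I)` with data in `Ω`. For the bounded increasing
sequences that occur here, weak convergence is convergence of all matrix entries. -/
structure POVM (I Ω : Type) [MeasurableSpace Ω] where
  effect : Set Ω → Op I
  pos : ∀ Δ, MeasurableSet Δ → (effect Δ).PosSemidef
  univ_diag : ∀ i, effect Set.univ i i = 1
  univ_offDiag : ∀ i j, i ≠ j → effect Set.univ i j = 0
  sigma_additive : ∀ f : ℕ → Set Ω, (∀ k, MeasurableSet (f k)) →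
    Pairwise (fun j k => Disjoint (f j) (f k)) → ∀ i j,
    HasSum (fun k => effect (f k) i j) (effect (⋃ k, f k) i j)

open scoped Classical in
/-- The measure `Δ ↦ tr A M(Δ)`, for a positive trace class operator `A`. It is the law of the
data if `A` is a state. -/
def law {I Ω : Type} [MeasurableSpace Ω] (M : POVM I Ω) (A : Op I) : Measure Ω :=
  if h : ∃ μ : Measure Ω, ∀ Δ, MeasurableSet Δ →
      μ Δ = ENNReal.ofReal (trMul A (M.effect Δ)).re then h.choose else 0

/-! ### Measurements by local operations and classical communication -/

/-- A local party: a splitting of `ℓ²(K)` into the local system and its environment. -/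
structure LocalSite (K : Type) where
  L : Type
  E : Type
  split : K ≃ L × E

/-- The data of the first `r` steps, with data in `ℝˡ` at each step. -/
abbrev Data (r l : ℕ) := Fin r → Fin l → ℝ

/-- `P` and `σ` are the laws of the data and the a posteriori states of the adaptive process that
starts from the state `τ` and whose step number `r` (`r < R`) applies, on the site `s r`, the
instrument `N r h` chosen according to the previous data `h`:
`∫_{A × Δ} σ_{r+1} dP_{r+1} = ∫_A (N_r^h[Δ] ⊗ id)(σ_r(h)) dP_r(h)`. -/
structure IsRun {K : Type} {l : ℕ} (R : ℕ) (s : ℕ → LocalSite K)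
    (N : ∀ r, Data r l → Instrument (s r).L (Fin l → ℝ)) (τ : Op K)
    (P : ∀ r, Measure (Data r l)) (σ : ∀ r, Data r l → TC K) : Prop where
  prob : ∀ r, r ≤ R → IsProbabilityMeasure (P r)
  state : ∀ r, r ≤ R → ∀ h, IsState (σ r h : Op K)
  meas : ∀ r, r ≤ R → ∀ i j, Measurable fun h => (σ r h : Op K) i j
  init : ∀ h, (σ 0 h : Op K) = τ
  step : ∀ r, r < R → ∀ (A : Set (Data r l)) (Δ : Set (Fin l → ℝ)),
    MeasurableSet A → MeasurableSet Δ → ∀ i j,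
    ∫ h in {h : Data (r + 1) l | (fun q : Fin r => h q.castSucc) ∈ A ∧ h (Fin.last r) ∈ Δ},
      (σ (r + 1) h : Op K) i j ∂(P (r + 1)) =
    ∫ h in A, ampl (s r).split ((N r h).map Δ) (σ r h) i j ∂(P r)

/-- `M` is the POVM of a measurement that is composed of finitely many steps. At each step, one
of the sites in `S` applies an instrument on its own system which depends measurably on all the
data obtained so far (by all the sites). -/
def IsLOCC {K : Type} (S : Set (LocalSite K)) {R l : ℕ} (M : POVM K (Data R l)) : Prop :=
  ∃ (s : ℕ → LocalSite K) (N : ∀ r, Data r l → Instrument (s r).L (Fin l → ℝ)),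
    (∀ r, r < R → s r ∈ S) ∧
    (∀ r, r < R → ∀ Δ, MeasurableSet Δ → ∀ A i j,
      Measurable fun h => ((N r h).map Δ A : Op (s r).L) i j) ∧
    ∀ τ : Op K, IsState τ →
      ∃ (P : ∀ r, Measure (Data r l)) (σ : ∀ r, Data r l → TC K), IsRun R s N τ P σ ∧
        ∀ Δ, MeasurableSet Δ → P R Δ = ENNReal.ofReal (trMul τ (M.effect Δ)).re

/-- Alice, who holds her shares of all `n` samples. -/
def aliceAll (I J : Type) (n : ℕ) : LocalSite (Fin n → I × J) where
  L := Fin n → I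
  E := Fin n → J
  split := Equiv.arrowProdEquivProdArrow (Fin n) (fun _ => I) fun _ => J

/-- Bob, who holds his shares of all `n` samples. -/
def bobAll (I J : Type) (n : ℕ) : LocalSite (Fin n → I × J) where
  L := Fin n → J
  E := Fin n → I
  split := (Equiv.arrowProdEquivProdArrow (Fin n) (fun _ => I) fun _ => J).trans
    (Equiv.prodComm _ _)

/-- Alice's share of the sample number `k`. -/
def aliceOne (I J : Type) (n : ℕ) (k : Fin n) : LocalSite (Fin n → I × J) where
  L := I
  E := J × ({q : Fin n // q ≠ k} → I × J)
  split := (Equiv.funSplitAt k (I × J)).trans (Equiv.prodAssoc _ _ _)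

/-- Bob's share of the sample number `k`. -/
def bobOne (I J : Type) (n : ℕ) (k : Fin n) : LocalSite (Fin n → I × J) where
  L := J
  E := I × ({q : Fin n // q ≠ k} → I × J)
  split := ((Equiv.funSplitAt k (I × J)).trans
    (Equiv.prodCongr (Equiv.prodComm _ _) (Equiv.refl _))).trans (Equiv.prodAssoc _ _ _)

/-- The two parties of LOCC measurements on `n` samples. -/
def collectiveSites (I J : Type) (n : ℕ) : Set (LocalSite (Fin n → I × J)) :=
  {aliceAll I J n, bobAll I J n}

/-- The `2n` parties of semi-classical LOCC measurements on `n` samples: the samples are measured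
separately, and each of them by local operations of Alice and Bob. -/
def separateSites (I J : Type) (n : ℕ) : Set (LocalSite (Fin n → I × J)) :=
  Set.range (aliceOne I J n) ∪ Set.range (bobOne I J n)

/-! ### Quantum statistical models -/

/-- The parameter space `ℝᵐ`. -/
abbrev Par (m : ℕ) := EuclideanSpace ℝ (Fin m)

/-- The `i`-th unit vector. -/
abbrev unitVec {m : ℕ} (i : Fin m) : Par m := EuclideanSpace.single i (1 : ℝ)

variable {m : ℕ} {I Ω : Type} [MeasurableSpace Ω]

/-- The matrix of the partial derivative `∂ᵢ ρ_θ`. -/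
def pd (ρ : Par m → Op I) (i : Fin m) (θ : Par m) : Op I :=
  Matrix.of fun k l => deriv (fun t : ℝ => ρ (θ + t • unitVec i) k l) 0

/-- The partial derivative `∂ᵢ ρ_θ` exists with respect to the trace norm. -/
def HasPD (ρ : Par m → Op I) (i : Fin m) (θ : Par m) : Prop :=
  Tendsto (fun t : ℝ => traceNorm (t⁻¹ • (ρ (θ + t • unitVec i) - ρ θ) - pd ρ i θ))
    (𝓝[≠] 0) (𝓝 0)

/-- Local uniform continuity on `Θ` with respect to the trace norm. -/
def LocUnifCont (Θ : Set (Par m)) (F : Par m → Op I) : Prop :=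
  ∀ θ ∈ Θ, ∃ U ∈ 𝓝 θ, ∀ ε : ℝ≥0∞, 0 < ε → ∃ δ > 0, ∀ x ∈ U ∩ Θ, ∀ y ∈ U ∩ Θ,
    dist x y < δ → traceNorm (F x - F y) < ε

/-- The regularity condition on models: the first and second partial derivatives exist with
respect to the trace norm, are locally uniformly continuous, and have bounded trace norms. -/
structure RegularModel (Θ : Set (Par m)) (ρ : Par m → Op I) : Prop where
  hasPD : ∀ θ ∈ Θ, ∀ i, HasPD ρ i θ
  hasPD₂ : ∀ θ ∈ Θ, ∀ i j, HasPD (pd ρ j) i θ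
  cont : ∀ i, LocUnifCont Θ (pd ρ i)
  cont₂ : ∀ i j, LocUnifCont Θ (pd (pd ρ j) i)
  bounded : ∃ a : ℝ, ∀ θ ∈ Θ, ∀ i j, traceNorm (pd ρ i θ) ≤ ENNReal.ofReal a ∧
    traceNorm (pd (pd ρ j) i θ) ≤ ENNReal.ofReal a

/-- The projector `Π_θ` onto the orthogonal complement of `{v | ∑ᵢ vᵢ ∂ᵢ ρ_θ = 0}` in `ℝᵐ`. -/
def identProj (ρ : Par m → Op I) (θ : Par m) : Matrix (Fin m) (Fin m) ℝ :=
  let Z : Submodule ℝ (Par m) :=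
    { carrier := {v | ∑ i, v i • pd ρ i θ = 0}
      zero_mem' := by simp
      add_mem' := fun {v w} hv hw => by
        simp only [Set.mem_ofPred_eq] at hv hw ⊢
        simp [add_smul, Finset.sum_add_distrib, hv, hw]
      smul_mem' := fun c v hv => by
        simp only [Set.mem_ofPred_eq] at hv ⊢
        simp [mul_smul, ← Finset.smul_sum, hv] }
  Matrix.of fun i j => (Zᗮ.starProjection (unitVec j)) i

/-! ### Estimators

An estimator is a pair of a POVM `M` and a function `T` from the data to `ℝᵐ`. -/

/-- `E_θ[Tⁱ]`. -/
def mean (ρ : Par m → Op I) (M : POVM I Ω) (T : Ω → Par m) (θ : Par m) (i : Fin m) : ℝ :=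
  ∫ ω, T ω i ∂(law M (ρ θ))

/-- The mean square error matrix. -/
def mse (ρ : Par m → Op I) (M : POVM I Ω) (T : Ω → Par m) (θ : Par m) :
    Matrix (Fin m) (Fin m) ℝ :=
  Matrix.of fun i j => ∫ ω, (T ω i - θ i) * (T ω j - θ j) ∂(law M (ρ θ))

/-- The variance matrix `V_θ`. -/
def var (ρ : Par m → Op I) (M : POVM I Ω) (T : Ω → Par m) (θ : Par m) :
    Matrix (Fin m) (Fin m) ℝ :=
  Matrix.of fun i j =>
    ∫ ω, (T ω i - mean ρ M T θ i) * (T ω j - mean ρ M T θ j) ∂(law M (ρ θ))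

/-- The matrix `B_θ` of the derivatives `∂ⱼ E_θ[Tⁱ]`. -/
def biasMat (ρ : Par m → Op I) (M : POVM I Ω) (T : Ω → Par m) (θ : Par m) :
    Matrix (Fin m) (Fin m) ℝ :=
  Matrix.of fun i j => deriv (fun t : ℝ => mean ρ M T (θ + t • unitVec j) i) 0

/-- The regularity condition on estimators: at every `θ ∈ Θ`, the second moment is finite and,
for every `i`, `‖T - θ‖` has finite integral against `tr D M(dω)` for some positive trace class
operator `D` with `-D ≤ ∂ᵢ ρ ≤ D` on the points of `Θ` on a segment around `θ` in direction `i`.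
For regular models it makes `E_θ[T]` differentiable. -/
def RegularEst (Θ : Set (Par m)) (ρ : Par m → Op I) (M : POVM I Ω) (T : Ω → Par m) : Prop :=
  ∀ θ ∈ Θ,
    (∀ i, ∃ (δ : ℝ) (D : Op I), 0 < δ ∧ IsPosTC D ∧
      (∀ t : ℝ, |t| < δ → θ + t • unitVec i ∈ Θ →
        (D - pd ρ i (θ + t • unitVec i)).PosSemidef ∧
        (D + pd ρ i (θ + t • unitVec i)).PosSemidef) ∧
      Integrable (fun ω => ‖T ω - θ‖) (law M D)) ∧
    Integrable (fun ω => ‖T ω - θ‖ ^ 2) (law M (ρ θ))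

/-- The variance matrices at `θ` of the regular estimators of the model `ρ` with data in some
`ℝˡ` and with `B_θ = Q`. -/
def variances (Θ : Set (Par m)) (ρ : Par m → Op I) (Q : Matrix (Fin m) (Fin m) ℝ) (θ : Par m) :
    Set (Matrix (Fin m) (Fin m) ℝ) :=
  {V | ∃ (l : ℕ) (M : POVM I (Fin l → ℝ)) (T : (Fin l → ℝ) → Par m), Measurable T ∧
    RegularEst Θ ρ M T ∧ biasMat ρ M T θ = Q ∧ V = var ρ M T θ}

/-- The asymptotic Cramér-Rao type bound for the weight `G` and the measurements on `n` samples
that are composed of local operations on the sites in `S n`: the infimum of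
`limsup n Tr G MSE_θ` over the asymptotically unbiased sequences of regular estimators. -/
def crBound (S : ∀ n : ℕ, Set (LocalSite (Fin n → I))) (Θ : Set (Par m)) (ρ : Par m → Op I)
    (G : Matrix (Fin m) (Fin m) ℝ) (θ : Par m) : EReal :=
  sInf {c | ∃ (R l : ℕ → ℕ) (M : ∀ n, POVM (Fin n → I) (Data (R n) (l n)))
    (T : ∀ n, Data (R n) (l n) → Par m),
    (∀ n, IsLOCC (S n) (M n)) ∧ (∀ n, Measurable (T n)) ∧
    (∀ n, RegularEst Θ (fun η => tensorPow (ρ η) n) (M n) (T n)) ∧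
    (∀ η ∈ Θ, ∀ i, Tendsto (fun n => mean (fun η => tensorPow (ρ η) n) (M n) (T n) η i)
      atTop (𝓝 (η i))) ∧
    (∀ η ∈ Θ, ∀ i j,
      Tendsto (fun n => biasMat (fun η => tensorPow (ρ η) n) (M n) (T n) η i j)
        atTop (𝓝 ((1 : Matrix (Fin m) (Fin m) ℝ) i j))) ∧
    c = limsup (fun n : ℕ => (((n : ℝ) *
      (G * mse (fun η => tensorPow (ρ η) n) (M n) (T n) θ).trace : ℝ) : EReal)) atTop}

variable {J : Type}

/-- `C^{Q,L}_θ(G)`: collective measurements on the samples, LOCC between Alice and Bob. -/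
def collectiveLOCCBound (Θ : Set (Par m)) (ρ : Par m → Op (I × J))
    (G : Matrix (Fin m) (Fin m) ℝ) (θ : Par m) : EReal :=
  crBound (collectiveSites I J) Θ ρ G θ

/-- `C^L_θ(G)`: semi-classical measurements on the samples, LOCC between Alice and Bob. -/
def semiclassicalLOCCBound (Θ : Set (Par m)) (ρ : Par m → Op (I × J))
    (G : Matrix (Fin m) (Fin m) ℝ) (θ : Par m) : EReal :=
  crBound (separateSites I J) Θ ρ G θ

/-- The generalized (Moore-Penrose) inverse of a symmetric real matrix: the eigenvalues are
inverted, with `0⁻¹ = 0`. -/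
def pinv (A : Matrix (Fin m) (Fin m) ℝ) : Matrix (Fin m) (Fin m) ℝ := cfc (fun x : ℝ => x⁻¹) A

theorem pinv_spec {A : Matrix (Fin m) (Fin m) ℝ} (hA : A.IsHermitian) :
    A * pinv A * A = A ∧ pinv A * A * pinv A = pinv A ∧ (A * pinv A).IsHermitian ∧
      (pinv A * A).IsHermitian := by
  have hA' : IsSelfAdjoint A := hA
  have hc : ∀ f : ℝ → ℝ, ContinuousOn f (spectrum ℝ A) := fun f =>
    (Matrix.finite_real_spectrum (A := A)).continuousOn f
  have h0 : cfc (fun x : ℝ => x) A = A := cfc_id' ℝ A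
  have e1 : A * pinv A = cfc (fun x : ℝ => x * x⁻¹) A := by
    rw [cfc_mul _ _ A (hc _) (hc _), h0, pinv]
  have e2 : pinv A * A = cfc (fun x : ℝ => x⁻¹ * x) A := by
    rw [cfc_mul _ _ A (hc _) (hc _), h0, pinv]
  refine ⟨?_, ?_, ?_, ?_⟩
  · rw [e1]
    nth_rewrite 2 [← h0]
    rw [← cfc_mul _ _ A (hc _) (hc _)]
    simpa using h0
  · rw [e2, pinv, ← cfc_mul _ _ A (hc _) (hc _)]
    congr 1
    ext x
    by_cases hx : x = 0 <;> simp [hx]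
  · rw [e1]; exact cfc_predicate _ A
  · rw [e2]; exact cfc_predicate _ A

/-- The infimum of `Tr G (Πᵃ Vₐ⁻¹ Πᵃ + Πᵇ V_b⁻¹ Πᵇ)⁻¹` over the variance matrices `Vₐ`, `V_b` of the
regular estimators with `B_θ = Πᵃ`, `B_θ = Πᵇ` in `n` copies of the two marginal models; the
inverses are generalized inverses. -/
def marginalInf (Θ : Set (Par m)) (ρa : Par m → Op I) (ρb : Par m → Op J)
    (G : Matrix (Fin m) (Fin m) ℝ) (θ : Par m) (n : ℕ) : EReal :=
  sInf {c | ∃ Va ∈ variances Θ (fun η => tensorPow (ρa η) n) (identProj ρa θ) θ,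
    ∃ Vb ∈ variances Θ (fun η => tensorPow (ρb η) n) (identProj ρb θ) θ,
    c = (((G * pinv (identProj ρa θ * pinv Va * identProj ρa θ +
      identProj ρb θ * pinv Vb * identProj ρb θ)).trace : ℝ) : EReal)}

end QEst

end

/-!
The proof compares estimators through the pairs `(B, W)` of the derivative of the mean and of the
variance at the fixed parameter `θ`. For a state `S` and derivatives `X j`, `Adm S X` is the set of
the pairs that are attained by measurements with finitely many outcomes. It depends on the model
only through `S` and `X`, it is closed under linear changes of the estimator, mixtures, added noise
and averages over independent copies, and the pair of every regular estimator lies in its closure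
(`momentPair_mem_closure_Adm`). Conversely, every pair in `Adm` belongs to a regular estimator of a
model whose derivatives are locally dominated (`mem_variances_of_Adm`).

The central fact is that LOCC measurements on a product state contribute additively. Decompose a
bounded function `T` of the data into its martingale increments along the steps of the measurement,
and collect the increments of the steps that are performed at each site. The increments are
orthogonal, so that the variance of `T` is the sum of the variances of these contributions. The
derivative of the state at a site does not see the increments of the steps at the other sites:
along the run a product state stays a product state, hence the conditional law of such a step
does not depend on the state at the site under consideration (`RatioStable`,
`signedInt_eq_zero_of_ratioStable`). So the pair of an LOCC estimator is a sum of pairs that are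
attained locally (`IsLOCC.exists_momentPair_eq_sum`, and `RegularEst.mem_closure_sum_sites` for
regular estimators). For semi-classical measurements on `n` samples the `n` contributions of each
of Alice and Bob can moreover be replaced by one measurement on a single sample, chosen at random
among `n`, at the cost of a factor `n` in the variance (`Adm.sum_mix`).

It remains to minimise the trace of `G (Wₐ + W_b)` over sums of admissible pairs with `Bₐ + B_b =
1`. Completing the square bounds it below by the generalized inverse of the sum of the information
matrices `Bᵀ W⁻¹ B`. After mixing with a fixed estimator with derivative `Π`, with a small weight
`p`, the inverse of each of them is the variance of an estimator with derivative `Π`; an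
asymptotically vanishing bias costs a term that tends to zero (`le_trace_of_mem_closure_sumAdm`).
The limit in the collective bound exists because optimal estimators for `n` copies can be repeated
on blocks, so that it is the infimum over `n` of the terms of the sequence
(`tendsto_mul_marginalInf`).
-/

noncomputable section

namespace QEst

/-! ### Double sums of matrices dominated by a summable diagonal -/

theorem posSemidef_sum_nonneg {I : Type} {H : Op I} (hH : H.PosSemidef) (s : Finset I)
    (d : I → ℂ) : 0 ≤ ∑ i ∈ s, ∑ j ∈ s, star (d i) * H i j * d j := by
  have h2 := (hH.submatrix (Subtype.val : s → I)).dotProduct_mulVec_nonneg (fun i : s => d i)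
  convert h2 using 1
  simp only [dotProduct, Matrix.mulVec, Matrix.submatrix_apply, Pi.star_apply, Finset.mul_sum]
  rw [← Finset.sum_coe_sort s]
  refine Finset.sum_congr rfl fun i _ => ?_
  rw [← Finset.sum_coe_sort s]
  exact Finset.sum_congr rfl fun j _ => by ring

open scoped Classical in
/-- `0 ≤ H ≤ diag a` with a summable diagonal `a`. -/
structure DiagDom {I : Type} (H : Op I) (a : I → ℝ) : Prop where
  pos : H.PosSemidef
  le : (Matrix.diagonal (fun i => (a i : ℂ)) - H).PosSemidef
  summable : Summable a

/-- The sum of the entries of `H` over the rectangle `u × t`. -/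
def rectSum {I : Type} (H : Op I) (u t : Finset I) : ℂ := ∑ i ∈ u, ∑ j ∈ t, H i j

open scoped Classical in
/-- The expansion of a sesquilinear form at a combination of two indicator vectors. -/
theorem sum_sum_two_indicators {I : Type} (f : I → I → ℂ) (u t : Finset I) (c z : ℂ) :
    (∑ i ∈ u ∪ t, ∑ j ∈ u ∪ t,
        star ((if i ∈ u then c else 0) + if i ∈ t then z else 0) * f i j *
          ((if j ∈ u then c else 0) + if j ∈ t then z else 0)) =
      star c * c * (∑ i ∈ u, ∑ j ∈ u, f i j) + star c * z * (∑ i ∈ u, ∑ j ∈ t, f i j)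
        + star z * c * (∑ i ∈ t, ∑ j ∈ u, f i j) + star z * z * ∑ i ∈ t, ∑ j ∈ t, f i j := by
  have e3 : ∀ v w : Finset I, ∀ α β : ℂ, v ⊆ u ∪ t → w ⊆ u ∪ t →
      ∑ i ∈ u ∪ t, ∑ j ∈ u ∪ t, (if i ∈ v then α else 0) * f i j * (if j ∈ w then β else 0) =
        α * β * ∑ i ∈ v, ∑ j ∈ w, f i j := by
    intro v w α β hv hw
    simp only [ite_mul, mul_ite, zero_mul, mul_zero, Finset.sum_ite_irrel, Finset.sum_const_zero,
      Finset.sum_ite_mem, Finset.inter_eq_right.2 hv, Finset.inter_eq_right.2 hw, Finset.mul_sum]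
    exact Finset.sum_congr rfl fun i _ => Finset.sum_congr rfl fun j _ => by ring
  rw [← e3 u u _ _ (by simp) (by simp), ← e3 u t _ _ (by simp) (by simp),
    ← e3 t u _ _ (by simp) (by simp), ← e3 t t _ _ (by simp) (by simp)]
  simp only [← Finset.sum_add_distrib]
  refine Finset.sum_congr rfl fun i _ => Finset.sum_congr rfl fun j _ => ?_
  rw [star_add, apply_ite star, apply_ite star, star_zero]
  ring

namespace DiagDom

variable {I : Type} {H : Op I} {a : I → ℝ}

theorem nonneg (h : DiagDom H a) (i : I) : 0 ≤ a i := by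
  classical
  have h1 : 0 ≤ H i i := h.pos.diag_nonneg
  have h2 : 0 ≤ (Matrix.diagonal (fun i => (a i : ℂ)) - H) i i := h.le.diag_nonneg
  have := add_nonneg h1 h2
  simpa using this

/-- The Cauchy-Schwarz inequality for the positive form `H`, at two indicator vectors. -/
theorem norm_rectSum_sq_le (h : DiagDom H a) (u t : Finset I) :
    ‖rectSum H u t‖ ^ 2 ≤ (∑ i ∈ u, a i) * ∑ i ∈ t, a i := by
  classical
  set q := rectSum H u t with hq
  have hstar : rectSum H t u = star q := by
    rw [hq, rectSum, rectSum]
    refine Finset.sum_comm.trans ?_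
    rw [star_sum]
    refine Finset.sum_congr rfl fun i _ => ?_
    rw [star_sum]
    exact Finset.sum_congr rfl fun j _ => (h.pos.1.apply _ _).symm
  have hdiag : ∀ v : Finset I, (rectSum H v v).re ≤ ∑ i ∈ v, a i := by
    intro v
    have := posSemidef_sum_nonneg h.le v (fun _ => 1)
    have h3 := (Complex.le_def.1 this).1
    simp only [star_one, one_mul, mul_one, Matrix.sub_apply, Finset.sum_sub_distrib,
      Matrix.diagonal_apply, Finset.sum_ite_eq, Complex.zero_re, Complex.sub_re] at h3
    have h4 : (∑ x ∈ v, if x ∈ v then (a x : ℂ) else 0) = ((∑ i ∈ v, a i : ℝ) : ℂ) := by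
      push_cast
      exact Finset.sum_congr rfl fun i hi => by simp [hi]
    rw [h4, Complex.ofReal_re] at h3
    unfold rectSum
    linarith
  obtain ⟨z, hz1, hz2⟩ : ∃ z : ℂ, star z * z = 1 ∧ z * q = -(‖q‖ : ℂ) := by
    by_cases h0 : q = 0
    · exact ⟨1, by simp, by simp [h0]⟩
    · have hn : (‖q‖ : ℂ) ≠ 0 := by simpa using h0
      have hm : star q * q = (‖q‖ : ℂ) ^ 2 := Complex.conj_mul' q
      refine ⟨-(star q / ‖q‖), ?_, ?_⟩
      · simp only [star_neg, star_div₀, star_star]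
        have : star (‖q‖ : ℂ) = ‖q‖ := Complex.conj_ofReal _
        rw [this]
        field_simp
        rw [mul_comm, hm]
      · field_simp
        linear_combination -hm
  have key : ∀ c : ℝ, 0 ≤ (∑ i ∈ u, a i) * (c * c) + (-2 * ‖q‖) * c + ∑ i ∈ t, a i := by
    intro c
    have h5 := posSemidef_sum_nonneg h.pos (u ∪ t)
      (fun i => (if i ∈ u then (c : ℂ) else 0) + if i ∈ t then z else 0)
    have hc : star (c : ℂ) = c := Complex.conj_ofReal _
    have h6 := sum_sum_two_indicators (fun i j => H i j) u t c z
    rw [hc] at h6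
    rw [h6] at h5
    change 0 ≤ c * c * rectSum H u u + c * z * rectSum H u t + star z * c * rectSum H t u
          + star z * z * rectSum H t t at h5
    rw [hstar] at h5
    have h7 : (c : ℂ) * z * rectSum H u t = -(c * ‖q‖ : ℂ) := by
      rw [← hq]; linear_combination (c : ℂ) * hz2
    have h8 : star z * (c : ℂ) * star q = -(c * ‖q‖ : ℂ) := by
      have := congrArg star hz2
      simp only [star_mul', star_neg] at this
      have hn : star (‖q‖ : ℂ) = ‖q‖ := Complex.conj_ofReal _
      rw [hn] at this
      linear_combination (c : ℂ) * this
    rw [h7, h8, hz1] at h5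
    have h9 := (Complex.le_def.1 h5).1
    simp only [Complex.zero_re, Complex.add_re, Complex.neg_re, one_mul] at h9
    have e3 : ((c : ℂ) * c * rectSum H u u).re = c * c * (rectSum H u u).re := by
      rw [← Complex.ofReal_mul, Complex.re_ofReal_mul]
    have e4 : ((c : ℂ) * (‖q‖ : ℂ)).re = c * ‖q‖ := by
      rw [← Complex.ofReal_mul, Complex.ofReal_re]
    rw [e3, e4] at h9
    have := hdiag u
    have := hdiag t
    nlinarith [mul_nonneg (mul_self_nonneg c) (sub_nonneg.2 (hdiag u))]
  have := discrim_le_zero key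
  unfold discrim at this
  nlinarith

theorem norm_rectSum_le (h : DiagDom H a) (u t : Finset I) :
    ‖rectSum H u t‖ ≤ √((∑ i ∈ u, a i) * ∑ i ∈ t, a i) :=
  Real.le_sqrt_of_sq_le (h.norm_rectSum_sq_le u t)

theorem sum_le (h : DiagDom H a) (u : Finset I) : ∑ i ∈ u, a i ≤ ∑' i, a i :=
  h.summable.sum_le_tsum u fun i _ => h.nonneg i

theorem row_summable (h : DiagDom H a) (i : I) : Summable fun j => H i j := by
  classical
  rw [summable_iff_vanishing_norm]
  intro ε hε
  have h1 := (summable_iff_vanishing_norm.1 (h.summable.mul_left (a i))) (ε ^ 2) (by positivity)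
  obtain ⟨s, hs⟩ := h1
  refine ⟨s, fun t ht => ?_⟩
  have h2 := h.norm_rectSum_sq_le {i} t
  have h3 := hs t ht
  simp only [rectSum, Finset.sum_singleton, Finset.mul_sum] at h2
  rw [← Finset.mul_sum] at h2 h3
  have h4 := le_abs_self (a i * ∑ i ∈ t, a i)
  rw [Real.norm_eq_abs] at h3
  exact lt_of_pow_lt_pow_left₀ 2 hε.le (by linarith)

theorem norm_sum_row_sq_le (h : DiagDom H a) (u : Finset I) :
    ‖∑ i ∈ u, ∑' j, H i j‖ ^ 2 ≤ (∑ i ∈ u, a i) * ∑' i, a i := by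
  have h1 : Tendsto (fun t => rectSum H u t) atTop (𝓝 (∑ i ∈ u, ∑' j, H i j)) :=
    tendsto_finsetSum _ fun i _ => (h.row_summable i).hasSum
  refine le_of_tendsto ((h1.norm).pow 2) (Eventually.of_forall fun t => ?_)
  refine (h.norm_rectSum_sq_le u t).trans ?_
  exact mul_le_mul_of_nonneg_left (h.sum_le t) (Finset.sum_nonneg fun i _ => h.nonneg i)

theorem col_summable (h : DiagDom H a) : Summable fun i => ∑' j, H i j := by
  classical
  rw [summable_iff_vanishing_norm]
  intro ε hε
  have h1 := (summable_iff_vanishing_norm.1 (h.summable.mul_right (∑' i, a i))) (ε ^ 2)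
    (by positivity)
  obtain ⟨s, hs⟩ := h1
  refine ⟨s, fun t ht => ?_⟩
  have h2 := h.norm_sum_row_sq_le t
  have h3 := hs t ht
  rw [← Finset.sum_mul] at h3
  rw [Real.norm_eq_abs] at h3
  have h4 := le_abs_self ((∑ i ∈ t, a i) * ∑' i, a i)
  exact lt_of_pow_lt_pow_left₀ 2 hε.le (by linarith)

/-- Finite rectangles approximate the full double sum, with an error that depends on the
diagonal only. -/
theorem norm_tsum_sub_rectSum_le (h : DiagDom H a) (u t : Finset I) :
    ‖(∑' i, ∑' j, H i j) - rectSum H u t‖ ≤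
      √(((∑' i, a i) - ∑ i ∈ u, a i) * ∑' i, a i) +
        √((∑' i, a i) * ((∑' i, a i) - ∑ i ∈ t, a i)) := by
  classical
  have hA : 0 ≤ ∑' i, a i := tsum_nonneg h.nonneg
  have h1 : Tendsto (fun v => (∑ i ∈ v, ∑' j, H i j) - rectSum H u t) atTop
      (𝓝 ((∑' i, ∑' j, H i j) - rectSum H u t)) := (h.col_summable.hasSum).sub_const _
  refine le_of_tendsto h1.norm ((eventually_ge_atTop u).mono fun v hv => ?_)
  have h2 : Tendsto (fun w => rectSum H v w - rectSum H u t) atTop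
      (𝓝 ((∑ i ∈ v, ∑' j, H i j) - rectSum H u t)) :=
    (tendsto_finsetSum _ fun i _ => (h.row_summable i).hasSum).sub_const _
  refine le_of_tendsto h2.norm ((eventually_ge_atTop t).mono fun w hw => ?_)
  have h3 : rectSum H v w - rectSum H u t = rectSum H (v \ u) w + rectSum H u (w \ t) := by
    have e1 : rectSum H v w = rectSum H (v \ u) w + rectSum H u w :=
      (Finset.sum_sdiff hv).symm
    have e2 : rectSum H u w = rectSum H u (w \ t) + rectSum H u t := by
      simp only [rectSum, ← Finset.sum_add_distrib]
      exact Finset.sum_congr rfl fun i _ => (Finset.sum_sdiff hw).symm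
    rw [e1, e2]; ring
  have e3 : ∀ x y : Finset I, x ⊆ y → ∑ i ∈ y \ x, a i ≤ (∑' i, a i) - ∑ i ∈ x, a i := by
    intro x y hxy
    have := Finset.sum_sdiff (f := a) hxy
    have := h.sum_le y
    linarith
  have e4 : ∀ x : Finset I, 0 ≤ ∑ i ∈ x, a i := fun x => Finset.sum_nonneg fun i _ => h.nonneg i
  rw [h3]
  refine (norm_add_le _ _).trans (add_le_add ((h.norm_rectSum_le _ _).trans ?_)
    ((h.norm_rectSum_le _ _).trans ?_))
  · exact Real.sqrt_le_sqrt (mul_le_mul (e3 u v hv) (h.sum_le w) (e4 _) ((e4 _).trans (e3 u v hv)))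
  · exact Real.sqrt_le_sqrt (mul_le_mul (h.sum_le u) (e3 t w hw) (e4 _) hA)

end DiagDom

/-- The bound of `DiagDom.norm_tsum_sub_rectSum_le` tends to zero. -/
theorem tendsto_rectError {I : Type} {a : I → ℝ} (ha : Summable a) :
    Tendsto (fun p : Finset I × Finset I => √(((∑' i, a i) - ∑ i ∈ p.1, a i) * ∑' i, a i) +
        √((∑' i, a i) * ((∑' i, a i) - ∑ i ∈ p.2, a i))) (atTop ×ˢ atTop) (𝓝 0) := by
  have h0 : Tendsto (fun s : Finset I => (∑' i, a i) - ∑ i ∈ s, a i) atTop (𝓝 0) := by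
    simpa using (ha.hasSum.const_sub (∑' i, a i))
  have h1 := ((h0.comp tendsto_fst (f := fun p : Finset I × Finset I => p.1)
    (y := atTop) (x := atTop ×ˢ atTop)).mul_const (∑' i, a i)).sqrt
  have h2 := ((h0.comp tendsto_snd (f := fun p : Finset I × Finset I => p.2)
    (y := atTop) (x := atTop ×ˢ atTop)).const_mul (∑' i, a i)).sqrt
  simpa using h1.add h2

/-- The double series converges along rectangles, jointly in the two index sets. -/
theorem DiagDom.tendsto_rectSum {I : Type} {H : Op I} {a : I → ℝ} (h : DiagDom H a) :
    Tendsto (fun p : Finset I × Finset I => rectSum H p.1 p.2) (atTop ×ˢ atTop)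
      (𝓝 (∑' i, ∑' j, H i j)) := by
  rw [tendsto_iff_norm_sub_tendsto_zero]
  refine squeeze_zero (fun _ => norm_nonneg _) (fun p => ?_) (tendsto_rectError h.summable)
  rw [norm_sub_rev]
  exact h.norm_tsum_sub_rectSum_le p.1 p.2

/-! ### The trace pairing of trace class operators and effects -/

open scoped Classical in
/-- The identity of `ℓ²(I)`. -/
def idOp (I : Type) : Op I := 1

/-- Effects: operators `M` with `0 ≤ M ≤ 1`. -/
structure IsEffect {I : Type} (M : Op I) : Prop where
  pos : M.PosSemidef
  le : (idOp I - M).PosSemidef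

/-- The double sum that defines `trMul A M` converges, row by row as well as along finite
rectangles. -/
structure TrSum {I : Type} (A M : Op I) : Prop where
  row : ∀ i, Summable fun j => A i j * M j i
  col : Summable fun i => ∑' j, A i j * M j i
  lim : Tendsto (fun p : Finset I × Finset I => ∑ i ∈ p.1, ∑ j ∈ p.2, A i j * M j i)
    (atTop ×ˢ atTop) (𝓝 (trMul A M))

theorem posSemidef_of_tendsto {I ι : Type} {l : Filter ι} [l.NeBot] {A : ι → Op I} {B : Op I}
    (hA : ∀ k, (A k).PosSemidef) (h : ∀ i j, Tendsto (fun k => A k i j) l (𝓝 (B i j))) :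
    B.PosSemidef := by
  constructor
  · ext i j
    refine tendsto_nhds_unique ((h j i).star) ((h i j).congr fun k => ?_)
    exact ((hA k).1.apply i j).symm
  · intro x
    refine ge_of_tendsto (x := l) (f := fun k => x.sum fun i xi => x.sum fun j xj =>
      star xi * A k i j * xj) ?_ (Eventually.of_forall fun k => (hA k).2 x)
    exact tendsto_finsetSum _ fun i _ => tendsto_finsetSum _ fun j _ =>
      ((h i j).const_mul _).mul_const _

theorem diag_re_nonneg {I : Type} {A : Op I} (hA : A.PosSemidef) (i : I) : 0 ≤ (A i i).re :=
  (Complex.le_def.1 (hA.diag_nonneg (i := i))).1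

theorem diag_eq_re {I : Type} {A : Op I} (hA : A.PosSemidef) (i : I) :
    A i i = ((A i i).re : ℂ) := by
  have h := (Complex.le_def.1 (hA.diag_nonneg (i := i))).2
  apply Complex.ext <;> simp [← h]

theorem norm_entry_le {I : Type} {A : Op I} (hA : A.PosSemidef) (i j : I) :
    ‖A i j‖ ≤ ((A i i).re + (A j j).re) / 2 := by
  have hdet := (hA.submatrix ![i, j]).det_nonneg
  rw [Matrix.det_fin_two] at hdet
  simp only [Matrix.submatrix_apply, Matrix.cons_val_zero, Matrix.cons_val_one] at hdet
  have hw : A j i = star (A i j) := (hA.1.apply j i).symm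
  rw [hw, diag_eq_re hA i, diag_eq_re hA j] at hdet
  have hz : A i j * star (A i j) = ((‖A i j‖ ^ 2 : ℝ) : ℂ) := by
    simpa using Complex.mul_conj' (A i j)
  rw [hz] at hdet
  have h2 : 0 ≤ (A i i).re * (A j j).re - ‖A i j‖ ^ 2 := by exact_mod_cast hdet
  have := diag_re_nonneg hA i
  have := diag_re_nonneg hA j
  nlinarith [norm_nonneg (A i j), sq_nonneg ((A i i).re - (A j j).re)]

section PosTC

variable {I : Type} {A B M N : Op I}

theorem IsPosTC.summable_re (hA : IsPosTC A) : Summable fun i => (A i i).re :=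
  (Complex.hasSum_re hA.2.hasSum).summable

/-- The diagonal of a positive operator is real. -/
theorem isPosTC_of_summable_re (h : A.PosSemidef) (hs : Summable fun i => (A i i).re) :
    IsPosTC A := by
  refine ⟨h, ?_⟩
  have : (fun i => A i i) = fun i => (((A i i).re : ℝ) : ℂ) := funext fun i => diag_eq_re h i
  rw [this]
  exact_mod_cast hs

theorem IsPosTC.tr_eq (hA : IsPosTC A) : tr A = ((∑' i, (A i i).re : ℝ) : ℂ) := by
  rw [tr, Complex.ofReal_tsum]
  exact tsum_congr fun i => diag_eq_re hA.1 i

theorem IsPosTC.tr_re (hA : IsPosTC A) : (tr A).re = ∑' i, (A i i).re := by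
  rw [hA.tr_eq, Complex.ofReal_re]

theorem IsPosTC.tr_re_nonneg (hA : IsPosTC A) : 0 ≤ (tr A).re := by
  rw [hA.tr_re]; exact tsum_nonneg fun i => diag_re_nonneg hA.1 i

theorem isPosTC_zero : IsPosTC (0 : Op I) := ⟨Matrix.PosSemidef.zero, by simp⟩

theorem IsPosTC.add (hA : IsPosTC A) (hB : IsPosTC B) : IsPosTC (A + B) :=
  ⟨hA.1.add hB.1, hA.2.add hB.2⟩

theorem posSemidef_real_smul (hA : A.PosSemidef) {c : ℝ} (hc : 0 ≤ c) : (c • A).PosSemidef := by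
  have : c • A = (c : ℂ) • A := by ext i j; simp
  rw [this]
  exact hA.smul (by exact_mod_cast hc)

theorem IsPosTC.smul (hA : IsPosTC A) {c : ℝ} (hc : 0 ≤ c) : IsPosTC (c • A) :=
  ⟨posSemidef_real_smul hA.1 hc, hA.2.const_smul c⟩

theorem isPosTC_sum {ι : Type} {s : Finset ι} {A : ι → Op I} (h : ∀ i ∈ s, IsPosTC (A i)) :
    IsPosTC (∑ i ∈ s, A i) := by
  classical
  induction s using Finset.induction_on with
  | empty => simpa using isPosTC_zero
  | insert a s ha ih =>
    rw [Finset.sum_insert ha]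
    exact (h a (by simp)).add (ih fun i hi => h i (by simp [hi]))

/-- An operator between zero and a trace class operator is trace class. -/
theorem IsPosTC.of_le (hB : IsPosTC B) (hA : A.PosSemidef) (h : (B - A).PosSemidef) :
    IsPosTC A := by
  refine isPosTC_of_summable_re hA (Summable.of_nonneg_of_le (fun i => diag_re_nonneg hA i)
    (fun i => ?_) hB.summable_re)
  have := diag_re_nonneg h i
  simp only [Matrix.sub_apply, Complex.sub_re] at this
  linarith

theorem IsPosTC.mem (hA : IsPosTC A) : A ∈ TC I := Submodule.subset_span hA

theorem IsState.isPosTC (hA : IsState A) : IsPosTC A := ⟨hA.1, hA.2.summable⟩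

theorem IsState.tr_eq (hA : IsState A) : tr A = 1 := hA.2.tsum_eq

theorem isState_iff : IsState A ↔ IsPosTC A ∧ tr A = 1 :=
  ⟨fun h => ⟨h.isPosTC, h.tr_eq⟩, fun h => ⟨h.1.1, h.2 ▸ h.1.2.hasSum⟩⟩

theorem IsPosTC.norm_entry_le_tr (hA : IsPosTC A) (i j : I) : ‖A i j‖ ≤ (tr A).re := by
  have h1 := norm_entry_le hA.1 i j
  have h2 : ∀ i, (A i i).re ≤ (tr A).re := fun i => by
    rw [hA.tr_re]
    exact hA.summable_re.le_tsum i fun j _ => diag_re_nonneg hA.1 j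
  have := h2 i
  have := h2 j
  linarith

theorem IsEffect.compl (hM : IsEffect M) : IsEffect (idOp I - M) :=
  ⟨hM.le, by simpa using hM.pos⟩

theorem posSemidef_idOp : (idOp I).PosSemidef := by
  classical
  have h : (Matrix.diagonal (fun _ : I => (1 : ℂ))).PosSemidef :=
    Matrix.PosSemidef.diagonal (fun i => zero_le_one)
  convert h using 1
  ext i j
  by_cases hij : i = j
  · subst hij; simp [idOp]
  · simp [idOp, hij]

theorem isEffect_one : IsEffect (idOp I) :=
  ⟨posSemidef_idOp, by simpa using Matrix.PosSemidef.zero⟩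

theorem isEffect_zero : IsEffect (0 : Op I) :=
  ⟨Matrix.PosSemidef.zero, by simpa using posSemidef_idOp⟩

/-- `A` against an effect `M`: the entrywise product of `A` and the transpose of `M` lies between
zero and the diagonal of `A`, by the Schur product theorem. -/
theorem IsPosTC.diagDom (hA : IsPosTC A) (hM : IsEffect M) :
    DiagDom (A ⊙ Mᵀ) fun i => (A i i).re := by
  classical
  refine ⟨hA.1.hadamard hM.pos.transpose, ?_, hA.summable_re⟩
  have h : (A ⊙ (idOp I - M)ᵀ).PosSemidef := hA.1.hadamard hM.le.transpose
  have e : Matrix.diagonal (fun i => ((A i i).re : ℂ)) - A ⊙ Mᵀ = A ⊙ (idOp I - M)ᵀ := by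
    ext i j
    by_cases hij : i = j
    · subst hij
      simp only [Matrix.sub_apply, Matrix.diagonal_apply_eq, Matrix.hadamard_apply,
        Matrix.transpose_apply, idOp, Matrix.one_apply_eq]
      rw [← diag_eq_re hA.1 i]; ring
    · simp [Matrix.hadamard_apply, idOp, hij]
  rw [e]
  exact h

theorem IsPosTC.trSum (hA : IsPosTC A) (hM : IsEffect M) : TrSum A M :=
  ⟨(hA.diagDom hM).row_summable, (hA.diagDom hM).col_summable, (hA.diagDom hM).tendsto_rectSum⟩

theorem trMul_add_left (h1 : TrSum A M) (h2 : TrSum B M) :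
    trMul (A + B) M = trMul A M + trMul B M := by
  simp only [trMul, Matrix.add_apply, add_mul]
  rw [← h1.col.tsum_add h2.col]
  exact tsum_congr fun i => (h1.row i).tsum_add (h2.row i)

theorem TrSum.add_left (h1 : TrSum A M) (h2 : TrSum B M) : TrSum (A + B) M := by
  have e : ∀ i, ∑' j, (A + B) i j * M j i = ∑' j, A i j * M j i + ∑' j, B i j * M j i := by
    intro i
    simp only [Matrix.add_apply, add_mul]
    exact (h1.row i).tsum_add (h2.row i)
  refine ⟨fun i => ?_, ?_, ?_⟩
  · simpa only [Matrix.add_apply, add_mul] using (h1.row i).add (h2.row i)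
  · simpa only [e] using h1.col.add h2.col
  · rw [trMul_add_left h1 h2]
    refine (h1.lim.add h2.lim).congr fun p => ?_
    simp only [Matrix.add_apply, add_mul, Finset.sum_add_distrib]

theorem trMul_smul_left (c : ℂ) : trMul (c • A) M = c * trMul A M := by
  simp only [trMul, Matrix.smul_apply, smul_eq_mul, mul_assoc, tsum_mul_left]

theorem TrSum.smul_left (h1 : TrSum A M) (c : ℂ) : TrSum (c • A) M := by
  refine ⟨fun i => ?_, ?_, ?_⟩
  · simpa only [Matrix.smul_apply, smul_eq_mul, mul_assoc] using (h1.row i).mul_left c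
  · simpa only [Matrix.smul_apply, smul_eq_mul, mul_assoc, tsum_mul_left] using h1.col.mul_left c
  · rw [trMul_smul_left]
    refine (h1.lim.const_mul c).congr fun p => ?_
    simp only [Matrix.smul_apply, smul_eq_mul, mul_assoc, Finset.mul_sum]

theorem trMul_add_right (h1 : TrSum A M) (h2 : TrSum A N) :
    trMul A (M + N) = trMul A M + trMul A N := by
  simp only [trMul, Matrix.add_apply, mul_add]
  rw [← h1.col.tsum_add h2.col]
  exact tsum_congr fun i => (h1.row i).tsum_add (h2.row i)

theorem TrSum.add_right (h1 : TrSum A M) (h2 : TrSum A N) : TrSum A (M + N) := by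
  have e : ∀ i, ∑' j, A i j * (M + N) j i = ∑' j, A i j * M j i + ∑' j, A i j * N j i := by
    intro i
    simp only [Matrix.add_apply, mul_add]
    exact (h1.row i).tsum_add (h2.row i)
  refine ⟨fun i => ?_, ?_, ?_⟩
  · simpa only [Matrix.add_apply, mul_add] using (h1.row i).add (h2.row i)
  · simpa only [e] using h1.col.add h2.col
  · rw [trMul_add_right h1 h2]
    refine (h1.lim.add h2.lim).congr fun p => ?_
    simp only [Matrix.add_apply, mul_add, Finset.sum_add_distrib]

theorem trMul_smul_right (c : ℂ) : trMul A (c • M) = c * trMul A M := by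
  simp only [trMul, Matrix.smul_apply, smul_eq_mul, mul_left_comm _ c, tsum_mul_left]

theorem TrSum.smul_right (h1 : TrSum A M) (c : ℂ) : TrSum A (c • M) := by
  refine ⟨fun i => ?_, ?_, ?_⟩
  · simpa only [Matrix.smul_apply, smul_eq_mul, mul_left_comm _ c] using (h1.row i).mul_left c
  · simpa only [Matrix.smul_apply, smul_eq_mul, mul_left_comm _ c, tsum_mul_left]
      using h1.col.mul_left c
  · rw [trMul_smul_right]
    refine (h1.lim.const_mul c).congr fun p => ?_
    simp only [Matrix.smul_apply, smul_eq_mul, mul_left_comm _ c, Finset.mul_sum]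

theorem trSum_zero_left : TrSum 0 M := by
  refine ⟨fun i => by simp, by simp, ?_⟩
  simp [trMul]

theorem trSum_zero_right : TrSum A 0 := by
  refine ⟨fun i => by simp, by simp, ?_⟩
  simp [trMul]

theorem trSum_of_mem (hA : A ∈ TC I) (hM : IsEffect M) : TrSum A M := by
  induction hA using Submodule.span_induction with
  | mem X hX => exact IsPosTC.trSum hX hM
  | zero => exact trSum_zero_left
  | add X Y _ _ h1 h2 => exact h1.add_left h2
  | smul c X _ h => exact h.smul_left c

theorem trMul_sub_left (h1 : TrSum A M) (h2 : TrSum B M) :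
    trMul (A - B) M = trMul A M - trMul B M := by
  have : A - B = A + (-1 : ℂ) • B := by simp [sub_eq_add_neg]
  rw [this, trMul_add_left h1 (h2.smul_left _), trMul_smul_left]
  ring

theorem trMul_sub_right (h1 : TrSum A M) (h2 : TrSum A N) :
    trMul A (M - N) = trMul A M - trMul A N := by
  have : M - N = M + (-1 : ℂ) • N := by simp [sub_eq_add_neg]
  rw [this, trMul_add_right h1 (h2.smul_right _), trMul_smul_right]
  ring

theorem TrSum.sum_right {ι : Type} {s : Finset ι} {E : ι → Op I} (h : ∀ k ∈ s, TrSum A (E k)) :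
    TrSum A (∑ k ∈ s, E k) ∧ trMul A (∑ k ∈ s, E k) = ∑ k ∈ s, trMul A (E k) := by
  classical
  induction s using Finset.induction_on with
  | empty => exact ⟨by simpa using trSum_zero_right, by simp [trMul]⟩
  | insert a s ha ih =>
    have h1 := h a (by simp)
    obtain ⟨h2, h3⟩ := ih fun i hi => h i (by simp [hi])
    rw [Finset.sum_insert ha, Finset.sum_insert ha, ← h3]
    exact ⟨h1.add_right h2, trMul_add_right h1 h2⟩

theorem TrSum.sum_left {ι : Type} {s : Finset ι} {A : ι → Op I} (h : ∀ k ∈ s, TrSum (A k) M) :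
    TrSum (∑ k ∈ s, A k) M ∧ trMul (∑ k ∈ s, A k) M = ∑ k ∈ s, trMul (A k) M := by
  classical
  induction s using Finset.induction_on with
  | empty => exact ⟨by simpa using trSum_zero_left, by simp [trMul]⟩
  | insert a s ha ih =>
    have h1 := h a (by simp)
    obtain ⟨h2, h3⟩ := ih fun i hi => h i (by simp [hi])
    rw [Finset.sum_insert ha, Finset.sum_insert ha, ← h3]
    exact ⟨h1.add_left h2, trMul_add_left h1 h2⟩

theorem trMul_one : trMul A (idOp I) = tr A := by
  classical
  simp only [trMul, tr, idOp]
  refine tsum_congr fun i => ?_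
  rw [tsum_eq_single i]
  · simp
  · intro j hj; simp [Matrix.one_apply_ne hj]

theorem IsPosTC.trMul_nonneg (hA : IsPosTC A) (hM : IsEffect M) : 0 ≤ trMul A M := by
  have h := (hA.trSum hM).lim
  have h2 : Tendsto (fun s : Finset I => (s, s)) atTop (atTop ×ˢ atTop) :=
    tendsto_id.prodMk tendsto_id
  refine ge_of_tendsto (h.comp h2) (Eventually.of_forall fun s => ?_)
  simpa using posSemidef_sum_nonneg (hA.diagDom hM).pos s (fun _ => 1)

theorem IsPosTC.trMul_eq_re (hA : IsPosTC A) (hM : IsEffect M) :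
    trMul A M = ((trMul A M).re : ℂ) := by
  have h := (Complex.le_def.1 (hA.trMul_nonneg hM)).2
  apply Complex.ext <;> simp [← h]

theorem IsPosTC.trMul_re_nonneg (hA : IsPosTC A) (hM : IsEffect M) : 0 ≤ (trMul A M).re :=
  (Complex.le_def.1 (hA.trMul_nonneg hM)).1

theorem IsPosTC.trMul_re_le (hA : IsPosTC A) (hM : IsEffect M) :
    (trMul A M).re ≤ (tr A).re := by
  have h := hA.trMul_re_nonneg hM.compl
  rw [trMul_sub_right (hA.trSum isEffect_one) (hA.trSum hM), trMul_one, Complex.sub_re] at h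
  linarith

theorem IsPosTC.norm_trMul_le (hA : IsPosTC A) (hM : IsEffect M) :
    ‖trMul A M‖ ≤ (tr A).re := by
  rw [hA.trMul_eq_re hM, Complex.norm_real, Real.norm_of_nonneg (hA.trMul_re_nonneg hM)]
  exact hA.trMul_re_le hM

/-- The pairing is continuous for entrywise convergence of effects. -/
theorem IsPosTC.tendsto_trMul {ι : Type} {l : Filter ι} {M : ι → Op I} {M' : Op I}
    (hA : IsPosTC A) (hM : ∀ k, IsEffect (M k)) (hM' : IsEffect M')
    (h : ∀ i j, Tendsto (fun k => M k i j) l (𝓝 (M' i j))) :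
    Tendsto (fun k => trMul A (M k)) l (𝓝 (trMul A M')) := by
  rw [Metric.tendsto_nhds]
  intro ε hε
  have h1 := (tendsto_rectError hA.summable_re).eventually (gt_mem_nhds (show 0 < ε / 3 by positivity))
  obtain ⟨p, hp⟩ := h1.exists
  have h2 : Tendsto (fun k => rectSum (A ⊙ (M k)ᵀ) p.1 p.2) l (𝓝 (rectSum (A ⊙ M'ᵀ) p.1 p.2)) :=
    tendsto_finsetSum _ fun i _ => tendsto_finsetSum _ fun j _ => (h j i).const_mul _
  filter_upwards [(Metric.tendsto_nhds.1 h2) (ε / 3) (by positivity)] with k hk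
  have e1 := ((hA.diagDom (hM k)).norm_tsum_sub_rectSum_le p.1 p.2).trans_lt hp
  have e2 := ((hA.diagDom hM').norm_tsum_sub_rectSum_le p.1 p.2).trans_lt hp
  change ‖trMul A (M k) - _‖ < _ at e1
  change ‖trMul A M' - _‖ < _ at e2
  rw [dist_eq_norm] at hk ⊢
  have : trMul A (M k) - trMul A M' = (trMul A (M k) - rectSum (A ⊙ (M k)ᵀ) p.1 p.2) +
      (rectSum (A ⊙ (M k)ᵀ) p.1 p.2 - rectSum (A ⊙ M'ᵀ) p.1 p.2) -
      (trMul A M' - rectSum (A ⊙ M'ᵀ) p.1 p.2) := by ring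
  rw [this]
  refine (norm_sub_le _ _).trans_lt ?_
  have := norm_add_le (trMul A (M k) - rectSum (A ⊙ (M k)ᵀ) p.1 p.2)
    (rectSum (A ⊙ (M k)ᵀ) p.1 p.2 - rectSum (A ⊙ M'ᵀ) p.1 p.2)
  linarith

end PosTC

/-! ### Tensor products and partial traces -/

/-- The tensor product of operators on the factors of a splitting `ℓ²(K) = ℓ²(L) ⊗ ℓ²(E)`. -/
def tens {K L E : Type} (e : K ≃ L × E) (x : Op L) (y : Op E) : Op K :=
  Matrix.of fun p q => x (e p).1 (e q).1 * y (e p).2 (e q).2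

section tens

variable {K L E : Type} (e : K ≃ L × E)

theorem tens_apply (x : Op L) (y : Op E) (p q : K) :
    tens e x y p q = x (e p).1 (e q).1 * y (e p).2 (e q).2 := rfl

theorem tens_add_left (x x' : Op L) (y : Op E) : tens e (x + x') y = tens e x y + tens e x' y := by
  ext p q; simp [tens_apply, add_mul]

theorem tens_add_right (x : Op L) (y y' : Op E) : tens e x (y + y') = tens e x y + tens e x y' := by
  ext p q; simp [tens_apply, mul_add]

theorem tens_sub_left (x x' : Op L) (y : Op E) : tens e (x - x') y = tens e x y - tens e x' y := by
  ext p q; simp [tens_apply, sub_mul]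

theorem tens_sub_right (x : Op L) (y y' : Op E) : tens e x (y - y') = tens e x y - tens e x y' := by
  ext p q; simp [tens_apply, mul_sub]

theorem tens_smul_left (c : ℂ) (x : Op L) (y : Op E) : tens e (c • x) y = c • tens e x y := by
  ext p q; simp [tens_apply, mul_assoc]

theorem tens_smul_right (c : ℂ) (x : Op L) (y : Op E) : tens e x (c • y) = c • tens e x y := by
  ext p q; simp only [tens_apply, Matrix.smul_apply, smul_eq_mul]; ring

theorem tens_rsmul_left (c : ℝ) (x : Op L) (y : Op E) : tens e (c • x) y = c • tens e x y := by
  ext p q; simp [tens_apply, mul_assoc]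

theorem tens_rsmul_right (c : ℝ) (x : Op L) (y : Op E) : tens e x (c • y) = c • tens e x y := by
  ext p q; simp only [tens_apply, Matrix.smul_apply, Complex.real_smul]; ring

theorem tens_zero_left (y : Op E) : tens e 0 y = 0 := by
  ext p q; simp [tens_apply]

theorem tens_zero_right (x : Op L) : tens e x 0 = 0 := by
  ext p q; simp [tens_apply]

theorem tens_sum_left {ι : Type} (s : Finset ι) (x : ι → Op L) (y : Op E) :
    tens e (∑ k ∈ s, x k) y = ∑ k ∈ s, tens e (x k) y := by
  ext p q; simp [tens_apply, Matrix.sum_apply, Finset.sum_mul]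

theorem tens_sum_right {ι : Type} (s : Finset ι) (x : Op L) (y : ι → Op E) :
    tens e x (∑ k ∈ s, y k) = ∑ k ∈ s, tens e x (y k) := by
  ext p q; simp [tens_apply, Matrix.sum_apply, Finset.mul_sum]

theorem tens_idOp : tens e (idOp L) (idOp E) = idOp K := by
  classical
  ext p q
  simp only [tens_apply, idOp, Matrix.one_apply]
  by_cases h : p = q
  · simp [h]
  · have : ¬ ((e p).1 = (e q).1 ∧ (e p).2 = (e q).2) := fun h' =>
      h (e.injective (Prod.ext h'.1 h'.2))
    rw [if_neg h]
    by_cases h1 : (e p).1 = (e q).1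
    · rw [if_neg (fun h2 => this ⟨h1, h2⟩)]; simp
    · rw [if_neg h1]; simp

variable {x : Op L} {y : Op E}

theorem tens_posSemidef (hx : x.PosSemidef) (hy : y.PosSemidef) : (tens e x y).PosSemidef :=
  (hx.submatrix fun p => (e p).1).hadamard (hy.submatrix fun p => (e p).2)

theorem IsPosTC.tens (hx : IsPosTC x) (hy : IsPosTC y) : IsPosTC (tens e x y) := by
  refine isPosTC_of_summable_re (tens_posSemidef e hx.1 hy.1) ?_
  have h : Summable fun p : L × E => (x p.1 p.1).re * (y p.2 p.2).re :=
    hx.summable_re.mul_of_nonneg hy.summable_re (fun i => diag_re_nonneg hx.1 i)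
      (fun i => diag_re_nonneg hy.1 i)
  refine (e.summable_iff.2 h).congr fun p => ?_
  simp only [Function.comp, tens_apply]
  rw [diag_eq_re hx.1, diag_eq_re hy.1, ← Complex.ofReal_mul, Complex.ofReal_re]
  simp

theorem IsEffect.tens {M : Op L} {N : Op E} (hM : IsEffect M) (hN : IsEffect N) :
    IsEffect (tens e M N) := by
  refine ⟨tens_posSemidef e hM.pos hN.pos, ?_⟩
  have : idOp K - QEst.tens e M N =
      QEst.tens e (idOp L - M) (idOp E) + QEst.tens e M (idOp E - N) := by
    rw [tens_sub_left, tens_sub_right, tens_idOp]; abel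
  rw [this]
  exact (tens_posSemidef e hM.le posSemidef_idOp).add (tens_posSemidef e hM.pos hN.le)

theorem tens_mem (hx : x ∈ TC L) (hy : y ∈ TC E) : tens e x y ∈ TC K := by
  induction hx using Submodule.span_induction with
  | mem X hX =>
    induction hy using Submodule.span_induction with
    | mem Y hY => exact (IsPosTC.tens e hX hY).mem
    | zero => rw [tens_zero_right]; exact (TC K).zero_mem
    | add X Y _ _ h1 h2 => rw [tens_add_right]; exact (TC K).add_mem h1 h2
    | smul c X _ h => rw [tens_smul_right]; exact (TC K).smul_mem c h
  | zero => rw [tens_zero_left]; exact (TC K).zero_mem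
  | add X Y _ _ h1 h2 => rw [tens_add_left]; exact (TC K).add_mem h1 h2
  | smul c X _ h => rw [tens_smul_left]; exact (TC K).smul_mem c h

/-- The rectangle of the indices in `s` and `t`. -/
def rect (p : Finset L × Finset E) : Finset K := (p.1 ×ˢ p.2).map e.symm.toEmbedding

theorem tendsto_rect_atTop : Tendsto (rect e) atTop atTop := by
  have h1 : Tendsto (fun p : Finset L × Finset E => p.1 ×ˢ p.2) atTop atTop :=
    Filter.tendsto_finsetProd_atTop
  have h2 : Tendsto (fun s : Finset (L × E) => s.map e.symm.toEmbedding) atTop atTop := by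
    classical
    refine tendsto_atTop.2 fun v => ?_
    filter_upwards [eventually_ge_atTop (v.map e.toEmbedding)] with s hs
    intro k hk
    rw [Finset.mem_map_equiv]
    exact hs (by simpa using hk)
  exact h2.comp h1

theorem sum_rect {M : Type} [AddCommMonoid M] (p : Finset L × Finset E) (f : K → M) :
    ∑ k ∈ rect e p, f k = ∑ i ∈ p.1, ∑ a ∈ p.2, f (e.symm (i, a)) := by
  rw [rect, Finset.sum_map, Finset.sum_product]
  rfl

theorem TrSum.tendsto_rect {A M : Op K} (h : TrSum A M) :
    Tendsto (fun p : Finset L × Finset E => ∑ i ∈ rect e p, ∑ j ∈ rect e p, A i j * M j i) atTop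
      (𝓝 (trMul A M)) := by
  have h1 : Tendsto (fun p : Finset L × Finset E => (rect e p, rect e p)) atTop
      (atTop ×ˢ atTop) := (tendsto_rect_atTop e).prodMk (tendsto_rect_atTop e)
  have h2 := h.lim.comp h1
  exact h2

/-- The pairing is multiplicative on tensor products. -/
theorem trMul_tens {M : Op L} {N : Op E} (hx : x ∈ TC L) (hy : y ∈ TC E) (hM : IsEffect M)
    (hN : IsEffect N) : trMul (tens e x y) (tens e M N) = trMul x M * trMul y N := by
  have h2 : Tendsto (fun s : Finset L => (s, s)) atTop (atTop ×ˢ atTop) :=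
    tendsto_id.prodMk tendsto_id
  have h3 : Tendsto (fun s : Finset E => (s, s)) atTop (atTop ×ˢ atTop) :=
    tendsto_id.prodMk tendsto_id
  have h4 : Tendsto (fun p : Finset L × Finset E => ∑ i ∈ p.1, ∑ j ∈ p.1, x i j * M j i)
      (atTop ×ˢ atTop) (𝓝 (trMul x M)) :=
    ((trSum_of_mem hx hM).lim.comp h2).comp tendsto_fst
  have h5 : Tendsto (fun p : Finset L × Finset E => ∑ i ∈ p.2, ∑ j ∈ p.2, y i j * N j i)
      (atTop ×ˢ atTop) (𝓝 (trMul y N)) :=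
    ((trSum_of_mem hy hN).lim.comp h3).comp tendsto_snd
  have h6 := (trSum_of_mem (tens_mem e hx hy) (IsEffect.tens e hM hN)).tendsto_rect e
  rw [← prod_atTop_atTop_eq] at h6
  refine tendsto_nhds_unique h6 ((h4.mul h5).congr fun p => ?_)
  simp only [sum_rect, tens_apply, Equiv.apply_symm_apply]
  rw [Finset.sum_mul_sum]
  refine Finset.sum_congr rfl fun i _ => Finset.sum_congr rfl fun a _ => ?_
  rw [Finset.sum_mul_sum]
  refine Finset.sum_congr rfl fun j _ => Finset.sum_congr rfl fun b _ => ?_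
  ring

theorem tr_tens (hx : x ∈ TC L) (hy : y ∈ TC E) : tr (tens e x y) = tr x * tr y := by
  rw [← trMul_one, ← tens_idOp e, trMul_tens e hx hy isEffect_one isEffect_one, trMul_one,
    trMul_one]

theorem IsState.tens (hx : IsState x) (hy : IsState y) : IsState (tens e x y) := by
  rw [isState_iff]
  refine ⟨hx.isPosTC.tens e hy.isPosTC, ?_⟩
  rw [tr_tens e hx.isPosTC.mem hy.isPosTC.mem, hx.tr_eq, hy.tr_eq, one_mul]

end tens

/-! ### Compression of effects by a state of the environment -/

section compress

variable {K L E : Type} (e : K ≃ L × E) {x : Op L} {y : Op E} {M : Op K}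

theorem single_mem [DecidableEq L] (i j : L) : Matrix.single i j (1 : ℂ) ∈ TC L := by
  have hv : ∀ v : L →₀ ℂ, (Matrix.of fun k l => v k * star (v l) : Op L) ∈ TC L := by
    intro v
    refine IsPosTC.mem ⟨⟨?_, fun w => ?_⟩, ?_⟩
    · ext k l; simp [mul_comm]
    · have : (w.sum fun i xi => w.sum fun j xj => star xi * (v i * star (v j)) * xj) =
          (w.sum fun i xi => star xi * v i) * star (w.sum fun i xi => star xi * v i) := by
        simp only [Finsupp.sum, star_sum, Finset.sum_mul_sum, star_mul', star_star]
        exact Finset.sum_congr rfl fun i _ => Finset.sum_congr rfl fun j _ => by ring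
      simp only [Matrix.of_apply, this]
      exact mul_star_self_nonneg _
    · refine summable_of_ne_finset_zero (s := v.support) fun k hk => ?_
      simp [Finsupp.notMem_support_iff.1 hk]
  set f : ℂ → L →₀ ℂ := fun c => Finsupp.single i 1 + Finsupp.single j c with hf
  have h1 := hv (f 1)
  have h2 := hv (f (-1))
  have h3 := hv (f Complex.I)
  have h4 := hv (f (-Complex.I))
  have := (TC L).smul_mem (1 / 4 : ℂ) ((TC L).add_mem ((TC L).sub_mem h1 h2)
      ((TC L).smul_mem (Complex.I) ((TC L).sub_mem h3 h4)))
  convert this using 1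
  ext k l
  have hs : ∀ (c : ℂ) (k : L), f c k = (if i = k then 1 else 0) + c * (if j = k then 1 else 0) := by
    intro c k
    simp only [hf, Finsupp.coe_add, Pi.add_apply, Finsupp.single_apply, mul_ite, mul_one, mul_zero]
  have e1 : Matrix.single i j (1 : ℂ) k l = (if i = k then 1 else 0) * (if j = l then 1 else 0) := by
    rw [Matrix.single_apply]
    by_cases hik : i = k <;> by_cases hjl : j = l <;> simp [hik, hjl]
  simp only [Matrix.smul_apply, Matrix.add_apply, Matrix.sub_apply, Matrix.of_apply, smul_eq_mul,
    hs, e1, star_add, star_mul', apply_ite star, star_one, star_zero, star_neg]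
  have hI : star Complex.I = -Complex.I := Complex.conj_I
  rw [hI]
  linear_combination ((if i = k then (1 : ℂ) else 0) * (if j = l then 1 else 0) / 2
    - (if j = k then (1 : ℂ) else 0) * (if i = l then 1 else 0) / 2) * Complex.I_mul_I

open scoped Classical in
/-- The compression `tr_E ((1 ⊗ y) M)` of an effect `M` by a state `y` of the environment. -/
def compr (y : Op E) (M : Op K) : Op L :=
  Matrix.of fun i j => trMul (tens e (Matrix.single j i 1) y) M

open scoped Classical in
/-- The restriction of `x` to the indices in `s`. -/
def cut (s : Finset L) (x : Op L) : Op L :=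
  Matrix.of fun i j => if i ∈ s ∧ j ∈ s then x i j else 0

theorem cut_eq [DecidableEq L] (s : Finset L) (x : Op L) :
    cut s x = ∑ i ∈ s, ∑ j ∈ s, x i j • Matrix.single i j (1 : ℂ) := by
  ext k l
  simp only [cut, Matrix.of_apply, Matrix.sum_apply, Matrix.smul_apply, Matrix.single_apply,
    smul_eq_mul, mul_ite, mul_one, mul_zero]
  by_cases hk : k ∈ s
  · rw [Finset.sum_eq_single k]
    · by_cases hl : l ∈ s
      · rw [Finset.sum_eq_single l] <;> simp +contextual [hk, hl]
      · rw [if_neg (by tauto)]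
        refine (Finset.sum_eq_zero fun j hj => ?_).symm
        rw [if_neg]; rintro ⟨-, rfl⟩; exact hl hj
    · intro i _ hi; exact Finset.sum_eq_zero fun j _ => by simp [hi]
    · exact fun h => absurd hk h
  · rw [if_neg (by tauto)]
    refine (Finset.sum_eq_zero fun i hi => Finset.sum_eq_zero fun j hj => ?_).symm
    rw [if_neg]; rintro ⟨rfl, -⟩; exact hk hi

theorem cut_posSemidef (s : Finset L) (hx : x.PosSemidef) : (cut s x).PosSemidef := by
  classical
  have h1 : (Matrix.of fun i j => (if i ∈ s then (1 : ℂ) else 0) * star (if j ∈ s then (1 : ℂ) else 0) :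
      Op L).PosSemidef := by
    have hf : ∀ t : Finset L, (Matrix.of fun i j : t => (if (i : L) ∈ s then (1 : ℂ) else 0) *
      star (if (j : L) ∈ s then (1 : ℂ) else 0)).PosSemidef := fun t =>
      Matrix.posSemidef_vecMulVec_self_star (fun i : t => if (i : L) ∈ s then (1 : ℂ) else 0)
    exact posSemidef_of_finite fun t => hf t
  have h2 := hx.hadamard h1
  have e : cut s x = x ⊙ (Matrix.of fun i j => (if i ∈ s then (1 : ℂ) else 0) *
      star (if j ∈ s then (1 : ℂ) else 0)) := by
    ext i j
    by_cases hi : i ∈ s <;> by_cases hj : j ∈ s <;> simp [cut, Matrix.hadamard_apply, hi, hj]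
  rw [e]; exact h2

theorem cut_isPosTC (s : Finset L) (hx : x.PosSemidef) : IsPosTC (cut s x) := by
  refine ⟨cut_posSemidef s hx, summable_of_ne_finset_zero (s := s) fun i hi => ?_⟩
  simp [cut, hi]

/-- The compression represents the effect on products with operators of finite support. -/
theorem trMul_cut_tens (hy : y ∈ TC E) (hM : IsEffect M) (s : Finset L) :
    trMul (tens e (cut s x) y) M = ∑ i ∈ s, ∑ j ∈ s, x i j * compr e y M j i := by
  classical
  have h1 : ∀ i j, TrSum (tens e (Matrix.single i j (1 : ℂ)) y) M := fun i j =>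
    trSum_of_mem (tens_mem e (single_mem i j) hy) hM
  rw [cut_eq, tens_sum_left]
  have h2 : ∀ i j, TrSum (tens e (x i j • Matrix.single i j (1 : ℂ)) y) M := fun i j => by
    rw [tens_smul_left]; exact (h1 i j).smul_left _
  have h3 : ∀ i, TrSum (tens e (∑ j ∈ s, x i j • Matrix.single i j (1 : ℂ)) y) M := fun i => by
    rw [tens_sum_left]; exact (TrSum.sum_left fun j _ => h2 i j).1
  rw [(TrSum.sum_left fun i _ => h3 i).2]
  refine Finset.sum_congr rfl fun i _ => ?_
  rw [tens_sum_left, (TrSum.sum_left fun j _ => h2 i j).2]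
  refine Finset.sum_congr rfl fun j _ => ?_
  rw [tens_smul_left, trMul_smul_left, compr, Matrix.of_apply]

theorem compr_posSemidef (hy : IsPosTC y) (hM : IsEffect M) : (compr e y M).PosSemidef := by
  classical
  have key : ∀ v : L →₀ ℂ, 0 ≤ v.sum fun i xi => v.sum fun j xj => star xi * compr e y M i j * xj := by
    intro v
    have hx : (Matrix.of fun i j => v i * star (v j) : Op L).PosSemidef := by
      refine posSemidef_of_finite fun t => ?_
      exact Matrix.posSemidef_vecMulVec_self_star (fun i : t => v i)
    have h := ((cut_isPosTC v.support hx).tens e hy).trMul_nonneg hM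
    rw [trMul_cut_tens e hy.mem hM] at h
    convert h using 1
    simp only [Finsupp.sum]
    refine Finset.sum_comm.trans (Finset.sum_congr rfl fun i _ => Finset.sum_congr rfl fun j _ => ?_)
    simp only [Matrix.of_apply]
    ring
  refine ⟨?_, key⟩
  -- the values of the quadratic form are real, so that the form is hermitian by polarization
  have hq : ∀ (i j : L) (c : ℂ), i ≠ j → (compr e y M i i + compr e y M i j * c
      + star c * compr e y M j i + star c * c * compr e y M j j).im = 0 := by
    intro i j c hij
    have h := (Complex.le_def.1 (key (Finsupp.single i 1 + Finsupp.single j c))).2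
    rw [Finsupp.sum_add_index' (by simp) (by
      intro a b₁ b₂
      simp only [Finsupp.sum, ← Finset.sum_add_distrib]
      exact Finset.sum_congr rfl fun _ _ => by rw [star_add]; ring)] at h
    have h0 : ∀ (a : L) (xi : ℂ), ((Finsupp.single i (1 : ℂ) + Finsupp.single j c).sum fun j_1 xj =>
        star xi * compr e y M a j_1 * xj) = star xi * compr e y M a i + star xi * compr e y M a j * c := by
      intro a xi
      rw [Finsupp.sum_add_index' (by simp) (by intros; ring)]
      simp
    simp only [h0] at h
    rw [Finsupp.sum_single_index (by simp), Finsupp.sum_single_index (by simp)] at h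
    simp only [Complex.zero_im, star_one, one_mul] at h
    rw [h]
    congr 1; ring
  have hd : ∀ i, (compr e y M i i).im = 0 := by
    intro i
    have h := (Complex.le_def.1 (key (Finsupp.single i 1))).2
    rw [Finsupp.sum_single_index (by simp), Finsupp.sum_single_index (by simp)] at h
    simpa using h.symm
  ext i j
  rw [Matrix.conjTranspose_apply]
  by_cases hij : i = j
  · subst hij
    apply Complex.ext
    · simp
    · simp [hd]
  · have h1 := hq i j 1 hij
    have h2 := hq i j Complex.I hij
    simp [hd, Complex.add_im, Complex.mul_im] at h1 h2
    apply Complex.ext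
    · simp; linarith
    · simp; linarith

theorem compr_idOp (hy : y ∈ TC E) (h1 : tr y = 1) : compr e y (idOp K) = idOp L := by
  classical
  ext i j
  rw [compr, Matrix.of_apply, trMul_one, tr_tens e (single_mem _ _) hy, h1, mul_one, idOp, tr]
  rw [Matrix.one_apply, tsum_eq_single i]
  · simp [Matrix.single_apply, eq_comm]
  · intro k hk; simp [Ne.symm hk]

theorem compr_sub (hy : y ∈ TC E) {N : Op K} (hM : IsEffect M) (hN : IsEffect N) :
    compr e y (M - N) = compr e y M - compr e y N := by
  classical
  ext i j
  simp only [compr, Matrix.of_apply, Matrix.sub_apply]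
  exact trMul_sub_right (trSum_of_mem (tens_mem e (single_mem _ _) hy) hM)
    (trSum_of_mem (tens_mem e (single_mem _ _) hy) hN)

theorem compr_isEffect (hy : IsState y) (hM : IsEffect M) : IsEffect (compr e y M) := by
  refine ⟨compr_posSemidef e hy.isPosTC hM, ?_⟩
  rw [← compr_idOp e hy.isPosTC.mem hy.tr_eq, ← compr_sub e hy.isPosTC.mem isEffect_one hM]
  exact compr_posSemidef e hy.isPosTC hM.compl

/-- The compression of an effect represents it on the states `x ⊗ y`. -/
theorem IsPosTC.trMul_compr (hx : IsPosTC x) (hy : IsState y) (hM : IsEffect M) :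
    trMul x (compr e y M) = trMul (QEst.tens e x y) M := by
  classical
  have hX := hx.tens e hy.isPosTC
  have h2 : Tendsto (fun s : Finset L => (s, s)) atTop (atTop ×ˢ atTop) :=
    tendsto_id.prodMk tendsto_id
  have h1 := ((hx.trSum (compr_isEffect e hy hM)).lim.comp h2)
  refine tendsto_nhds_unique h1 ?_
  have h4 : ∀ s : Finset L, Tendsto (fun t : Finset E =>
      ∑ i ∈ rect e (s, t), ∑ j ∈ rect e (s, t), QEst.tens e x y i j * M j i) atTop
      (𝓝 (∑ i ∈ s, ∑ j ∈ s, x i j * compr e y M j i)) := by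
    intro s
    rw [← trMul_cut_tens e hy.isPosTC.mem hM s]
    have h5 := (((cut_isPosTC s hx.1).tens e hy.isPosTC).trSum hM).tendsto_rect e
    -- enlarging the rectangle in the first direction beyond `s` does not change the sum
    have h6 : ∀ p : Finset L × Finset E, s ⊆ p.1 →
        (∑ i ∈ rect e p, ∑ j ∈ rect e p, QEst.tens e (cut s x) y i j * M j i) =
        ∑ i ∈ rect e (s, p.2), ∑ j ∈ rect e (s, p.2), QEst.tens e x y i j * M j i := by
      intro p hp
      have hsub : rect e (s, p.2) ⊆ rect e p :=
        Finset.map_subset_map.2 (Finset.product_subset_product_left hp)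
      have hmem : ∀ k ∈ rect e p, k ∉ rect e (s, p.2) → (e k).1 ∉ s := by
        intro k hk hk' h
        simp only [rect, Finset.mem_map_equiv, Finset.mem_product, Equiv.symm_symm] at hk hk'
        exact hk' ⟨h, hk.2⟩
      have hin : ∀ k ∈ rect e (s, p.2), (e k).1 ∈ s := by
        intro k hk
        simp only [rect, Finset.mem_map_equiv, Finset.mem_product, Equiv.symm_symm] at hk
        exact hk.1
      rw [← Finset.sum_subset hsub]
      · refine Finset.sum_congr rfl fun i hi => ?_
        rw [← Finset.sum_subset hsub]
        · refine Finset.sum_congr rfl fun j hj => ?_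
          simp [tens_apply, cut, hin i hi, hin j hj]
        · intro j hj hj'
          simp [tens_apply, cut, hmem j hj hj']
      · intro i hi hi'
        refine Finset.sum_eq_zero fun j _ => ?_
        simp [tens_apply, cut, hmem i hi hi']
    have h7 : Tendsto (fun p : Finset L × Finset E => ∑ i ∈ rect e (s, p.2),
        ∑ j ∈ rect e (s, p.2), QEst.tens e x y i j * M j i) atTop
        (𝓝 (trMul (QEst.tens e (cut s x) y) M)) := by
      refine h5.congr' ?_
      rw [← prod_atTop_atTop_eq]
      filter_upwards [(eventually_ge_atTop s).prod_inl _] with p hp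
      exact h6 p hp
    rw [← prod_atTop_atTop_eq] at h7
    refine Metric.tendsto_nhds.2 fun ε hε => ?_
    have h9 := (Metric.tendsto_nhds.1 h7 ε hε).curry
    obtain ⟨u, hu⟩ := h9.exists
    exact hu
  rw [Metric.tendsto_nhds]
  intro ε hε
  have h10 := (hX.trSum hM).tendsto_rect e
  rw [← prod_atTop_atTop_eq] at h10
  have h11 := (Metric.tendsto_nhds.1 h10 (ε / 2) (by positivity)).curry
  filter_upwards [h11] with s hs
  have := le_of_tendsto ((h4 s).dist (tendsto_const_nhds (x := trMul (QEst.tens e x y) M)))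
    (hs.mono fun t ht => ht.le)
  exact lt_of_le_of_lt this (by linarith)

end compress

/-! ### Partial traces -/

/-- The partial trace over the second factor. -/
def ptr {K L E : Type} (e : K ≃ L × E) (X : Op K) : Op L :=
  Matrix.of fun i j => ∑' a, X (e.symm (i, a)) (e.symm (j, a))

section ptr

variable {K L E : Type} (e : K ≃ L × E) {X Y : Op K}

theorem ptr_summable (hX : X ∈ TC K) (i j : L) :
    Summable fun a => X (e.symm (i, a)) (e.symm (j, a)) := by
  induction hX using Submodule.span_induction with
  | mem X hX =>
    have hX : IsPosTC X := hX
    have h : ∀ i : L, Summable fun a => (X (e.symm (i, a)) (e.symm (i, a))).re := fun i =>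
      hX.summable_re.comp_injective (i := fun a => e.symm (i, a)) fun a b h => by simpa using h
    exact Summable.of_norm_bounded (((h i).add (h j)).div_const 2) fun a =>
      norm_entry_le hX.1 _ _
  | zero => simp
  | add X Y _ _ h1 h2 => exact h1.add h2
  | smul c X _ h => exact h.mul_left c

theorem ptr_add (hX : X ∈ TC K) (hY : Y ∈ TC K) : ptr e (X + Y) = ptr e X + ptr e Y := by
  ext i j
  exact (ptr_summable e hX i j).tsum_add (ptr_summable e hY i j)

theorem ptr_sub (hX : X ∈ TC K) (hY : Y ∈ TC K) : ptr e (X - Y) = ptr e X - ptr e Y := by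
  ext i j
  exact (ptr_summable e hX i j).tsum_sub (ptr_summable e hY i j)

theorem ptr_rsmul (c : ℝ) : ptr e (c • X) = c • ptr e X := by
  ext i j
  simp only [ptr, Matrix.of_apply, Matrix.smul_apply, Complex.real_smul, tsum_mul_left]

theorem ptr_posSemidef (hX : IsPosTC X) : (ptr e X).PosSemidef := by
  classical
  refine posSemidef_of_tendsto (l := atTop) (A := fun s : Finset E => ∑ a ∈ s,
    X.submatrix (fun i => e.symm (i, a)) (fun i => e.symm (i, a))) (fun s => ?_) (fun i j => ?_)
  · exact Matrix.posSemidef_sum s fun a _ => hX.1.submatrix _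
  · simp only [Matrix.sum_apply, Matrix.submatrix_apply]
    exact (ptr_summable e hX.mem i j).hasSum

theorem IsPosTC.ptr_hasSum (hX : IsPosTC X) : HasSum (fun i => ptr e X i i) (tr X) := by
  have h1 : HasSum (fun p : L × E => X (e.symm p) (e.symm p)) (tr X) :=
    (e.symm.hasSum_iff (f := fun k => X k k)).2 hX.2.hasSum
  exact h1.prod_fiberwise fun i => (ptr_summable e hX.mem i i).hasSum

theorem IsPosTC.ptr (hX : IsPosTC X) : IsPosTC (ptr e X) :=
  ⟨ptr_posSemidef e hX, (hX.ptr_hasSum e).summable⟩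

theorem IsPosTC.tr_ptr (hX : IsPosTC X) : tr (QEst.ptr e X) = tr X := (hX.ptr_hasSum e).tsum_eq

theorem ptr_tens (x : Op L) (y : Op E) : ptr e (tens e x y) = tr y • x := by
  ext i j
  simp only [ptr, Matrix.of_apply, tens_apply, Equiv.apply_symm_apply, tsum_mul_left, tr,
    Matrix.smul_apply, smul_eq_mul]
  ring

theorem IsState.ptr (hX : IsState X) : IsState (QEst.ptr e X) := by
  rw [isState_iff] at hX ⊢
  exact ⟨hX.1.ptr e, (hX.1.tr_ptr e).trans hX.2⟩

end ptr

/-! ### The trace norm -/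

/-- `X = P - N` with positive trace class operators `P`, `N` with `tr P + tr N ≤ r`. -/
def TNle {I : Type} (X : Op I) (r : ℝ) : Prop :=
  ∃ P N : Op I, IsPosTC P ∧ IsPosTC N ∧ X = P - N ∧ (tr P).re + (tr N).re ≤ r

theorem TC_tr_add {I : Type} {A B : Op I} (hA : IsPosTC A) (hB : IsPosTC B) :
    tr (A + B) = tr A + tr B := hA.2.tsum_add hB.2

theorem tr_rsmul {I : Type} (c : ℝ) (A : Op I) : tr (c • A) = c * tr A := by
  simp only [tr, Matrix.smul_apply, Complex.real_smul, tsum_mul_left]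

section TNle

variable {I : Type} {X Y : Op I} {r s : ℝ}

theorem traceNorm_le_of (h : TNle X r) : traceNorm X ≤ ENNReal.ofReal r := by
  obtain ⟨P, N, hP, hN, hX, hr⟩ := h
  refine (iInf_le_of_le P <| iInf_le_of_le N <| iInf_le_of_le hP <| iInf_le_of_le hN <|
    iInf_le_of_le hX ?_)
  rw [Complex.add_re]
  exact ENNReal.ofReal_le_ofReal hr

theorem TNle_of_traceNorm_lt (h : traceNorm X < ENNReal.ofReal r) : TNle X r := by
  simp only [traceNorm, iInf_lt_iff] at h
  obtain ⟨P, N, hP, hN, hX, hr⟩ := h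
  refine ⟨P, N, hP, hN, hX, ?_⟩
  rw [Complex.add_re] at hr
  exact (ENNReal.lt_ofReal_iff_toReal_lt (by simp)).1 hr |>.le |> fun h => by
    rwa [ENNReal.toReal_ofReal (add_nonneg hP.tr_re_nonneg hN.tr_re_nonneg)] at h

theorem tendsto_traceNorm_iff {ι : Type*} {l : Filter ι} {F : ι → Op I} :
    Tendsto (fun k => traceNorm (F k)) l (𝓝 0) ↔ ∀ ε > 0, ∀ᶠ k in l, TNle (F k) ε := by
  rw [ENNReal.tendsto_nhds_zero]
  constructor
  · intro h ε hε
    refine (h (ENNReal.ofReal (ε / 2)) (by simpa using hε)).mono fun k hk => ?_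
    refine TNle_of_traceNorm_lt (hk.trans_lt ?_)
    rw [ENNReal.ofReal_lt_ofReal_iff hε]
    linarith
  · intro h ε hε
    by_cases htop : ε = ⊤
    · simp [htop]
    · refine (h ε.toReal (ENNReal.toReal_pos hε.ne' htop)).mono fun k hk => ?_
      exact (traceNorm_le_of hk).trans (ENNReal.ofReal_toReal htop).le

theorem TNle.mono (h : TNle X r) (hrs : r ≤ s) : TNle X s := by
  obtain ⟨P, N, hP, hN, hX, hr⟩ := h
  exact ⟨P, N, hP, hN, hX, hr.trans hrs⟩

theorem TNle.nonneg (h : TNle X r) : 0 ≤ r := by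
  obtain ⟨P, N, hP, hN, -, hr⟩ := h
  exact (add_nonneg hP.tr_re_nonneg hN.tr_re_nonneg).trans hr

theorem TNle.mem (h : TNle X r) : X ∈ TC I := by
  obtain ⟨P, N, hP, hN, rfl, -⟩ := h
  exact (TC I).sub_mem hP.mem hN.mem

theorem IsPosTC.tnle (h : IsPosTC X) : TNle X (tr X).re :=
  ⟨X, 0, h, isPosTC_zero, by simp, by simp [tr]⟩

theorem TNle.add (h1 : TNle X r) (h2 : TNle Y s) : TNle (X + Y) (r + s) := by
  obtain ⟨P, N, hP, hN, rfl, hr⟩ := h1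
  obtain ⟨P', N', hP', hN', rfl, hr'⟩ := h2
  refine ⟨P + P', N + N', hP.add hP', hN.add hN', by abel, ?_⟩
  rw [TC_tr_add hP hP', TC_tr_add hN hN', Complex.add_re, Complex.add_re]
  linarith

theorem TNle.neg (h : TNle X r) : TNle (-X) r := by
  obtain ⟨P, N, hP, hN, rfl, hr⟩ := h
  exact ⟨N, P, hN, hP, by abel, by linarith⟩

theorem TNle.sub (h1 : TNle X r) (h2 : TNle Y s) : TNle (X - Y) (r + s) := by
  rw [sub_eq_add_neg]; exact h1.add h2.neg

theorem TNle.smul (h : TNle X r) (c : ℝ) : TNle (c • X) (|c| * r) := by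
  have key : ∀ c : ℝ, 0 ≤ c → TNle (c • X) (c * r) := by
    intro c hc
    obtain ⟨P, N, hP, hN, rfl, hr⟩ := h
    refine ⟨c • P, c • N, hP.smul hc, hN.smul hc, smul_sub _ _ _, ?_⟩
    simp only [tr_rsmul, Complex.re_ofReal_mul]
    nlinarith
  rcases le_total 0 c with hc | hc
  · rw [abs_of_nonneg hc]; exact key c hc
  · rw [abs_of_nonpos hc]
    have := (key (-c) (by linarith)).neg
    simpa using this

theorem TNle.tens {K L E : Type} (e : K ≃ L × E) {x : Op L} {y : Op E} (h1 : TNle x r)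
    (h2 : TNle y s) : TNle (tens e x y) (r * s) := by
  have hs := h2.nonneg
  obtain ⟨P, N, hP, hN, rfl, hr⟩ := h1
  obtain ⟨P', N', hP', hN', rfl, hr'⟩ := h2
  refine ⟨QEst.tens e P P' + QEst.tens e N N', QEst.tens e P N' + QEst.tens e N P',
    (hP.tens e hP').add (hN.tens e hN'), (hP.tens e hN').add (hN.tens e hP'), ?_, ?_⟩
  · simp only [tens_sub_left, tens_sub_right]; abel
  · rw [TC_tr_add (hP.tens e hP') (hN.tens e hN'), TC_tr_add (hP.tens e hN') (hN.tens e hP'),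
      tr_tens e hP.mem hP'.mem, tr_tens e hN.mem hN'.mem, tr_tens e hP.mem hN'.mem,
      tr_tens e hN.mem hP'.mem, hP.tr_eq, hN.tr_eq, hP'.tr_eq, hN'.tr_eq, ← hP.tr_re, ← hN.tr_re,
      ← hP'.tr_re, ← hN'.tr_re]
    simp only [← Complex.ofReal_mul, ← Complex.ofReal_add, Complex.ofReal_re]
    have := hP.tr_re_nonneg
    have := hN.tr_re_nonneg
    have := mul_le_mul hr hr' (add_nonneg hP'.tr_re_nonneg hN'.tr_re_nonneg)
      ((add_nonneg hP.tr_re_nonneg hN.tr_re_nonneg).trans hr)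
    linarith

theorem TNle.ptr {K L E : Type} (e : K ≃ L × E) {X : Op K} (h : TNle X r) : TNle (ptr e X) r := by
  obtain ⟨P, N, hP, hN, rfl, hr⟩ := h
  exact ⟨QEst.ptr e P, QEst.ptr e N, hP.ptr e, hN.ptr e, ptr_sub e hP.mem hN.mem, by
    rwa [hP.tr_ptr, hN.tr_ptr]⟩

theorem TNle.norm_entry_le (h : TNle X r) (i j : I) : ‖X i j‖ ≤ r := by
  obtain ⟨P, N, hP, hN, rfl, hr⟩ := h
  rw [Matrix.sub_apply]
  have := hP.norm_entry_le_tr i j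
  have := hN.norm_entry_le_tr i j
  linarith [norm_sub_le (P i j) (N i j)]

theorem TNle.norm_trMul_le (h : TNle X r) {M : Op I} (hM : IsEffect M) : ‖trMul X M‖ ≤ r := by
  obtain ⟨P, N, hP, hN, rfl, hr⟩ := h
  rw [trMul_sub_left (hP.trSum hM) (hN.trSum hM)]
  have := hP.norm_trMul_le hM
  have := hN.norm_trMul_le hM
  linarith [norm_sub_le (trMul P M) (trMul N M)]

end TNle

/-! ### Derivatives of curves of states in trace norm -/

/-- `X` is the derivative at `0` of the curve `c`, with respect to the trace norm. -/
def HasTD {I : Type} (c : ℝ → Op I) (X : Op I) : Prop :=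
  ∀ ε > 0, ∀ᶠ t in 𝓝[≠] (0 : ℝ), TNle (t⁻¹ • (c t - c 0) - X) ε

section HasTD

variable {I : Type} {c : ℝ → Op I} {X : Op I}

theorem HasTD.exists_TNle (h : HasTD c X) (hc : ∀ᶠ t in 𝓝 (0 : ℝ), IsState (c t)) :
    ∃ r, TNle X r := by
  obtain ⟨t, ht1, ht2⟩ := ((h 1 one_pos).and (hc.filter_mono nhdsWithin_le_nhds)).exists
  have h2 := ((ht2.isPosTC.tnle.sub hc.self_of_nhds.isPosTC.tnle).smul t⁻¹).sub ht1
  exact ⟨_, by simpa using h2⟩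

/-- Functions that are controlled by the trace norm are differentiable along the curve. -/
theorem HasTD.hasDerivAt_of_bound (h : HasTD c X) {φ : Op I → ℂ} {ψ : ℂ}
    (hφ : ∀ r t, TNle (t⁻¹ • (c t - c 0) - X) r → t ≠ 0 → ‖(t : ℂ)⁻¹ * (φ (c t) - φ (c 0)) - ψ‖ ≤ r) :
    HasDerivAt (fun t : ℝ => φ (c t)) ψ 0 := by
  rw [hasDerivAt_iff_tendsto_slope]
  rw [Metric.tendsto_nhds]
  intro ε hε
  filter_upwards [h (ε / 2) (by positivity), self_mem_nhdsWithin] with t ht ht0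
  rw [dist_eq_norm, slope_def_module, sub_zero, Complex.real_smul, Complex.ofReal_inv]
  exact (hφ _ t ht ht0).trans_lt (by linarith)

theorem HasTD.hasDerivAt_entry (h : HasTD c X) (i j : I) :
    HasDerivAt (fun t : ℝ => c t i j) (X i j) 0 := by
  refine h.hasDerivAt_of_bound (φ := fun A => A i j) fun r t ht _ => ?_
  have := ht.norm_entry_le i j
  simpa using this

theorem HasTD.hasDerivAt_trMul (h : HasTD c X) (hc : ∀ᶠ t in 𝓝 (0 : ℝ), IsState (c t))
    {M : Op I} (hM : IsEffect M) :
    HasDerivAt (fun t : ℝ => trMul (c t) M) (trMul X M) 0 := by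
  obtain ⟨r, hX⟩ := h.exists_TNle hc
  have h0 := hc.self_of_nhds
  rw [hasDerivAt_iff_tendsto_slope, Metric.tendsto_nhds]
  intro ε hε
  filter_upwards [h (ε / 2) (by positivity), self_mem_nhdsWithin,
    hc.filter_mono nhdsWithin_le_nhds] with t ht ht0 hst
  rw [dist_eq_norm, slope_def_module, sub_zero, Complex.real_smul, Complex.ofReal_inv]
  have h1 := ht.norm_trMul_le hM
  have e1 : t⁻¹ • (c t - c 0) = ((t : ℂ)⁻¹) • (c t - c 0) := by
    ext i j; simp
  have h2 : TrSum (c t - c 0) M := trSum_of_mem ((TC I).sub_mem hst.isPosTC.mem h0.isPosTC.mem) hM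
  rw [e1, trMul_sub_left (h2.smul_left _) (trSum_of_mem hX.mem hM), trMul_smul_left,
    trMul_sub_left (hst.isPosTC.trSum hM) (h0.isPosTC.trSum hM)] at h1
  exact h1.trans_lt (by linarith)

theorem HasTD.tr_eq_zero (h : HasTD c X) (hc : ∀ᶠ t in 𝓝 (0 : ℝ), IsState (c t)) : tr X = 0 := by
  have h1 := h.hasDerivAt_trMul hc isEffect_one
  simp only [trMul_one] at h1
  have h2 : HasDerivAt (fun t : ℝ => tr (c t)) 0 0 :=
    (hasDerivAt_const (0 : ℝ) (1 : ℂ)).congr_of_eventuallyEq (hc.mono fun t ht => ht.tr_eq)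
  exact h1.unique h2

theorem HasTD.ptr {K L E : Type} (e : K ≃ L × E) {c : ℝ → Op K} {X : Op K} (h : HasTD c X)
    (hc : ∀ᶠ t in 𝓝 (0 : ℝ), IsState (c t)) : HasTD (fun t => ptr e (c t)) (ptr e X) := by
  obtain ⟨r, hX⟩ := h.exists_TNle hc
  have h0 := hc.self_of_nhds
  intro ε hε
  filter_upwards [h ε hε, hc.filter_mono nhdsWithin_le_nhds] with t ht hst
  have h1 := ht.ptr e
  have h2 := ((hst.isPosTC.tnle.sub h0.isPosTC.tnle).smul t⁻¹).mem
  rwa [ptr_sub e h2 hX.mem, ptr_rsmul, ptr_sub e hst.isPosTC.mem h0.isPosTC.mem] at h1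

theorem HasTD.tens {K L E : Type} (e : K ≃ L × E) {c : ℝ → Op L} {d : ℝ → Op E} {X : Op L}
    {Y : Op E} (h1 : HasTD c X) (h2 : HasTD d Y) (hc : ∀ᶠ t in 𝓝 (0 : ℝ), IsState (c t))
    (hd : ∀ᶠ t in 𝓝 (0 : ℝ), IsState (d t)) :
    HasTD (fun t => tens e (c t) (d t)) (tens e X (d 0) + tens e (c 0) Y) := by
  obtain ⟨r, hX⟩ := h1.exists_TNle hc
  obtain ⟨s, hY⟩ := h2.exists_TNle hd
  have hc0 := hc.self_of_nhds.isPosTC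
  have htr0 : (tr (c 0)).re = 1 := by rw [hc.self_of_nhds.tr_eq]; simp
  have hr := hX.nonneg
  have hs := hY.nonneg
  intro ε hε
  have ht0 : ∀ᶠ t in 𝓝[≠] (0 : ℝ), r * (|t| * (s + 1)) < ε / 3 := by
    have : Tendsto (fun t : ℝ => r * (|t| * (s + 1))) (𝓝[≠] 0) (𝓝 (r * (|0| * (s + 1)))) := by
      refine Tendsto.mono_left ?_ nhdsWithin_le_nhds
      exact (continuous_const.mul (continuous_abs.mul continuous_const)).tendsto 0
    exact this.eventually (gt_mem_nhds (by simpa using by positivity))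
  filter_upwards [h1 (ε / 3) (by positivity), h2 (ε / 3) (by positivity), h2 1 one_pos, ht0,
    hd.filter_mono nhdsWithin_le_nhds, self_mem_nhdsWithin] with t e1 e2 e3 e4 hdt htne
  have htr : (tr (d t)).re = 1 := by rw [hdt.tr_eq]; simp
  -- `d t - d 0` is small in trace norm
  have e5 : TNle (d t - d 0) (|t| * (s + 1)) := by
    have h5 := (e3.add hY).smul t
    rw [sub_add_cancel, smul_smul, mul_inv_cancel₀ htne, one_smul] at h5
    exact h5.mono (by rw [add_comm])
  have a1 := e1.tens e hdt.isPosTC.tnle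
  have a2 := hX.tens e e5
  have a3 := hc0.tnle.tens e e2
  rw [htr, mul_one] at a1
  rw [htr0, one_mul] at a3
  refine (((a1.add a2).add a3).mono (by linarith : _ ≤ ε)) |> fun h => ?_
  convert h using 1
  ext p q
  simp only [Matrix.sub_apply, Matrix.smul_apply, Matrix.add_apply, tens_apply, Complex.real_smul]
  ring

end HasTD

/-! ### The laws of measurement data -/

section law

variable {I Ω : Type} [MeasurableSpace Ω] (M : POVM I Ω) {A B D : Op I}

theorem POVM.effect_univ : M.effect Set.univ = idOp I := by
  classical
  ext i j
  by_cases h : i = j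
  · subst h; simp [idOp, M.univ_diag]
  · simp [idOp, M.univ_offDiag i j h, h]

theorem POVM.effect_empty : M.effect ∅ = 0 := by
  ext i j
  have h := M.sigma_additive (fun _ => ∅) (fun _ => MeasurableSet.empty)
    (fun _ _ _ => by simp) i j
  simpa using (summable_const_iff _).1 h.summable

theorem POVM.effect_union {Δ Δ' : Set Ω} (h : MeasurableSet Δ) (h' : MeasurableSet Δ')
    (hd : Disjoint Δ Δ') : M.effect (Δ ∪ Δ') = M.effect Δ + M.effect Δ' := by
  ext i j
  have h1 := M.sigma_additive (fun k => if k = 0 then Δ else if k = 1 then Δ' else ∅)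
    (fun k => by split_ifs <;> simp [h, h']) (fun k l hkl => by
      dsimp only
      split_ifs <;> simp_all [hd.symm]) i j
  have e : (⋃ k : ℕ, if k = 0 then Δ else if k = 1 then Δ' else ∅) = Δ ∪ Δ' := by
    ext ω
    simp only [Set.mem_iUnion, Set.mem_union]
    constructor
    · rintro ⟨k, hk⟩
      split_ifs at hk <;> simp_all
    · rintro (hω | hω)
      · exact ⟨0, by simpa using hω⟩
      · exact ⟨1, by simpa using hω⟩
  rw [e] at h1
  have h2 : HasSum (fun k : ℕ => M.effect (if k = 0 then Δ else if k = 1 then Δ' else ∅) i j)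
      (∑ k ∈ Finset.range 2, M.effect (if k = 0 then Δ else if k = 1 then Δ' else ∅) i j) := by
    refine hasSum_sum_of_ne_finset_zero fun k hk => ?_
    have : 1 < k := by simpa using hk
    rw [if_neg (by omega), if_neg (by omega), M.effect_empty]; rfl
  rw [h1.unique h2]
  simp [Finset.sum_range_succ]

theorem POVM.effect_compl {Δ : Set Ω} (h : MeasurableSet Δ) :
    M.effect Δᶜ = idOp I - M.effect Δ := by
  rw [← M.effect_univ, ← Set.union_compl_self Δ, M.effect_union h h.compl disjoint_compl_right]
  abel

theorem POVM.isEffect {Δ : Set Ω} (h : MeasurableSet Δ) : IsEffect (M.effect Δ) :=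
  ⟨M.pos Δ h, by rw [← M.effect_compl h]; exact M.pos _ h.compl⟩

theorem POVM.effect_biUnion {f : ℕ → Set Ω} (hf : ∀ k, MeasurableSet (f k))
    (hd : Pairwise (fun j k => Disjoint (f j) (f k))) (n : ℕ) :
    M.effect (⋃ k ∈ Finset.range n, f k) = ∑ k ∈ Finset.range n, M.effect (f k) := by
  induction n with
  | zero => simp [M.effect_empty]
  | succ n ih =>
    rw [Finset.sum_range_succ, ← ih, ← M.effect_union (Finset.measurableSet_biUnion _ fun k _ => hf k)
      (hf n)]
    · congr 1
      ext ω
      simp only [Finset.mem_range, Set.mem_iUnion, Set.mem_union, Nat.lt_succ_iff_lt_or_eq]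
      constructor
      · rintro ⟨k, hk | hk, h⟩
        · exact Or.inl ⟨k, hk, h⟩
        · exact Or.inr (hk ▸ h)
      · rintro (⟨k, hk, h⟩ | h)
        · exact ⟨k, Or.inl hk, h⟩
        · exact ⟨n, Or.inr rfl, h⟩
    · rw [Set.disjoint_iUnion₂_left]
      intro k hk
      exact hd (Finset.mem_range.1 hk).ne

/-- Countable additivity of `Δ ↦ tr A M(Δ)`. -/
theorem POVM.hasSum_trMul (hA : IsPosTC A) {f : ℕ → Set Ω} (hf : ∀ k, MeasurableSet (f k))
    (hd : Pairwise (fun j k => Disjoint (f j) (f k))) :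
    HasSum (fun k => (trMul A (M.effect (f k))).re) (trMul A (M.effect (⋃ k, f k))).re := by
  have h0 : ∀ n, MeasurableSet (⋃ k ∈ Finset.range n, f k) := fun n =>
    Finset.measurableSet_biUnion _ fun k _ => hf k
  have h1 := hA.tendsto_trMul (l := atTop) (fun n => M.isEffect (h0 n))
    (M.isEffect (MeasurableSet.iUnion hf)) (fun i j => by
      have := (M.sigma_additive f hf hd i j).tendsto_sum_nat
      refine this.congr fun n => ?_
      rw [M.effect_biUnion hf hd, Matrix.sum_apply])
  rw [hasSum_iff_tendsto_nat_of_nonneg fun k => hA.trMul_re_nonneg (M.isEffect (hf k))]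
  refine ((Complex.continuous_re.tendsto _).comp h1).congr fun n => ?_
  simp only [Function.comp]
  rw [M.effect_biUnion hf hd, (TrSum.sum_right fun k _ => hA.trSum (M.isEffect (hf k))).2,
    Complex.re_sum]

theorem exists_law (hA : IsPosTC A) : ∃ μ : Measure Ω, ∀ Δ, MeasurableSet Δ →
    μ Δ = ENNReal.ofReal (trMul A (M.effect Δ)).re := by
  refine ⟨Measure.ofMeasurable (fun Δ _ => ENNReal.ofReal (trMul A (M.effect Δ)).re) ?_ ?_,
    fun Δ hΔ => Measure.ofMeasurable_apply Δ hΔ⟩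
  · simp [M.effect_empty, trMul]
  · intro f hf hd
    have h := M.hasSum_trMul hA hf hd
    rw [← h.tsum_eq, ENNReal.ofReal_tsum_of_nonneg
      (fun k => hA.trMul_re_nonneg (M.isEffect (hf k))) h.summable]

theorem law_apply (hA : IsPosTC A) {Δ : Set Ω} (hΔ : MeasurableSet Δ) :
    law M A Δ = ENNReal.ofReal (trMul A (M.effect Δ)).re := by
  classical
  have h := exists_law M hA
  rw [law, dif_pos h]
  exact h.choose_spec Δ hΔ

theorem law_real_apply (hA : IsPosTC A) {Δ : Set Ω} (hΔ : MeasurableSet Δ) :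
    (law M A).real Δ = (trMul A (M.effect Δ)).re := by
  rw [Measure.real, law_apply M hA hΔ,
    ENNReal.toReal_ofReal (hA.trMul_re_nonneg (M.isEffect hΔ))]

instance isFiniteMeasure_law (A : Op I) : IsFiniteMeasure (law M A) := by
  classical
  rw [law]
  split_ifs with h
  · exact ⟨by rw [h.choose_spec _ MeasurableSet.univ]; exact ENNReal.ofReal_lt_top⟩
  · infer_instance

theorem law_eq_of (hA : IsPosTC A) {μ : Measure Ω} (h : ∀ Δ, MeasurableSet Δ →
    μ Δ = ENNReal.ofReal (trMul A (M.effect Δ)).re) : law M A = μ :=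
  Measure.ext fun Δ hΔ => by rw [law_apply M hA hΔ, h Δ hΔ]

theorem law_add (hA : IsPosTC A) (hB : IsPosTC B) : law M (A + B) = law M A + law M B := by
  refine law_eq_of M (hA.add hB) fun Δ hΔ => ?_
  rw [Measure.add_apply, law_apply M hA hΔ, law_apply M hB hΔ,
    trMul_add_left (hA.trSum (M.isEffect hΔ)) (hB.trSum (M.isEffect hΔ)), Complex.add_re,
    ENNReal.ofReal_add (hA.trMul_re_nonneg (M.isEffect hΔ)) (hB.trMul_re_nonneg (M.isEffect hΔ))]

theorem trMul_rsmul_left (c : ℝ) (N : Op I) : trMul (c • A) N = c * trMul A N := by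
  have : c • A = (c : ℂ) • A := by ext i j; simp
  rw [this, trMul_smul_left]

theorem law_smul (hA : IsPosTC A) {c : ℝ} (hc : 0 ≤ c) :
    law M (c • A) = ENNReal.ofReal c • law M A := by
  refine law_eq_of M (hA.smul hc) fun Δ hΔ => ?_
  rw [Measure.smul_apply, law_apply M hA hΔ, trMul_rsmul_left, Complex.re_ofReal_mul,
    ENNReal.ofReal_mul hc, smul_eq_mul]

theorem law_mono (hA : IsPosTC A) (hB : IsPosTC B) (h : (B - A).PosSemidef) :
    law M A ≤ law M B := by
  have hBA : IsPosTC (B - A) := hB.of_le h (by simpa using hA.1)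
  have : B = A + (B - A) := by abel
  rw [this, law_add M hA hBA]
  exact Measure.le_add_right le_rfl

theorem isProbabilityMeasure_law (hA : IsState A) : IsProbabilityMeasure (law M A) :=
  ⟨by rw [law_apply M hA.isPosTC MeasurableSet.univ, M.effect_univ, trMul_one, hA.tr_eq]; simp⟩

end law

/-! ### The compression of a measurement by a state of the environment -/

/-- The measurement of the first factor that consists in preparing the environment in the state
`y` and measuring `M`. -/
def comprPOVM {K L E Ω : Type} [MeasurableSpace Ω] (e : K ≃ L × E) {y : Op E} (hy : IsState y)
    (M : POVM K Ω) : POVM L Ω where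
  effect Δ := compr e y (M.effect Δ)
  pos Δ hΔ := compr_posSemidef e hy.isPosTC (M.isEffect hΔ)
  univ_diag i := by rw [M.effect_univ, compr_idOp e hy.isPosTC.mem hy.tr_eq]; simp [idOp]
  univ_offDiag i j h := by
    rw [M.effect_univ, compr_idOp e hy.isPosTC.mem hy.tr_eq]; simp [idOp, h]
  sigma_additive f hf hd i j := by
    classical
    simp only [compr, Matrix.of_apply]
    have key : ∀ X ∈ TC K, HasSum (fun k => trMul X (M.effect (f k)))
        (trMul X (M.effect (⋃ k, f k))) := by
      intro X hX
      have hE : ∀ k, IsEffect (M.effect (f k)) := fun k => M.isEffect (hf k)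
      have hU : IsEffect (M.effect (⋃ k, f k)) := M.isEffect (MeasurableSet.iUnion hf)
      induction hX using Submodule.span_induction with
      | mem X hX =>
        have hX : IsPosTC X := hX
        have h := M.hasSum_trMul hX hf hd
        rw [← Complex.hasSum_ofReal, ← hX.trMul_eq_re hU] at h
        simpa only [← hX.trMul_eq_re (hE _)] using h
      | zero => simp [trMul]
      | add X Y hX hY h1 h2 =>
        simp only [fun k => trMul_add_left (trSum_of_mem hX (hE k)) (trSum_of_mem hY (hE k)),
          trMul_add_left (trSum_of_mem hX hU) (trSum_of_mem hY hU)]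
        exact h1.add h2
      | smul c X _ h => simpa only [trMul_smul_left] using h.mul_left c
    exact key _ (tens_mem e (single_mem _ _) hy.isPosTC.mem)

theorem law_comprPOVM {K L E Ω : Type} [MeasurableSpace Ω] (e : K ≃ L × E) {x : Op L} {y : Op E}
    (hx : IsPosTC x) (hy : IsState y) (M : POVM K Ω) :
    law (comprPOVM e hy M) x = law M (tens e x y) := by
  refine law_eq_of _ hx fun Δ hΔ => ?_
  rw [law_apply M (hx.tens e hy.isPosTC) hΔ, comprPOVM, hx.trMul_compr e hy (M.isEffect hΔ)]

/-! ### Estimators with finitely many outcomes -/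

/-- The pairs `(B, W)` of the derivative of the mean and the variance matrix, at a state `S` with
derivatives `X`, of the centered estimators with finitely many outcomes: the effects are `E k`,
the value of the estimator at the outcome `k` is `t k`. -/
def Adm {L : Type} {m : ℕ} (S : Op L) (X : Fin m → Op L) :
    Set (Matrix (Fin m) (Fin m) ℝ × Matrix (Fin m) (Fin m) ℝ) :=
  {p | ∃ (κ : Type) (_ : Fintype κ) (E : κ → Op L) (t : κ → Fin m → ℝ),
    (∀ k, (E k).PosSemidef) ∧ ∑ k, E k = idOp L ∧
    (∀ i, ∑ k, t k i * (trMul S (E k)).re = 0) ∧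
    (∀ i j, p.1 i j = ∑ k, t k i * (trMul (X j) (E k)).re) ∧
    ∀ i j, p.2 i j = ∑ k, t k i * t k j * (trMul S (E k)).re}

theorem isEffect_of_sum {L κ : Type} [Fintype κ] {E : κ → Op L} (hE : ∀ k, (E k).PosSemidef)
    (h1 : ∑ k, E k = idOp L) (k : κ) : IsEffect (E k) := by
  classical
  refine ⟨hE k, ?_⟩
  rw [← h1, ← Finset.sum_erase_add _ _ (Finset.mem_univ k), add_sub_cancel_right]
  exact Matrix.posSemidef_sum _ fun i _ => hE i

section Adm

variable {L : Type} {m : ℕ} {S : Op L} {X : Fin m → Op L}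
  {B B' W W' : Matrix (Fin m) (Fin m) ℝ}

theorem mem_Adm : (B, W) ∈ Adm S X ↔ ∃ (κ : Type) (_ : Fintype κ) (E : κ → Op L)
    (t : κ → Fin m → ℝ), (∀ k, (E k).PosSemidef) ∧ ∑ k, E k = idOp L ∧
    (∀ i, ∑ k, t k i * (trMul S (E k)).re = 0) ∧
    (∀ i j, B i j = ∑ k, t k i * (trMul (X j) (E k)).re) ∧
    ∀ i j, W i j = ∑ k, t k i * t k j * (trMul S (E k)).re := Iff.rfl

theorem Adm.mul (h : (B, W) ∈ Adm S X) (c : Matrix (Fin m) (Fin m) ℝ) :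
    (c * B, c * W * cᵀ) ∈ Adm S X := by
  obtain ⟨κ, _, E, t, hE, h1, h0, hB, hW⟩ := mem_Adm.1 h
  refine ⟨κ, inferInstance, E, fun k => c *ᵥ t k, hE, h1, fun i => ?_, fun i j => ?_,
    fun i j => ?_⟩
  · simp only [Matrix.mulVec, dotProduct, Finset.sum_mul]
    rw [Finset.sum_comm]
    refine Finset.sum_eq_zero fun a _ => ?_
    simp only [mul_assoc, ← Finset.mul_sum, h0, mul_zero]
  · simp only [Matrix.mul_apply, Matrix.mulVec, dotProduct, Finset.sum_mul]
    rw [Finset.sum_comm]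
    refine Finset.sum_congr rfl fun a _ => ?_
    rw [hB, Finset.mul_sum]
    exact Finset.sum_congr rfl fun k _ => by ring
  · simp only [Matrix.mul_apply, Matrix.transpose_apply, Matrix.mulVec, dotProduct]
    simp only [hW, Finset.sum_mul, Finset.mul_sum]
    have e : ∀ k : κ, (∑ a, ∑ b, c i a * t k a * (c j b * t k b) * (trMul S (E k)).re) =
        ∑ b, ∑ a, c i a * (t k a * t k b * (trMul S (E k)).re) * c j b := fun k => by
      rw [Finset.sum_comm]
      exact Finset.sum_congr rfl fun b _ => Finset.sum_congr rfl fun a _ => by ring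
    calc _ = ∑ b, ∑ k, ∑ a, c i a * (t k a * t k b * (trMul S (E k)).re) * c j b :=
          Finset.sum_congr rfl fun b _ => Finset.sum_comm
      _ = ∑ k, ∑ b, ∑ a, c i a * (t k a * t k b * (trMul S (E k)).re) * c j b := Finset.sum_comm
      _ = ∑ k, ∑ a, ∑ b, c i a * t k a * (c j b * t k b) * (trMul S (E k)).re :=
          Finset.sum_congr rfl fun k _ => (e k).symm
      _ = _ := by
          refine Finset.sum_congr rfl fun k _ => ?_
          rw [Finset.sum_comm]

theorem Adm.smul (h : (B, W) ∈ Adm S X) (c : ℝ) : (c • B, c ^ 2 • W) ∈ Adm S X := by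
  have h1 := Adm.mul h (c • (1 : Matrix (Fin m) (Fin m) ℝ))
  simp only [Matrix.smul_mul, one_mul, Matrix.transpose_smul, Matrix.transpose_one,
    Matrix.mul_smul, mul_one, smul_smul] at h1
  rwa [pow_two]

/-- Randomization: choosing one of two estimators at random. -/
theorem Adm.mix (h : (B, W) ∈ Adm S X) (h' : (B', W') ∈ Adm S X) {p : ℝ} (hp0 : 0 ≤ p)
    (hp1 : p ≤ 1) : ((1 - p) • B + p • B', (1 - p) • W + p • W') ∈ Adm S X := by
  obtain ⟨κ, _, E, t, hE, h1, h0, hB, hW⟩ := mem_Adm.1 h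
  obtain ⟨κ', _, E', t', hE', h1', h0', hB', hW'⟩ := mem_Adm.1 h'
  have e : ∀ (c : ℝ) (A M : Op L), (trMul A (c • M)).re = c * (trMul A M).re := fun c A M => by
    have : c • M = (c : ℂ) • M := by ext i j; simp
    rw [this, trMul_smul_right, Complex.re_ofReal_mul]
  refine ⟨κ ⊕ κ', inferInstance, Sum.elim (fun k => (1 - p) • E k) (fun k => p • E' k),
    Sum.elim t t', ?_, ?_, fun i => ?_, fun i j => ?_, fun i j => ?_⟩
  · rintro (k | k)
    · exact posSemidef_real_smul (hE k) (by linarith)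
    · exact posSemidef_real_smul (hE' k) hp0
  · rw [Fintype.sum_sum_type]
    simp only [Sum.elim_inl, Sum.elim_inr, ← Finset.smul_sum, h1, h1', ← add_smul]
    simp
  · rw [Fintype.sum_sum_type]
    simp only [Sum.elim_inl, Sum.elim_inr, e, mul_left_comm _ (1 - p), mul_left_comm _ p,
      ← Finset.mul_sum, h0, h0', mul_zero, add_zero]
  · rw [Fintype.sum_sum_type]
    simp only [Sum.elim_inl, Sum.elim_inr, e, mul_left_comm _ (1 - p), mul_left_comm _ p,
      ← Finset.mul_sum, Matrix.add_apply, Matrix.smul_apply, smul_eq_mul, hB, hB']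
  · rw [Fintype.sum_sum_type]
    simp only [Sum.elim_inl, Sum.elim_inr, e, mul_left_comm _ (1 - p), mul_left_comm _ p,
      ← Finset.mul_sum, Matrix.add_apply, Matrix.smul_apply, smul_eq_mul, hW, hW']

theorem trMul_re_rsmul_right (c : ℝ) (A M : Op L) :
    (trMul A (c • M)).re = c * (trMul A M).re := by
  have : c • M = (c : ℂ) • M := by ext i j; simp
  rw [this, trMul_smul_right, Complex.re_ofReal_mul]

/-- Adding independent isotropic noise to an estimator. -/
theorem Adm.noise (hS : IsState S) (h : (B, W) ∈ Adm S X) {δ : ℝ} (hδ : 0 ≤ δ) :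
    (B, W + δ • (1 : Matrix (Fin m) (Fin m) ℝ)) ∈ Adm S X := by
  obtain ⟨κ, _, E, t, hE, h1, h0, hB, hW⟩ := mem_Adm.1 h
  rcases Nat.eq_zero_or_pos m with rfl | hm
  · exact ⟨κ, inferInstance, E, t, hE, h1, h0, hB, fun i => i.elim0⟩
  have hm' : (m : ℝ) ≠ 0 := by exact_mod_cast hm.ne'
  have hsum : ∑ k, (trMul S (E k)).re = 1 := by
    have := (TrSum.sum_right (A := S) (s := Finset.univ) fun k _ =>
      hS.isPosTC.trSum (isEffect_of_sum hE h1 k)).2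
    rw [h1, trMul_one, hS.tr_eq] at this
    rw [← Complex.re_sum, ← this, Complex.one_re]
  set r : ℝ := √(m * δ) with hr
  have hr2 : r * r = m * δ := Real.mul_self_sqrt (by positivity)
  set w : Fin m → Bool → Fin m → ℝ := fun a b => Pi.single a (if b then r else -r) with hw
  refine ⟨κ × Fin m × Bool, inferInstance, fun q => (1 / (2 * m) : ℝ) • E q.1,
    fun q => t q.1 + w q.2.1 q.2.2, fun q => posSemidef_real_smul (hE _) (by positivity), ?_,
    fun i => ?_, fun i j => ?_, fun i j => ?_⟩
  · simp only [Fintype.sum_prod_type, Finset.sum_const, Finset.card_univ, ← Finset.smul_sum, h1]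
    ext i j
    simp only [Matrix.smul_apply, nsmul_eq_mul, Complex.real_smul, Fintype.card_prod,
      Fintype.card_bool, Fintype.card_fin]
    push_cast
    have : (m : ℂ) ≠ 0 := by exact_mod_cast hm.ne'
    field_simp
  · have e : ∀ k : κ, (∑ a : Fin m, ∑ b : Bool, (t k + w a b) i *
        (trMul S ((1 / (2 * m) : ℝ) • E k)).re) = t k i * (trMul S (E k)).re := by
      intro k
      simp only [trMul_re_rsmul_right, Pi.add_apply, Fintype.sum_bool, hw]
      have : ∀ a : Fin m, (Pi.single a r : Fin m → ℝ) i + (Pi.single a (-r) : Fin m → ℝ) i = 0 := by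
        intro a; by_cases ha : i = a
        · subst ha; simp
        · simp [ha]
      simp only [if_true, if_false, Bool.false_eq_true]
      have e2 : ∀ a : Fin m, (t k i + (Pi.single a r : Fin m → ℝ) i) * (1 / (2 * m) * (trMul S (E k)).re)
          + (t k i + (Pi.single a (-r) : Fin m → ℝ) i) * (1 / (2 * m) * (trMul S (E k)).re) =
          1 / m * (t k i * (trMul S (E k)).re) := by
        intro a
        have h5 := this a
        field_simp
        linear_combination (trMul S (E k)).re * h5
      simp only [e2, Finset.sum_const, Finset.card_univ, Fintype.card_fin, nsmul_eq_mul]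
      field_simp
    simp only [Fintype.sum_prod_type, e, h0]
  · have e : ∀ k : κ, (∑ a : Fin m, ∑ b : Bool, (t k + w a b) i *
        (trMul (X j) ((1 / (2 * m) : ℝ) • E k)).re) = t k i * (trMul (X j) (E k)).re := by
      intro k
      simp only [trMul_re_rsmul_right, Pi.add_apply, Fintype.sum_bool, hw]
      have : ∀ a : Fin m, (Pi.single a r : Fin m → ℝ) i + (Pi.single a (-r) : Fin m → ℝ) i = 0 := by
        intro a; by_cases ha : i = a
        · subst ha; simp
        · simp [ha]
      simp only [if_true, if_false, Bool.false_eq_true]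
      have e2 : ∀ a : Fin m, (t k i + (Pi.single a r : Fin m → ℝ) i) * (1 / (2 * m) * (trMul (X j) (E k)).re)
          + (t k i + (Pi.single a (-r) : Fin m → ℝ) i) * (1 / (2 * m) * (trMul (X j) (E k)).re) =
          1 / m * (t k i * (trMul (X j) (E k)).re) := by
        intro a
        have h5 := this a
        field_simp
        linear_combination (trMul (X j) (E k)).re * h5
      simp only [e2, Finset.sum_const, Finset.card_univ, Fintype.card_fin, nsmul_eq_mul]
      field_simp
    simp only [Fintype.sum_prod_type, e, hB]
  · have e : ∀ k : κ, (∑ a : Fin m, ∑ b : Bool, (t k + w a b) i * (t k + w a b) j *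
        (trMul S ((1 / (2 * m) : ℝ) • E k)).re) = t k i * t k j * (trMul S (E k)).re +
          (if i = j then δ else 0) * (trMul S (E k)).re := by
      intro k
      simp only [trMul_re_rsmul_right, Pi.add_apply, Fintype.sum_bool, hw, if_true, if_false,
        Bool.false_eq_true]
      have e2 : ∀ a : Fin m, (t k i + (Pi.single a r : Fin m → ℝ) i) *
            (t k j + (Pi.single a r : Fin m → ℝ) j) * (1 / (2 * m) * (trMul S (E k)).re)
          + (t k i + (Pi.single a (-r) : Fin m → ℝ) i) * (t k j + (Pi.single a (-r) : Fin m → ℝ) j) *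
            (1 / (2 * m) * (trMul S (E k)).re) =
          1 / m * (t k i * t k j * (trMul S (E k)).re) +
            if a = i then (if i = j then δ else 0) * (trMul S (E k)).re else 0 := by
        intro a
        by_cases hai : a = i
        · subst hai
          by_cases hij : a = j
          · subst hij
            simp only [Pi.single_eq_same, if_true]
            field_simp
            linear_combination 2 * (trMul S (E k)).re * hr2
          · simp only [Pi.single_eq_same, hij, if_false, Pi.single_eq_of_ne (Ne.symm hij), if_true]
            field_simp
            ring
        · simp only [Pi.single_eq_of_ne (Ne.symm hai), hai, if_false, add_zero]
          by_cases hij : j = a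
          · subst hij; simp only [Pi.single_eq_same]; field_simp; ring
          · simp only [Pi.single_eq_of_ne hij]; field_simp; ring
      simp only [e2, Finset.sum_add_distrib, Finset.sum_const, Finset.card_univ, Fintype.card_fin,
        nsmul_eq_mul, Finset.sum_ite_eq', Finset.mem_univ, if_true]
      field_simp
    simp only [Fintype.sum_prod_type, e, Finset.sum_add_distrib, ← Finset.mul_sum, hsum,
      Matrix.add_apply, hW, Matrix.smul_apply, Matrix.one_apply, smul_eq_mul, mul_one, mul_ite,
      mul_zero]

/-- The average of estimators on two independent systems. -/
theorem Adm.tens {K E : Type} (e : K ≃ L × E) {S' : Op E} {X' : Fin m → Op E} (hS : IsState S)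
    (hS' : IsState S') (hX : ∀ j, X j ∈ TC L) (hX' : ∀ j, X' j ∈ TC E) (hX0 : ∀ j, tr (X j) = 0)
    (hX0' : ∀ j, tr (X' j) = 0) (h : (B, W) ∈ Adm S X) (h' : (B', W') ∈ Adm S' X') (c c' : ℝ) :
    (c • B + c' • B', c ^ 2 • W + c' ^ 2 • W') ∈
      Adm (tens e S S') (fun j => QEst.tens e (X j) S' + QEst.tens e S (X' j)) := by
  obtain ⟨κ, _, F, t, hF, h1, h0, hB, hW⟩ := mem_Adm.1 h
  obtain ⟨κ', _, F', t', hF', h1', h0', hB', hW'⟩ := mem_Adm.1 h'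
  have hFe := isEffect_of_sum hF h1
  have hFe' := isEffect_of_sum hF' h1'
  have hS1 := hS.isPosTC
  have hS1' := hS'.isPosTC
  have sumL : ∀ {A : Op L}, A ∈ TC L → ∑ k, (trMul A (F k)).re = (tr A).re := by
    intro A hA
    have := (TrSum.sum_right (s := Finset.univ) fun k _ => trSum_of_mem hA (hFe k)).2
    rw [h1, trMul_one] at this
    rw [← Complex.re_sum, ← this]
  have sumE : ∀ {A : Op E}, A ∈ TC E → ∑ k, (trMul A (F' k)).re = (tr A).re := by
    intro A hA
    have := (TrSum.sum_right (s := Finset.univ) fun k _ => trSum_of_mem hA (hFe' k)).2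
    rw [h1', trMul_one] at this
    rw [← Complex.re_sum, ← this]
  have v1 : ∀ k k', (trMul (QEst.tens e S S') (QEst.tens e (F k) (F' k'))).re =
      (trMul S (F k)).re * (trMul S' (F' k')).re := by
    intro k k'
    rw [trMul_tens e hS1.mem hS1'.mem (hFe k) (hFe' k'), hS1.trMul_eq_re (hFe k),
      Complex.re_ofReal_mul, Complex.ofReal_re]
  have v2 : ∀ k k' j, (trMul (QEst.tens e (X j) S' + QEst.tens e S (X' j))
      (QEst.tens e (F k) (F' k'))).re = (trMul (X j) (F k)).re * (trMul S' (F' k')).re +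
        (trMul S (F k)).re * (trMul (X' j) (F' k')).re := by
    intro k k' j
    rw [trMul_add_left (trSum_of_mem (tens_mem e (hX j) hS1'.mem) ((hFe k).tens e (hFe' k')))
      (trSum_of_mem (tens_mem e hS1.mem (hX' j)) ((hFe k).tens e (hFe' k'))),
      trMul_tens e (hX j) hS1'.mem (hFe k) (hFe' k'), trMul_tens e hS1.mem (hX' j) (hFe k) (hFe' k'),
      hS1.trMul_eq_re (hFe k), hS1'.trMul_eq_re (hFe' k'), Complex.add_re, Complex.re_mul_ofReal,
      Complex.re_ofReal_mul, Complex.ofReal_re, Complex.ofReal_re]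
  have sS : ∑ k, (trMul S (F k)).re = 1 := by rw [sumL hS1.mem, hS.tr_eq]; simp
  have sS' : ∑ k, (trMul S' (F' k)).re = 1 := by rw [sumE hS1'.mem, hS'.tr_eq]; simp
  have sX : ∀ j, ∑ k, (trMul (X j) (F k)).re = 0 := fun j => by rw [sumL (hX j), hX0]; simp
  have sX' : ∀ j, ∑ k, (trMul (X' j) (F' k)).re = 0 := fun j => by rw [sumE (hX' j), hX0']; simp
  -- sums of products over the pairs of outcomes factorize
  have fac : ∀ (f : κ → ℝ) (g : κ' → ℝ), ∑ q : κ × κ', f q.1 * g q.2 = (∑ k, f k) * ∑ k, g k :=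
    fun f g => by rw [Fintype.sum_prod_type, Finset.sum_mul_sum]
  refine ⟨κ × κ', inferInstance, fun q => QEst.tens e (F q.1) (F' q.2),
    fun q i => c * t q.1 i + c' * t' q.2 i, fun q => tens_posSemidef e (hF _) (hF' _), ?_,
    fun i => ?_, fun i j => ?_, fun i j => ?_⟩
  · rw [Fintype.sum_prod_type]
    simp only [← tens_sum_right, h1', ← tens_sum_left, h1, tens_idOp]
  · simp only [v1]
    calc _ = ∑ q : κ × κ', (c * ((t q.1 i * (trMul S (F q.1)).re) * (trMul S' (F' q.2)).re) +
          c' * ((trMul S (F q.1)).re * (t' q.2 i * (trMul S' (F' q.2)).re))) :=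
          Finset.sum_congr rfl fun q _ => by ring
      _ = 0 := by
          rw [Finset.sum_add_distrib, ← Finset.mul_sum, ← Finset.mul_sum,
            fac (fun k => t k i * (trMul S (F k)).re) (fun k => (trMul S' (F' k)).re),
            fac (fun k => (trMul S (F k)).re) (fun k => t' k i * (trMul S' (F' k)).re), h0, h0']
          ring
  · simp only [v2]
    symm
    calc _ = ∑ q : κ × κ', (c * ((t q.1 i * (trMul (X j) (F q.1)).re) * (trMul S' (F' q.2)).re) +
          c * ((t q.1 i * (trMul S (F q.1)).re) * (trMul (X' j) (F' q.2)).re) +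
          c' * ((trMul (X j) (F q.1)).re * (t' q.2 i * (trMul S' (F' q.2)).re)) +
          c' * ((trMul S (F q.1)).re * (t' q.2 i * (trMul (X' j) (F' q.2)).re))) :=
          Finset.sum_congr rfl fun q _ => by ring
      _ = _ := by
          rw [Finset.sum_add_distrib, Finset.sum_add_distrib, Finset.sum_add_distrib,
            ← Finset.mul_sum, ← Finset.mul_sum, ← Finset.mul_sum, ← Finset.mul_sum,
            fac (fun k => t k i * (trMul (X j) (F k)).re) (fun k => (trMul S' (F' k)).re),
            fac (fun k => t k i * (trMul S (F k)).re) (fun k => (trMul (X' j) (F' k)).re),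
            fac (fun k => (trMul (X j) (F k)).re) (fun k => t' k i * (trMul S' (F' k)).re),
            fac (fun k => (trMul S (F k)).re) (fun k => t' k i * (trMul (X' j) (F' k)).re),
            h0, h0', sS, sS', sX, sX', ← hB, ← hB']
          simp
  · simp only [v1]
    symm
    calc _ = ∑ q : κ × κ', (c ^ 2 * ((t q.1 i * t q.1 j * (trMul S (F q.1)).re) *
            (trMul S' (F' q.2)).re) +
          c * c' * ((t q.1 i * (trMul S (F q.1)).re) * (t' q.2 j * (trMul S' (F' q.2)).re)) +
          c * c' * ((t q.1 j * (trMul S (F q.1)).re) * (t' q.2 i * (trMul S' (F' q.2)).re)) +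
          c' ^ 2 * ((trMul S (F q.1)).re * (t' q.2 i * t' q.2 j * (trMul S' (F' q.2)).re))) :=
          Finset.sum_congr rfl fun q _ => by ring
      _ = _ := by
          rw [Finset.sum_add_distrib, Finset.sum_add_distrib, Finset.sum_add_distrib,
            ← Finset.mul_sum, ← Finset.mul_sum, ← Finset.mul_sum, ← Finset.mul_sum,
            fac (fun k => t k i * t k j * (trMul S (F k)).re) (fun k => (trMul S' (F' k)).re),
            fac (fun k => t k i * (trMul S (F k)).re) (fun k => t' k j * (trMul S' (F' k)).re),
            fac (fun k => t k j * (trMul S (F k)).re) (fun k => t' k i * (trMul S' (F' k)).re),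
            fac (fun k => (trMul S (F k)).re) (fun k => t' k i * t' k j * (trMul S' (F' k)).re),
            h0 i, h0 j, h0' j, sS, sS', ← hW, ← hW']
          simp

/-- Estimators do not react to directions in which the state does not change. -/
theorem Adm.mulVec_eq_zero (hX : ∀ j, X j ∈ TC L) (h : (B, W) ∈ Adm S X) {v : Fin m → ℝ}
    (hv : ∑ j, v j • X j = 0) : B *ᵥ v = 0 := by
  obtain ⟨κ, _, E, t, hE, h1, h0, hB, hW⟩ := mem_Adm.1 h
  have hEe := isEffect_of_sum hE h1
  ext i
  simp only [Matrix.mulVec, dotProduct, Pi.zero_apply, hB, Finset.sum_mul]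
  rw [Finset.sum_comm]
  refine Finset.sum_eq_zero fun k _ => ?_
  have h2 : ∀ j, TrSum (v j • X j) (E k) := fun j => by
    have : v j • X j = (v j : ℂ) • X j := by ext a b; simp
    rw [this]; exact (trSum_of_mem (hX j) (hEe k)).smul_left _
  have h3 := (TrSum.sum_left (s := Finset.univ) fun j _ => h2 j).2
  rw [hv] at h3
  have h4 := congrArg Complex.re h3
  simp only [trMul_rsmul_left, Complex.re_sum, Complex.re_ofReal_mul] at h4
  have h5 : (trMul (0 : Op L) (E k)).re = 0 := by simp [trMul]
  rw [h5] at h4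
  calc _ = t k i * ∑ j, v j * (trMul (X j) (E k)).re := by
        rw [Finset.mul_sum]; exact Finset.sum_congr rfl fun j _ => by ring
    _ = 0 := by rw [← h4, mul_zero]

end Adm

section existence

variable {L : Type} {m : ℕ} {S : Op L} {X : Fin m → Op L}

/-- The rank one operator of a finitely supported vector. -/
def rankOne (v : L →₀ ℂ) : Op L := Matrix.of fun i j => v i * star (v j)

theorem rankOne_form (v x : L →₀ ℂ) :
    (x.sum fun i xi => x.sum fun j xj => star xi * rankOne v i j * xj) =
      ((‖x.sum fun i xi => star xi * v i‖ ^ 2 : ℝ) : ℂ) := by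
  have h : (x.sum fun i xi => x.sum fun j xj => star xi * rankOne v i j * xj) =
      (x.sum fun i xi => star xi * v i) * star (x.sum fun i xi => star xi * v i) := by
    simp only [Finsupp.sum, star_sum, Finset.sum_mul_sum, star_mul', star_star, rankOne,
      Matrix.of_apply]
    exact Finset.sum_congr rfl fun i _ => Finset.sum_congr rfl fun j _ => by ring
  rw [h]
  generalize (x.sum fun i xi => star xi * v i) = z
  simpa using Complex.mul_conj' z

theorem rankOne_isHermitian (v : L →₀ ℂ) : (rankOne v).IsHermitian := by
  ext i j
  simp [rankOne, mul_comm]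

/-- Projections on small vectors are effects, by the Cauchy-Schwarz inequality. -/
theorem rankOne_isEffect {v : L →₀ ℂ} (hv : ∑ i ∈ v.support, ‖v i‖ ^ 2 ≤ 1) :
    IsEffect (rankOne v) := by
  classical
  refine ⟨⟨rankOne_isHermitian v, fun x => ?_⟩, ⟨posSemidef_idOp.1.sub (rankOne_isHermitian v),
    fun x => ?_⟩⟩
  · rw [rankOne_form]
    exact Complex.zero_le_real.2 (sq_nonneg _)
  · have e1 : (x.sum fun i xi => x.sum fun j xj => star xi * (idOp L - rankOne v) i j * xj) =
        (x.sum fun i xi => x.sum fun j xj => star xi * idOp L i j * xj) -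
        (x.sum fun i xi => x.sum fun j xj => star xi * rankOne v i j * xj) := by
      simp only [Finsupp.sum, ← Finset.sum_sub_distrib, Matrix.sub_apply]
      exact Finset.sum_congr rfl fun i _ => Finset.sum_congr rfl fun j _ => by ring
    have e2 : (x.sum fun i xi => x.sum fun j xj => star xi * idOp L i j * xj) =
        ((∑ i ∈ x.support, ‖x i‖ ^ 2 : ℝ) : ℂ) := by
      simp only [Finsupp.sum, idOp, Matrix.one_apply, mul_ite, mul_one, mul_zero, ite_mul, zero_mul,
        Finset.sum_ite_eq]
      push_cast
      refine Finset.sum_congr rfl fun i hi => ?_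
      rw [if_pos hi]
      exact Complex.conj_mul' _
    rw [e1, e2, rankOne_form, ← Complex.ofReal_sub]
    have e3 : ‖x.sum fun i xi => star xi * v i‖ ≤ ∑ i ∈ x.support ∩ v.support, ‖x i‖ * ‖v i‖ := by
      simp only [Finsupp.sum]
      rw [← Finset.sum_subset (Finset.inter_subset_left (s₂ := v.support))]
      · refine (norm_sum_le _ _).trans (Finset.sum_le_sum fun i _ => ?_)
        rw [norm_mul, norm_star]
      · intro i hi hi'
        have : v i = 0 := by
          by_contra h
          exact hi' (Finset.mem_inter.2 ⟨hi, Finsupp.mem_support_iff.2 h⟩)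
        simp [this]
    have e4 := Finset.sum_mul_sq_le_sq_mul_sq (x.support ∩ v.support) (fun i => ‖x i‖) (fun i => ‖v i‖)
    have e5 : ∑ i ∈ x.support ∩ v.support, ‖x i‖ ^ 2 ≤ ∑ i ∈ x.support, ‖x i‖ ^ 2 :=
      Finset.sum_le_sum_of_subset_of_nonneg Finset.inter_subset_left fun _ _ _ => sq_nonneg _
    have e6 : ∑ i ∈ x.support ∩ v.support, ‖v i‖ ^ 2 ≤ ∑ i ∈ v.support, ‖v i‖ ^ 2 :=
      Finset.sum_le_sum_of_subset_of_nonneg Finset.inter_subset_right fun _ _ _ => sq_nonneg _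
    have e7 : 0 ≤ ∑ i ∈ x.support ∩ v.support, ‖x i‖ ^ 2 := Finset.sum_nonneg fun _ _ => sq_nonneg _
    have e8 : 0 ≤ ∑ i ∈ x.support ∩ v.support, ‖v i‖ ^ 2 := Finset.sum_nonneg fun _ _ => sq_nonneg _
    have e9 : ‖x.sum fun i xi => star xi * v i‖ ^ 2 ≤ ∑ i ∈ x.support, ‖x i‖ ^ 2 := by
      have := pow_le_pow_left₀ (norm_nonneg _) e3 2
      nlinarith
    exact Complex.zero_le_real.2 (sub_nonneg.2 e9)

/-- The pairing with a rank one effect is the quadratic form. -/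
theorem trMul_rankOne (Y : Op L) (v : L →₀ ℂ) :
    trMul Y (rankOne v) = v.sum fun i vi => v.sum fun j vj => star vi * Y i j * vj := by
  have h0 : ∀ i, i ∉ v.support → v i = 0 := fun i => Finsupp.notMem_support_iff.1
  have e1 : ∀ i, ∑' j, Y i j * rankOne v j i = ∑ j ∈ v.support, Y i j * rankOne v j i := fun i =>
    tsum_eq_sum fun j hj => by simp [rankOne, h0 j hj]
  rw [trMul, tsum_congr e1, tsum_eq_sum (s := v.support) fun i hi => by
    simp [rankOne, h0 i hi]]
  simp only [Finsupp.sum, rankOne, Matrix.of_apply]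
  exact Finset.sum_congr rfl fun i _ => Finset.sum_congr rfl fun j _ => by ring

/-- Effects separate hermitian operators. -/
theorem eq_zero_of_trMul_eq_zero {Y : Op L} (hY : Y.IsHermitian)
    (h : ∀ E, IsEffect E → (trMul Y E).re = 0) : Y = 0 := by
  classical
  have key : ∀ v : L →₀ ℂ,
      (v.sum fun i vi => v.sum fun j vj => star vi * Y i j * vj).re = 0 := by
    intro v
    -- scale `v` to a vector of norm at most one, so that its rank one operator is an effect
    set s : ℝ := 1 + ∑ i ∈ v.support, ‖v i‖ ^ 2 with hs
    have hs0 : 0 < s := by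
      have : 0 ≤ ∑ i ∈ v.support, ‖v i‖ ^ 2 := Finset.sum_nonneg fun _ _ => sq_nonneg _
      linarith
    set r : ℝ := √(s⁻¹) with hr
    have hr2 : r ^ 2 = s⁻¹ := Real.sq_sqrt (by positivity)
    have hr0 : r ≠ 0 := by
      intro h0; rw [h0] at hr2; simp at hr2; exact hs0.ne' hr2.symm
    have h1 := h _ (rankOne_isEffect (v := (r : ℂ) • v) (by
      refine (Finset.sum_le_sum_of_subset_of_nonneg (Finsupp.support_smul (b := (r : ℂ)) (g := v))
        fun _ _ _ => sq_nonneg _).trans ?_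
      simp only [Finsupp.smul_apply, norm_smul, mul_pow, ← Finset.mul_sum, Complex.norm_real,
        Real.norm_eq_abs, sq_abs, hr2]
      rw [inv_mul_le_iff₀ hs0]
      linarith))
    have hrc : (r : ℂ) ≠ 0 := by exact_mod_cast hr0
    have e2 : trMul Y (rankOne ((r : ℂ) • v)) = ((r ^ 2 : ℝ) : ℂ) *
        v.sum fun i vi => v.sum fun j vj => star vi * Y i j * vj := by
      have : rankOne ((r : ℂ) • v) = ((r ^ 2 : ℝ) : ℂ) • rankOne v := by
        ext i j
        simp only [rankOne, Matrix.of_apply, Finsupp.smul_apply, smul_eq_mul, star_mul',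
          Matrix.smul_apply]
        have : star (r : ℂ) = r := Complex.conj_ofReal _
        rw [this]; push_cast; ring
      rw [this, trMul_smul_right, trMul_rankOne]
    rw [e2, Complex.re_ofReal_mul] at h1
    exact (mul_eq_zero.1 h1).resolve_left (pow_ne_zero 2 hr0)
  have hd : ∀ i, Y i i = 0 := by
    intro i
    have h1 := key (Finsupp.single i 1)
    rw [Finsupp.sum_single_index (by simp), Finsupp.sum_single_index (by simp)] at h1
    have h2 : (Y i i).im = 0 := by
      have := congrArg Complex.im (hY.apply i i)
      simp at this
      linarith
    apply Complex.ext
    · simpa using h1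
    · simpa using h2
  have hq : ∀ (i j : L) (c : ℂ), (Y i j * c + star c * Y j i).re = 0 := by
    intro i j c
    have h1 := key (Finsupp.single i 1 + Finsupp.single j c)
    rw [Finsupp.sum_add_index' (by simp) (by
      intro a b₁ b₂
      simp only [Finsupp.sum, ← Finset.sum_add_distrib]
      exact Finset.sum_congr rfl fun _ _ => by rw [star_add]; ring)] at h1
    have h0 : ∀ (a : L) (xi : ℂ), ((Finsupp.single i (1 : ℂ) + Finsupp.single j c).sum fun b xj =>
        star xi * Y a b * xj) = star xi * Y a i + star xi * Y a j * c := by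
      intro a xi
      rw [Finsupp.sum_add_index' (by simp) (by intros; ring)]
      simp
    simp only [h0] at h1
    rw [Finsupp.sum_single_index (by simp), Finsupp.sum_single_index (by simp)] at h1
    simpa [hd] using h1
  ext i j
  have h1 := hq i j 1
  have h2 := hq i j Complex.I
  have h3 := hY.apply j i
  rw [← h3] at h1 h2
  simp at h1 h2
  apply Complex.ext
  · simp; linarith
  · simp; linarith

theorem Adm.add {B B' : Matrix (Fin m) (Fin m) ℝ} (h : ∃ U, (B, U) ∈ Adm S X)
    (h' : ∃ U, (B', U) ∈ Adm S X) : ∃ U, (B + B', U) ∈ Adm S X := by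
  obtain ⟨U, hU⟩ := h
  obtain ⟨U', hU'⟩ := h'
  have h1 := Adm.mix (Adm.smul hU 2) (Adm.smul hU' 2) (p := 1 / 2) (by norm_num) (by norm_num)
  have e : (1 - 1 / 2 : ℝ) • (2 : ℝ) • B + (1 / 2 : ℝ) • (2 : ℝ) • B' = B + B' := by
    ext i j; simp; ring
  rw [e] at h1
  exact ⟨_, h1⟩

/-- A two-outcome measurement. -/
theorem Adm.single (hS : IsState S) (hX : ∀ j, X j ∈ TC L) (hX0 : ∀ j, tr (X j) = 0) {E : Op L}
    (hE : IsEffect E) (u : Fin m → ℝ) :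
    ∃ U, (Matrix.of fun i j => u i * (trMul (X j) E).re, U) ∈ Adm S X := by
  set q := (trMul S E).re with hq
  have hq' : (trMul S (idOp L - E)).re = 1 - q := by
    rw [trMul_sub_right (hS.isPosTC.trSum isEffect_one) (hS.isPosTC.trSum hE), trMul_one, hS.tr_eq]
    simp [hq]
  have hX' : ∀ j, (trMul (X j) (idOp L - E)).re = - (trMul (X j) E).re := fun j => by
    rw [trMul_sub_right (trSum_of_mem (hX j) isEffect_one) (trSum_of_mem (hX j) hE), trMul_one, hX0]
    simp
  refine ⟨Matrix.of fun i j => ∑ b : Bool, (cond b ((1 - q) * u i) (-(q * u i))) *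
    (cond b ((1 - q) * u j) (-(q * u j))) * (trMul S (cond b E (idOp L - E))).re,
    mem_Adm.2 ⟨Bool, inferInstance, fun b => cond b E (idOp L - E),
      fun b i => cond b ((1 - q) * u i) (-(q * u i)), ?_, ?_, fun i => ?_, fun i j => ?_,
      fun i j => rfl⟩⟩
  · rintro (b | b)
    · exact hE.le
    · exact hE.pos
  · rw [Fintype.sum_bool]; simp
  · rw [Fintype.sum_bool]
    simp only [cond_true, cond_false, hq', ← hq]
    ring
  · rw [Fintype.sum_bool]
    simp only [cond_true, cond_false, hX', Matrix.of_apply]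
    ring

theorem Adm.zero (hS : IsState S) (hX : ∀ j, X j ∈ TC L) (hX0 : ∀ j, tr (X j) = 0) :
    ∃ U, ((0 : Matrix (Fin m) (Fin m) ℝ), U) ∈ Adm S X := by
  obtain ⟨U, hU⟩ := Adm.single hS hX hX0 isEffect_zero (0 : Fin m → ℝ)
  refine ⟨U, ?_⟩
  convert hU using 2
  ext i j; simp

/-- Every matrix that vanishes on the directions in which the state does not change is the
derivative of the mean of some estimator. -/
theorem Adm.exists_of_mulVec (hS : IsState S) (hX : ∀ j, X j ∈ TC L) (hX0 : ∀ j, tr (X j) = 0)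
    (hXh : ∀ j, (X j).IsHermitian) (B : Matrix (Fin m) (Fin m) ℝ)
    (hB : ∀ v : Fin m → ℝ, ∑ j, v j • X j = 0 → B *ᵥ v = 0) : ∃ U, (B, U) ∈ Adm S X := by
  classical
  set g : {E : Op L // IsEffect E} → Par m := fun E => WithLp.toLp 2 fun j => (trMul (X j) E.1).re
    with hg
  set V : Submodule ℝ (Par m) := Submodule.span ℝ (Set.range g) with hV
  -- the rows of `B` are orthogonal to `Vᗮ`, because effects separate the hermitian operators
  have hrow : ∀ i, (WithLp.toLp 2 (fun j => B i j) : Par m) ∈ V := by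
    intro i
    rw [← Submodule.orthogonal_orthogonal V, Submodule.mem_orthogonal]
    intro v hv
    have h1 : ∑ j, v j • X j = 0 := by
      refine eq_zero_of_trMul_eq_zero ?_ fun E hE => ?_
      · rw [Matrix.IsHermitian, Matrix.conjTranspose_sum]
        refine Finset.sum_congr rfl fun j _ => ?_
        rw [Matrix.conjTranspose_smul, (hXh j).eq]; simp
      · have h2 : ∀ j, TrSum (v j • X j) E := fun j => by
          have : v j • X j = (v j : ℂ) • X j := by ext a b; simp
          rw [this]; exact (trSum_of_mem (hX j) hE).smul_left _
        rw [(TrSum.sum_left (s := Finset.univ) fun j _ => h2 j).2]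
        simp only [trMul_rsmul_left, Complex.re_sum, Complex.re_ofReal_mul]
        have h3 := (Submodule.mem_orthogonal V v).1 hv (g ⟨E, hE⟩) (Submodule.subset_span ⟨_, rfl⟩)
        rw [PiLp.inner_apply] at h3
        simpa [hg, mul_comm] using h3
    have h2 := congrFun (hB v h1) i
    rw [PiLp.inner_apply]
    simpa [Matrix.mulVec, dotProduct, mul_comm] using h2
  have key : ∀ r ∈ V, ∀ u : Fin m → ℝ, ∃ U, (Matrix.of fun i j => u i * r j, U) ∈ Adm S X := by
    intro r hr
    induction hr using Submodule.span_induction with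
    | mem r hr =>
      obtain ⟨E, rfl⟩ := hr
      exact fun u => Adm.single hS hX hX0 E.2 u
    | zero =>
      intro u
      obtain ⟨U, hU⟩ := Adm.zero hS hX hX0
      exact ⟨U, by convert hU using 2; ext i j; simp⟩
    | add r s _ _ h1 h2 =>
      intro u
      obtain ⟨U, hU⟩ := Adm.add (h1 u) (h2 u)
      exact ⟨U, by convert hU using 2; ext i j; simp [mul_add]⟩
    | smul c r _ h1 =>
      intro u
      obtain ⟨U, hU⟩ := h1 (c • u)
      exact ⟨U, by convert hU using 2; ext i j; simp; ring⟩
  have hsum : ∀ s : Finset (Fin m), ∃ U, (∑ a ∈ s, (Matrix.of fun i j =>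
      (Pi.single a (1 : ℝ) : Fin m → ℝ) i * B a j), U) ∈ Adm S X := by
    intro s
    induction s using Finset.induction_on with
    | empty => simpa using Adm.zero hS hX hX0
    | insert a s ha ih =>
      rw [Finset.sum_insert ha]
      exact Adm.add (key _ (hrow a) _) ih
  obtain ⟨U, hU⟩ := hsum Finset.univ
  refine ⟨U, ?_⟩
  convert hU using 2
  ext i j
  simp [Matrix.sum_apply, Pi.single_apply]

end existence

/-! ### Regular estimators with finitely many outcomes -/

/-- A model of states on `Θ` that is differentiable in trace norm. -/
structure DiffModel {m : ℕ} {I : Type} (Θ : Set (Par m)) (σ : Par m → Op I) : Prop where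
  state : ∀ η ∈ Θ, IsState (σ η)
  td : ∀ η ∈ Θ, ∀ i, HasTD (fun t : ℝ => σ (η + t • unitVec i)) (pd σ i η)

/-- The derivatives of the model are locally dominated by positive trace class operators. -/
def Dominated {m : ℕ} {I : Type} (Θ : Set (Par m)) (σ : Par m → Op I) : Prop :=
  ∀ η ∈ Θ, ∀ i, ∃ (δ : ℝ) (D : Op I), 0 < δ ∧ IsPosTC D ∧
    ∀ t : ℝ, |t| < δ → η + t • unitVec i ∈ Θ →
      (D - pd σ i (η + t • unitVec i)).PosSemidef ∧ (D + pd σ i (η + t • unitVec i)).PosSemidef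

theorem hasDerivAt_re {f : ℝ → ℂ} {z : ℂ} {a : ℝ} (h : HasDerivAt f z a) :
    HasDerivAt (fun t => (f t).re) z.re a :=
  (Complex.reCLM.hasFDerivAt (x := f a)).comp_hasDerivAt a h

theorem eventually_line_mem {m : ℕ} {Θ : Set (Par m)} (hopen : IsOpen Θ) {η : Par m} (hη : η ∈ Θ)
    (v : Par m) : ∀ᶠ t : ℝ in 𝓝 0, η + t • v ∈ Θ := by
  have : Tendsto (fun t : ℝ => η + t • v) (𝓝 0) (𝓝 (η + (0 : ℝ) • v)) :=
    (by fun_prop : Continuous fun t : ℝ => η + t • v).tendsto 0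
  rw [zero_smul, add_zero] at this
  exact this.eventually (hopen.mem_nhds hη)

theorem DiffModel.eventually_state {m : ℕ} {I : Type} {Θ : Set (Par m)} {σ : Par m → Op I}
    (h : DiffModel Θ σ) (hopen : IsOpen Θ) {η : Par m} (hη : η ∈ Θ) (i : Fin m) :
    ∀ᶠ t : ℝ in 𝓝 0, IsState (σ (η + t • unitVec i)) :=
  (eventually_line_mem hopen hη _).mono fun _ ht => h.state _ ht

section finite

variable {I κ : Type} [Fintype κ]

/-- The measurement with finitely many outcomes, with the outcomes coded by real numbers. -/
def finPOVM (E : κ → Op I) (hE : ∀ k, (E k).PosSemidef) (h1 : ∑ k, E k = idOp I) (x : κ → Fin 1 → ℝ) :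
    POVM I (Fin 1 → ℝ) where
  effect Δ := by
    classical
    exact ∑ k, if x k ∈ Δ then E k else 0
  pos Δ _ := by
    classical
    refine Matrix.posSemidef_sum _ fun k _ => ?_
    split_ifs
    · exact hE k
    · exact Matrix.PosSemidef.zero
  univ_diag i := by
    classical
    simp [h1, idOp]
  univ_offDiag i j h := by
    classical
    simp [h1, idOp, h]
  sigma_additive f hf hd i j := by
    classical
    simp only [Matrix.sum_apply]
    refine hasSum_sum fun k _ => ?_
    by_cases hk : x k ∈ ⋃ n, f n
    · obtain ⟨n, hn⟩ := Set.mem_iUnion.1 hk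
      rw [if_pos hk]
      have : (fun n' => (if x k ∈ f n' then E k else 0) i j) =
          fun n' => if n' = n then E k i j else 0 := by
        ext n'
        by_cases h : n' = n
        · subst h; simp [hn]
        · have : x k ∉ f n' := fun h' => (Set.disjoint_left.1 (hd h)) h' hn
          simp [h, this]
      rw [this]
      exact hasSum_ite_eq n _
    · rw [if_neg hk]
      have : ∀ n, x k ∉ f n := fun n hn => hk (Set.mem_iUnion.2 ⟨n, hn⟩)
      simp [this]

variable {E : κ → Op I} (hE : ∀ k, (E k).PosSemidef) (h1 : ∑ k, E k = idOp I)
  (x : κ → Fin 1 → ℝ)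

theorem law_finPOVM {A : Op I} (hA : IsPosTC A) :
    law (finPOVM E hE h1 x) A =
      ∑ k, ENNReal.ofReal (trMul A (E k)).re • Measure.dirac (x k) := by
  classical
  refine law_eq_of _ hA fun Δ hΔ => ?_
  have hEe := isEffect_of_sum hE h1
  have e0 : (finPOVM E hE h1 x).effect Δ = ∑ k, if x k ∈ Δ then E k else 0 := by
    simp only [finPOVM]
  rw [Measure.finsetSum_apply, e0, (TrSum.sum_right (s := Finset.univ) fun k _ => ?_).2]
  · rw [Complex.re_sum, ENNReal.ofReal_sum_of_nonneg]
    · refine Finset.sum_congr rfl fun k _ => ?_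
      rw [Measure.smul_apply, Measure.dirac_apply' _ hΔ]
      by_cases h : x k ∈ Δ <;> simp [h, trMul]
    · intro k _
      split_ifs
      · exact hA.trMul_re_nonneg (hEe k)
      · simp [trMul]
  · split_ifs
    · exact hA.trSum (hEe k)
    · exact trSum_zero_right

theorem integrable_law_finPOVM {A : Op I} (hA : IsPosTC A) (f : (Fin 1 → ℝ) → ℝ) :
    Integrable f (law (finPOVM E hE h1 x) A) := by
  rw [law_finPOVM hE h1 x hA]
  refine integrable_finsetSum_measure.2 fun k _ => ?_
  exact (integrable_dirac (by simp)).smul_measure ENNReal.ofReal_ne_top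

theorem integral_law_finPOVM {A : Op I} (hA : IsPosTC A) (f : (Fin 1 → ℝ) → ℝ) :
    ∫ ω, f ω ∂(law (finPOVM E hE h1 x) A) = ∑ k, f (x k) * (trMul A (E k)).re := by
  have hEe := isEffect_of_sum hE h1
  rw [law_finPOVM hE h1 x hA, integral_finsetSum_measure]
  · refine Finset.sum_congr rfl fun k _ => ?_
    rw [integral_smul_measure, integral_dirac,
      ENNReal.toReal_ofReal (hA.trMul_re_nonneg (hEe k)), smul_eq_mul, mul_comm]
  · exact fun k _ => (integrable_dirac (by simp)).smul_measure ENNReal.ofReal_ne_top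

end finite

/-- Estimators with finitely many outcomes are regular. -/
theorem mem_variances_of_Adm {m : ℕ} {I : Type} {Θ : Set (Par m)} (hopen : IsOpen Θ)
    {σ : Par m → Op I} (hσ : DiffModel Θ σ) (hD : Dominated Θ σ) {θ : Par m} (hθ : θ ∈ Θ)
    {B W : Matrix (Fin m) (Fin m) ℝ} (h : (B, W) ∈ Adm (σ θ) fun j => pd σ j θ) :
    W ∈ variances Θ σ B θ := by
  classical
  obtain ⟨κ, _, E, t, hE, h1, h0, hB, hW⟩ := mem_Adm.1 h
  have hEe := isEffect_of_sum hE h1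
  set x : κ → Fin 1 → ℝ := fun k _ => ((Fintype.equivFin κ k : ℕ) : ℝ) with hx
  have hxi : Function.Injective x := fun k l hkl => by
    have := congrFun hkl 0
    simp only [hx, Nat.cast_inj] at this
    exact (Fintype.equivFin κ).injective (Fin.ext this)
  set T : (Fin 1 → ℝ) → Par m := fun ω => ∑ k, if ω = x k then WithLp.toLp 2 (t k) else 0 with hT
  have hTx : ∀ k, T (x k) = WithLp.toLp 2 (t k) := fun k => by
    simp [hT, hxi.eq_iff]
  have hTm : Measurable T := by
    refine Finset.measurable_sum _ fun k _ => ?_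
    exact Measurable.ite (measurableSet_singleton (x k)) measurable_const measurable_const
  have hmean : ∀ η, IsState (σ η) → ∀ i, mean σ (finPOVM E hE h1 x) T η i =
      ∑ k, t k i * (trMul (σ η) (E k)).re := fun η hη i => by
    rw [mean, integral_law_finPOVM hE h1 x hη.isPosTC]
    simp [hTx]
  refine ⟨1, finPOVM E hE h1 x, T, hTm, fun η hη => ⟨fun i => ?_,
    integrable_law_finPOVM hE h1 x (hσ.state η hη).isPosTC _⟩, ?_, ?_⟩
  · obtain ⟨δ, D, hδ, hD1, hD2⟩ := hD η hη i
    exact ⟨δ, D, hδ, hD1, hD2, integrable_law_finPOVM hE h1 x hD1 _⟩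
  · ext i j
    have hst := hσ.eventually_state hopen hθ j
    have hd : ∀ k, HasDerivAt (fun s : ℝ => (trMul (σ (θ + s • unitVec j)) (E k)).re)
        (trMul (pd σ j θ) (E k)).re 0 := fun k =>
      hasDerivAt_re ((hσ.td θ hθ j).hasDerivAt_trMul hst (hEe k))
    have h2 : HasDerivAt (fun s : ℝ => ∑ k, t k i * (trMul (σ (θ + s • unitVec j)) (E k)).re)
        (∑ k, t k i * (trMul (pd σ j θ) (E k)).re) 0 :=
      HasDerivAt.fun_sum fun k _ => (hd k).const_mul _
    rw [biasMat, Matrix.of_apply, hB i j]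
    exact (h2.congr_of_eventuallyEq (hst.mono fun s hs => hmean _ hs i)).deriv
  · ext i j
    have hm0 : ∀ i, mean σ (finPOVM E hE h1 x) T θ i = 0 := fun i => by
      rw [hmean θ (hσ.state θ hθ), h0]
    rw [var, Matrix.of_apply, integral_law_finPOVM hE h1 x (hσ.state θ hθ).isPosTC, hW]
    simp [hm0, hTx]

/-! ### Generalized inverses -/

section pinv

variable {m : ℕ} {A P Q : Matrix (Fin m) (Fin m) ℝ}

theorem pinv_isHermitian (A : Matrix (Fin m) (Fin m) ℝ) : (pinv A).IsHermitian :=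
  cfc_predicate _ A

theorem pinv_pinv (hA : A.IsHermitian) : pinv (pinv A) = A := by
  have hA' : IsSelfAdjoint A := hA
  have hc : ∀ f : ℝ → ℝ, ContinuousOn f (spectrum ℝ A) := fun f =>
    (Matrix.finite_real_spectrum (A := A)).continuousOn f
  have hc' : ∀ f g : ℝ → ℝ, ContinuousOn f (g '' spectrum ℝ A) := fun f g =>
    ((Matrix.finite_real_spectrum (A := A)).image g).continuousOn f
  unfold pinv
  rw [← cfc_comp' (fun x : ℝ => x⁻¹) (fun x : ℝ => x⁻¹) A (hc' _ _) (hc _)]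
  simp only [inv_inv]
  exact cfc_id' ℝ A

theorem pinv_posSemidef (hA : A.PosSemidef) : (pinv A).PosSemidef := by
  have h := hA.conjTranspose_mul_mul_same (pinv A)
  rwa [(pinv_isHermitian A).eq, (pinv_spec hA.1).2.1] at h

theorem mul_eq_zero_of_mulVec {M N : Matrix (Fin m) (Fin m) ℝ} (h : ∀ v, M *ᵥ (N *ᵥ v) = 0) :
    M * N = 0 := by
  refine Matrix.toLin'.injective (LinearMap.ext fun v => ?_)
  simpa [Matrix.toLin'_apply] using h v

/-- An idempotent `P` is absorbed by every matrix that vanishes on its kernel. -/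
theorem mul_eq_of_mulVec (hP2 : P * P = P) (h : ∀ v, P *ᵥ v = 0 → A *ᵥ v = 0) : A * P = A := by
  have h1 : A * (1 - P) = 0 := mul_eq_zero_of_mulVec fun v => h _ (by
    rw [Matrix.mulVec_mulVec, mul_sub, mul_one, hP2, sub_self, Matrix.zero_mulVec])
  rw [mul_sub, mul_one, sub_eq_zero] at h1
  exact h1.symm

/-- Orthogonal projections with the same kernel are equal. -/
theorem proj_eq_of_ker (hP : P.IsHermitian) (hP2 : P * P = P) (hQ : Q.IsHermitian)
    (hQ2 : Q * Q = Q) (h : ∀ v, P *ᵥ v = 0 ↔ Q *ᵥ v = 0) : P = Q := by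
  have h1 := mul_eq_of_mulVec hP2 fun v hv => (h v).1 hv
  have h2 := mul_eq_of_mulVec hQ2 fun v hv => (h v).2 hv
  have h3 := congrArg Matrix.conjTranspose h1
  rw [Matrix.conjTranspose_mul, hP.eq, hQ.eq] at h3
  rw [← h2, h3]

theorem pinv_mul_self_idem (hA : A.IsHermitian) : pinv A * A * (pinv A * A) = pinv A * A := by
  rw [← mul_assoc, (pinv_spec hA).2.1]

theorem pinv_mul_mulVec_eq_zero (hA : A.IsHermitian) (v : Fin m → ℝ) :
    (pinv A * A) *ᵥ v = 0 ↔ A *ᵥ v = 0 := by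
  constructor
  · intro h
    rw [← (pinv_spec hA).1, mul_assoc, ← Matrix.mulVec_mulVec, h, Matrix.mulVec_zero]
  · intro h
    rw [← Matrix.mulVec_mulVec, h, Matrix.mulVec_zero]

theorem pinv_mul_eq (hA : A.IsHermitian) (hP : P.IsHermitian) (hP2 : P * P = P)
    (h : ∀ v, A *ᵥ v = 0 ↔ P *ᵥ v = 0) : pinv A * A = P :=
  proj_eq_of_ker (pinv_spec hA).2.2.2 (pinv_mul_self_idem hA) hP hP2 fun v =>
    (pinv_mul_mulVec_eq_zero hA v).trans (h v)

theorem mul_pinv_eq (hA : A.IsHermitian) (hP : P.IsHermitian) (hP2 : P * P = P)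
    (h : ∀ v, A *ᵥ v = 0 ↔ P *ᵥ v = 0) : A * pinv A = P := by
  have h1 := congrArg Matrix.conjTranspose (pinv_mul_eq hA hP hP2 h)
  rwa [Matrix.conjTranspose_mul, hA.eq, (pinv_isHermitian A).eq, hP.eq] at h1

theorem dotProduct_mulVec_comm (hA : A.IsHermitian) (v w : Fin m → ℝ) :
    v ⬝ᵥ (A *ᵥ w) = (A *ᵥ v) ⬝ᵥ w := by
  have : Aᵀ = A := by simpa [Matrix.IsHermitian, Matrix.conjTranspose_eq_transpose_of_trivial] using hA
  rw [Matrix.dotProduct_mulVec, ← Matrix.mulVec_transpose, this]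

theorem posSemidef_real_nonneg (hA : A.PosSemidef) (v : Fin m → ℝ) : 0 ≤ v ⬝ᵥ (A *ᵥ v) := by
  simpa using hA.dotProduct_mulVec_nonneg v

theorem posSemidef_mulVec_eq_zero (hA : A.PosSemidef) {v : Fin m → ℝ} (h : v ⬝ᵥ (A *ᵥ v) = 0) :
    A *ᵥ v = 0 := by
  have := (hA.dotProduct_mulVec_zero_iff v).1 (by simpa using h)
  exact this

/-- The kernel of a sum of positive semidefinite matrices. -/
theorem posSemidef_add_mulVec_eq_zero (hA : A.PosSemidef) (hP : P.PosSemidef) (v : Fin m → ℝ) :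
    (A + P) *ᵥ v = 0 ↔ A *ᵥ v = 0 ∧ P *ᵥ v = 0 := by
  constructor
  · intro h
    have h1 : v ⬝ᵥ (A *ᵥ v) + v ⬝ᵥ (P *ᵥ v) = 0 := by
      rw [← dotProduct_add, ← Matrix.add_mulVec, h, dotProduct_zero]
    have h2 := posSemidef_real_nonneg hA v
    have h3 := posSemidef_real_nonneg hP v
    exact ⟨posSemidef_mulVec_eq_zero hA (by linarith), posSemidef_mulVec_eq_zero hP (by linarith)⟩
  · rintro ⟨h1, h2⟩
    rw [Matrix.add_mulVec, h1, h2, add_zero]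

/-- Completing the square. -/
theorem two_dotProduct_sub_le {W : Matrix (Fin m) (Fin m) ℝ} (hW : W.PosDef) {c : ℝ} (hc : 0 < c)
    (g y : Fin m → ℝ) :
    2 * (g ⬝ᵥ y) - c * (y ⬝ᵥ (W⁻¹ *ᵥ y)) ≤ 1 / c * (g ⬝ᵥ (W *ᵥ g)) := by
  have hdet : IsUnit W.det := hW.det_pos.ne'.isUnit
  have h1 := posSemidef_real_nonneg hW.inv.posSemidef (c • y - W *ᵥ g)
  have e1 : W⁻¹ *ᵥ (c • y - W *ᵥ g) = c • (W⁻¹ *ᵥ y) - g := by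
    rw [Matrix.mulVec_sub, Matrix.mulVec_smul, Matrix.mulVec_mulVec, Matrix.nonsing_inv_mul _ hdet,
      Matrix.one_mulVec]
  have e2 : (W *ᵥ g) ⬝ᵥ (W⁻¹ *ᵥ y) = g ⬝ᵥ y := by
    rw [← dotProduct_mulVec_comm hW.1, Matrix.mulVec_mulVec, Matrix.mul_nonsing_inv _ hdet,
      Matrix.one_mulVec]
  rw [e1, sub_dotProduct, dotProduct_sub, dotProduct_sub, smul_dotProduct, smul_dotProduct,
    dotProduct_smul, dotProduct_smul, e2, dotProduct_comm y g, dotProduct_comm (W *ᵥ g) g] at h1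
  simp only [smul_eq_mul] at h1
  rw [one_div, ← div_eq_inv_mul, le_div_iff₀ hc]
  linarith

open scoped MatrixOrder Matrix.Norms.L2Operator in
theorem trace_mul_nonneg {G : Matrix (Fin m) (Fin m) ℝ} (hG : G.PosSemidef) (hA : A.PosSemidef) :
    0 ≤ (G * A).trace := by
  obtain ⟨C, rfl⟩ := CStarAlgebra.nonneg_iff_eq_star_mul_self.1 hA.nonneg
  rw [Matrix.star_eq_conjTranspose, ← mul_assoc, Matrix.trace_mul_comm, ← mul_assoc]
  exact (hG.mul_mul_conjTranspose_same C).trace_nonneg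

theorem trace_mul_mono {G : Matrix (Fin m) (Fin m) ℝ} (hG : G.PosSemidef) (hA : A.IsHermitian)
    (hP : P.IsHermitian) (h : ∀ v, v ⬝ᵥ (A *ᵥ v) ≤ v ⬝ᵥ (P *ᵥ v)) :
    (G * A).trace ≤ (G * P).trace := by
  have h1 : (P - A).PosSemidef := Matrix.PosSemidef.of_dotProduct_mulVec_nonneg (hP.sub hA)
    fun v => by
      rw [Matrix.sub_mulVec, dotProduct_sub]
      simpa using h v
  have h2 := trace_mul_nonneg hG h1
  rw [mul_sub, Matrix.trace_sub] at h2
  linarith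

end pinv

/-! ### Information matrices and sums of estimators -/

section hub

variable {L L' : Type} {m : ℕ} {S : Op L} {X : Fin m → Op L} {S' : Op L'} {X' : Fin m → Op L'}
  {B W P U B' W' P' U' G : Matrix (Fin m) (Fin m) ℝ}

/-- The information matrix obtained by using an estimator `(B, W)` with probability `1 - p` and an
estimator `(P, U)` with probability `p`. -/
def infoMat (B W P U : Matrix (Fin m) (Fin m) ℝ) (p : ℝ) : Matrix (Fin m) (Fin m) ℝ :=
  (1 - p) • (Bᵀ * W⁻¹ * B) + p • (P * U⁻¹ * P)

theorem real_conjTranspose (A : Matrix (Fin m) (Fin m) ℝ) : Aᴴ = Aᵀ :=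
  Matrix.conjTranspose_eq_transpose_of_trivial A

theorem infoMat_form (hP : P.IsHermitian) (p : ℝ) (v : Fin m → ℝ) :
    v ⬝ᵥ (infoMat B W P U p *ᵥ v) = (1 - p) * ((B *ᵥ v) ⬝ᵥ (W⁻¹ *ᵥ (B *ᵥ v))) +
      p * ((P *ᵥ v) ⬝ᵥ (U⁻¹ *ᵥ (P *ᵥ v))) := by
  rw [infoMat, Matrix.add_mulVec, dotProduct_add, Matrix.smul_mulVec, Matrix.smul_mulVec,
    dotProduct_smul, dotProduct_smul, ← Matrix.mulVec_mulVec, ← Matrix.mulVec_mulVec,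
    ← Matrix.mulVec_mulVec, ← Matrix.mulVec_mulVec, dotProduct_mulVec_comm hP,
    Matrix.dotProduct_mulVec v Bᵀ, Matrix.vecMul_transpose, smul_eq_mul, smul_eq_mul]

theorem infoMat_posSemidef (hP : P.IsHermitian) (hW : W.PosDef) (hU : U.PosDef) {p : ℝ}
    (hp0 : 0 ≤ p) (hp1 : p ≤ 1) : (infoMat B W P U p).PosSemidef := by
  have h1 := hW.inv.posSemidef.conjTranspose_mul_mul_same B
  have h2 := hU.inv.posSemidef.conjTranspose_mul_mul_same P
  rw [hP.eq] at h2
  rw [real_conjTranspose] at h1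
  exact (h1.smul (by linarith : (0 : ℝ) ≤ 1 - p)).add (h2.smul hp0)

theorem infoMat_mulVec_eq_zero (hP : P.IsHermitian) (hBP : B * P = B) (hW : W.PosDef)
    (hU : U.PosDef) {p : ℝ} (hp0 : 0 < p) (hp1 : p ≤ 1) (v : Fin m → ℝ) :
    infoMat B W P U p *ᵥ v = 0 ↔ P *ᵥ v = 0 := by
  constructor
  · intro h
    have h1 := infoMat_form (B := B) (W := W) (U := U) hP p v
    rw [h, dotProduct_zero] at h1
    have h2 := posSemidef_real_nonneg hW.inv.posSemidef (B *ᵥ v)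
    have h3 : 0 ≤ (1 - p) * ((B *ᵥ v) ⬝ᵥ (W⁻¹ *ᵥ (B *ᵥ v))) := mul_nonneg (by linarith) h2
    by_contra h0
    have h4 := hU.inv.dotProduct_mulVec_pos h0
    rw [star_trivial] at h4
    have := mul_pos hp0 h4
    linarith
  · intro h
    have hB : B *ᵥ v = 0 := by rw [← hBP, ← Matrix.mulVec_mulVec, h, Matrix.mulVec_zero]
    rw [infoMat, Matrix.add_mulVec, Matrix.smul_mulVec, Matrix.smul_mulVec, ← Matrix.mulVec_mulVec,
      ← Matrix.mulVec_mulVec, ← Matrix.mulVec_mulVec v (P * U⁻¹) P, hB, h]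
    simp

/-- The inverse of the information matrix is the variance of the optimally weighted mixture. -/
theorem pinv_infoMat_mem (hP : P.IsHermitian) (hP2 : P * P = P) (hBP : B * P = B) (hW : W.PosDef)
    (hU : U.PosDef) {p : ℝ} (hp0 : 0 < p) (hp1 : p ≤ 1) (h : (B, W) ∈ Adm S X)
    (h' : (P, U) ∈ Adm S X) : (P, pinv (infoMat B W P U p)) ∈ Adm S X := by
  have hJ := infoMat_posSemidef (B := B) hP hW hU hp0.le hp1
  have hker := infoMat_mulVec_eq_zero hP hBP hW hU hp0 hp1
  set K := pinv (infoMat B W P U p) with hK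
  have hKt : Kᵀ = K := by rw [← real_conjTranspose]; exact pinv_isHermitian _
  have hPt : Pᵀ = P := by rw [← real_conjTranspose]; exact hP
  have hWt : W⁻¹ᵀ = W⁻¹ := by rw [← real_conjTranspose]; exact hW.inv.1
  have hUt : U⁻¹ᵀ = U⁻¹ := by rw [← real_conjTranspose]; exact hU.inv.1
  have hWd : IsUnit W.det := hW.det_pos.ne'.isUnit
  have hUd : IsUnit U.det := hU.det_pos.ne'.isUnit
  -- the mixture of the two estimators, each weighted with its part of the information
  have h1 := Adm.mix (Adm.mul h (K * Bᵀ * W⁻¹)) (Adm.mul h' (K * P * U⁻¹)) hp0.le hp1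
  have e1 : (1 - p) • (K * Bᵀ * W⁻¹ * B) + p • (K * P * U⁻¹ * P) = P := by
    have e := pinv_mul_eq hJ.1 hP hP2 hker
    rw [← hK, infoMat, mul_add, Matrix.mul_smul, Matrix.mul_smul] at e
    simp only [mul_assoc] at e ⊢
    exact e
  have e2 : (1 - p) • (K * Bᵀ * W⁻¹ * W * (K * Bᵀ * W⁻¹)ᵀ) +
      p • (K * P * U⁻¹ * U * (K * P * U⁻¹)ᵀ) = K := by
    have : K * infoMat B W P U p * K = K := (pinv_spec hJ.1).2.1
    conv_rhs => rw [← this]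
    simp only [Matrix.transpose_mul, hKt, hWt, hUt, hPt, Matrix.transpose_transpose, infoMat,
      mul_add, add_mul, Matrix.mul_smul, Matrix.smul_mul]
    rw [mul_assoc (K * Bᵀ) W⁻¹ W, Matrix.nonsing_inv_mul _ hWd, mul_assoc (K * P) U⁻¹ U,
      Matrix.nonsing_inv_mul _ hUd]
    simp only [mul_assoc, one_mul]
  rwa [e1, e2] at h1

/-- The comparison for nonsingular variance matrices. -/
theorem exists_trace_pinv_le (hG : G.PosSemidef) (hP : P.IsHermitian) (hP2 : P * P = P)
    (hP' : P'.IsHermitian) (hP2' : P' * P' = P') (hBP : B * P = B) (hBP' : B' * P' = B')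
    (hW : W.PosDef) (hU : U.PosDef) (hW' : W'.PosDef) (hU' : U'.PosDef) {p : ℝ} (hp0 : 0 < p)
    (hp1 : p < 1) (h : (B, W) ∈ Adm S X) (hu : (P, U) ∈ Adm S X) (h' : (B', W') ∈ Adm S' X')
    (hu' : (P', U') ∈ Adm S' X') :
    ∃ V V', (P, V) ∈ Adm S X ∧ (P', V') ∈ Adm S' X' ∧
      (G * pinv (P * pinv V * P + P' * pinv V' * P')).trace ≤
        (G * ((1 / (1 - p)) • (W + W') + (1 / p) •
          ((pinv (P + P') * (P + P') - (B + B')) * pinv (P + P') * (U + U') *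
            ((pinv (P + P') * (P + P') - (B + B')) * pinv (P + P'))ᵀ))).trace := by
  have hJ := infoMat_posSemidef (B := B) hP hW hU hp0.le hp1.le
  have hJ' := infoMat_posSemidef (B := B') hP' hW' hU' hp0.le hp1.le
  have hker := infoMat_mulVec_eq_zero hP hBP hW hU hp0 hp1.le
  have hker' := infoMat_mulVec_eq_zero hP' hBP' hW' hU' hp0 hp1.le
  refine ⟨_, _, pinv_infoMat_mem hP hP2 hBP hW hU hp0 hp1.le h hu,
    pinv_infoMat_mem hP' hP2' hBP' hW' hU' hp0 hp1.le h' hu', ?_⟩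
  rw [pinv_pinv hJ.1, pinv_pinv hJ'.1]
  have hPt : Pᵀ = P := by rw [← real_conjTranspose]; exact hP
  have hPt' : P'ᵀ = P' := by rw [← real_conjTranspose]; exact hP'
  have hBt : P * Bᵀ = Bᵀ := by simpa [hPt] using congrArg Matrix.transpose hBP
  have hBt' : P' * B'ᵀ = B'ᵀ := by simpa [hPt'] using congrArg Matrix.transpose hBP'
  have e1 : P * infoMat B W P U p * P = infoMat B W P U p := by
    simp only [infoMat, mul_add, add_mul, Matrix.mul_smul, Matrix.smul_mul]
    rw [← mul_assoc P, ← mul_assoc P Bᵀ, hBt, mul_assoc _ B P, hBP, ← mul_assoc P, ← mul_assoc P P,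
      hP2, mul_assoc _ P P, hP2]
  have e1' : P' * infoMat B' W' P' U' p * P' = infoMat B' W' P' U' p := by
    simp only [infoMat, mul_add, add_mul, Matrix.mul_smul, Matrix.smul_mul]
    rw [← mul_assoc P', ← mul_assoc P' B'ᵀ, hBt', mul_assoc _ B' P', hBP', ← mul_assoc P',
      ← mul_assoc P' P', hP2', mul_assoc _ P' P', hP2']
  rw [e1, e1']
  set J := infoMat B W P U p + infoMat B' W' P' U' p with hJdef
  set Q := P + P' with hQ
  set E := pinv Q * Q with hE
  -- `Z` turns the estimators with derivatives `P`, `P'` into a correction of the bias: `Z Q = E - (B + B')`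
  set Z := (E - (B + B')) * pinv Q with hZ
  have hPp : P.PosSemidef := by
    have := Matrix.posSemidef_conjTranspose_mul_self P
    rwa [hP.eq, hP2] at this
  have hPp' : P'.PosSemidef := by
    have := Matrix.posSemidef_conjTranspose_mul_self P'
    rwa [hP'.eq, hP2'] at this
  have hJp : J.PosSemidef := hJ.add hJ'
  have hQh : Q.IsHermitian := hP.add hP'
  have hEker : ∀ v, E *ᵥ v = 0 ↔ P *ᵥ v = 0 ∧ P' *ᵥ v = 0 := fun v =>
    (pinv_mul_mulVec_eq_zero hQh v).trans (posSemidef_add_mulVec_eq_zero hPp hPp' v)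
  have hE2 : E * E = E := pinv_mul_self_idem hQh
  have hEh : E.IsHermitian := (pinv_spec hQh).2.2.2
  have hPE : P * E = P := mul_eq_of_mulVec hE2 fun v hv => ((hEker v).1 hv).1
  have hPE' : P' * E = P' := mul_eq_of_mulVec hE2 fun v hv => ((hEker v).1 hv).2
  have hBE : (B + B') * E = B + B' := by
    rw [add_mul, ← hBP, mul_assoc, hPE, ← hBP', mul_assoc B', hPE', hBP, hBP']
  have hJE : pinv J * J = E := pinv_mul_eq hJp.1 hEh hE2 fun v => by
    rw [hEker, hJdef, posSemidef_add_mulVec_eq_zero hJ hJ', hker, hker']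
  refine trace_mul_mono hG (pinv_isHermitian _) ?_ fun g => ?_
  · have h3 : (U + U').IsHermitian := hU.1.add hU'.1
    have h1 : (Z * (U + U') * Zᵀ).IsHermitian := by
      have := Matrix.isHermitian_mul_mul_conjTranspose Z h3
      rwa [real_conjTranspose] at this
    have h2 : (W + W').IsHermitian := hW.1.add hW'.1
    exact (h2.smul (by simp [IsSelfAdjoint])).add (h1.smul (by simp [IsSelfAdjoint]))
  set x := pinv J *ᵥ g with hx
  have hEx : E *ᵥ x = x := by
    rw [hx, ← hJE, Matrix.mulVec_mulVec, (pinv_spec hJp.1).2.1]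
  have q1 : x ⬝ᵥ (J *ᵥ x) = g ⬝ᵥ x := by
    rw [dotProduct_mulVec_comm hJp.1, dotProduct_comm, hx, dotProduct_mulVec_comm (pinv_isHermitian J),
      ← dotProduct_mulVec_comm (pinv_isHermitian J), ← dotProduct_mulVec_comm (pinv_isHermitian J),
      Matrix.mulVec_mulVec, Matrix.mulVec_mulVec, (pinv_spec hJp.1).2.1]
  have q2 : g ⬝ᵥ x = g ⬝ᵥ (B *ᵥ x) + g ⬝ᵥ (B' *ᵥ x) + ((Zᵀ *ᵥ g) ⬝ᵥ (P *ᵥ x) +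
      (Zᵀ *ᵥ g) ⬝ᵥ (P' *ᵥ x)) := by
    rw [← dotProduct_add, ← dotProduct_add, ← Matrix.add_mulVec, ← Matrix.add_mulVec,
      Matrix.mulVec_transpose, ← Matrix.dotProduct_mulVec, Matrix.mulVec_mulVec x, hZ, ← hQ,
      mul_assoc _ (pinv Q) Q, ← hE, sub_mul, hE2, hBE, Matrix.sub_mulVec, hEx, dotProduct_sub]
    ring
  have q3 : x ⬝ᵥ (J *ᵥ x) = (1 - p) * ((B *ᵥ x) ⬝ᵥ (W⁻¹ *ᵥ (B *ᵥ x))) +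
      p * ((P *ᵥ x) ⬝ᵥ (U⁻¹ *ᵥ (P *ᵥ x))) + ((1 - p) * ((B' *ᵥ x) ⬝ᵥ (W'⁻¹ *ᵥ (B' *ᵥ x))) +
      p * ((P' *ᵥ x) ⬝ᵥ (U'⁻¹ *ᵥ (P' *ᵥ x)))) := by
    rw [hJdef, Matrix.add_mulVec, dotProduct_add, infoMat_form hP, infoMat_form hP']
  -- `g · J⁺ g = 2 g · x - x · J x` at `x = J⁺ g`; the four parts are bounded by completing squares
  have s1 := two_dotProduct_sub_le hW (by linarith : 0 < 1 - p) g (B *ᵥ x)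
  have s2 := two_dotProduct_sub_le hW' (by linarith : 0 < 1 - p) g (B' *ᵥ x)
  have s3 := two_dotProduct_sub_le hU hp0 (Zᵀ *ᵥ g) (P *ᵥ x)
  have s4 := two_dotProduct_sub_le hU' hp0 (Zᵀ *ᵥ g) (P' *ᵥ x)
  have q4 : g ⬝ᵥ (((1 / (1 - p)) • (W + W') + (1 / p) • (Z * (U + U') * Zᵀ)) *ᵥ g) =
      1 / (1 - p) * (g ⬝ᵥ (W *ᵥ g)) + 1 / (1 - p) * (g ⬝ᵥ (W' *ᵥ g)) +
      (1 / p * ((Zᵀ *ᵥ g) ⬝ᵥ (U *ᵥ (Zᵀ *ᵥ g))) + 1 / p * ((Zᵀ *ᵥ g) ⬝ᵥ (U' *ᵥ (Zᵀ *ᵥ g)))) := by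
    rw [← mul_add, ← mul_add, ← dotProduct_add, ← dotProduct_add, ← Matrix.add_mulVec,
      ← Matrix.add_mulVec, Matrix.add_mulVec, dotProduct_add, Matrix.smul_mulVec,
      Matrix.smul_mulVec, dotProduct_smul, dotProduct_smul, smul_eq_mul, smul_eq_mul,
      ← Matrix.mulVec_mulVec, ← Matrix.mulVec_mulVec, Matrix.dotProduct_mulVec g Z,
      ← Matrix.mulVec_transpose]
  have hgx : g ⬝ᵥ (pinv J *ᵥ g) = 2 * (g ⬝ᵥ x) - x ⬝ᵥ (J *ᵥ x) := by rw [q1, ← hx]; ring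
  rw [hgx, q4, q3, q2]
  linarith

/-- The sums of pairs of derivative and variance of estimators of two models. -/
def SumAdm (S : Op L) (X : Fin m → Op L) (S' : Op L') (X' : Fin m → Op L') :
    Set (Matrix (Fin m) (Fin m) ℝ × Matrix (Fin m) (Fin m) ℝ) :=
  {p | ∃ q ∈ Adm S X, ∃ q' ∈ Adm S' X', p = q + q'}

theorem Adm.isHermitian (h : (B, W) ∈ Adm S X) : W.IsHermitian := by
  obtain ⟨κ, _, E, t, -, -, -, -, hW⟩ := mem_Adm.1 h
  ext i j
  simp only [Matrix.conjTranspose_apply, star_trivial, hW]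
  exact Finset.sum_congr rfl fun k _ => by ring

theorem Adm.posSemidef (hS : IsState S) (h : (B, W) ∈ Adm S X) : W.PosSemidef := by
  refine Matrix.PosSemidef.of_dotProduct_mulVec_nonneg (Adm.isHermitian h) fun v => ?_
  obtain ⟨κ, _, E, t, hE, h1, -, -, hW⟩ := mem_Adm.1 h
  have : v ⬝ᵥ (W *ᵥ v) = ∑ k, (∑ i, v i * t k i) ^ 2 * (trMul S (E k)).re := by
    simp only [dotProduct, Matrix.mulVec, hW, Finset.mul_sum, Finset.sum_mul, pow_two]
    calc _ = ∑ i, ∑ k, ∑ j, v i * (t k i * t k j * (trMul S (E k)).re * v j) :=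
          Finset.sum_congr rfl fun i _ => Finset.sum_comm
      _ = ∑ k, ∑ i, ∑ j, v i * (t k i * t k j * (trMul S (E k)).re * v j) := Finset.sum_comm
      _ = _ := Finset.sum_congr rfl fun k _ => by
          rw [Finset.sum_comm]
          exact Finset.sum_congr rfl fun i _ => Finset.sum_congr rfl fun j _ => by ring
  rw [star_trivial, this]
  exact Finset.sum_nonneg fun k _ => mul_nonneg (sq_nonneg _)
    (hS.isPosTC.trMul_re_nonneg (isEffect_of_sum hE h1 k))

theorem Adm.posDef (hS : IsState S) (h : (B, W) ∈ Adm S X) {δ : ℝ} (hδ : 0 < δ) :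
    (W + δ • (1 : Matrix (Fin m) (Fin m) ℝ)).PosDef :=
  Matrix.PosDef.posSemidef_add (Adm.posSemidef hS h) (Matrix.PosDef.one.smul hδ)

/-- A lower bound for the combined variance of unbiased estimators of the two models is, up to the
bias, a lower bound for all sums of estimators of the two models. -/
theorem le_trace_of_mem_closure_sumAdm (hS : IsState S) (hS' : IsState S') (hG : G.PosSemidef)
    (hP : P.IsHermitian) (hP2 : P * P = P) (hP' : P'.IsHermitian) (hP2' : P' * P' = P')
    (hker : ∀ B W, (B, W) ∈ Adm S X → B * P = B)
    (hker' : ∀ B W, (B, W) ∈ Adm S' X' → B * P' = B) (hu : (P, U) ∈ Adm S X)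
    (hu' : (P', U') ∈ Adm S' X') {c : EReal}
    (hc : ∀ V V', (P, V) ∈ Adm S X → (P', V') ∈ Adm S' X' →
      c ≤ ((G * pinv (P * pinv V * P + P' * pinv V' * P')).trace : ℝ))
    {p : ℝ} (hp0 : 0 < p) (hp1 : p < 1) (h : (B, W) ∈ closure (SumAdm S X S' X')) :
    c ≤ ((G * ((1 / (1 - p)) • W + (1 / p) • ((pinv (P + P') * (P + P') - B) * pinv (P + P') *
      (U + U') * ((pinv (P + P') * (P + P') - B) * pinv (P + P'))ᵀ))).trace : ℝ) := by
  set F : Matrix (Fin m) (Fin m) ℝ × Matrix (Fin m) (Fin m) ℝ → ℝ := fun q =>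
    (G * ((1 / (1 - p)) • q.2 + (1 / p) • ((pinv (P + P') * (P + P') - q.1) * pinv (P + P') *
      (U + U') * ((pinv (P + P') * (P + P') - q.1) * pinv (P + P'))ᵀ))).trace with hF
  have hFc : Continuous F := by fun_prop
  have hcl : IsClosed {q | c ≤ (F q : EReal)} :=
    isClosed_le continuous_const (continuous_coe_real_ereal.comp hFc)
  suffices hsub : SumAdm S X S' X' ⊆ {q | c ≤ (F q : EReal)} by
    have h3 : c ≤ (F (B, W) : EReal) := closure_minimal hsub hcl h
    simpa only [hF] using h3
  rintro - ⟨⟨B₁, W₁⟩, h₁, ⟨B₂, W₂⟩, h₂, rfl⟩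
  set Φ : ℝ → ℝ := fun δ => (G * ((1 / (1 - p)) • ((W₁ + δ • 1) + (W₂ + δ • 1)) + (1 / p) •
    ((pinv (P + P') * (P + P') - (B₁ + B₂)) * pinv (P + P') * ((U + δ • 1) + (U' + δ • 1)) *
      ((pinv (P + P') * (P + P') - (B₁ + B₂)) * pinv (P + P'))ᵀ))).trace with hΦ
  have hΦc : Continuous Φ := by fun_prop
  have h0 : F ((B₁, W₁) + (B₂, W₂)) = Φ 0 := by
    simp only [hF, hΦ, zero_smul, add_zero, Prod.mk_add_mk]
  change c ≤ (F ((B₁, W₁) + (B₂, W₂)) : EReal)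
  rw [h0]
  have hlim : Tendsto (fun δ => (Φ δ : EReal)) (𝓝[>] 0) (𝓝 (Φ 0 : EReal)) :=
    ((continuous_coe_real_ereal.comp hΦc).tendsto 0).mono_left nhdsWithin_le_nhds
  refine ge_of_tendsto hlim ?_
  filter_upwards [self_mem_nhdsWithin] with δ hδ
  have hδ : 0 < δ := hδ
  obtain ⟨V, V', hV, hV', hle⟩ := exists_trace_pinv_le hG hP hP2 hP' hP2' (hker _ _ h₁)
    (hker' _ _ h₂) (Adm.posDef hS h₁ hδ) (Adm.posDef hS hu hδ) (Adm.posDef hS' h₂ hδ)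
    (Adm.posDef hS' hu' hδ) hp0 hp1 (Adm.noise hS h₁ hδ.le) (Adm.noise hS hu hδ.le)
    (Adm.noise hS' h₂ hδ.le) (Adm.noise hS' hu' hδ.le)
  exact (hc V V' hV hV').trans (EReal.coe_le_coe_iff.2 hle)

end hub

/-! ### Differentiable models, their marginals and their tensor powers -/

section quadForm

variable {I : Type} {A D : Op I}

/-- The quadratic form of an operator. -/
def quadForm (x : I →₀ ℂ) (A : Op I) : ℂ := x.sum fun i xi => x.sum fun j xj => star xi * A i j * xj

theorem quadForm_sub (x : I →₀ ℂ) (A D : Op I) :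
    quadForm x (A - D) = quadForm x A - quadForm x D := by
  simp only [quadForm, Finsupp.sum, ← Finset.sum_sub_distrib, Matrix.sub_apply]
  exact Finset.sum_congr rfl fun i _ => Finset.sum_congr rfl fun j _ => by ring

theorem quadForm_add (x : I →₀ ℂ) (A D : Op I) :
    quadForm x (A + D) = quadForm x A + quadForm x D := by
  simp only [quadForm, Finsupp.sum, ← Finset.sum_add_distrib, Matrix.add_apply]
  exact Finset.sum_congr rfl fun i _ => Finset.sum_congr rfl fun j _ => by ring

theorem quadForm_rsmul (x : I →₀ ℂ) (c : ℝ) (A : Op I) :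
    quadForm x (c • A) = c * quadForm x A := by
  simp only [quadForm, Finsupp.sum, Finset.mul_sum, Matrix.smul_apply, Complex.real_smul]
  exact Finset.sum_congr rfl fun i _ => Finset.sum_congr rfl fun j _ => by ring

theorem norm_le_of_between {z d : ℂ} (h1 : 0 ≤ d - z) (h2 : 0 ≤ d + z) : ‖z‖ ≤ d.re := by
  obtain ⟨a1, b1⟩ := Complex.le_def.1 h1
  obtain ⟨a2, b2⟩ := Complex.le_def.1 h2
  simp at a1 b1 a2 b2
  have hz : z.im = 0 := by linarith
  have : z = (z.re : ℂ) := Complex.ext (by simp) (by simp [hz])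
  rw [this, Complex.norm_real, Real.norm_eq_abs]
  exact abs_le.2 ⟨by linarith, by linarith⟩

end quadForm

section models

variable {m : ℕ} {I J K : Type} {Θ : Set (Par m)} {σ : Par m → Op I} {σ' : Par m → Op J}

theorem HasTD.congr {c d : ℝ → Op I} {X : Op I} (h : HasTD c X) (hcd : ∀ᶠ t in 𝓝 (0 : ℝ), d t = c t) :
    HasTD d X := by
  intro ε hε
  filter_upwards [h ε hε, hcd.filter_mono nhdsWithin_le_nhds] with t ht hdt
  rwa [hdt, hcd.self_of_nhds]

theorem pd_eq_of_hasTD {η : Par m} {i : Fin m} {X : Op I}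
    (h : HasTD (fun t : ℝ => σ (η + t • unitVec i)) X) : pd σ i η = X := by
  ext k l
  exact (h.hasDerivAt_entry k l).deriv

theorem hasTD_of_hasPD {η : Par m} {i : Fin m} (h : HasPD σ i η) :
    HasTD (fun t : ℝ => σ (η + t • unitVec i)) (pd σ i η) := by
  have := tendsto_traceNorm_iff.1 h
  simpa only [HasTD, zero_smul, add_zero] using this

theorem DiffModel.congr (h : DiffModel Θ σ) (hopen : IsOpen Θ) {τ : Par m → Op I}
    (he : ∀ η ∈ Θ, τ η = σ η) : DiffModel Θ τ ∧ ∀ η ∈ Θ, ∀ i, pd τ i η = pd σ i η := by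
  have key : ∀ η ∈ Θ, ∀ i, HasTD (fun t : ℝ => τ (η + t • unitVec i)) (pd σ i η) := fun η hη i =>
    (h.td η hη i).congr ((eventually_line_mem hopen hη _).mono fun t ht => he _ ht)
  refine ⟨⟨fun η hη => he η hη ▸ h.state η hη, fun η hη i => ?_⟩, fun η hη i =>
    pd_eq_of_hasTD (key η hη i)⟩
  rw [pd_eq_of_hasTD (key η hη i)]
  exact key η hη i

theorem DiffModel.pd_mem (h : DiffModel Θ σ) (hopen : IsOpen Θ) {η : Par m} (hη : η ∈ Θ)
    (i : Fin m) : pd σ i η ∈ TC I := by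
  obtain ⟨r, hr⟩ := (h.td η hη i).exists_TNle (h.eventually_state hopen hη i)
  exact hr.mem

theorem DiffModel.tr_pd (h : DiffModel Θ σ) (hopen : IsOpen Θ) {η : Par m} (hη : η ∈ Θ)
    (i : Fin m) : tr (pd σ i η) = 0 :=
  (h.td η hη i).tr_eq_zero (h.eventually_state hopen hη i)

theorem DiffModel.pd_isHermitian (h : DiffModel Θ σ) (hopen : IsOpen Θ) {η : Par m} (hη : η ∈ Θ)
    (i : Fin m) : (pd σ i η).IsHermitian := by
  obtain ⟨r, P, N, hP, hN, hPN, -⟩ :=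
    (h.td η hη i).exists_TNle (h.eventually_state hopen hη i)
  rw [hPN]
  exact hP.1.1.sub hN.1.1

theorem DiffModel.ptr (e : K ≃ I × J) {τ : Par m → Op K} (h : DiffModel Θ τ) (hopen : IsOpen Θ) :
    DiffModel Θ (fun η => ptr e (τ η)) ∧
      ∀ η ∈ Θ, ∀ i, pd (fun η => QEst.ptr e (τ η)) i η = QEst.ptr e (pd τ i η) := by
  have key : ∀ η ∈ Θ, ∀ i, HasTD (fun t : ℝ => QEst.ptr e (τ (η + t • unitVec i)))
      (QEst.ptr e (pd τ i η)) := fun η hη i =>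
    (h.td η hη i).ptr e (h.eventually_state hopen hη i)
  have key2 : ∀ η ∈ Θ, ∀ i, pd (fun η => QEst.ptr e (τ η)) i η = QEst.ptr e (pd τ i η) :=
    fun η hη i => pd_eq_of_hasTD (σ := fun η => QEst.ptr e (τ η)) (key η hη i)
  exact ⟨⟨fun η hη => (h.state η hη).ptr e, fun η hη i => by rw [key2 η hη i]; exact key η hη i⟩,
    key2⟩

theorem DiffModel.tens (e : K ≃ I × J) (h : DiffModel Θ σ) (h' : DiffModel Θ σ') (hopen : IsOpen Θ) :
    DiffModel Θ (fun η => tens e (σ η) (σ' η)) ∧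
      ∀ η ∈ Θ, ∀ i, pd (fun η => QEst.tens e (σ η) (σ' η)) i η =
        QEst.tens e (pd σ i η) (σ' η) + QEst.tens e (σ η) (pd σ' i η) := by
  have key : ∀ η ∈ Θ, ∀ i, HasTD (fun t : ℝ => QEst.tens e (σ (η + t • unitVec i))
      (σ' (η + t • unitVec i))) (QEst.tens e (pd σ i η) (σ' η) + QEst.tens e (σ η) (pd σ' i η)) :=
    fun η hη i => by
      simpa only [zero_smul, add_zero] using (h.td η hη i).tens e (h'.td η hη i)
        (h.eventually_state hopen hη i) (h'.eventually_state hopen hη i)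
  have key2 : ∀ η ∈ Θ, ∀ i, pd (fun η => QEst.tens e (σ η) (σ' η)) i η =
      QEst.tens e (pd σ i η) (σ' η) + QEst.tens e (σ η) (pd σ' i η) :=
    fun η hη i => pd_eq_of_hasTD (σ := fun η => QEst.tens e (σ η) (σ' η)) (key η hη i)
  exact ⟨⟨fun η hη => (h.state η hη).tens e (h'.state η hη),
    fun η hη i => by rw [key2 η hη i]; exact key η hη i⟩, key2⟩

/-! ### Domination -/

theorem Dominated.congr (h : Dominated Θ σ) {τ : Par m → Op I}
    (he : ∀ η ∈ Θ, ∀ i, pd τ i η = pd σ i η) : Dominated Θ τ := by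
  intro η hη i
  obtain ⟨δ, D, hδ, hD, h1⟩ := h η hη i
  refine ⟨δ, D, hδ, hD, fun t ht hm => ?_⟩
  rw [he _ hm]
  exact h1 t ht hm

theorem Dominated.ptr (e : K ≃ I × J) {τ : Par m → Op K} (h : Dominated Θ τ)
    (hm : DiffModel Θ τ) (hopen : IsOpen Θ) : Dominated Θ (fun η => ptr e (τ η)) := by
  intro η hη i
  obtain ⟨δ, D, hδ, hD, h1⟩ := h η hη i
  refine ⟨δ, QEst.ptr e D, hδ, hD.ptr e, fun t ht hmem => ?_⟩
  obtain ⟨a, b⟩ := h1 t ht hmem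
  have hp := hm.pd_mem hopen hmem i
  have hpt : IsPosTC (D - pd τ i (η + t • unitVec i)) := by
    refine (hD.add hD).of_le a ?_
    rw [show D + D - (D - pd τ i (η + t • unitVec i)) = D + pd τ i (η + t • unitVec i) by abel]
    exact b
  have hpt' : IsPosTC (D + pd τ i (η + t • unitVec i)) := by
    refine (hD.add hD).of_le b ?_
    rw [show D + D - (D + pd τ i (η + t • unitVec i)) = D - pd τ i (η + t • unitVec i) by abel]
    exact a
  rw [(hm.ptr e hopen).2 _ hmem, ← ptr_sub e hD.mem hp, ← ptr_add e hD.mem hp]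
  exact ⟨(hpt.ptr e).1, (hpt'.ptr e).1⟩

/-- The increments of the model on a short segment are bounded by a multiple of the dominating
operator, by the mean value theorem. -/
theorem DiffModel.segment_between (hm : DiffModel Θ σ) (hconv : Convex ℝ Θ) {η : Par m}
    (hη : η ∈ Θ) {i : Fin m} {δ : ℝ} {D : Op I} (hδ : 0 < δ) (hD : IsPosTC D)
    (h1 : ∀ t : ℝ, |t| < δ → η + t • unitVec i ∈ Θ →
      (D - pd σ i (η + t • unitVec i)).PosSemidef ∧ (D + pd σ i (η + t • unitVec i)).PosSemidef)
    {t : ℝ} (ht : |t| < δ) (hmem : η + t • unitVec i ∈ Θ) :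
    (|t| • D - (σ (η + t • unitVec i) - σ η)).PosSemidef ∧
      (|t| • D + (σ (η + t • unitVec i) - σ η)).PosSemidef := by
  have hseg : ∀ s ∈ segment ℝ (0 : ℝ) t, |s| < δ ∧ η + s • unitVec i ∈ Θ := by
    intro s hs
    constructor
    · have h2 := (convex_Ioo (-δ) δ).segment_subset (x := 0) (y := t) (by simp [hδ])
        (by simpa [abs_lt] using ht) hs
      exact abs_lt.2 h2
    · obtain ⟨a, b, ha, hb, hab, rfl⟩ := hs
      have := hconv hη hmem ha hb hab
      convert this using 1
      rw [smul_add, ← add_assoc, ← add_smul, hab, one_smul, smul_zero, zero_add, smul_eq_mul,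
        mul_smul]
  have hh1 := (hD.smul (abs_nonneg t)).1.1
  have hh2 := (hm.state _ hmem).1.1.sub (hm.state _ hη).1.1
  have key : ∀ x : I →₀ ℂ, 0 ≤ ((|t| : ℝ) : ℂ) * quadForm x D -
      (quadForm x (σ (η + t • unitVec i)) - quadForm x (σ η)) ∧ 0 ≤ ((|t| : ℝ) : ℂ) * quadForm x D +
      (quadForm x (σ (η + t • unitVec i)) - quadForm x (σ η)) := by
    intro x
    have hder : ∀ s ∈ segment ℝ (0 : ℝ) t, HasDerivWithinAt
        (fun s : ℝ => quadForm x (σ (η + s • unitVec i))) (quadForm x (pd σ i (η + s • unitVec i)))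
        (segment ℝ 0 t) s := by
      intro s hs
      refine HasDerivAt.hasDerivWithinAt ?_
      have h2 := hm.td _ (hseg s hs).2 i
      have h3 : ∀ a b, HasDerivAt (fun s' : ℝ => σ (η + s' • unitVec i) a b)
          (pd σ i (η + s • unitVec i) a b) s := by
        intro a b
        have h4 := h2.hasDerivAt_entry a b
        rw [← sub_self s] at h4
        have h5 := HasDerivAt.comp_sub_const s s h4
        refine h5.congr_of_eventuallyEq (Eventually.of_forall fun s' => ?_)
        have e : η + s • unitVec i + (s' - s) • unitVec i = η + s' • unitVec i := by
          rw [add_assoc, ← add_smul, add_sub_cancel]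
        simp only [e]
      simp only [quadForm, Finsupp.sum]
      exact HasDerivAt.fun_sum fun a _ => HasDerivAt.fun_sum fun b _ =>
        ((h3 a b).const_mul _).mul_const _
    have hbd : ∀ s ∈ segment ℝ (0 : ℝ) t, ‖quadForm x (pd σ i (η + s • unitVec i))‖ ≤
        (quadForm x D).re := fun s hs => by
      obtain ⟨a, b⟩ := h1 s (hseg s hs).1 (hseg s hs).2
      refine norm_le_of_between ?_ ?_
      · rw [← quadForm_sub]; exact a.2 x
      · rw [← quadForm_add]; exact b.2 x
    have hmv := (convex_segment (0 : ℝ) t).norm_image_sub_le_of_norm_hasDerivWithin_le hder hbd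
      (left_mem_segment ℝ 0 t) (right_mem_segment ℝ 0 t)
    have hD0 : 0 ≤ quadForm x D := hD.1.2 x
    have ha : 0 ≤ quadForm x (σ η) := (hm.state η hη).1.2 x
    have hb : 0 ≤ quadForm x (σ (η + t • unitVec i)) := (hm.state _ hmem).1.2 x
    simp only [zero_smul, add_zero, sub_zero, Real.norm_eq_abs] at hmv
    have hre := abs_le.1 ((Complex.abs_re_le_norm _).trans hmv)
    rw [Complex.sub_re] at hre
    have i1 := (Complex.le_def.1 hD0).2
    have i2 := (Complex.le_def.1 ha).2
    have i3 := (Complex.le_def.1 hb).2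
    simp only [Complex.zero_im] at i1 i2 i3
    simp only [Complex.le_def, Complex.sub_re, Complex.add_re, Complex.sub_im, Complex.add_im,
      Complex.re_ofReal_mul, Complex.im_ofReal_mul, Complex.zero_re, Complex.zero_im, ← i1, ← i2,
      ← i3]
    exact ⟨⟨by linarith [mul_comm |t| (quadForm x D).re], by ring⟩,
      ⟨by linarith [mul_comm |t| (quadForm x D).re], by ring⟩⟩
  refine ⟨⟨hh1.sub hh2, fun x => ?_⟩, ⟨hh1.add hh2, fun x => ?_⟩⟩
  · change 0 ≤ quadForm x _
    rw [quadForm_sub, quadForm_sub, quadForm_rsmul]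
    exact (key x).1
  · change 0 ≤ quadForm x _
    rw [quadForm_add, quadForm_sub, quadForm_rsmul]
    exact (key x).2

/-- The states of a dominated model on a short segment are bounded by a single trace class
operator. -/
theorem Dominated.exists_le (h : Dominated Θ σ) (hm : DiffModel Θ σ) (hconv : Convex ℝ Θ)
    {η : Par m} (hη : η ∈ Θ) (i : Fin m) : ∃ (δ : ℝ) (D S : Op I), 0 < δ ∧ IsPosTC D ∧ IsPosTC S ∧
      ∀ t : ℝ, |t| < δ → η + t • unitVec i ∈ Θ →
        (D - pd σ i (η + t • unitVec i)).PosSemidef ∧ (D + pd σ i (η + t • unitVec i)).PosSemidef ∧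
          (S - σ (η + t • unitVec i)).PosSemidef := by
  obtain ⟨δ, D, hδ, hD, h1⟩ := h η hη i
  refine ⟨δ, D, σ η + δ • D, hδ, hD, (hm.state η hη).isPosTC.add (hD.smul hδ.le),
    fun t ht hmem => ⟨(h1 t ht hmem).1, (h1 t ht hmem).2, ?_⟩⟩
  have h2 := (hm.segment_between hconv hη hδ hD h1 ht hmem).1.add
    (posSemidef_real_smul hD.1 (sub_nonneg.2 ht.le))
  convert h2 using 1
  rw [sub_smul]
  abel

/-- If `-D ≤ X ≤ D` and `0 ≤ y ≤ Y`, then `-D ⊗ Y ≤ X ⊗ y ≤ D ⊗ Y`. -/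
theorem tens_between (e : K ≃ I × J) {X D : Op I} {y Y : Op J} (h1 : (D - X).PosSemidef)
    (h2 : (D + X).PosSemidef) (hD : D.PosSemidef) (hy : y.PosSemidef) (hyY : (Y - y).PosSemidef) :
    (tens e D Y - tens e X y).PosSemidef ∧ (tens e D Y + tens e X y).PosSemidef := by
  have e1 : tens e D Y - tens e X y = tens e (D - X) y + tens e D (Y - y) := by
    rw [tens_sub_left, tens_sub_right]; abel
  have e2 : tens e D Y + tens e X y = tens e (D + X) y + tens e D (Y - y) := by
    rw [tens_add_left, tens_sub_right]; abel
  rw [e1, e2]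
  exact ⟨(tens_posSemidef e h1 hy).add (tens_posSemidef e hD hyY),
    (tens_posSemidef e h2 hy).add (tens_posSemidef e hD hyY)⟩

/-- The estimate of `tens_between` with the factors exchanged. -/
theorem tens_between' (e : K ≃ I × J) {x Y : Op I} {X D : Op J} (h1 : (D - X).PosSemidef)
    (h2 : (D + X).PosSemidef) (hD : D.PosSemidef) (hx : x.PosSemidef) (hxY : (Y - x).PosSemidef) :
    (tens e Y D - tens e x X).PosSemidef ∧ (tens e Y D + tens e x X).PosSemidef := by
  have e1 : tens e Y D - tens e x X = tens e x (D - X) + tens e (Y - x) D := by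
    rw [tens_sub_left, tens_sub_right]; abel
  have e2 : tens e Y D + tens e x X = tens e x (D + X) + tens e (Y - x) D := by
    rw [tens_add_right, tens_sub_left]; abel
  rw [e1, e2]
  exact ⟨(tens_posSemidef e hx h1).add (tens_posSemidef e hxY hD),
    (tens_posSemidef e hx h2).add (tens_posSemidef e hxY hD)⟩

/-- By the product rule, the derivative of the product is dominated once the states of each factor are
bounded by a single operator near `η`. -/
theorem Dominated.tens (e : K ≃ I × J) (h : Dominated Θ σ) (h' : Dominated Θ σ')
    (hm : DiffModel Θ σ) (hm' : DiffModel Θ σ') (hopen : IsOpen Θ) (hconv : Convex ℝ Θ) :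
    Dominated Θ (fun η => tens e (σ η) (σ' η)) := by
  intro η hη i
  obtain ⟨δ, D, S, hδ, hD, hS, h1⟩ := h.exists_le hm hconv hη i
  obtain ⟨δ', D', S', hδ', hD', hS', h1'⟩ := h'.exists_le hm' hconv hη i
  refine ⟨min δ δ', QEst.tens e D S' + QEst.tens e S D', lt_min hδ hδ',
    (hD.tens e hS').add (hS.tens e hD'), fun t ht hmem => ?_⟩
  obtain ⟨a, b, c⟩ := h1 t (ht.trans_le (min_le_left _ _)) hmem
  obtain ⟨a', b', c'⟩ := h1' t (ht.trans_le (min_le_right _ _)) hmem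
  obtain ⟨p1, p2⟩ := tens_between e a b hD.1 (hm'.state _ hmem).1 c'
  obtain ⟨q1, q2⟩ := tens_between' e a' b' hD'.1 (hm.state _ hmem).1 c
  rw [(hm.tens e hm' hopen).2 _ hmem]
  constructor
  · have := p1.add q1
    convert this using 1
    abel
  · have := p2.add q2
    convert this using 1
    abel

end models

section tensorPow

variable {m : ℕ} {I : Type} {Θ : Set (Par m)} {σ : Par m → Op I}

theorem tensorPow_succ (A : Op I) (n : ℕ) :
    tensorPow A (n + 1) = tens (Fin.consEquiv fun _ : Fin (n + 1) => I).symm A (tensorPow A n) := by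
  ext i j
  simp [tensorPow, tens_apply, Fin.prod_univ_succ, Fin.consEquiv, Fin.tail]

theorem tensorPow_add (A : Op I) (n n' : ℕ) :
    tensorPow A (n + n') = tens (Fin.appendEquiv n n').symm (tensorPow A n) (tensorPow A n') := by
  ext i j
  simp [tensorPow, tens_apply, Fin.prod_univ_add, Fin.appendEquiv]

theorem isState_tensorPow_zero (A : Op I) : IsState (tensorPow A 0) := by
  have h : tensorPow A 0 = idOp (Fin 0 → I) := by
    classical
    ext i j
    simp [tensorPow, idOp, Matrix.one_apply, Subsingleton.elim i j]
  constructor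
  · rw [h]; exact posSemidef_idOp
  · have := hasSum_fintype fun i : Fin 0 → I => tensorPow A 0 i i
    convert this using 1
    simp [tensorPow]

theorem isState_tensorPow {A : Op I} (hA : IsState A) (n : ℕ) : IsState (tensorPow A n) := by
  induction n with
  | zero => exact isState_tensorPow_zero A
  | succ n ih => rw [tensorPow_succ]; exact hA.tens _ ih

theorem hasTD_const (A : Op I) : HasTD (fun _ => A) 0 := fun ε hε => Eventually.of_forall fun t =>
  ⟨0, 0, isPosTC_zero, isPosTC_zero, by simp, by simp [tr, hε.le]⟩

theorem tensorPow_zero_eq (A A' : Op I) : tensorPow A 0 = tensorPow A' 0 := by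
  ext i j; simp [tensorPow]

theorem pd_tensorPow_zero (η : Par m) (i : Fin m) : pd (fun η => tensorPow (σ η) 0) i η = 0 := by
  refine pd_eq_of_hasTD (σ := fun η => tensorPow (σ η) 0) ?_
  rw [show (fun t : ℝ => tensorPow (σ (η + t • unitVec i)) 0) = fun _ => tensorPow (σ η) 0 from
    funext fun t => tensorPow_zero_eq _ _]
  exact hasTD_const _

theorem DiffModel.tensorPow (h : DiffModel Θ σ) (hopen : IsOpen Θ) (n : ℕ) :
    DiffModel Θ fun η => QEst.tensorPow (σ η) n := by
  induction n with
  | zero =>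
    refine ⟨fun η _ => isState_tensorPow_zero _, fun η _ i => ?_⟩
    rw [pd_tensorPow_zero]
    rw [show (fun t : ℝ => QEst.tensorPow (σ (η + t • unitVec i)) 0) =
      fun _ => QEst.tensorPow (σ η) 0 from funext fun t => tensorPow_zero_eq _ _]
    exact hasTD_const _
  | succ n ih =>
    simp only [tensorPow_succ]
    exact (h.tens _ ih hopen).1

theorem DiffModel.pd_tensorPow_succ (h : DiffModel Θ σ) (hopen : IsOpen Θ) (n : ℕ) {η : Par m}
    (hη : η ∈ Θ) (i : Fin m) : pd (fun η => QEst.tensorPow (σ η) (n + 1)) i η =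
      QEst.tens (Fin.consEquiv fun _ : Fin (n + 1) => I).symm (pd σ i η) (QEst.tensorPow (σ η) n) +
      QEst.tens (Fin.consEquiv fun _ : Fin (n + 1) => I).symm (σ η)
        (pd (fun η => QEst.tensorPow (σ η) n) i η) := by
  simp only [tensorPow_succ]
  exact (h.tens _ (h.tensorPow hopen n) hopen).2 η hη i

theorem DiffModel.pd_tensorPow_add (h : DiffModel Θ σ) (hopen : IsOpen Θ) (n n' : ℕ) {η : Par m}
    (hη : η ∈ Θ) (i : Fin m) : pd (fun η => QEst.tensorPow (σ η) (n + n')) i η =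
      QEst.tens (Fin.appendEquiv n n').symm (pd (fun η => QEst.tensorPow (σ η) n) i η)
        (QEst.tensorPow (σ η) n') +
      QEst.tens (Fin.appendEquiv n n').symm (QEst.tensorPow (σ η) n)
        (pd (fun η => QEst.tensorPow (σ η) n') i η) := by
  simp only [tensorPow_add]
  exact ((h.tensorPow hopen n).tens _ (h.tensorPow hopen n') hopen).2 η hη i

theorem Dominated.tensorPow (h : Dominated Θ σ) (hm : DiffModel Θ σ) (hopen : IsOpen Θ)
    (hconv : Convex ℝ Θ) (n : ℕ) : Dominated Θ fun η => QEst.tensorPow (σ η) n := by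
  induction n with
  | zero =>
    refine fun η _ i => ⟨1, 0, one_pos, isPosTC_zero, fun t _ _ => ?_⟩
    rw [pd_tensorPow_zero]
    simp [Matrix.PosSemidef.zero]
  | succ n ih =>
    simp only [tensorPow_succ]
    exact h.tens _ ih hm (hm.tensorPow hopen n) hopen hconv

/-! ### Estimators of independent copies -/

/-- The pairs of derivative of the mean and variance for the estimators of `n` copies with finitely
many outcomes. -/
abbrev AdmPow (σ : Par m → Op I) (θ : Par m) (n : ℕ) :
    Set (Matrix (Fin m) (Fin m) ℝ × Matrix (Fin m) (Fin m) ℝ) :=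
  Adm (tensorPow (σ θ) n) fun j => pd (fun η => tensorPow (σ η) n) j θ

variable {θ : Par m} {B B' W W' : Matrix (Fin m) (Fin m) ℝ}

theorem Adm.trivial {L : Type} {S : Op L} {X : Fin m → Op L} :
    ((0 : Matrix (Fin m) (Fin m) ℝ), (0 : Matrix (Fin m) (Fin m) ℝ)) ∈ Adm S X :=
  mem_Adm.2 ⟨Unit, inferInstance, fun _ => idOp L, fun _ _ => 0, fun _ => posSemidef_idOp, by simp,
    by simp, by simp, by simp⟩

theorem admPow_add (h : DiffModel Θ σ) (hopen : IsOpen Θ) (hθ : θ ∈ Θ) {n n' : ℕ}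
    (h1 : (B, W) ∈ AdmPow σ θ n) (h2 : (B', W') ∈ AdmPow σ θ n') (c c' : ℝ) :
    (c • B + c' • B', c ^ 2 • W + c' ^ 2 • W') ∈ AdmPow σ θ (n + n') := by
  have hn := h.tensorPow hopen n
  have hn' := h.tensorPow hopen n'
  have := Adm.tens (Fin.appendEquiv n n').symm (hn.state θ hθ) (hn'.state θ hθ)
    (fun j => hn.pd_mem hopen hθ j) (fun j => hn'.pd_mem hopen hθ j)
    (fun j => hn.tr_pd hopen hθ j) (fun j => hn'.tr_pd hopen hθ j) h1 h2 c c'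
  simp only [AdmPow, h.pd_tensorPow_add hopen n n' hθ]
  rwa [tensorPow_add]

theorem admPow_succ (h : DiffModel Θ σ) (hopen : IsOpen Θ) (hθ : θ ∈ Θ) {n : ℕ}
    (h1 : (B, W) ∈ Adm (σ θ) fun j => pd σ j θ) (h2 : (B', W') ∈ AdmPow σ θ n) (c c' : ℝ) :
    (c • B + c' • B', c ^ 2 • W + c' ^ 2 • W') ∈ AdmPow σ θ (n + 1) := by
  have hn := h.tensorPow hopen n
  have := Adm.tens (Fin.consEquiv fun _ : Fin (n + 1) => I).symm (h.state θ hθ) (hn.state θ hθ)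
    (fun j => h.pd_mem hopen hθ j) (fun j => hn.pd_mem hopen hθ j)
    (fun j => h.tr_pd hopen hθ j) (fun j => hn.tr_pd hopen hθ j) h1 h2 c c'
  simp only [AdmPow, h.pd_tensorPow_succ hopen n hθ]
  rwa [tensorPow_succ]

theorem admPow_one (h : DiffModel Θ σ) (hopen : IsOpen Θ) (hθ : θ ∈ Θ)
    (h1 : (B, W) ∈ Adm (σ θ) fun j => pd σ j θ) : (B, W) ∈ AdmPow σ θ 1 := by
  have := admPow_succ h hopen hθ h1 (Adm.trivial : _ ∈ AdmPow σ θ 0) 1 0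
  simpa using this

/-- The average of `q` independent copies of an estimator of `n` copies, extended to `r` further
copies. -/
theorem admPow_average (h : DiffModel Θ σ) (hopen : IsOpen Θ) (hθ : θ ∈ Θ) {n : ℕ}
    (h1 : (B, W) ∈ AdmPow σ θ n) (r q : ℕ) :
    (B, ((q : ℝ) + 1)⁻¹ • W) ∈ AdmPow σ θ (n * (q + 1) + r) := by
  induction q with
  | zero =>
    have := admPow_add h hopen hθ h1 (Adm.trivial : _ ∈ AdmPow σ θ r) 1 0
    simpa using this
  | succ q ih =>
    have hq : (0 : ℝ) < q + 1 := by positivity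
    have := admPow_add h hopen hθ h1 ih ((q : ℝ) + 2)⁻¹ (((q : ℝ) + 1) * ((q : ℝ) + 2)⁻¹)
    rw [show n * (q + 1 + 1) + r = n + (n * (q + 1) + r) by ring]
    convert this using 2
    · rw [← add_smul, ← one_add_mul, show (1 + ((q : ℝ) + 1)) = q + 2 by ring,
        mul_inv_cancel₀ (by positivity), one_smul]
    · rw [smul_smul, ← add_smul]
      congr 1
      push_cast
      field_simp
      ring

/-- Independent estimators at one copy, used with equal probabilities. -/
theorem Adm.sum_mix {L : Type} {S : Op L} {X : Fin m → Op L} {n : ℕ}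
    {B W : Fin n → Matrix (Fin m) (Fin m) ℝ} (h : ∀ k, (B k, W k) ∈ Adm S X) :
    (∑ k, B k, (n : ℝ) • ∑ k, W k) ∈ Adm S X := by
  have key : ∀ k : ℕ, ∀ {B W : Fin (k + 1) → Matrix (Fin m) (Fin m) ℝ},
      (∀ k, (B k, W k) ∈ Adm S X) → (((k : ℝ) + 1)⁻¹ • ∑ k, B k, ((k : ℝ) + 1)⁻¹ • ∑ k, W k) ∈
        Adm S X := by
    intro k
    induction k with
    | zero => intro B W h; simpa using h 0
    | succ k ih =>
      intro B W h
      have h1 := ih (B := fun j => B j.castSucc) (W := fun j => W j.castSucc) fun j => h _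
      have h2 := Adm.mix h1 (h (Fin.last _)) (p := ((k : ℝ) + 2)⁻¹) (by positivity)
        (inv_le_one_of_one_le₀ (by linarith [(Nat.cast_nonneg k : (0 : ℝ) ≤ k)]))
      have e : ((1 : ℝ) - ((k : ℝ) + 2)⁻¹) * ((k : ℝ) + 1)⁻¹ = ((k : ℝ) + 2)⁻¹ := by
        have : (k : ℝ) + 1 ≠ 0 := by positivity
        field_simp
        ring
      rw [smul_smul, smul_smul, e, ← smul_add, ← smul_add, ← Fin.sum_univ_castSucc,
        ← Fin.sum_univ_castSucc] at h2
      push_cast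
      rwa [show (k : ℝ) + 1 + 1 = k + 2 by ring]
  cases n with
  | zero => simpa using Adm.trivial
  | succ n =>
    have h1 := key n fun k => Adm.smul (h k) ((n : ℝ) + 1)
    have hn : (n : ℝ) + 1 ≠ 0 := by positivity
    simp only [← Finset.smul_sum, smul_smul] at h1
    rw [inv_mul_cancel₀ hn, one_smul, show ((n : ℝ) + 1)⁻¹ * ((n : ℝ) + 1) ^ 2 = n + 1 by
      field_simp] at h1
    push_cast
    exact h1

end tensorPow

/-! ### The identifiable directions -/

section identProj

variable {m : ℕ} {I : Type} {Θ : Set (Par m)} {ρ : Par m → Op I} {θ : Par m}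

theorem exists_identProj (ρ : Par m → Op I) (θ : Par m) : ∃ Z : Submodule ℝ (Par m),
    (∀ v, v ∈ Z ↔ ∑ i, v i • pd ρ i θ = 0) ∧
    ∀ i j, identProj ρ θ i j = (Zᗮ.starProjection (unitVec j)) i :=
  ⟨_, fun _ => Iff.rfl, fun _ _ => rfl⟩

/-- The matrix `identProj ρ θ` acts as the projection onto `Zᗮ`. -/
theorem identProj_mulVec_aux {Z : Submodule ℝ (Par m)}
    (hZ : ∀ i j, identProj ρ θ i j = (Zᗮ.starProjection (unitVec j)) i) (v : Par m) :
    identProj ρ θ *ᵥ v.ofLp = (Zᗮ.starProjection v).ofLp := by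
  have hv : v = ∑ j, v j • (unitVec j : Par m) := by
    ext i
    simp [Finset.sum_apply, Pi.single_apply]
  ext i
  conv_rhs => rw [hv]
  simp only [Matrix.mulVec, dotProduct, hZ, map_sum, map_smul, WithLp.ofLp_sum, Finset.sum_apply,
    PiLp.smul_apply, smul_eq_mul]
  exact Finset.sum_congr rfl fun j _ => mul_comm _ _

theorem identProj_mulVec_eq_zero (v : Fin m → ℝ) :
    identProj ρ θ *ᵥ v = 0 ↔ ∑ i, v i • pd ρ i θ = 0 := by
  obtain ⟨Z, hZ1, hZ2⟩ := exists_identProj ρ θ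
  have h1 := identProj_mulVec_aux hZ2 (WithLp.toLp 2 v)
  have h2 := hZ1 (WithLp.toLp 2 v)
  simp only at h1 h2
  rw [h1, ← h2, ← WithLp.ofLp_zero (p := 2), (WithLp.ofLp_injective 2).eq_iff,
    Submodule.starProjection_apply_eq_zero_iff, Submodule.orthogonal_orthogonal]

theorem identProj_isHermitian : (identProj ρ θ).IsHermitian := by
  obtain ⟨Z, hZ1, hZ2⟩ := exists_identProj ρ θ
  ext i j
  have h := Zᗮ.inner_starProjection_left_eq_right (unitVec j) (unitVec i)
  rw [Matrix.conjTranspose_apply, star_trivial, hZ2, hZ2]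
  simpa [EuclideanSpace.inner_single_left, EuclideanSpace.inner_single_right] using h.symm

theorem identProj_mul_self : identProj ρ θ * identProj ρ θ = identProj ρ θ := by
  obtain ⟨Z, hZ1, hZ2⟩ := exists_identProj ρ θ
  have h : ∀ v : Fin m → ℝ, identProj ρ θ *ᵥ (identProj ρ θ *ᵥ v) = identProj ρ θ *ᵥ v := by
    intro v
    have h1 := identProj_mulVec_aux hZ2 (WithLp.toLp 2 v)
    simp only at h1
    rw [h1, identProj_mulVec_aux hZ2]
    congr 1
    exact Zᗮ.starProjection_eq_self_iff.2 (Submodule.starProjection_apply_mem _ _)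
  refine Matrix.toLin'.injective (LinearMap.ext fun v => ?_)
  simpa [Matrix.toLin'_apply] using h v

/-- A direction in which the state does not change at `θ` has this property for `n` copies, too. -/
theorem sum_smul_pd_tensorPow (hm : DiffModel Θ ρ) (hopen : IsOpen Θ) (hθ : θ ∈ Θ)
    {v : Fin m → ℝ} (hv : ∑ i, v i • pd ρ i θ = 0) (n : ℕ) :
    ∑ i, v i • pd (fun η => tensorPow (ρ η) n) i θ = 0 := by
  induction n with
  | zero => simp [pd_tensorPow_zero]
  | succ n ih =>
    simp only [hm.pd_tensorPow_succ hopen n hθ, smul_add, Finset.sum_add_distrib]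
    simp only [← tens_rsmul_left _ _ (pd ρ _ θ), ← tens_rsmul_right, ← tens_sum_left,
      ← tens_sum_right, hv, ih]
    rw [tens_zero_left, tens_zero_right, add_zero]

theorem admPow_mul_identProj (hm : DiffModel Θ ρ) (hopen : IsOpen Θ) (hθ : θ ∈ Θ) {n : ℕ}
    {B W : Matrix (Fin m) (Fin m) ℝ} (h : (B, W) ∈ AdmPow ρ θ n) :
    B * identProj ρ θ = B :=
  mul_eq_of_mulVec identProj_mul_self fun v hv =>
    Adm.mulVec_eq_zero (fun j => (hm.tensorPow hopen n).pd_mem hopen hθ j) h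
      (sum_smul_pd_tensorPow hm hopen hθ ((identProj_mulVec_eq_zero v).1 hv) n)

theorem exists_adm_identProj (hm : DiffModel Θ ρ) (hopen : IsOpen Θ) (hθ : θ ∈ Θ) :
    ∃ U, (identProj ρ θ, U) ∈ AdmPow ρ θ 1 := by
  obtain ⟨U, hU⟩ := Adm.exists_of_mulVec (hm.state θ hθ) (fun j => hm.pd_mem hopen hθ j)
    (fun j => hm.tr_pd hopen hθ j) (fun j => hm.pd_isHermitian hopen hθ j) (identProj ρ θ)
    fun v hv => (identProj_mulVec_eq_zero v).2 hv
  exact ⟨U, admPow_one hm hopen hθ hU⟩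

end identProj

/-! ### Approximation of estimators by estimators with finitely many outcomes -/

section signed

variable {L Ω : Type} [MeasurableSpace Ω] {M : POVM L Ω} {D X : Op L}

/-- The integral against the signed measure `Δ ↦ tr X M(Δ)`, for an operator `X` between `-D`
and `D`. It is written as a difference of integrals against measures. -/
def signedInt (M : POVM L Ω) (D X : Op L) (f : Ω → ℝ) : ℝ :=
  ∫ ω, f ω ∂(law M (D + X)) - ∫ ω, f ω ∂(law M D)

theorem isPosTC_add_of_between (hD : IsPosTC D) (h1 : (D - X).PosSemidef)
    (h2 : (D + X).PosSemidef) : IsPosTC (D + X) := by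
  refine (hD.add hD).of_le h2 ?_
  rw [show D + D - (D + X) = D - X by abel]
  exact h1

theorem mem_of_between (hD : IsPosTC D) (h1 : (D - X).PosSemidef)
    (h2 : (D + X).PosSemidef) : X ∈ TC L := by
  rw [show X = D + X - D by abel]
  exact Submodule.sub_mem _ (isPosTC_add_of_between hD h1 h2).mem hD.mem

theorem law_add_between_le (hD : IsPosTC D) (h1 : (D - X).PosSemidef)
    (h2 : (D + X).PosSemidef) : law M (D + X) ≤ ENNReal.ofReal 2 • law M D := by
  rw [← law_smul M hD (by norm_num)]
  refine law_mono M (isPosTC_add_of_between hD h1 h2) (hD.smul (by norm_num)) ?_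
  rw [two_smul, show D + D - (D + X) = D - X by abel]
  exact h1

theorem integrable_law_add_between (hD : IsPosTC D) (h1 : (D - X).PosSemidef)
    (h2 : (D + X).PosSemidef) {E : Type*} [NormedAddCommGroup E] {f : Ω → E}
    (hf : Integrable f (law M D)) : Integrable f (law M (D + X)) :=
  (hf.smul_measure ENNReal.ofReal_ne_top).mono_measure (law_add_between_le hD h1 h2)

theorem law_real_add_sub (hD : IsPosTC D) (h1 : (D - X).PosSemidef) (h2 : (D + X).PosSemidef)
    {Δ : Set Ω} (hΔ : MeasurableSet Δ) :
    (law M (D + X)).real Δ - (law M D).real Δ = (trMul X (M.effect Δ)).re := by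
  rw [law_real_apply M (isPosTC_add_of_between hD h1 h2) hΔ, law_real_apply M hD hΔ,
    trMul_add_left (hD.trSum (M.isEffect hΔ))
      (trSum_of_mem (mem_of_between hD h1 h2) (M.isEffect hΔ)), Complex.add_re]
  ring

/-- The integral of a function of a simple function, as a sum over its values. -/
theorem integral_comp_simpleFunc {β : Type*} (s : SimpleFunc Ω β) (μ : Measure Ω)
    [IsFiniteMeasure μ] (g : β → ℝ) :
    ∫ ω, g (s ω) ∂μ = ∑ k : s.range, g k * μ.real (s ⁻¹' {(k : β)}) := by
  classical
  have e : ∀ ω, g (s ω) = ∑ k : s.range, (s ⁻¹' {(k : β)}).indicator (fun _ => g k) ω := by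
    intro ω
    rw [Finset.sum_eq_single (⟨s ω, s.mem_range_self ω⟩ : s.range)]
    · simp
    · intro k _ hk
      refine Set.indicator_of_notMem ?_ _
      intro h
      exact hk (Subtype.ext (by simpa using Eq.symm h))
    · simp
  rw [integral_congr_ae (Eventually.of_forall e), integral_finsetSum]
  · refine Finset.sum_congr rfl fun k _ => ?_
    rw [integral_indicator_const _ (s.measurableSet_fiber _), smul_eq_mul, mul_comm]
  · exact fun k _ => (integrable_const _).indicator (s.measurableSet_fiber _)

theorem POVM.sum_effect_fiber {m : ℕ} (M : POVM L Ω) (s : SimpleFunc Ω (Fin m → ℝ)) :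
    ∑ k : s.range, M.effect (s ⁻¹' {(k : Fin m → ℝ)}) = idOp L := by
  classical
  have key : ∀ F : Finset (Fin m → ℝ), ∑ k ∈ F, M.effect (s ⁻¹' {k}) = M.effect (s ⁻¹' F) := by
    intro F
    induction F using Finset.induction_on with
    | empty => simp [M.effect_empty]
    | insert a F ha ih =>
      rw [Finset.sum_insert ha, ih, ← M.effect_union (s.measurableSet_fiber _)
        (s.measurableSet_preimage _)]
      · congr 1
        ext ω; simp
      · refine Set.disjoint_left.2 fun ω h1 h2 => ha ?_
        have h1 : s ω = a := h1
        simpa [h1] using h2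
  rw [Finset.sum_coe_sort s.range fun k => M.effect (s ⁻¹' {k}), key, ← M.effect_univ]
  congr 1
  ext ω
  simp

end signed

section closure

variable {L Ω : Type} [MeasurableSpace Ω] {m : ℕ} {S : Op L} {X D : Fin m → Op L}

/-- The derivative of the mean and the covariance matrix of an estimator. -/
def momentPair (M : POVM L Ω) (S : Op L) (D X : Fin m → Op L) (T : Ω → Fin m → ℝ) :
    Matrix (Fin m) (Fin m) ℝ × Matrix (Fin m) (Fin m) ℝ :=
  (Matrix.of fun i j => signedInt M (D j) (X j) fun ω => T ω i,
    Matrix.of fun i j => ∫ ω, T ω i * T ω j ∂(law M S) -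
      (∫ ω, T ω i ∂(law M S)) * ∫ ω, T ω j ∂(law M S))

/-- An estimator with finitely many values is determined by the finitely many events on which it is
constant. -/
theorem simpleFunc_mem_Adm (hS : IsState S) (hD : ∀ j, IsPosTC (D j))
    (h1 : ∀ j, (D j - X j).PosSemidef) (h2 : ∀ j, (D j + X j).PosSemidef)
    (hX : ∀ j, tr (X j) = 0) (M : POVM L Ω) (s : SimpleFunc Ω (Fin m → ℝ)) :
    momentPair M S D X s ∈ Adm S X := by
  have hSp := hS.isPosTC
  have hme : ∀ k, MeasurableSet (s ⁻¹' {k}) := fun k => s.measurableSet_fiber k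
  set μ : Fin m → ℝ := fun i => ∫ ω, s ω i ∂(law M S) with hμ
  have hμ' : ∀ i, μ i = ∑ k : s.range, k.1 i * (trMul S (M.effect (s ⁻¹' {k.1}))).re := fun i => by
    rw [hμ]
    simp only [integral_comp_simpleFunc s (law M S) fun x => x i, law_real_apply M hSp (hme _)]
  have hsum : ∑ k : s.range, (trMul S (M.effect (s ⁻¹' {k.1}))).re = 1 := by
    have := (TrSum.sum_right (A := S) (s := Finset.univ) fun (k : s.range) _ =>
      hSp.trSum (M.isEffect (hme k.1))).2
    rw [M.sum_effect_fiber s, trMul_one, hS.tr_eq] at this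
    rw [← Complex.re_sum, ← this, Complex.one_re]
  have hsumX : ∀ j, ∑ k : s.range, (trMul (X j) (M.effect (s ⁻¹' {k.1}))).re = 0 := fun j => by
    have := (TrSum.sum_right (A := X j) (s := Finset.univ) fun (k : s.range) _ =>
      trSum_of_mem (mem_of_between (hD j) (h1 j) (h2 j)) (M.isEffect (hme k.1))).2
    rw [M.sum_effect_fiber s, trMul_one, hX] at this
    rw [← Complex.re_sum, ← this, Complex.zero_re]
  refine mem_Adm.2 ⟨s.range, inferInstance, fun k => M.effect (s ⁻¹' {k.1}), fun k i => k.1 i - μ i,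
    fun k => M.pos _ (hme _), M.sum_effect_fiber s, fun i => ?_, fun i j => ?_, fun i j => ?_⟩
  · simp only [sub_mul, Finset.sum_sub_distrib, ← Finset.mul_sum, hsum, ← hμ', mul_one, sub_self]
  · rw [Matrix.of_apply, signedInt, integral_comp_simpleFunc s _ fun x => x i,
      integral_comp_simpleFunc s _ fun x => x i, ← Finset.sum_sub_distrib]
    simp only [← mul_sub, law_real_add_sub (hD j) (h1 j) (h2 j) (hme _)]
    simp only [sub_mul, Finset.sum_sub_distrib, ← Finset.mul_sum, hsumX, mul_zero, sub_zero]
  · rw [Matrix.of_apply, integral_comp_simpleFunc s _ fun x => x i * x j]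
    simp only [law_real_apply M hSp (hme _)]
    have e : ∀ k : s.range, (k.1 i - μ i) * (k.1 j - μ j) *
        (trMul S (M.effect (s ⁻¹' {k.1}))).re =
        k.1 i * k.1 j * (trMul S (M.effect (s ⁻¹' {k.1}))).re -
        μ j * (k.1 i * (trMul S (M.effect (s ⁻¹' {k.1}))).re) -
        μ i * (k.1 j * (trMul S (M.effect (s ⁻¹' {k.1}))).re) +
        μ i * μ j * (trMul S (M.effect (s ⁻¹' {k.1}))).re := fun k => by ring
    simp only [e, Finset.sum_add_distrib, Finset.sum_sub_distrib, ← Finset.mul_sum, hsum, ← hμ']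
    ring

/-- Approximation by simple functions of the data, by dominated convergence. -/
theorem momentPair_mem_closure_range (hS : IsState S) (hD : ∀ j, IsPosTC (D j))
    (h1 : ∀ j, (D j - X j).PosSemidef) (h2 : ∀ j, (D j + X j).PosSemidef)
    (M : POVM L Ω) {T : Ω → Fin m → ℝ} (hT : Measurable T)
    (hT2 : Integrable (fun ω => ‖T ω‖ ^ 2) (law M S))
    (hT1 : ∀ j, Integrable (fun ω => ‖T ω‖) (law M (D j))) :
    momentPair M S D X T ∈
      closure (Set.range fun s : SimpleFunc Ω (Fin m → ℝ) => momentPair M S D X s) := by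
  set s : ℕ → SimpleFunc Ω (Fin m → ℝ) := fun n =>
    SimpleFunc.approxOn T hT Set.univ 0 (Set.mem_univ _) n with hs
  have hst : ∀ ω, Tendsto (fun n => s n ω) atTop (𝓝 (T ω)) := fun ω =>
    SimpleFunc.tendsto_approxOn hT _ (by simp)
  have hst' : ∀ ω i, Tendsto (fun n => s n ω i) atTop (𝓝 (T ω i)) := fun ω i =>
    (tendsto_pi_nhds.1 (hst ω)) i
  have hsb : ∀ n ω, ‖s n ω‖ ≤ 2 * ‖T ω‖ := fun n ω => by
    rw [two_mul]; exact SimpleFunc.norm_approxOn_zero_le hT _ ω n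
  have hsb' : ∀ n ω i, |s n ω i| ≤ 2 * ‖T ω‖ := fun n ω i =>
    (norm_le_pi_norm (s n ω) i).trans (hsb n ω)
  have hsm : ∀ n i, Measurable fun ω => s n ω i := fun n i =>
    (measurable_pi_apply i).comp (s n).measurable
  -- dominated convergence
  have lim1 : ∀ (μ : Measure Ω) (i : Fin m), Integrable (fun ω => ‖T ω‖) μ →
      Tendsto (fun n => ∫ ω, s n ω i ∂μ) atTop (𝓝 (∫ ω, T ω i ∂μ)) := fun μ i hμ =>
    tendsto_integral_of_dominated_convergence (fun ω => 2 * ‖T ω‖)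
      (fun n => (hsm n i).aestronglyMeasurable) (hμ.const_mul 2)
      (fun n => Eventually.of_forall fun ω => hsb' n ω i)
      (Eventually.of_forall fun ω => hst' ω i)
  have lim2 : ∀ i j, Tendsto (fun n => ∫ ω, s n ω i * s n ω j ∂(law M S)) atTop
      (𝓝 (∫ ω, T ω i * T ω j ∂(law M S))) := fun i j =>
    tendsto_integral_of_dominated_convergence (fun ω => 4 * ‖T ω‖ ^ 2)
      (fun n => ((hsm n i).mul (hsm n j)).aestronglyMeasurable) (hT2.const_mul 4)
      (fun n => Eventually.of_forall fun ω => by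
        rw [norm_mul, Real.norm_eq_abs, Real.norm_eq_abs]
        calc _ ≤ (2 * ‖T ω‖) * (2 * ‖T ω‖) :=
              mul_le_mul (hsb' n ω i) (hsb' n ω j) (abs_nonneg _) (by positivity)
          _ = _ := by ring)
      (Eventually.of_forall fun ω => (hst' ω i).mul (hst' ω j))
  have hp := isProbabilityMeasure_law M hS
  have hTS : Integrable (fun ω => ‖T ω‖) (law M S) := by
    refine (hT2.add (integrable_const (1 : ℝ))).mono' hT.norm.aestronglyMeasurable
      (Eventually.of_forall fun ω => ?_)
    simp only [norm_norm, Pi.add_apply]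
    nlinarith [sq_nonneg (‖T ω‖ - 1), norm_nonneg (T ω)]
  refine mem_closure_of_tendsto (b := atTop) ?_ (Eventually.of_forall fun n => ⟨s n, rfl⟩)
  refine Tendsto.prodMk_nhds ?_ ?_
  · refine tendsto_pi_nhds.2 fun i => tendsto_pi_nhds.2 fun j => ?_
    exact (lim1 _ i (integrable_law_add_between (hD j) (h1 j) (h2 j) (hT1 j))).sub (lim1 _ i (hT1 j))
  · refine tendsto_pi_nhds.2 fun i => tendsto_pi_nhds.2 fun j => ?_
    exact (lim2 i j).sub ((lim1 _ i hTS).mul (lim1 _ j hTS))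

/-- The derivative of the mean and the covariance matrix of every estimator with finite moments
are approximated by those of estimators with finitely many outcomes. -/
theorem momentPair_mem_closure_Adm (hS : IsState S) (hD : ∀ j, IsPosTC (D j))
    (h1 : ∀ j, (D j - X j).PosSemidef) (h2 : ∀ j, (D j + X j).PosSemidef)
    (hX : ∀ j, tr (X j) = 0) (M : POVM L Ω) {T : Ω → Fin m → ℝ} (hT : Measurable T)
    (hT2 : Integrable (fun ω => ‖T ω‖ ^ 2) (law M S))
    (hT1 : ∀ j, Integrable (fun ω => ‖T ω‖) (law M (D j))) :
    momentPair M S D X T ∈ closure (Adm S X) := by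
  refine closure_mono ?_ (momentPair_mem_closure_range hS hD h1 h2 M hT hT2 hT1)
  rintro - ⟨s, rfl⟩
  exact simpleFunc_mem_Adm hS hD h1 h2 hX M s

end closure

/-! ### The derivative of the mean of a regular estimator -/

section deriv

variable {L Ω : Type} [MeasurableSpace Ω] {M : POVM L Ω} {D X : Op L}

theorem abs_signedInt_le (hD : IsPosTC D) (h1 : (D - X).PosSemidef) (h2 : (D + X).PosSemidef)
    {f : Ω → ℝ} (hf : Integrable f (law M D)) :
    |signedInt M D X f| ≤ 3 * ∫ ω, |f ω| ∂(law M D) := by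
  have e1 : |∫ ω, f ω ∂(law M (D + X))| ≤ 2 * ∫ ω, |f ω| ∂(law M D) := by
    refine (abs_integral_le_integral_abs (f := f)).trans ?_
    have := integral_mono_measure (law_add_between_le (M := M) hD h1 h2)
      (Eventually.of_forall fun ω => abs_nonneg (f ω)) (hf.abs.smul_measure ENNReal.ofReal_ne_top)
    rwa [integral_smul_measure, ENNReal.toReal_ofReal (by norm_num), smul_eq_mul] at this
  have e2 := abs_integral_le_integral_abs (f := f) (μ := law M D)
  rw [signedInt]
  refine (abs_sub _ _).trans ?_
  linarith

theorem signedInt_sub (hD : IsPosTC D) (h1 : (D - X).PosSemidef) (h2 : (D + X).PosSemidef)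
    {f g : Ω → ℝ} (hf : Integrable f (law M D)) (hg : Integrable g (law M D)) :
    signedInt M D X (fun ω => f ω - g ω) = signedInt M D X f - signedInt M D X g := by
  rw [signedInt, signedInt, signedInt, integral_sub hf hg,
    integral_sub (integrable_law_add_between hD h1 h2 hf) (integrable_law_add_between hD h1 h2 hg)]
  ring

theorem signedInt_simpleFunc (hD : IsPosTC D) (h1 : (D - X).PosSemidef) (h2 : (D + X).PosSemidef)
    {β : Type*} (s : SimpleFunc Ω β) (g : β → ℝ) :
    signedInt M D X (fun ω => g (s ω)) =
      ∑ k : s.range, g k * (trMul X (M.effect (s ⁻¹' {(k : β)}))).re := by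
  rw [signedInt, integral_comp_simpleFunc s _ g, integral_comp_simpleFunc s _ g,
    ← Finset.sum_sub_distrib]
  exact Finset.sum_congr rfl fun k _ => by
    rw [← mul_sub, law_real_add_sub hD h1 h2 (s.measurableSet_fiber _)]

/-- Convergence in the trace norm implies convergence of the probabilities of effects. -/
theorem tendsto_trMul_of_TNle {ι : Type*} {l : Filter ι} {F : ι → Op L} {N : Op L}
    (hF : ∀ᶠ k in l, F k ∈ TC L) (hX : X ∈ TC L) (h : ∀ ε > 0, ∀ᶠ k in l, TNle (F k - X) ε)
    (hN : IsEffect N) : Tendsto (fun k => (trMul (F k) N).re) l (𝓝 (trMul X N).re) := by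
  rw [Metric.tendsto_nhds]
  intro ε hε
  filter_upwards [h (ε / 2) (by positivity), hF] with k hk hFk
  have h1 := hk.norm_trMul_le hN
  rw [trMul_sub_left (trSum_of_mem hFk hN) (trSum_of_mem hX hN)] at h1
  rw [Real.dist_eq, ← Complex.sub_re]
  exact ((Complex.abs_re_le_norm _).trans h1).trans_lt (by linarith)

/-- Continuity of the integral against `tr X M(dω)` in `X`, for dominated `X`. -/
theorem tendsto_signedInt {ι : Type*} {l : Filter ι} {F : ι → Op L} (hD : IsPosTC D)
    (h1 : (D - X).PosSemidef) (h2 : (D + X).PosSemidef)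
    (hF : ∀ᶠ k in l, (D - F k).PosSemidef ∧ (D + F k).PosSemidef)
    (h : ∀ ε > 0, ∀ᶠ k in l, TNle (F k - X) ε) {f : Ω → ℝ} (hfm : Measurable f)
    (hf : Integrable f (law M D)) :
    Tendsto (fun k => signedInt M D (F k) f) l (𝓝 (signedInt M D X f)) := by
  have hL1 : Tendsto (fun n => ∫ ω, |f ω - SimpleFunc.approxOn f hfm Set.univ 0 (Set.mem_univ _) n ω|
      ∂(law M D)) atTop (𝓝 (∫ ω, (0 : ℝ) ∂(law M D))) := by
    refine tendsto_integral_of_dominated_convergence (fun ω => 3 * ‖f ω‖)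
      (fun n => (hfm.sub (SimpleFunc.measurable _)).abs.aestronglyMeasurable) (hf.norm.const_mul 3)
      (fun n => Eventually.of_forall fun ω => ?_) (Eventually.of_forall fun ω => ?_)
    · have h3 := SimpleFunc.norm_approxOn_zero_le hfm (Set.mem_univ (0 : ℝ)) ω n
      rw [Real.norm_eq_abs, abs_abs]
      refine (abs_sub _ _).trans ?_
      simp only [Real.norm_eq_abs] at h3 ⊢
      linarith
    · have h3 := SimpleFunc.tendsto_approxOn hfm (Set.mem_univ (0 : ℝ)) (x := ω) (by simp)
      have h4 := (tendsto_const_nhds (x := f ω)).sub h3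
      rw [sub_self] at h4
      simpa using h4.abs
  rw [integral_zero] at hL1
  rw [Metric.tendsto_nhds]
  intro ε hε
  obtain ⟨n, hn⟩ := (hL1.eventually (gt_mem_nhds (show (0 : ℝ) < ε / 9 by positivity))).exists
  set s := SimpleFunc.approxOn f hfm Set.univ 0 (Set.mem_univ _) n with hs
  have hsi : Integrable (fun ω => s ω) (law M D) := by
    refine (hf.norm.const_mul 2).mono' s.measurable.aestronglyMeasurable
      (Eventually.of_forall fun ω => ?_)
    rw [two_mul]
    exact SimpleFunc.norm_approxOn_zero_le hfm (Set.mem_univ (0 : ℝ)) ω n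
  have hb : ∀ Y : Op L, (D - Y).PosSemidef → (D + Y).PosSemidef →
      |signedInt M D Y f - signedInt M D Y fun ω => s ω| < ε / 3 := by
    intro Y hY1 hY2
    rw [← signedInt_sub hD hY1 hY2 hf hsi]
    refine (abs_signedInt_le hD hY1 hY2 (hf.sub hsi)).trans_lt ?_
    simp only [Pi.sub_apply]
    linarith
  have hlim : Tendsto (fun k => ∑ x : s.range, (x : ℝ) * (trMul (F k) (M.effect (s ⁻¹' {(x : ℝ)}))).re)
      l (𝓝 (∑ x : s.range, (x : ℝ) * (trMul X (M.effect (s ⁻¹' {(x : ℝ)}))).re)) :=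
    tendsto_finsetSum _ fun x _ => (tendsto_trMul_of_TNle
      (hF.mono fun k hk => mem_of_between hD hk.1 hk.2) (mem_of_between hD h1 h2) h
      (M.isEffect (s.measurableSet_fiber _))).const_mul _
  filter_upwards [Metric.tendsto_nhds.1 hlim (ε / 3) (by positivity), hF] with k hk hFk
  rw [Real.dist_eq, ← signedInt_simpleFunc hD hFk.1 hFk.2 s fun x => x,
    ← signedInt_simpleFunc hD h1 h2 s fun x => x] at hk
  have a1 := abs_lt.1 (hb _ hFk.1 hFk.2)
  have a2 := abs_lt.1 (hb _ h1 h2)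
  have a3 := abs_lt.1 hk
  rw [Real.dist_eq, abs_lt]
  constructor <;> linarith [a1.1, a1.2, a2.1, a2.2, a3.1, a3.2]

/-- The difference quotient of the integral against the law. -/
theorem integral_law_eq_add_signedInt {S S' : Op L} (hS : IsPosTC S) (hS' : IsPosTC S')
    (hD : IsPosTC D) {t : ℝ} (hXt : S' = S + t • X) (h1 : (D - X).PosSemidef)
    (h2 : (D + X).PosSemidef) {f : Ω → ℝ} (hfD : Integrable f (law M D))
    (hfS : Integrable f (law M S)) :
    ∫ ω, f ω ∂(law M S') = ∫ ω, f ω ∂(law M S) + t * signedInt M D X f := by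
  have hDX := isPosTC_add_of_between hD h1 h2
  have hfX := integrable_law_add_between hD h1 h2 hfD
  have key : ∀ {c : ℝ} {A : Op L}, 0 ≤ c → IsPosTC A → Integrable f (law M A) →
      Integrable f (law M (c • A)) ∧ ∫ ω, f ω ∂(law M (c • A)) = c * ∫ ω, f ω ∂(law M A) := by
    intro c A hc hA hi
    rw [law_smul M hA hc, integral_smul_measure, ENNReal.toReal_ofReal hc, smul_eq_mul]
    exact ⟨hi.smul_measure ENNReal.ofReal_ne_top, rfl⟩
  have hfS' : Integrable f (law M S') := by
    have hb : IsPosTC (S + |t| • D) := hS.add (hD.smul (abs_nonneg t))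
    refine Integrable.mono_measure (ν := law M (S + |t| • D)) ?_ (law_mono M hS' hb ?_)
    · rw [law_add M hS (hD.smul (abs_nonneg t))]
      exact hfS.add_measure (key (abs_nonneg t) hD hfD).1
    · rcases le_total 0 t with ht | ht
      · rw [abs_of_nonneg ht, hXt, show S + t • D - (S + t • X) = t • (D - X) by
          rw [smul_sub]; abel]
        exact posSemidef_real_smul h1 ht
      · rw [abs_of_nonpos ht, hXt, show S + (-t) • D - (S + t • X) = (-t) • (D + X) by
          rw [smul_add, neg_smul, neg_smul]; abel]
        exact posSemidef_real_smul h2 (by linarith)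
  rcases le_total 0 t with ht | ht
  · have e : S' + t • D = S + t • (D + X) := by rw [hXt, smul_add]; abel
    have h3 := congrArg (law M) e
    rw [law_add M hS' (hD.smul ht), law_add M hS (hDX.smul ht)] at h3
    have h4 : ∫ ω, f ω ∂(law M S' + law M (t • D)) = ∫ ω, f ω ∂(law M S + law M (t • (D + X))) := by
      rw [h3]
    rw [integral_add_measure hfS' (key ht hD hfD).1, integral_add_measure hfS (key ht hDX hfX).1,
      (key ht hD hfD).2, (key ht hDX hfX).2] at h4
    rw [signedInt]; linarith
  · have ht' : 0 ≤ -t := by linarith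
    have e : S' + (-t) • (D + X) = S + (-t) • D := by rw [hXt, smul_add, neg_smul, neg_smul]; abel
    have h3 := congrArg (law M) e
    rw [law_add M hS' (hDX.smul ht'), law_add M hS (hD.smul ht')] at h3
    have h4 : ∫ ω, f ω ∂(law M S' + law M ((-t) • (D + X))) =
        ∫ ω, f ω ∂(law M S + law M ((-t) • D)) := by rw [h3]
    rw [integral_add_measure hfS' (key ht' hDX hfX).1, integral_add_measure hfS (key ht' hD hfD).1,
      (key ht' hD hfD).2, (key ht' hDX hfX).2] at h4
    rw [signedInt]; linarith

end deriv

section regular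

variable {m : ℕ} {I Ω : Type} [MeasurableSpace Ω] {Θ : Set (Par m)} {σ : Par m → Op I}
  {M : POVM I Ω} {T : Ω → Par m} {θ : Par m}

theorem norm_ofLp_le (x : Par m) : ‖(x.ofLp : Fin m → ℝ)‖ ≤ ‖x‖ :=
  (pi_norm_le_iff_of_nonneg (norm_nonneg x)).2 fun i => PiLp.norm_apply_le x i

theorem measurable_ofLp_comp (hT : Measurable T) : Measurable fun ω => (T ω).ofLp :=
  (PiLp.continuous_ofLp 2 _).measurable.comp hT

theorem RegularEst.dominated (h : RegularEst Θ σ M T) : Dominated Θ σ := fun η hη i => by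
  obtain ⟨δ, D, hδ, hD, h1, -⟩ := (h η hη).1 i
  exact ⟨δ, D, hδ, hD, h1⟩

theorem RegularEst.integrable_sq (h : RegularEst Θ σ M T) (hT : Measurable T) (hθ : θ ∈ Θ) :
    Integrable (fun ω => ‖(T ω).ofLp‖ ^ 2) (law M (σ θ)) := by
  refine (((h θ hθ).2.const_mul 2).add (integrable_const (2 * ‖θ‖ ^ 2))).mono'
    ((measurable_ofLp_comp hT).norm.pow_const 2).aestronglyMeasurable
    (Eventually.of_forall fun ω => ?_)
  rw [Real.norm_eq_abs, abs_of_nonneg (sq_nonneg _), Pi.add_apply]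
  have h1 := norm_ofLp_le (T ω)
  have h2 : ‖T ω‖ ≤ ‖T ω - θ‖ + ‖θ‖ := by simpa using norm_add_le (T ω - θ) θ
  have h3 := pow_le_pow_left₀ (norm_nonneg _) (h1.trans h2) 2
  nlinarith [sq_nonneg (‖T ω - θ‖ - ‖θ‖)]

theorem integrable_coord {μ : Measure Ω} {T : Ω → Fin m → ℝ} (hT : Measurable T)
    (h : Integrable (fun ω => ‖T ω‖) μ) (i : Fin m) : Integrable (fun ω => T ω i) μ :=
  h.mono' ((measurable_pi_apply i).comp hT).aestronglyMeasurable
    (Eventually.of_forall fun ω => norm_le_pi_norm (T ω) i)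

theorem integrable_norm_of_sq {μ : Measure Ω} [IsFiniteMeasure μ] {T : Ω → Fin m → ℝ}
    (hT : Measurable T) (h : Integrable (fun ω => ‖T ω‖ ^ 2) μ) :
    Integrable (fun ω => ‖T ω‖) μ := by
  refine (h.add (integrable_const (1 : ℝ))).mono' hT.norm.aestronglyMeasurable
    (Eventually.of_forall fun ω => ?_)
  simp only [norm_norm, Pi.add_apply]
  nlinarith [sq_nonneg (‖T ω‖ - 1), norm_nonneg (T ω)]

/-- The derivative of the mean of a regular estimator is obtained by differentiating the state. -/
theorem RegularEst.exists_momentPair (h : RegularEst Θ σ M T) (hm : DiffModel Θ σ)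
    (hopen : IsOpen Θ) (hconv : Convex ℝ Θ) (hT : Measurable T) (hθ : θ ∈ Θ) :
    ∃ D : Fin m → Op I, (∀ j, IsPosTC (D j)) ∧ (∀ j, (D j - pd σ j θ).PosSemidef) ∧
      (∀ j, (D j + pd σ j θ).PosSemidef) ∧
      (∀ j, Integrable (fun ω => ‖(T ω).ofLp‖) (law M (D j))) ∧
      (biasMat σ M T θ, var σ M T θ) =
        momentPair M (σ θ) D (fun j => pd σ j θ) fun ω => (T ω).ofLp := by
  have hTm := measurable_ofLp_comp hT
  have hst := hm.state θ hθ
  have hprob := isProbabilityMeasure_law M hst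
  have hsq := h.integrable_sq hT hθ
  have hint := integrable_norm_of_sq hTm hsq
  choose δ D hδ hD h1 h2 using (h θ hθ).1
  have h0 : ∀ j, (D j - pd σ j θ).PosSemidef ∧ (D j + pd σ j θ).PosSemidef := fun j => by
    simpa using h1 j 0 (by simpa using hδ j) (by simpa using hθ)
  have hTD : ∀ j, Integrable (fun ω => ‖(T ω).ofLp‖) (law M (D j)) := fun j => by
    refine ((h2 j).add (integrable_const ‖θ‖)).mono' hTm.norm.aestronglyMeasurable
      (Eventually.of_forall fun ω => ?_)
    rw [norm_norm, Pi.add_apply]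
    exact (norm_ofLp_le (T ω)).trans (by simpa using norm_add_le (T ω - θ) θ)
  refine ⟨D, hD, fun j => (h0 j).1, fun j => (h0 j).2, hTD, Prod.ext ?_ ?_⟩
  · ext i j
    simp only [biasMat, momentPair, Matrix.of_apply]
    refine HasDerivAt.deriv ?_
    rw [hasDerivAt_iff_tendsto_slope]
    set F : ℝ → Op I := fun t => t⁻¹ • (σ (θ + t • unitVec j) - σ θ) with hF
    have hne : ∀ᶠ t : ℝ in 𝓝[≠] 0, t ≠ 0 ∧ |t| < δ j ∧ θ + t • unitVec j ∈ Θ := by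
      filter_upwards [self_mem_nhdsWithin,
        (eventually_line_mem hopen hθ (unitVec j)).filter_mono nhdsWithin_le_nhds,
        nhdsWithin_le_nhds (Metric.ball_mem_nhds (0 : ℝ) (hδ j))] with t a b c
      have c : dist t 0 < δ j := c
      exact ⟨a, by simpa [Real.dist_eq] using c, b⟩
    -- the difference quotients lie between `-D` and `D`, too
    have hbet : ∀ t : ℝ, t ≠ 0 → |t| < δ j → θ + t • unitVec j ∈ Θ →
        (D j - F t).PosSemidef ∧ (D j + F t).PosSemidef := by
      intro t ht0 htd htm
      obtain ⟨a, b⟩ := hm.segment_between hconv hθ (hδ j) (hD j) (h1 j) htd htm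
      have ha := posSemidef_real_smul a (inv_nonneg.2 (abs_nonneg t))
      have hb := posSemidef_real_smul b (inv_nonneg.2 (abs_nonneg t))
      rw [smul_sub, smul_smul, inv_mul_cancel₀ (abs_ne_zero.2 ht0), one_smul] at ha
      rw [smul_add, smul_smul, inv_mul_cancel₀ (abs_ne_zero.2 ht0), one_smul] at hb
      rcases lt_or_gt_of_ne ht0 with ht | ht
      · rw [abs_of_neg ht, inv_neg, neg_smul] at ha hb
        rw [sub_neg_eq_add] at ha
        rw [← sub_eq_add_neg] at hb
        exact ⟨hb, ha⟩
      · rw [abs_of_pos ht] at ha hb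
        exact ⟨ha, hb⟩
    have hlim := tendsto_signedInt (M := M) (l := 𝓝[≠] (0 : ℝ)) (F := F) (hD j) (h0 j).1 (h0 j).2
      (hne.mono fun t ht => hbet t ht.1 ht.2.1 ht.2.2)
      (by simpa only [HasTD, zero_smul, add_zero] using hm.td θ hθ j)
      ((measurable_pi_apply i).comp hTm) (integrable_coord hTm (hTD j) i)
    refine hlim.congr' ?_
    filter_upwards [hne] with t ht
    obtain ⟨a, b⟩ := hbet t ht.1 ht.2.1 ht.2.2
    have h3 := integral_law_eq_add_signedInt (M := M) hst.isPosTC (hm.state _ ht.2.2).isPosTC (hD j)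
      (t := t) (X := F t) (by rw [hF]; simp only; rw [smul_smul, mul_inv_cancel₀ ht.1, one_smul]; abel)
      a b (integrable_coord hTm (hTD j) i) (integrable_coord hTm hint i)
    rw [slope_def_field, mean, mean, zero_smul, add_zero, sub_zero, h3, add_sub_cancel_left,
      mul_div_cancel_left₀ _ ht.1]
    rfl
  · ext i j
    simp only [var, momentPair, Matrix.of_apply]
    have hij : Integrable (fun ω => T ω i * T ω j) (law M (σ θ)) := by
      refine hsq.mono' ((((measurable_pi_apply i).comp hTm).mul
        ((measurable_pi_apply j).comp hTm)).aestronglyMeasurable) (Eventually.of_forall fun ω => ?_)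
      rw [norm_mul, pow_two]
      exact mul_le_mul (norm_le_pi_norm (T ω).ofLp i) (norm_le_pi_norm (T ω).ofLp j)
        (norm_nonneg _) (norm_nonneg _)
    have hi := integrable_coord hTm hint i
    have hj := integrable_coord hTm hint j
    set a := mean σ M T θ i with ha
    set b := mean σ M T θ j with hb
    have e : ∀ ω, (T ω i - a) * (T ω j - b) = T ω i * T ω j - b * T ω i - a * T ω j + a * b :=
      fun ω => by ring
    have ha' : ∫ ω, T ω i ∂(law M (σ θ)) = a := rfl
    have hb' : ∫ ω, T ω j ∂(law M (σ θ)) = b := rfl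
    simp only [e]
    have i1 : Integrable (fun ω => T ω i * T ω j - b * T ω i) (law M (σ θ)) :=
      hij.sub (hi.const_mul b)
    have i2 : Integrable (fun ω => T ω i * T ω j - b * T ω i - a * T ω j) (law M (σ θ)) :=
      i1.sub (hj.const_mul a)
    rw [integral_add i2 (integrable_const _),
      integral_sub i1 (hj.const_mul a), integral_sub hij (hi.const_mul b),
      integral_const_mul, integral_const_mul, ha', hb']
    simp
    ring

/-- An event of probability zero at `θ` has probability zero to first order around `θ`, because
its probability is minimal at `θ`. -/
theorem DiffModel.trMul_pd_eq_zero (h : DiffModel Θ σ) (hopen : IsOpen Θ)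
    (hθ : θ ∈ Θ) (j : Fin m) {E : Op I} (hE : IsEffect E) (h0 : (trMul (σ θ) E).re = 0) :
    (trMul (pd σ j θ) E).re = 0 := by
  have hd := hasDerivAt_re ((h.td θ hθ j).hasDerivAt_trMul (h.eventually_state hopen hθ j) hE)
  refine IsLocalMin.hasDerivAt_eq_zero ?_ hd
  filter_upwards [h.eventually_state hopen hθ j] with t ht
  rw [zero_smul, add_zero, h0]
  exact ht.isPosTC.trMul_re_nonneg hE

/-- A linear combination of the components of a regular estimator that is constant almost surely
has vanishing derivative of the mean: the probability of a null event has a minimum at `θ`. -/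
theorem RegularEst.biasMat_transpose_mulVec (h : RegularEst Θ σ M T) (hm : DiffModel Θ σ)
    (hopen : IsOpen Θ) (hconv : Convex ℝ Θ) (hT : Measurable T) (hθ : θ ∈ Θ) {u : Fin m → ℝ}
    (hu : var σ M T θ *ᵥ u = 0) : (biasMat σ M T θ)ᵀ *ᵥ u = 0 := by
  have hTm := measurable_ofLp_comp hT
  have hst := hm.state θ hθ
  have hprob := isProbabilityMeasure_law M hst
  have hsq := h.integrable_sq hT hθ
  have hint := integrable_norm_of_sq hTm hsq
  obtain ⟨D, hD, h1, h2, hTD, hpair⟩ := h.exists_momentPair hm hopen hconv hT hθ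
  have hB := congrArg Prod.fst hpair
  set P := law M (σ θ) with hP
  set μ : Fin m → ℝ := fun i => mean σ M T θ i with hμ
  set f : Ω → ℝ := fun ω => ∑ i, u i * (T ω i - μ i) with hf
  have hfm : Measurable f := Finset.measurable_sum _ fun i _ =>
    (((measurable_pi_apply i).comp hTm).sub_const _).const_mul _
  have hprod : ∀ i j, Integrable (fun ω => (T ω i - μ i) * (T ω j - μ j)) P := by
    intro i j
    have hb : Integrable (fun ω => 2 * ‖(T ω).ofLp‖ ^ 2 + 2 * ‖μ‖ ^ 2) P :=
      (hsq.const_mul 2).add (integrable_const _)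
    refine hb.mono' ((((measurable_pi_apply i).comp hTm).sub_const _).mul
      (((measurable_pi_apply j).comp hTm).sub_const _)).aestronglyMeasurable
      (Eventually.of_forall fun ω => ?_)
    have e : ∀ i, |T ω i - μ i| ≤ ‖(T ω).ofLp‖ + ‖μ‖ := fun i =>
      (abs_sub _ _).trans (add_le_add (norm_le_pi_norm (T ω).ofLp i) (norm_le_pi_norm μ i))
    rw [norm_mul]
    have h3 := mul_le_mul (e i) (e j) (abs_nonneg _) ((abs_nonneg _).trans (e i))
    simp only [Real.norm_eq_abs] at h3 ⊢
    nlinarith [sq_nonneg (‖(T ω).ofLp‖ - ‖μ‖)]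
  have hf2 : ∀ ω, f ω ^ 2 = ∑ i, ∑ j, u i * u j * ((T ω i - μ i) * (T ω j - μ j)) := fun ω => by
    rw [hf, pow_two, Finset.sum_mul_sum]
    exact Finset.sum_congr rfl fun i _ => Finset.sum_congr rfl fun j _ => by ring
  have hvar : ∫ ω, f ω ^ 2 ∂P = 0 := by
    have h3 : u ⬝ᵥ (var σ M T θ *ᵥ u) = 0 := by rw [hu, dotProduct_zero]
    simp only [hf2]
    rw [integral_finsetSum _ fun i _ => integrable_finsetSum _ fun j _ => (hprod i j).const_mul _,
      ← h3]
    simp only [dotProduct, Matrix.mulVec, Finset.mul_sum]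
    refine Finset.sum_congr rfl fun i _ => ?_
    rw [integral_finsetSum _ fun j _ => (hprod i j).const_mul _]
    refine Finset.sum_congr rfl fun j _ => ?_
    rw [integral_const_mul, var, Matrix.of_apply]
    ring
  have hfi : Integrable (fun ω => f ω ^ 2) P := by
    simp only [hf2]
    exact integrable_finsetSum _ fun i _ => integrable_finsetSum _ fun j _ => (hprod i j).const_mul _
  have hf0 : ∀ᵐ ω ∂P, f ω = 0 := by
    have := (integral_eq_zero_iff_of_nonneg (fun ω => sq_nonneg (f ω)) hfi).1 hvar
    filter_upwards [this] with ω hω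
    exact pow_eq_zero_iff (two_ne_zero) |>.1 hω
  set N : Set Ω := {ω | f ω ≠ 0} with hN
  have hNm : MeasurableSet N := (hfm (measurableSet_singleton 0)).compl
  have hN0 : P N = 0 := hf0
  ext j
  -- the two measures agree on the null set `N` of the law
  have hres : (law M (D j + pd σ j θ)).restrict N = (law M (D j)).restrict N := by
    refine Measure.ext fun Δ hΔ => ?_
    rw [Measure.restrict_apply hΔ, Measure.restrict_apply hΔ]
    have hΔN := hΔ.inter hNm
    have h0 : P (Δ ∩ N) = 0 := measure_mono_null Set.inter_subset_right hN0
    have hE := M.isEffect hΔN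
    have hz : (trMul (σ θ) (M.effect (Δ ∩ N))).re = 0 := by
      rw [← law_real_apply M hst.isPosTC hΔN, Measure.real, ← hP, h0, ENNReal.toReal_zero]
    have h4 := law_real_add_sub (M := M) (hD j) (h1 j) (h2 j) hΔN
    rw [hm.trMul_pd_eq_zero hopen hθ j hE hz, sub_eq_zero] at h4
    exact (measureReal_eq_measureReal_iff).1 h4
  have hcomp : ∀ ν : Measure Ω, ∫ ω, f ω ∂ν = ∫ ω in N, f ω ∂ν := fun ν =>
    (setIntegral_eq_integral_of_forall_compl_eq_zero fun ω hω => not_not.1 hω).symm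
  have hs0 : signedInt M (D j) (pd σ j θ) f = 0 := by
    rw [signedInt, hcomp, hcomp (law M (D j)), hres, sub_self]
  have htr : (law M (D j + pd σ j θ)).real Set.univ = (law M (D j)).real Set.univ := by
    have := law_real_add_sub (M := M) (hD j) (h1 j) (h2 j) MeasurableSet.univ
    rw [M.effect_univ, trMul_one, hm.tr_pd hopen hθ, Complex.zero_re] at this
    linarith
  have hlin : ∀ ν : Measure Ω, IsFiniteMeasure ν → Integrable (fun ω => ‖(T ω).ofLp‖) ν →
      ∫ ω, f ω ∂ν = ∑ i, u i * ∫ ω, T ω i ∂ν - (∑ i, u i * μ i) * ν.real Set.univ := by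
    intro ν _ hν
    have hc := fun i => integrable_coord hTm hν i
    have hci : ∀ i, Integrable (fun ω => u i * (T ω i - μ i)) ν := fun i =>
      ((hc i).sub (integrable_const _)).const_mul _
    simp only [hf]
    rw [integral_finsetSum _ fun i _ => hci i, Finset.sum_mul, ← Finset.sum_sub_distrib]
    refine Finset.sum_congr rfl fun i _ => ?_
    rw [integral_const_mul, integral_sub (hc i) (integrable_const _), integral_const, smul_eq_mul]
    ring
  rw [signedInt, hlin _ inferInstance (integrable_law_add_between (hD j) (h1 j) (h2 j) (hTD j)),
    hlin _ inferInstance (hTD j), htr] at hs0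
  simp only [Matrix.mulVec, dotProduct, Matrix.transpose_apply, Pi.zero_apply]
  rw [← hs0]
  have : ∀ i, biasMat σ M T θ i j = signedInt M (D j) (pd σ j θ) fun ω => T ω i := fun i => by
    have := congrFun (congrFun hB i) j
    simpa [momentPair] using this
  simp only [this, signedInt, sub_mul, Finset.sum_sub_distrib, mul_comm (u _)]
  ring

end regular

/-! ### Positive maps and instruments -/

section posmap

variable {L K E Ω : Type} [MeasurableSpace Ω]

theorem summable_diag_of_mem {X : Op L} (hX : X ∈ TC L) : Summable fun i => X i i := by
  induction hX using Submodule.span_induction with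
  | mem X hX => exact hX.2
  | zero => simp
  | add X Y _ _ h1 h2 => simpa using h1.add h2
  | smul c X _ h => simpa using h.mul_left c

theorem tr_add_of_mem {X Y : Op L} (hX : X ∈ TC L) (hY : Y ∈ TC L) : tr (X + Y) = tr X + tr Y :=
  (summable_diag_of_mem hX).tsum_add (summable_diag_of_mem hY)

/-- A positive map of the trace class that does not increase the trace. -/
structure IsPosMap (Φ : TC L →ₗ[ℂ] TC L) : Prop where
  pos : ∀ A : TC L, IsPosTC (A : Op L) → IsPosTC (Φ A : Op L)
  tr_le : ∀ A : TC L, IsPosTC (A : Op L) → (tr (Φ A : Op L)).re ≤ (tr (A : Op L)).re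

theorem IsPosMap.norm_apply_le {Φ : TC L →ₗ[ℂ] TC L} (h : IsPosMap Φ) {X : TC L} {r : ℝ}
    (hX : TNle (X : Op L) r) (i j : L) : ‖(Φ X : Op L) i j‖ ≤ r := by
  obtain ⟨P, N, hP, hN, hPN, hr⟩ := hX
  have : X = (⟨P, hP.mem⟩ : TC L) - ⟨N, hN.mem⟩ := Subtype.ext hPN
  rw [this, map_sub]
  refine (norm_sub_le _ _).trans (le_trans (add_le_add
    ((h.pos ⟨P, hP.mem⟩ hP).norm_entry_le_tr i j) ((h.pos ⟨N, hN.mem⟩ hN).norm_entry_le_tr i j)) ?_)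
  exact (add_le_add (h.tr_le ⟨P, hP.mem⟩ hP) (h.tr_le ⟨N, hN.mem⟩ hN)).trans hr

theorem idOp_apply_self {I : Type} (i : I) : idOp I i i = 1 := by simp [idOp]

theorem IsCP.posSemidef {Φ : TC L →ₗ[ℂ] TC L} (h : IsCP Φ) (A : TC L) (hA : IsPosTC (A : Op L)) :
    (Φ A : Op L).PosSemidef := by
  have h1 : IsPosTC (idOp (Fin 1)) :=
    ⟨posSemidef_idOp, (hasSum_fintype _).summable⟩
  have hX := hA.tens (Equiv.refl (L × Fin 1)) h1
  have := (h 1 ⟨_, hX.mem⟩ hX).submatrix (fun i : L => (i, (0 : Fin 1)))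
  convert this using 1
  ext i j
  simp only [ampl, Matrix.submatrix_apply, Matrix.of_apply, Equiv.refl_apply]
  refine congrArg (fun B : TC L => (Φ B : Op L) i j) (Subtype.ext ?_)
  ext k l
  exact (mul_one ((A : Op L) k l)).symm.trans
    (congrArg ((A : Op L) k l * ·) (idOp_apply_self (0 : Fin 1)).symm)

namespace Instrument

variable (N : Instrument L Ω)

theorem map_eq_zero_of_const {Y : Op L} (h : Tendsto (fun _ : ℕ => traceNorm Y) atTop (𝓝 0)) :
    Y = 0 := by
  ext i j
  rw [tendsto_traceNorm_iff] at h
  refine norm_le_zero_iff.1 (le_of_forall_pos_le_add fun ε hε => ?_)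
  obtain ⟨_, hn⟩ := (h ε hε).exists
  simpa using hn.norm_entry_le i j

theorem map_empty (A : TC L) (hA : IsPosTC (A : Op L)) : (N.map ∅ A : Op L) = 0 := by
  have h := N.sigma_additive (fun _ => ∅) (fun _ => MeasurableSet.empty)
    (fun _ _ _ => by simp) A hA
  have h1 := (tendsto_add_atTop_iff_nat 2).2 h
  rw [tendsto_traceNorm_iff] at h1
  ext i j
  refine norm_le_zero_iff.1 (le_of_forall_pos_le_add fun ε hε => ?_)
  obtain ⟨n, hn⟩ := (h1 ε hε).exists
  have h2 := hn.norm_entry_le i j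
  have h3 : ((N.map (⋃ _ : ℕ, ∅) A : Op L) -
      ∑ _k ∈ Finset.range (n + 2), (N.map ∅ A : Op L)) i j =
        -((n + 1 : ℝ) : ℂ) * (N.map ∅ A : Op L) i j := by
    simp [Matrix.sub_apply, Matrix.smul_apply]
    ring
  rw [h3, norm_mul, norm_neg, Complex.norm_real, Real.norm_of_nonneg (by positivity)] at h2
  have : ‖(N.map ∅ A : Op L) i j‖ ≤ (n + 1 : ℝ) * ‖(N.map ∅ A : Op L) i j‖ :=
    le_mul_of_one_le_left (norm_nonneg _) (by linarith [(Nat.cast_nonneg n : (0 : ℝ) ≤ n)])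
  simpa using this.trans h2

/-- Additivity on a set and its complement: `σ`-additivity for a sequence that is empty from the third
term on. -/
theorem map_add_compl {Δ : Set Ω} (hΔ : MeasurableSet Δ) (A : TC L) (hA : IsPosTC (A : Op L)) :
    (N.map Set.univ A : Op L) = N.map Δ A + N.map Δᶜ A := by
  let f : ℕ → Set Ω := fun k => if k = 0 then Δ else if k = 1 then Δᶜ else ∅
  have hU : (⋃ k, f k) = Set.univ := by
    refine Set.eq_univ_of_forall fun ω => Set.mem_iUnion.2 ?_
    by_cases h : ω ∈ Δ
    · exact ⟨0, by simpa [f] using h⟩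
    · exact ⟨1, by simpa [f] using h⟩
  have h := N.sigma_additive f (fun k => by
    simp only [f]; split_ifs <;> simp [hΔ]) (fun j k hjk => by
    simp only [f]
    split_ifs <;> simp_all [disjoint_compl_right, disjoint_compl_left]) A hA
  rw [hU] at h
  have h1 := (tendsto_add_atTop_iff_nat 2).2 h
  have h2 : ∀ n : ℕ, ∑ k ∈ Finset.range (n + 2), (N.map (f k) A : Op L) =
      N.map Δ A + N.map Δᶜ A := fun n => by
    rw [Finset.sum_range_succ', Finset.sum_range_succ']
    have : ∀ k : ℕ, (N.map (f (k + 1 + 1)) A : Op L) = 0 := fun k => by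
      simpa [f] using N.map_empty A hA
    simp only [this]
    simp [f, add_comm]
  simp only [h2] at h1
  exact sub_eq_zero.1 (map_eq_zero_of_const h1)

theorem isPosTC_map {Δ : Set Ω} (hΔ : MeasurableSet Δ) (A : TC L) (hA : IsPosTC (A : Op L)) :
    IsPosTC (N.map Δ A : Op L) :=
  ⟨(N.cp Δ hΔ).posSemidef A hA, summable_diag_of_mem (N.map Δ A).2⟩

theorem isPosMap {Δ : Set Ω} (hΔ : MeasurableSet Δ) : IsPosMap (N.map Δ) := by
  refine ⟨N.isPosTC_map hΔ, fun A hA => ?_⟩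
  have h1 := N.trace_preserving A
  rw [N.map_add_compl hΔ A hA, tr_add_of_mem (N.map Δ A).2 (N.map Δᶜ A).2] at h1
  rw [← h1, Complex.add_re]
  linarith [(N.isPosTC_map hΔ.compl A hA).tr_re_nonneg]

end Instrument

/-! ### Truncation in the trace norm -/

/-- Multiplication by a bounded diagonal matrix from both sides. -/
theorem isPosTC_weight {A : Op L} (hA : IsPosTC A) {w : L → ℝ} {C : ℝ} (h0 : ∀ i, 0 ≤ w i)
    (hw : ∀ i, w i ≤ C) :
    IsPosTC (Matrix.of fun i j => ((w i : ℝ) : ℂ) * A i j * ((w j : ℝ) : ℂ)) := by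
  refine isPosTC_of_summable_re (posSemidef_of_finite fun s => ?_) ?_
  · classical
    have h := (hA.1.submatrix (Subtype.val : s → L)).conjTranspose_mul_mul_same
      (Matrix.diagonal fun i : s => ((w i : ℝ) : ℂ))
    convert h using 1
    ext i j
    simp [Matrix.diagonal_conjTranspose, Matrix.mul_diagonal, Matrix.diagonal_mul]
  · refine Summable.of_nonneg_of_le (fun i => ?_) (fun i => ?_) (hA.summable_re.mul_left (C ^ 2))
    · rw [Matrix.of_apply, diag_eq_re hA.1 i]
      rw [← Complex.ofReal_mul, ← Complex.ofReal_mul, Complex.ofReal_re]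
      exact mul_nonneg (mul_nonneg (h0 i) (diag_re_nonneg hA.1 i)) (h0 i)
    · rw [Matrix.of_apply, diag_eq_re hA.1 i]
      rw [← Complex.ofReal_mul, ← Complex.ofReal_mul, Complex.ofReal_re, Complex.ofReal_re]
      have := diag_re_nonneg hA.1 i
      have h2 : w i * w i ≤ C ^ 2 := by nlinarith [h0 i, hw i]
      nlinarith

open scoped Classical in
/-- The part of `A` with both indices outside `s`. -/
def cutCompl (s : Finset L) (A : Op L) : Op L :=
  Matrix.of fun i j => if i ∉ s ∧ j ∉ s then A i j else 0

theorem cutCompl_isPosTC {A : Op L} (hA : IsPosTC A) (s : Finset L) : IsPosTC (cutCompl s A) := by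
  classical
  have := isPosTC_weight hA (w := fun i => if i ∈ s then 0 else 1) (C := 1)
    (fun i => by split_ifs <;> simp) (fun i => by split_ifs <;> simp)
  convert this using 1
  ext i j
  simp only [cutCompl, Matrix.of_apply]
  by_cases hi : i ∈ s <;> by_cases hj : j ∈ s <;> simp [hi, hj]

theorem tr_cut_re_le {A : Op L} (hA : IsPosTC A) (s : Finset L) :
    (tr (cut s A)).re ≤ (tr A).re := by
  rw [(cut_isPosTC s hA.1).tr_re, hA.tr_re]
  refine (cut_isPosTC s hA.1).summable_re.tsum_le_tsum (fun i => ?_) hA.summable_re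
  simp only [cut, Matrix.of_apply]
  split_ifs
  · exact le_rfl
  · exact diag_re_nonneg hA.1 i

theorem tr_cutCompl_re {A : Op L} (hA : IsPosTC A) (s : Finset L) :
    (tr (cutCompl s A)).re = (tr A).re - ∑ i ∈ s, (A i i).re := by
  classical
  rw [(cutCompl_isPosTC hA s).tr_re, hA.tr_re, ← hA.summable_re.sum_add_tsum_subtype_compl s,
    add_sub_cancel_left]
  refine Eq.trans (tsum_congr fun i => ?_) (tsum_subtype {x | x ∉ s} fun i => (A i i).re).symm
  by_cases hi : i ∈ s <;> simp [cutCompl, hi, Set.indicator]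

/-- The off-diagonal part is controlled by weighing the two diagonal parts with `t` and `t⁻¹`. -/
theorem tnle_sub_cut {A : Op L} (hA : IsPosTC A) (s : Finset L) {t : ℝ} (ht : 0 < t) :
    TNle (A - cut s A) (2 * (t * (tr A).re + (1 + t⁻¹) * (tr (cutCompl s A)).re)) := by
  classical
  have hc := cut_isPosTC s hA.1
  have hd := cutCompl_isPosTC hA s
  have hZ := isPosTC_weight hA (w := fun i => if i ∈ s then √t else √t⁻¹) (C := √t + √t⁻¹)
    (fun i => by split_ifs <;> positivity)
    (fun i => by split_ifs <;> simp [Real.sqrt_nonneg])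
  have ht' : 0 < t⁻¹ := inv_pos.2 ht
  have hss : √t * √t⁻¹ = 1 := by
    rw [← Real.sqrt_mul ht.le, mul_inv_cancel₀ ht.ne', Real.sqrt_one]
  have h1 : ((√t : ℝ) : ℂ) * ((√t : ℝ) : ℂ) = t := by
    rw [← Complex.ofReal_mul, Real.mul_self_sqrt ht.le]
  have h2 : ((√t⁻¹ : ℝ) : ℂ) * ((√t⁻¹ : ℝ) : ℂ) = (t : ℂ)⁻¹ := by
    rw [← Complex.ofReal_mul, Real.mul_self_sqrt ht'.le, Complex.ofReal_inv]
  have h3 : ((√t : ℝ) : ℂ) * ((√t⁻¹ : ℝ) : ℂ) = 1 := by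
    rw [← Complex.ofReal_mul, hss, Complex.ofReal_one]
  set Z : Op L := Matrix.of fun i j => (((if i ∈ s then √t else √t⁻¹ : ℝ)) : ℂ) * A i j *
    (((if j ∈ s then √t else √t⁻¹ : ℝ)) : ℂ) with hZdef
  have hNeg := (hc.smul ht.le).add (hd.smul ht'.le)
  have htrZ : tr Z = tr (t • cut s A + t⁻¹ • cutCompl s A) := by
    refine tsum_congr fun i => ?_
    simp only [hZdef, Matrix.of_apply, Matrix.add_apply, Matrix.smul_apply, cut, cutCompl,
      Complex.real_smul]
    by_cases hi : i ∈ s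
    · simp only [hi, if_true, and_self, not_true, if_false, mul_zero, add_zero]
      linear_combination (A i i) * h1
    · simp only [hi, if_false, and_self, not_false_eq_true, if_true, mul_zero, zero_add,
        Complex.ofReal_inv]
      linear_combination (A i i) * h2
  refine ⟨Z + cutCompl s A, t • cut s A + t⁻¹ • cutCompl s A, hZ.add hd, hNeg, ?_, ?_⟩
  · ext i j
    simp only [hZdef, Matrix.of_apply, Matrix.add_apply, Matrix.sub_apply, Matrix.smul_apply, cut,
      cutCompl, Complex.real_smul]
    by_cases hi : i ∈ s <;> by_cases hj : j ∈ s <;>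
      simp only [hi, hj, if_true, if_false, and_self, not_true, and_true, and_false,
        not_false_eq_true, mul_zero, add_zero, zero_add, sub_zero, sub_self, Complex.ofReal_inv]
    · linear_combination -(A i j) * h1
    · linear_combination -(A i j) * h3
    · linear_combination -(A i j) * h3
    · linear_combination -(A i j) * h2
  · rw [TC_tr_add hZ hd, htrZ, TC_tr_add (hc.smul ht.le) (hd.smul ht'.le), tr_rsmul, tr_rsmul]
    simp only [Complex.add_re, Complex.re_ofReal_mul]
    have := tr_cut_re_le hA s
    have h5 := hd.tr_re_nonneg
    nlinarith

/-- Truncations converge in the trace norm. -/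
theorem eventually_tnle_sub_cut {A : Op L} (hA : IsPosTC A) {ε : ℝ} (hε : 0 < ε) :
    ∀ᶠ s in atTop, TNle (A - cut s A) ε := by
  set T := (tr A).re
  have hT : 0 ≤ T := hA.tr_re_nonneg
  set t := ε / (4 * (T + 1)) with ht
  have ht0 : 0 < t := by positivity
  have h1 : t * T ≤ ε / 4 := by
    rw [ht, div_mul_eq_mul_div, div_le_div_iff₀ (by positivity) (by norm_num)]
    nlinarith
  have h2 : Tendsto (fun s : Finset L => (1 + t⁻¹) * (tr (cutCompl s A)).re) atTop (𝓝 0) := by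
    have h3 : Tendsto (fun s : Finset L => ∑ i ∈ s, (A i i).re) atTop (𝓝 T) := by
      have := hA.summable_re.hasSum
      rwa [← hA.tr_re] at this
    have h4 := (h3.const_sub T).const_mul (1 + t⁻¹)
    simp only [sub_self, mul_zero] at h4
    simpa only [tr_cutCompl_re hA] using h4
  filter_upwards [h2.eventually (gt_mem_nhds (show (0 : ℝ) < ε / 4 by positivity))] with s hs
  exact (tnle_sub_cut hA s ht0).mono (by linarith)

/-- A positive map is determined, in a continuous way, by its values on the matrix units. -/
theorem IsPosMap.tendsto_cut {Φ : TC L →ₗ[ℂ] TC L} (h : IsPosMap Φ) {A : Op L} (hA : IsPosTC A)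
    (i j : L) :
    Tendsto (fun s : Finset L => (Φ ⟨cut s A, (cut_isPosTC s hA.1).mem⟩ : Op L) i j) atTop
      (𝓝 ((Φ ⟨A, hA.mem⟩ : Op L) i j)) := by
  rw [Metric.tendsto_nhds]
  intro ε hε
  filter_upwards [eventually_tnle_sub_cut hA (half_pos hε)] with s hs
  rw [dist_comm, dist_eq_norm, ← Matrix.sub_apply, ← Submodule.coe_sub, ← map_sub]
  exact (h.norm_apply_le (X := ⟨A, hA.mem⟩ - ⟨cut s A, _⟩) hs i j).trans_lt (half_lt_self hε)

/-- Joint measurability: a measurable family of positive maps, applied to a measurable family of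
positive operators. -/
theorem measurable_apply [Countable L] {Φ : Ω → TC L →ₗ[ℂ] TC L} (hΦ : ∀ ω, IsPosMap (Φ ω))
    (hm : ∀ A i j, Measurable fun ω => (Φ ω A : Op L) i j) {A : Ω → TC L}
    (hA : ∀ ω, IsPosTC (A ω : Op L)) (hAm : ∀ i j, Measurable fun ω => (A ω : Op L) i j) (i j : L) :
    Measurable fun ω => (Φ ω (A ω) : Op L) i j := by
  classical
  have key : ∀ s : Finset L, Measurable fun ω =>
      (Φ ω ⟨cut s (A ω), (cut_isPosTC s (hA ω).1).mem⟩ : Op L) i j := fun s => by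
    have h1 : ∀ ω, (Φ ω ⟨cut s (A ω), (cut_isPosTC s (hA ω).1).mem⟩ : Op L) i j =
        ∑ k ∈ s, ∑ l ∈ s, (A ω : Op L) k l * (Φ ω ⟨_, single_mem k l⟩ : Op L) i j := fun ω => by
      have : (⟨cut s (A ω), (cut_isPosTC s (hA ω).1).mem⟩ : TC L) =
          ∑ k ∈ s, ∑ l ∈ s, (A ω : Op L) k l • (⟨_, single_mem k l⟩ : TC L) := by
        refine Subtype.ext ?_
        simp only [Submodule.coe_sum, Submodule.coe_smul]
        exact cut_eq s _
      rw [this]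
      simp only [map_sum, map_smul, Submodule.coe_sum, Submodule.coe_smul, Matrix.sum_apply,
        Matrix.smul_apply, smul_eq_mul]
    simp only [h1]
    exact Finset.measurable_fun_sum _ fun k _ => Finset.measurable_fun_sum _ fun l _ =>
      (hAm k l).mul (hm _ i j)
  exact measurable_of_tendsto_metrizable' atTop key
    (tendsto_pi_nhds.2 fun ω => (hΦ ω).tendsto_cut (hA ω) i j)

end posmap

/-! ### Integrals over the data of successive steps -/

/-- Integration term by term. -/
theorem hasSum_integral_of_sum_norm_le {α ι : Type*} [MeasurableSpace α] [Countable ι]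
    {μ : Measure α} [IsFiniteMeasure μ] {F : ι → α → ℂ} (hm : ∀ p, Measurable (F p)) {C : ℝ}
    (hb : ∀ (s : Finset ι) a, ∑ p ∈ s, ‖F p a‖ ≤ C) :
    HasSum (fun p => ∫ a, F p a ∂μ) (∫ a, ∑' p, F p a ∂μ) := by
  have hi : ∀ p, Integrable (F p) μ := fun p =>
    Integrable.of_bound (hm p).aestronglyMeasurable C (Eventually.of_forall fun a => by
      simpa using hb {p} a)
  refine hasSum_integral_of_summable_integral_norm hi (summable_of_sum_le
    (fun p => integral_nonneg fun a => norm_nonneg _) (c := C * μ.real Set.univ) fun s => ?_)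
  rw [← integral_finsetSum _ fun p _ => (hi p).norm]
  calc ∫ a, ∑ p ∈ s, ‖F p a‖ ∂μ ≤ ∫ _, C ∂μ :=
        integral_mono (integrable_finsetSum _ fun p _ => (hi p).norm) (integrable_const _)
          (hb s)
    _ = C * μ.real Set.univ := by simp [mul_comm]

/-- The pull-out property of conditional expectations, in terms of set integrals. -/
theorem setIntegral_comp_mul {α β : Type*} [MeasurableSpace α] [mβ : MeasurableSpace β]
    {μ : Measure β} [IsFiniteMeasure μ] {π : β → α} (hπ : Measurable π) {f : β → ℂ}
    (hf : Integrable f μ) {G : α → ℂ} (hG : Measurable G) (hGi : Integrable G (μ.map π))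
    (h : ∀ A, MeasurableSet A → ∫ b in π ⁻¹' A, f b ∂μ = ∫ a in A, G a ∂(μ.map π))
    {φ : α → ℂ} (hφ : Measurable φ) {C : ℝ} (hC : ∀ a, ‖φ a‖ ≤ C) {A : Set α}
    (hA : MeasurableSet A) :
    ∫ b in π ⁻¹' A, φ (π b) * f b ∂μ = ∫ a in A, φ a * G a ∂(μ.map π) := by
  have hle : MeasurableSpace.comap π inferInstance ≤ mβ := hπ.comap_le
  have hmap : ∀ H : α → ℂ, Measurable H → ∀ A, MeasurableSet A →
      ∫ a in A, H a ∂(μ.map π) = ∫ b in π ⁻¹' A, H (π b) ∂μ := fun H hH A hA =>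
    setIntegral_map hA hH.aestronglyMeasurable hπ.aemeasurable
  have hGπ : Integrable (fun b => G (π b)) μ := hGi.comp_measurable hπ
  have hsm : ∀ H : α → ℂ, Measurable H →
      StronglyMeasurable[MeasurableSpace.comap π inferInstance] fun b => H (π b) := fun H hH =>
    (hH.comp (comap_measurable π)).stronglyMeasurable
  have hcond : (fun b => G (π b)) =ᵐ[μ] μ[f | MeasurableSpace.comap π inferInstance] := by
    refine ae_eq_condExp_of_forall_setIntegral_eq hle hf (fun s _ _ => hGπ.integrableOn) ?_
      (hsm G hG).aestronglyMeasurable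
    rintro _ ⟨A, hA, rfl⟩ _
    rw [h A hA, hmap G hG A hA]
  have hfg : Integrable (fun b => φ (π b) * f b) μ :=
    hf.bdd_mul (c := C) (hφ.comp hπ).aestronglyMeasurable (Eventually.of_forall fun b => hC _)
  have hpull := condExp_bilin_of_stronglyMeasurable_left (ContinuousLinearMap.mul ℝ ℂ)
    (hsm φ hφ) hfg hf
  rw [hmap (fun a => φ a * G a) (hφ.mul hG) A hA,
    ← setIntegral_condExp hle hfg ⟨A, hA, rfl⟩]
  refine setIntegral_congr_ae (hπ hA) ?_
  filter_upwards [hcond, hpull] with b h1 h2 _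
  rw [show μ[fun b => φ (π b) * f b | MeasurableSpace.comap π inferInstance] b = _ from h2, h1]
  rfl

section data

variable {r l : ℕ}

/-- Forgetting the last of the data. -/
def trunc (h : Data (r + 1) l) : Data r l := fun q => h q.castSucc

theorem measurable_trunc : Measurable (trunc : Data (r + 1) l → Data r l) :=
  measurable_pi_iff.2 fun q => measurable_pi_apply q.castSucc

/-- The event that the first `r` data are in `A` and the last one is in `Δ`. -/
def rectEvent (A : Set (Data r l)) (Δ : Set (Fin l → ℝ)) : Set (Data (r + 1) l) :=
  {h | (fun q : Fin r => h q.castSucc) ∈ A ∧ h (Fin.last r) ∈ Δ}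

theorem rectEvent_eq (A : Set (Data r l)) (Δ : Set (Fin l → ℝ)) :
    rectEvent A Δ = trunc ⁻¹' A ∩ (fun h => h (Fin.last r)) ⁻¹' Δ := rfl

theorem measurableSet_last {Δ : Set (Fin l → ℝ)} (hΔ : MeasurableSet Δ) :
    MeasurableSet ((fun h : Data (r + 1) l => h (Fin.last r)) ⁻¹' Δ) :=
  measurable_pi_apply (Fin.last r) hΔ

theorem rectEvent_univ (A : Set (Data r l)) : rectEvent A Set.univ = trunc ⁻¹' A := by
  simp [rectEvent_eq]

/-- Functions with the same integrals over the rectangles are equal. -/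
theorem ae_eq_of_forall_rectEvent {μ : Measure (Data (r + 1) l)} [IsFiniteMeasure μ]
    {F F' : Data (r + 1) l → ℂ} (hF : Integrable F μ) (hF' : Integrable F' μ)
    (h : ∀ A Δ, MeasurableSet A → MeasurableSet Δ →
      ∫ h in rectEvent A Δ, F h ∂μ = ∫ h in rectEvent A Δ, F' h ∂μ) : F =ᵐ[μ] F' := by
  let φ : Data (r + 1) l → Data r l × (Fin l → ℝ) := fun h => (trunc h, h (Fin.last r))
  have hφ : Measurable φ := measurable_trunc.prodMk (measurable_pi_apply _)
  let ψ : Data r l × (Fin l → ℝ) → Data (r + 1) l :=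
    fun p => Fin.snoc (α := fun _ => Fin l → ℝ) p.1 p.2
  have hψ : Measurable ψ := measurable_pi_iff.2 fun q => by
    refine Fin.lastCases ?_ (fun q => ?_) q
    · simpa [ψ] using measurable_snd
    · simpa [ψ, Function.comp_def] using
        (measurable_pi_apply q).comp (measurable_fst (β := Fin l → ℝ) (α := Data r l))
  have hψφ : ∀ h, ψ (φ h) = h := fun h => Fin.snoc_init_self h
  have key : ∀ t, MeasurableSet t → ∫ h in φ ⁻¹' t, F h ∂μ = ∫ h in φ ⁻¹' t, F' h ∂μ := by
    intro t ht
    induction t, ht using MeasurableSpace.induction_on_inter generateFrom_prod.symm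
      isPiSystem_prod with
    | empty => simp
    | basic t ht =>
      obtain ⟨A, hA, Δ, hΔ, rfl⟩ := ht
      exact h A Δ hA hΔ
    | compl t ht ih =>
      have h0 : ∫ h, F h ∂μ = ∫ h, F' h ∂μ := by
        simpa [rectEvent_univ] using h Set.univ Set.univ MeasurableSet.univ MeasurableSet.univ
      rw [Set.preimage_compl, setIntegral_compl (hφ ht) hF, setIntegral_compl (hφ ht) hF', ih, h0]
    | iUnion f hd hm ih =>
      rw [Set.preimage_iUnion, integral_iUnion (fun k => hφ (hm k))
        (fun i j hij => (hd hij).preimage φ) hF.integrableOn,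
        integral_iUnion (fun k => hφ (hm k)) (fun i j hij => (hd hij).preimage φ)
          hF'.integrableOn]
      exact tsum_congr ih
  refine hF.ae_eq_of_forall_setIntegral_eq F F' hF' fun s hs _ => ?_
  have : s = φ ⁻¹' (ψ ⁻¹' s) := by
    ext x
    simp [hψφ]
  rw [this]
  exact key _ (hψ hs)

/-- If the last step has the same transition `G` for `F` and, up to the factor `φ` that depends on
the previous data, for `F'`, then `F' = φ F`. -/
theorem ae_eq_mul_of_forall_rectEvent {μ : Measure (Data (r + 1) l)} [IsFiniteMeasure μ]
    {F F' : Data (r + 1) l → ℂ} (hF : Integrable F μ) (hF' : Integrable F' μ)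
    {G : Set (Fin l → ℝ) → Data r l → ℂ} (hG : ∀ Δ, MeasurableSet Δ → Measurable (G Δ))
    {c : ℝ} (hGc : ∀ Δ, MeasurableSet Δ → ∀ h, ‖G Δ h‖ ≤ c)
    (h : ∀ A Δ, MeasurableSet A → MeasurableSet Δ →
      ∫ h in rectEvent A Δ, F h ∂μ = ∫ h in A, G Δ h ∂(μ.map trunc))
    {φ : Data r l → ℂ} (hφ : Measurable φ) {C : ℝ} (hC : ∀ h, ‖φ h‖ ≤ C)
    (h' : ∀ A Δ, MeasurableSet A → MeasurableSet Δ →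
      ∫ h in rectEvent A Δ, F' h ∂μ = ∫ h in A, φ h * G Δ h ∂(μ.map trunc)) :
    F' =ᵐ[μ] fun h => φ (trunc h) * F h := by
  have : IsFiniteMeasure (μ.map (trunc : Data (r + 1) l → Data r l)) :=
    Measure.isFiniteMeasure_map μ trunc
  refine ae_eq_of_forall_rectEvent hF' (hF.bdd_mul (c := C)
    (hφ.comp measurable_trunc).aestronglyMeasurable (Eventually.of_forall fun b => hC _))
    fun A Δ hA hΔ => ?_
  have hl := measurableSet_last (r := r) hΔ
  have h1 := setIntegral_comp_mul measurable_trunc (hF.indicator hl) (hG Δ hΔ)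
    (Integrable.of_bound (hG Δ hΔ).aestronglyMeasurable c (Eventually.of_forall (hGc Δ hΔ)))
    (fun A hA => by rw [setIntegral_indicator hl, ← rectEvent_eq, h A Δ hA hΔ]) hφ hC hA
  rw [h' A Δ hA hΔ, ← h1]
  have h2 : ∀ b, φ (trunc b) * ((fun h : Data (r + 1) l => h (Fin.last r)) ⁻¹' Δ).indicator F b =
      ((fun h : Data (r + 1) l => h (Fin.last r)) ⁻¹' Δ).indicator
        (fun b => φ (trunc b) * F b) b := fun b => by
    by_cases hb : b ∈ (fun h : Data (r + 1) l => h (Fin.last r)) ⁻¹' Δ <;> simp [hb]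
  simp only [h2]
  rw [setIntegral_indicator hl, ← rectEvent_eq]

end data

/-! ### Local maps -/

section ampl

variable {K L E Ω : Type} [MeasurableSpace Ω] (e : K ≃ L × E)

/-- The compression of `X` to the vectors `φ ⊗ (e_a + c e_b)`. -/
def pairBlock (X : Op K) (a b : E) (c : ℂ) : Op L :=
  block e X a a + c • block e X a b + star c • block e X b a + (star c * c) • block e X b b

theorem isPosTC_block {X : Op K} (hX : IsPosTC X) (a : E) : IsPosTC (block e X a a) :=
  ⟨hX.1.submatrix _, hX.2.comp_injective (i := fun i : L => e.symm (i, a)) fun i j h => by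
    simpa using h⟩

theorem tr_block_re_le {X : Op K} (hX : IsPosTC X) (a : E) :
    (tr (block e X a a)).re ≤ (tr X).re := by
  rw [(isPosTC_block e hX a).tr_re, hX.tr_re]
  exact tsum_comp_le_tsum_of_inj hX.summable_re (fun i => diag_re_nonneg hX.1 i)
    (i := fun i : L => e.symm (i, a)) fun i j h => by simpa using h

theorem tr_smul_complex {I : Type} (c : ℂ) (A : Op I) : tr (c • A) = c * tr A := by
  simp [tr, tsum_mul_left]

/-- The compressions for `c` and `-c` add up to multiples of diagonal blocks, whose traces are at most
that of `X`. -/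
theorem tr_pairBlock_re_le {X : Op K} (hX : IsPosTC X) (a b : E) {c : ℂ} (hc : star c * c = 1) :
    (tr (pairBlock e X a b c)).re ≤ 4 * (tr X).re := by
  have h1 : pairBlock e X a b c + pairBlock e X a b (-c) =
      (2 : ℂ) • (block e X a a + block e X b b) := by
    simp only [pairBlock, star_neg, neg_mul_neg, hc, one_smul, neg_smul]
    module
  have h2 := congrArg (fun Y => (tr Y).re) h1
  have p1 : IsPosTC (pairBlock e X a b c) := isPosTC_compress e hX a b c
  have p2 : IsPosTC (pairBlock e X a b (-c)) := isPosTC_compress e hX a b (-c)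
  change (tr (pairBlock e X a b c + pairBlock e X a b (-c))).re = _ at h2
  rw [TC_tr_add p1 p2, tr_smul_complex, TC_tr_add (isPosTC_block e hX a) (isPosTC_block e hX b)]
    at h2
  have h3 := tr_block_re_le e hX a
  have h4 := tr_block_re_le e hX b
  have h5 := p2.tr_re_nonneg
  simp only [Complex.add_re, Complex.mul_re, Complex.re_ofNat, Complex.im_ofNat, zero_mul,
    sub_zero] at h2
  linarith

/-- The polarization identity for blocks. -/
theorem ampl_eq_pairBlock (Φ : TC L →ₗ[ℂ] TC L) {X : Op K} (hX : IsPosTC X) (p q : K) :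
    ampl e Φ ⟨X, hX.mem⟩ p q = 1 / 4 *
      ((Φ ⟨pairBlock e X (e p).2 (e q).2 1, (isPosTC_compress e hX _ _ _).mem⟩ : Op L)
          (e p).1 (e q).1 -
        (Φ ⟨pairBlock e X (e p).2 (e q).2 (-1), (isPosTC_compress e hX _ _ _).mem⟩ : Op L)
          (e p).1 (e q).1 + (-Complex.I) *
        ((Φ ⟨pairBlock e X (e p).2 (e q).2 Complex.I, (isPosTC_compress e hX _ _ _).mem⟩ : Op L)
          (e p).1 (e q).1 -
        (Φ ⟨pairBlock e X (e p).2 (e q).2 (-Complex.I), (isPosTC_compress e hX _ _ _).mem⟩ : Op L)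
          (e p).1 (e q).1)) := by
  have h : ∀ a b, (⟨block e X a b, block_mem e hX.mem a b⟩ : TC L) = (1 / 4 : ℂ) •
      ((⟨pairBlock e X a b 1, (isPosTC_compress e hX _ _ _).mem⟩ : TC L) -
        ⟨pairBlock e X a b (-1), (isPosTC_compress e hX _ _ _).mem⟩ + (-Complex.I) •
        ((⟨pairBlock e X a b Complex.I, (isPosTC_compress e hX _ _ _).mem⟩ : TC L) -
        ⟨pairBlock e X a b (-Complex.I), (isPosTC_compress e hX _ _ _).mem⟩)) := fun a b => by
    refine Subtype.ext ?_
    ext i j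
    simp only [pairBlock, Submodule.coe_smul, Submodule.coe_add, Submodule.coe_sub,
      Matrix.add_apply, Matrix.sub_apply, Matrix.smul_apply, smul_eq_mul]
    simp
    linear_combination ((1 / 2 : ℂ) * block e X a b i j
      - (1 / 2 : ℂ) * block e X b a i j) * Complex.I_mul_I
  simp only [ampl, Matrix.of_apply]
  rw [h, map_smul, map_add, map_sub, map_smul, map_sub]
  simp only [Submodule.coe_smul, Submodule.coe_add, Submodule.coe_sub,
      Matrix.add_apply, Matrix.sub_apply, Matrix.smul_apply, smul_eq_mul]

/-- A bound for the entries of `(Φ ⊗ id) X` that is uniform in the positive map `Φ`, by polarization. -/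
theorem IsPosMap.norm_ampl_le {Φ : TC L →ₗ[ℂ] TC L} (h : IsPosMap Φ) {X : Op K} (hX : IsPosTC X)
    (p q : K) : ‖ampl e Φ ⟨X, hX.mem⟩ p q‖ ≤ 4 * (tr X).re := by
  have key : ∀ c : ℂ, star c * c = 1 →
      ‖(Φ ⟨pairBlock e X (e p).2 (e q).2 c, (isPosTC_compress e hX _ _ _).mem⟩ : Op L)
        (e p).1 (e q).1‖ ≤ 4 * (tr X).re := fun c hc =>
    (h.norm_apply_le (X := ⟨_, (isPosTC_compress e hX _ _ _).mem⟩)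
      (isPosTC_compress e hX (e p).2 (e q).2 c).tnle _ _).trans
        (tr_pairBlock_re_le e hX _ _ hc)
  have k1 := key 1 (by simp)
  have k2 := key (-1) (by simp)
  have k3 := key Complex.I (by simp)
  have k4 := key (-Complex.I) (by simp)
  rw [ampl_eq_pairBlock e Φ hX, norm_mul]
  refine (mul_le_mul_of_nonneg_left (norm_add_le _ _) (norm_nonneg _)).trans ?_
  rw [norm_mul, norm_neg, Complex.norm_I, one_mul]
  refine (mul_le_mul_of_nonneg_left (add_le_add (norm_sub_le _ _) (norm_sub_le _ _))
    (norm_nonneg _)).trans ?_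
  norm_num
  linarith

/-- Measurability of adaptive local maps, by polarization. -/
theorem measurable_ampl [Countable L] {Φ : Ω → TC L →ₗ[ℂ] TC L} (hΦ : ∀ ω, IsPosMap (Φ ω))
    (hm : ∀ A i j, Measurable fun ω => (Φ ω A : Op L) i j) {X : Ω → Op K}
    (hX : ∀ ω, IsPosTC (X ω)) (hXm : ∀ i j, Measurable fun ω => X ω i j) (p q : K) :
    Measurable fun ω => ampl e (Φ ω) ⟨X ω, (hX ω).mem⟩ p q := by
  have key : ∀ c : ℂ, Measurable fun ω =>
      (Φ ω ⟨pairBlock e (X ω) (e p).2 (e q).2 c, (isPosTC_compress e (hX ω) _ _ _).mem⟩ : Op L)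
        (e p).1 (e q).1 := fun c => by
    refine measurable_apply hΦ hm (A := fun ω => ⟨pairBlock e (X ω) (e p).2 (e q).2 c, _⟩)
      (fun ω => isPosTC_compress e (hX ω) _ _ _) (fun i j => ?_) _ _
    simp only [pairBlock, block, Matrix.add_apply, Matrix.smul_apply, Matrix.of_apply, smul_eq_mul]
    exact (((hXm _ _).add ((hXm _ _).const_mul _)).add ((hXm _ _).const_mul _)).add
      ((hXm _ _).const_mul _)
  simp only [ampl_eq_pairBlock e _ (hX _)]
  exact (((key _).sub (key _)).add (((key _).sub (key _)).const_mul _)).const_mul _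

theorem ampl_diag_eq_re {Φ : TC L →ₗ[ℂ] TC L} (h : IsPosMap Φ) {X : Op K} (hX : IsPosTC X)
    (p : K) : 0 ≤ (ampl e Φ ⟨X, hX.mem⟩ p p).re ∧
      ampl e Φ ⟨X, hX.mem⟩ p p = ((ampl e Φ ⟨X, hX.mem⟩ p p).re : ℂ) := by
  have := (h.pos ⟨_, block_mem e hX.mem (e p).2 (e p).2⟩ (isPosTC_block e hX _)).1
  exact ⟨diag_re_nonneg this _, diag_eq_re this _⟩

/-- `Φ ⊗ id` preserves the trace if `Φ` does. -/
theorem hasSum_ampl_diag {Φ : TC L →ₗ[ℂ] TC L} (h : IsPosMap Φ)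
    (ht : ∀ A : TC L, tr (Φ A : Op L) = tr (A : Op L)) {X : Op K} (hX : IsPosTC X) :
    HasSum (fun p => (ampl e Φ ⟨X, hX.mem⟩ p p).re) (tr X).re := by
  have hb := fun a => h.pos ⟨_, block_mem e hX.mem a a⟩ (isPosTC_block e hX a)
  have h0 : ∀ z : E × L, 0 ≤ ((Φ ⟨_, block_mem e hX.mem z.1 z.1⟩ : Op L) z.2 z.2).re :=
    fun z => diag_re_nonneg (hb z.1).1 _
  have hrow : ∀ a, ∑' i, ((Φ ⟨_, block_mem e hX.mem a a⟩ : Op L) i i).re =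
      ∑' i, (X (e.symm (i, a)) (e.symm (i, a))).re := fun a => by
    rw [← (hb a).tr_re, ht, (isPosTC_block e hX a).tr_re]
    rfl
  have hXs : Summable fun z : E × L => (X (e.symm (z.2, z.1)) (e.symm (z.2, z.1))).re :=
    hX.summable_re.comp_injective (i := fun z : E × L => e.symm (z.2, z.1)) fun z w hzw => by
      have := e.symm.injective hzw
      exact Prod.ext (congrArg Prod.snd this) (congrArg Prod.fst this)
  have hs : Summable fun z : E × L => ((Φ ⟨_, block_mem e hX.mem z.1 z.1⟩ : Op L) z.2 z.2).re := by
    rw [summable_prod_of_nonneg (fun z => h0 z)]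
    refine ⟨fun a => (hb a).summable_re, ?_⟩
    simp only [hrow]
    exact hXs.prod
  have h1 : HasSum (fun z : E × L => ((Φ ⟨_, block_mem e hX.mem z.1 z.1⟩ : Op L) z.2 z.2).re)
      (tr X).re := by
    have := hs.hasSum
    rw [hs.tsum_prod] at this
    simp only [hrow] at this
    rw [← hXs.tsum_prod] at this
    rw [hX.tr_re, ← (e.trans (Equiv.prodComm L E)).symm.tsum_eq]
    exact this
  exact ((e.trans (Equiv.prodComm L E)).hasSum_iff (f := fun z : E × L =>
    ((Φ ⟨_, block_mem e hX.mem z.1 z.1⟩ : Op L) z.2 z.2).re)).2 h1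

/-- The action of a local map on a product. -/
theorem ampl_tens (Φ : TC L →ₗ[ℂ] TC L) {x : Op L} {y : Op E} (hx : x ∈ TC L)
    (h : tens e x y ∈ TC K) (p q : K) :
    ampl e Φ ⟨tens e x y, h⟩ p q = (Φ ⟨x, hx⟩ : Op L) (e p).1 (e q).1 * y (e p).2 (e q).2 := by
  have : (⟨block e (tens e x y) (e p).2 (e q).2, block_mem e h _ _⟩ : TC L) =
      y (e p).2 (e q).2 • ⟨x, hx⟩ := by
    refine Subtype.ext ?_
    ext i j
    simp [block, tens, mul_comm]
  simp only [ampl, Matrix.of_apply]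
  rw [this, map_smul]
  simp [mul_comm]

end ampl

/-! ### Independent sites -/

section indep

variable {K : Type}

/-- The site `s` is a part of the environment of the site `u`: the map `v` reads the index of the
local system of `s` off that of the environment of `u`, and `w` replaces it. -/
def IsIndepOf (u s : LocalSite K) : Prop :=
  ∃ w : s.L → u.E → u.E, ∃ v : u.E → s.L,
    (∀ p, (s.split p).1 = v (u.split p).2) ∧
    ∀ l p, u.split (s.split.symm (l, (s.split p).2)) = ((u.split p).1, w l (u.split p).2)

open scoped Classical in
/-- The action of a map of the site `s` on the environment of `u`, computed with the state
`ℓ₀` at `u`. -/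
def envAct (u s : LocalSite K) (Φ : TC s.L →ₗ[ℂ] TC s.L) (ℓ : u.L) {y : Op u.E} (hy : y ∈ TC u.E) :
    Op u.E :=
  Matrix.of fun a b => ampl s.split Φ ⟨tens u.split (Matrix.single ℓ ℓ 1) y,
    tens_mem u.split (single_mem ℓ ℓ) hy⟩ (u.split.symm (ℓ, a)) (u.split.symm (ℓ, b))

/-- The maps at a site that is independent of `u` act on the second factor of the products. -/
theorem IsIndepOf.ampl_tens {u s : LocalSite K} (h : IsIndepOf u s) (Φ : TC s.L →ₗ[ℂ] TC s.L)
    (ℓ : u.L) {x : Op u.L} {y : Op u.E} (hy : y ∈ TC u.E) (hxy : tens u.split x y ∈ TC K)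
    (p q : K) :
    ampl s.split Φ ⟨tens u.split x y, hxy⟩ p q =
      x (u.split p).1 (u.split q).1 * envAct u s Φ ℓ hy (u.split p).2 (u.split q).2 := by
  classical
  obtain ⟨w, v, hv, hw⟩ := h
  set p' := u.split.symm (ℓ, (u.split p).2) with hp'
  set q' := u.split.symm (ℓ, (u.split q).2) with hq'
  have hup : u.split p' = (ℓ, (u.split p).2) := by simp [p']
  have huq : u.split q' = (ℓ, (u.split q).2) := by simp [q']
  have h1 : (s.split p').1 = (s.split p).1 := by rw [hv, hv, hup]
  have h2 : (s.split q').1 = (s.split q).1 := by rw [hv, hv, huq]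
  have hm := tens_mem u.split (single_mem ℓ ℓ) hy
  have key : (⟨block s.split (tens u.split x y) (s.split p).2 (s.split q).2,
      block_mem s.split hxy _ _⟩ : TC s.L) = x (u.split p).1 (u.split q).1 •
      ⟨block s.split (tens u.split (Matrix.single ℓ ℓ 1) y) (s.split p').2 (s.split q').2,
        block_mem s.split hm _ _⟩ := by
    refine Subtype.ext ?_
    ext i j
    simp only [block, tens, Matrix.of_apply, hw, hup, huq, Submodule.coe_smul, Matrix.smul_apply,
      smul_eq_mul]
    simp
  simp only [envAct, ampl, Matrix.of_apply]
  rw [key, map_smul, ← h1, ← h2]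
  rfl

end indep

/-! ### Product structure of the a posteriori states -/

section step

variable {K L E : Type} {r l : ℕ}

theorem sum_norm_ptr_le (e : K ≃ L × E) {X : Op K} (hX : IsPosTC X) (i j : L) (s : Finset E) :
    ∑ a ∈ s, ‖X (e.symm (i, a)) (e.symm (j, a))‖ ≤ (tr X).re := by
  have h : ∀ i : L, ∑ a ∈ s, (X (e.symm (i, a)) (e.symm (i, a))).re ≤ (tr X).re := fun i => by
    have hinj : Function.Injective fun a => e.symm (i, a) := fun a b h => by simpa using h
    rw [hX.tr_re]
    exact ((hX.summable_re.comp_injective hinj).sum_le_tsum s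
      fun a _ => diag_re_nonneg hX.1 _).trans
        (tsum_comp_le_tsum_of_inj hX.summable_re (fun k => diag_re_nonneg hX.1 k) hinj)
  calc _ ≤ ∑ a ∈ s, ((X (e.symm (i, a)) (e.symm (i, a))).re +
        (X (e.symm (j, a)) (e.symm (j, a))).re) / 2 :=
        Finset.sum_le_sum fun a _ => norm_entry_le hX.1 _ _
    _ ≤ _ := by
      rw [← Finset.sum_div, Finset.sum_add_distrib]
      linarith [h i, h j]

theorem IsState.tr_re_eq {I : Type} {X : Op I} (h : IsState X) : (tr X).re = 1 := by
  rw [h.tr_eq, Complex.one_re]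

theorem measurable_ptr [Countable E] {α : Type*} [MeasurableSpace α] (e : K ≃ L × E)
    {F : α → Op K} (hF : ∀ a, IsPosTC (F a)) (hm : ∀ p q, Measurable fun a => F a p q) (i j : L) :
    Measurable fun a => ptr e (F a) i j := by
  classical
  refine measurable_of_tendsto_metrizable' atTop
    (f := fun (s : Finset E) a => ∑ b ∈ s, F a (e.symm (i, b)) (e.symm (j, b)))
    (fun s => Finset.measurable_fun_sum _ fun b _ => hm _ _) (tendsto_pi_nhds.2 fun a => ?_)
  exact (ptr_summable e (hF a).mem i j).hasSum

/-- If a step acts on the first factor only, the state factorizes after the step, with the second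
factor from before the step. -/
theorem factor_step [Countable L] [Countable E] (e : K ≃ L × E)
    {μ : Measure (Data (r + 1) l)} [IsFiniteMeasure μ] {F : Data (r + 1) l → Op K} {c C : ℝ}
    (hF : ∀ h, IsPosTC (F h)) (hFc : ∀ h, (tr (F h)).re ≤ c)
    (hFm : ∀ p q, Measurable fun h => F h p q) {ζ : Data r l → Op E} (hζ : ∀ h, IsState (ζ h))
    (hζm : ∀ a b, Measurable fun h => ζ h a b) {G : Set (Fin l → ℝ) → Data r l → Op L}
    (hGm : ∀ Δ, MeasurableSet Δ → ∀ i j, Measurable fun h => G Δ h i j)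
    (hGC : ∀ Δ, MeasurableSet Δ → ∀ h i j, ‖G Δ h i j‖ ≤ C)
    (hstep : ∀ A Δ, MeasurableSet A → MeasurableSet Δ → ∀ p q,
      ∫ h in rectEvent A Δ, F h p q ∂μ =
        ∫ h in A, G Δ h (e p).1 (e q).1 * ζ h (e p).2 (e q).2 ∂(μ.map trunc)) :
    (∀ A Δ, MeasurableSet A → MeasurableSet Δ → ∀ i j,
      ∫ h in rectEvent A Δ, ptr e (F h) i j ∂μ = ∫ h in A, G Δ h i j ∂(μ.map trunc)) ∧
    ∀ᵐ h ∂μ, F h = tens e (ptr e (F h)) (ζ (trunc h)) := by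
  have : IsFiniteMeasure (μ.map (trunc : Data (r + 1) l → Data r l)) :=
    Measure.isFiniteMeasure_map μ trunc
  have : Countable K := e.countable_iff.2 inferInstance
  have h1 : ∀ A Δ, MeasurableSet A → MeasurableSet Δ → ∀ i j,
      ∫ h in rectEvent A Δ, ptr e (F h) i j ∂μ = ∫ h in A, G Δ h i j ∂(μ.map trunc) := by
    intro A Δ hA hΔ i j
    have a1 := hasSum_integral_of_sum_norm_le (μ := μ.restrict (rectEvent A Δ))
      (F := fun a h => F h (e.symm (i, a)) (e.symm (j, a))) (fun a => hFm _ _) (C := c)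
      (fun s h => (sum_norm_ptr_le e (hF h) i j s).trans (hFc h))
    have a2 := hasSum_integral_of_sum_norm_le (μ := (μ.map trunc).restrict A)
      (F := fun a h => G Δ h i j * ζ h a a) (fun a => (hGm Δ hΔ i j).mul (hζm a a)) (C := C * 1)
      (fun s h => by
        simp only [norm_mul]
        rw [← Finset.mul_sum]
        have hC : 0 ≤ C := (norm_nonneg _).trans (hGC Δ hΔ h i j)
        refine mul_le_mul (hGC Δ hΔ h i j) ?_ (Finset.sum_nonneg fun _ _ => norm_nonneg _) hC
        have hz := (hζ h).isPosTC
        rw [← (hζ h).tr_re_eq, hz.tr_re]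
        refine (Finset.sum_le_sum fun a _ => ?_).trans
          (hz.summable_re.sum_le_tsum s fun a _ => diag_re_nonneg hz.1 a)
        have := norm_entry_le hz.1 a a
        linarith)
    have a3 : ∀ a, ∫ h in rectEvent A Δ, F h (e.symm (i, a)) (e.symm (j, a)) ∂μ =
        ∫ h in A, G Δ h i j * ζ h a a ∂(μ.map trunc) := fun a => by
      rw [hstep A Δ hA hΔ]
      simp only [Equiv.apply_symm_apply]
    simp only [a3] at a1
    have a4 : ∀ h, ∑' a, G Δ h i j * ζ h a a = G Δ h i j := fun h => by
      rw [tsum_mul_left, show ∑' a, ζ h a a = 1 from (hζ h).tr_eq, mul_one]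
    simp only [a4] at a2
    exact a1.unique a2
  refine ⟨h1, ?_⟩
  have h2 : ∀ p q, ∀ᵐ h ∂μ, F h p q =
      ζ (trunc h) (e p).2 (e q).2 * ptr e (F h) (e p).1 (e q).1 := fun p q =>
    ae_eq_mul_of_forall_rectEvent
      (F := fun h => ptr e (F h) (e p).1 (e q).1) (F' := fun h => F h p q)
      (Integrable.of_bound (measurable_ptr e hF hFm _ _).aestronglyMeasurable c
        (Eventually.of_forall fun h => ((hF h).ptr e).norm_entry_le_tr _ _ |>.trans
          (by rw [(hF h).tr_ptr e]; exact hFc h)))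
      (Integrable.of_bound (hFm p q).aestronglyMeasurable c
        (Eventually.of_forall fun h => ((hF h).norm_entry_le_tr _ _).trans (hFc h)))
      (G := fun Δ h => G Δ h (e p).1 (e q).1) (fun Δ hΔ => hGm Δ hΔ _ _) (c := C)
      (fun Δ hΔ h => hGC Δ hΔ h _ _) (fun A Δ hA hΔ => h1 A Δ hA hΔ _ _)
      (φ := fun h => ζ h (e p).2 (e q).2) (hζm _ _) (C := 1)
      (fun h => ((hζ h).isPosTC.norm_entry_le_tr _ _).trans (hζ h).tr_re_eq.le)
      (fun A Δ hA hΔ => by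
        rw [hstep A Δ hA hΔ]
        simp only [mul_comm])
  filter_upwards [ae_all_iff.2 fun p => ae_all_iff.2 fun q => h2 p q] with h hh
  ext p q
  rw [hh p q, tens_apply, mul_comm]

/-- The two families of operators `f₀` (states) and `f₁` (of trace at most `c`) that depend on the
data factorize at the site `u`, with the same state of the environment. -/
def IsProductAt (u : LocalSite K) (c : ℝ) (μ : Measure (Data r l)) (f₀ f₁ : Data r l → TC K) :
    Prop :=
  ∃ (η : Data r l → Op u.E) (ξ₀ ξ₁ : Data r l → Op u.L),
    (∀ h, IsState (η h)) ∧ (∀ h, IsState (ξ₀ h)) ∧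
    (∀ h, IsPosTC (ξ₁ h) ∧ (tr (ξ₁ h)).re ≤ c) ∧
    (∀ a b, Measurable fun h => η h a b) ∧ (∀ i j, Measurable fun h => ξ₀ h i j) ∧
    (∀ i j, Measurable fun h => ξ₁ h i j) ∧
    (∀ᵐ h ∂μ, (f₀ h : Op K) = tens u.split (ξ₀ h) (η h)) ∧
    ∀ᵐ h ∂μ, (f₁ h : Op K) = tens u.split (ξ₁ h) (η h)

variable {μ : Measure (Data (r + 1) l)} [IsFiniteMeasure μ] {c : ℝ}
  {f₀ f₁ : Data r l → TC K} {f₀' f₁' : Data (r + 1) l → TC K}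

/-- `f'` arises from `f` by the maps `Φ` at the site `v`. -/
def IsStep (v : LocalSite K) (Φ : Set (Fin l → ℝ) → Data r l → TC v.L →ₗ[ℂ] TC v.L)
    (μ : Measure (Data (r + 1) l)) (f : Data r l → TC K) (f' : Data (r + 1) l → TC K) : Prop :=
  ∀ A Δ, MeasurableSet A → MeasurableSet Δ → ∀ p q,
    ∫ h in rectEvent A Δ, (f' h : Op K) p q ∂μ =
      ∫ h in A, ampl v.split (Φ Δ h) (f h) p q ∂(μ.map trunc)

/-- A step at the site `u`. -/
theorem IsProductAt.step_self {u : LocalSite K} [Countable u.L] [Countable u.E]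
    {Φ : Set (Fin l → ℝ) → Data r l → TC u.L →ₗ[ℂ] TC u.L}
    (hΦ : ∀ Δ, MeasurableSet Δ → ∀ h, IsPosMap (Φ Δ h))
    (hΦm : ∀ Δ, MeasurableSet Δ → ∀ A i j, Measurable fun h => (Φ Δ h A : Op u.L) i j)
    (h₀ : ∀ h, IsState (f₀' h : Op K)) (h₁ : ∀ h, IsPosTC (f₁' h : Op K))
    (hc : ∀ h, (tr (f₁' h : Op K)).re ≤ c)
    (hm₀ : ∀ p q, Measurable fun h => (f₀' h : Op K) p q)
    (hm₁ : ∀ p q, Measurable fun h => (f₁' h : Op K) p q)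
    (hs₀ : IsStep u Φ μ f₀ f₀') (hs₁ : IsStep u Φ μ f₁ f₁')
    (hp : IsProductAt u c (μ.map trunc) f₀ f₁) : IsProductAt u c μ f₀' f₁' := by
  obtain ⟨η, ξ₀, ξ₁, hη, hξ₀, hξ₁, hηm, hξ₀m, hξ₁m, he₀, he₁⟩ := hp
  have key : ∀ (c : ℝ) (f : Data r l → TC K) (f' : Data (r + 1) l → TC K) (ξ : Data r l → Op u.L),
      (∀ h, IsPosTC (f' h : Op K)) → (∀ h, (tr (f' h : Op K)).re ≤ c) →
      (∀ p q, Measurable fun h => (f' h : Op K) p q) → IsStep u Φ μ f f' →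
      (∀ h, IsPosTC (ξ h) ∧ (tr (ξ h)).re ≤ c) → (∀ i j, Measurable fun h => ξ h i j) →
      (∀ᵐ h ∂(μ.map trunc), (f h : Op K) = tens u.split (ξ h) (η h)) →
      ∀ᵐ h ∂μ, (f' h : Op K) = tens u.split (ptr u.split (f' h : Op K)) (η (trunc h)) := by
    intro c f f' ξ hf hfc hfm hs hξ hξm he
    refine (factor_step u.split hf hfc hfm hη hηm
      (G := fun Δ h => (Φ Δ h ⟨ξ h, (hξ h).1.mem⟩ : Op u.L)) (C := c)
      (fun Δ hΔ i j => measurable_apply (hΦ Δ hΔ) (hΦm Δ hΔ) (A := fun h => ⟨ξ h, (hξ h).1.mem⟩)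
        (fun h => (hξ h).1) hξm i j)
      (fun Δ hΔ h i j => (hΦ Δ hΔ h).norm_apply_le (X := ⟨ξ h, (hξ h).1.mem⟩)
        ((hξ h).1.tnle.mono (hξ h).2) i j)
      (fun A Δ hA hΔ p q => ?_)).2
    rw [hs A Δ hA hΔ]
    refine setIntegral_congr_ae hA (he.mono fun h hh _ => ?_)
    have hm : tens u.split (ξ h) (η h) ∈ TC K := hh ▸ (f h).2
    rw [show f h = ⟨_, hm⟩ from Subtype.ext hh, ampl_tens]
  refine ⟨fun h => η (trunc h), fun h => ptr u.split (f₀' h : Op K),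
    fun h => ptr u.split (f₁' h : Op K), fun h => hη _, fun h => (h₀ h).ptr _,
    fun h => ⟨(h₁ h).ptr _, by rw [(h₁ h).tr_ptr]; exact hc h⟩,
    fun a b => (hηm a b).comp measurable_trunc,
    measurable_ptr _ (fun h => (h₀ h).isPosTC) hm₀, measurable_ptr _ h₁ hm₁, ?_, ?_⟩
  · exact key 1 f₀ f₀' ξ₀ (fun h => (h₀ h).isPosTC) (fun h => (h₀ h).tr_re_eq.le) hm₀ hs₀
      (fun h => ⟨(hξ₀ h).isPosTC, (hξ₀ h).tr_re_eq.le⟩) hξ₀m he₀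
  · exact key c f₁ f₁' ξ₁ h₁ hc hm₁ hs₁ hξ₁ hξ₁m he₁

/-- A step at a site that is independent of `u`: the law of the new datum given the previous ones is
the same for both inputs. -/
theorem IsProductAt.step_indep {u v : LocalSite K} (huv : IsIndepOf u v) [Countable u.L]
    [Countable u.E] [Countable v.L] [Nonempty u.L]
    {Φ : Set (Fin l → ℝ) → Data r l → TC v.L →ₗ[ℂ] TC v.L}
    (hΦ : ∀ Δ, MeasurableSet Δ → ∀ h, IsPosMap (Φ Δ h))
    (hΦm : ∀ Δ, MeasurableSet Δ → ∀ A i j, Measurable fun h => (Φ Δ h A : Op v.L) i j)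
    (h₀ : ∀ h, IsState (f₀' h : Op K)) (h₁ : ∀ h, IsPosTC (f₁' h : Op K))
    (hc : ∀ h, (tr (f₁' h : Op K)).re ≤ c)
    (hm₀ : ∀ p q, Measurable fun h => (f₀' h : Op K) p q)
    (hm₁ : ∀ p q, Measurable fun h => (f₁' h : Op K) p q)
    (hs₀ : IsStep v Φ μ f₀ f₀') (hs₁ : IsStep v Φ μ f₁ f₁')
    (hp : IsProductAt u c (μ.map trunc) f₀ f₁) :
    IsProductAt u c μ f₀' f₁' ∧
      ∀ᵐ h ∂μ, (tr (f₁' h : Op K)).re = (tr (f₁ (trunc h) : Op K)).re := by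
  classical
  obtain ⟨η, ξ₀, ξ₁, hη, hξ₀, hξ₁, hηm, hξ₀m, hξ₁m, he₀, he₁⟩ := hp
  have : Countable K := u.split.countable_iff.2 inferInstance
  obtain ⟨ℓ⟩ := ‹Nonempty u.L›
  have hℓ : IsState (Matrix.single ℓ ℓ (1 : ℂ)) := by
    have h1 : (Matrix.single ℓ ℓ (1 : ℂ) : Op u.L) =
        Matrix.diagonal fun i => if i = ℓ then 1 else 0 := by
      ext i j
      by_cases hi : i = ℓ <;> by_cases hj : i = j <;> simp_all [eq_comm]
    refine ⟨?_, ?_⟩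
    · refine posSemidef_of_finite fun s => ?_
      rw [h1, Matrix.submatrix_diagonal _ _ Subtype.val_injective]
      exact Matrix.PosSemidef.diagonal fun i => by
        simp only [Function.comp_apply, Pi.zero_apply]
        split_ifs <;> simp
    · rw [h1]
      simp only [Matrix.diagonal_apply_eq]
      exact hasSum_ite_eq ℓ 1
  have hX := fun h => hℓ.tens u.split (hη h)
  let G : Set (Fin l → ℝ) → Data r l → Op u.E := fun Δ h => envAct u v (Φ Δ h) ℓ (hη h).isPosTC.mem
  have hGm : ∀ Δ, MeasurableSet Δ → ∀ a b, Measurable fun h => G Δ h a b := fun Δ hΔ a b =>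
    measurable_ampl v.split (hΦ Δ hΔ) (hΦm Δ hΔ) (fun h => (hX h).isPosTC)
      (fun p q => by
        simp only [tens_apply]
        exact (hηm _ _).const_mul _) _ _
  have hGC : ∀ Δ, MeasurableSet Δ → ∀ h a b, ‖G Δ h a b‖ ≤ 4 := fun Δ hΔ h a b => by
    have := (hΦ Δ hΔ h).norm_ampl_le v.split (hX h).isPosTC (u.split.symm (ℓ, a))
      (u.split.symm (ℓ, b))
    rw [(hX h).tr_re_eq, mul_one] at this
    exact this
  have hstep : ∀ (f : Data r l → TC K) (f' : Data (r + 1) l → TC K) (ξ : Data r l → Op u.L),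
      IsStep v Φ μ f f' → (∀ᵐ h ∂(μ.map trunc), (f h : Op K) = tens u.split (ξ h) (η h)) →
      ∀ A Δ, MeasurableSet A → MeasurableSet Δ → ∀ p q,
      ∫ h in rectEvent A Δ, (f' h : Op K) p q ∂μ =
        ∫ h in A, ξ h (u.split p).1 (u.split q).1 * G Δ h (u.split p).2 (u.split q).2
          ∂(μ.map trunc) := by
    intro f f' ξ hs he A Δ hA hΔ p q
    rw [hs A Δ hA hΔ]
    refine setIntegral_congr_ae hA (he.mono fun h hh _ => ?_)
    have hm : tens u.split (ξ h) (η h) ∈ TC K := hh ▸ (f h).2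
    rw [show f h = ⟨_, hm⟩ from Subtype.ext hh, huv.ampl_tens (Φ Δ h) ℓ (hη h).isPosTC.mem]
  let e' := u.split.trans (Equiv.prodComm _ _)
  obtain ⟨k1, k2⟩ := factor_step e' (fun h => (h₀ h).isPosTC) (fun h => (h₀ h).tr_re_eq.le) hm₀
    hξ₀ hξ₀m hGm hGC (fun A Δ hA hΔ p q => by
      rw [hstep f₀ f₀' ξ₀ hs₀ he₀ A Δ hA hΔ]
      simp only [mul_comm]
      rfl)
  have k3 : ∀ p q, ∀ᵐ h ∂μ, (f₁' h : Op K) p q = ξ₁ (trunc h) (u.split p).1 (u.split q).1 *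
      ptr e' (f₀' h : Op K) (u.split p).2 (u.split q).2 := fun p q =>
    ae_eq_mul_of_forall_rectEvent
      (F := fun h => ptr e' (f₀' h : Op K) (u.split p).2 (u.split q).2)
      (F' := fun h => (f₁' h : Op K) p q)
      (Integrable.of_bound (measurable_ptr e' (fun h => (h₀ h).isPosTC) hm₀ _ _).aestronglyMeasurable
        1 (Eventually.of_forall fun h => (((h₀ h).ptr e').isPosTC.norm_entry_le_tr _ _).trans
          ((h₀ h).ptr e').tr_re_eq.le))
      (Integrable.of_bound (hm₁ p q).aestronglyMeasurable c
        (Eventually.of_forall fun h => ((h₁ h).norm_entry_le_tr _ _).trans (hc h)))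
      (G := fun Δ h => G Δ h (u.split p).2 (u.split q).2) (fun Δ hΔ => hGm Δ hΔ _ _) (c := 4)
      (fun Δ hΔ h => hGC Δ hΔ h _ _) (fun A Δ hA hΔ => k1 A Δ hA hΔ _ _)
      (φ := fun h => ξ₁ h (u.split p).1 (u.split q).1) (hξ₁m _ _) (C := c)
      (fun h => ((hξ₁ h).1.norm_entry_le_tr _ _).trans (hξ₁ h).2)
      (hstep f₁ f₁' ξ₁ hs₁ he₁ · · · · p q)
  have k4 : ∀ᵐ h ∂μ, (f₁' h : Op K) = tens u.split (ξ₁ (trunc h)) (ptr e' (f₀' h : Op K)) := by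
    filter_upwards [ae_all_iff.2 fun p => ae_all_iff.2 fun q => k3 p q] with h hh
    ext p q
    rw [hh p q, tens_apply]
  refine ⟨⟨fun h => ptr e' (f₀' h : Op K), fun h => ξ₀ (trunc h), fun h => ξ₁ (trunc h),
    fun h => (h₀ h).ptr _, fun h => hξ₀ _, fun h => hξ₁ _,
    measurable_ptr _ (fun h => (h₀ h).isPosTC) hm₀, fun i j => (hξ₀m i j).comp measurable_trunc,
    fun i j => (hξ₁m i j).comp measurable_trunc, ?_, k4⟩, ?_⟩
  · filter_upwards [k2] with h hh
    rw [hh]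
    ext p q
    simp only [tens_apply, mul_comm]
    rw [← hh]
    rfl
  · have k5 : ∀ᵐ h ∂μ, (f₁ (trunc h) : Op K) = tens u.split (ξ₁ (trunc h)) (η (trunc h)) :=
      ae_of_ae_map measurable_trunc.aemeasurable he₁
    filter_upwards [k4, k5] with h hh hh'
    rw [hh, hh', tr_tens _ (hξ₁ _).1.mem ((h₀ h).ptr e').isPosTC.mem,
      tr_tens _ (hξ₁ _).1.mem (hη _).isPosTC.mem, ((h₀ h).ptr e').tr_eq, (hη _).tr_eq]

end step

/-! ### Laws of the data of local measurements -/

section run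

variable {K : Type} {l R : ℕ}

/-- A measure below a multiple of another one has a bounded density with finite values. -/
theorem exists_density {α : Type*} [MeasurableSpace α] {μ ν : Measure α} [IsFiniteMeasure μ]
    [IsFiniteMeasure ν] {c : NNReal} (h : μ ≤ c • ν) :
    ∃ g : α → NNReal, Measurable g ∧ (∀ a, g a ≤ c) ∧ μ = ν.withDensity fun a => (g a : ℝ≥0∞) := by
  have hac : μ ≪ ν := (Measure.absolutelyContinuous_of_le h).trans
    (Measure.smul_absolutelyContinuous (c := c))
  have hle : μ.rnDeriv ν ≤ᵐ[ν] fun _ => (c : ℝ≥0∞) := by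
    refine ae_le_of_forall_setLIntegral_le_of_sigmaFinite (Measure.measurable_rnDeriv μ ν)
      fun s hs _ => ?_
    rw [← withDensity_apply _ hs, Measure.withDensity_rnDeriv_eq μ ν hac, setLIntegral_const]
    exact h s
  refine ⟨fun a => (min (μ.rnDeriv ν a) c).toNNReal,
    ((Measure.measurable_rnDeriv μ ν).min measurable_const).ennreal_toNNReal, fun a => ?_, ?_⟩
  · exact (ENNReal.toNNReal_mono ENNReal.coe_ne_top (min_le_right _ _)).trans_eq
      (ENNReal.toNNReal_coe c)
  · conv_lhs => rw [← Measure.withDensity_rnDeriv_eq μ ν hac]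
    refine withDensity_congr_ae (hle.mono fun a ha => ?_)
    change μ.rnDeriv ν a = ((min (μ.rnDeriv ν a) (c : ℝ≥0∞)).toNNReal : ℝ≥0∞)
    have ha : μ.rnDeriv ν a ≤ c := ha
    rw [min_eq_left ha, ENNReal.coe_toNNReal (ne_top_of_le_ne_top ENNReal.coe_ne_top ha)]

theorem measurableSet_rectEvent {r : ℕ} {A : Set (Data r l)} {Δ : Set (Fin l → ℝ)}
    (hA : MeasurableSet A) (hΔ : MeasurableSet Δ) : MeasurableSet (rectEvent A Δ) :=
  (measurable_trunc hA).inter (measurableSet_last hΔ)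

theorem LocalSite.countable_L [Countable K] [Nonempty K] (u : LocalSite K) : Countable u.L := by
  obtain ⟨k⟩ := ‹Nonempty K›
  exact Function.Injective.countable (f := fun i => u.split.symm (i, (u.split k).2))
    fun i j h => by simpa using h

theorem LocalSite.countable_E [Countable K] [Nonempty K] (u : LocalSite K) : Countable u.E := by
  obtain ⟨k⟩ := ‹Nonempty K›
  exact Function.Injective.countable (f := fun i => u.split.symm ((u.split k).1, i))
    fun i j h => by simpa using h

variable {s : ℕ → LocalSite K} {N : ∀ r, Data r l → Instrument (s r).L (Fin l → ℝ)}

/-- The instruments depend measurably on the data. -/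
def MeasurableSteps (R : ℕ) (s : ℕ → LocalSite K)
    (N : ∀ r, Data r l → Instrument (s r).L (Fin l → ℝ)) : Prop :=
  ∀ r, r < R → ∀ Δ, MeasurableSet Δ → ∀ A i j,
    Measurable fun h => ((N r h).map Δ A : Op (s r).L) i j

section one

variable {τ : Op K} {P : ∀ r, Measure (Data r l)} {σ : ∀ r, Data r l → TC K}

/-- The law of the data after a step extends the law before it, because the instruments preserve the
trace. -/
theorem IsRun.map_trunc [Countable K] [Nonempty K] (hN : MeasurableSteps R s N)
    (h : IsRun R s N τ P σ) {r : ℕ} (hr : r < R) : (P (r + 1)).map trunc = P r := by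
  have := (s r).countable_L
  have := h.prob (r + 1) hr
  have := h.prob r hr.le
  have hst := h.state (r + 1) hr
  have hst' := h.state r hr.le
  have hpos := fun d => (N r d).isPosMap MeasurableSet.univ
  refine Measure.ext fun A hA => ?_
  rw [Measure.map_apply measurable_trunc hA, ← ENNReal.toReal_eq_toReal_iff'
    (measure_ne_top _ _) (measure_ne_top _ _)]
  have a1 := hasSum_integral_of_sum_norm_le (μ := (P (r + 1)).restrict (trunc ⁻¹' A))
    (F := fun p d => (σ (r + 1) d : Op K) p p) (fun p => h.meas (r + 1) hr p p) (C := 1)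
    (fun t d => by
      have hz := (hst d).isPosTC
      rw [← (hst d).tr_re_eq, hz.tr_re]
      refine (Finset.sum_le_sum fun a _ => ?_).trans
        (hz.summable_re.sum_le_tsum t fun a _ => diag_re_nonneg hz.1 a)
      have := norm_entry_le hz.1 a a
      linarith)
  have a2 := hasSum_integral_of_sum_norm_le (μ := (P r).restrict A)
    (F := fun p d => ampl (s r).split ((N r d).map Set.univ) (σ r d) p p)
    (fun p => measurable_ampl (s r).split hpos (hN r hr _ MeasurableSet.univ)
      (X := fun d => (σ r d : Op K)) (fun d => (hst' d).isPosTC) (h.meas r hr.le) p p) (C := 1)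
    (fun t d => by
      have hz := (hst' d).isPosTC
      have h1 := hasSum_ampl_diag (s r).split (hpos d) (N r d).trace_preserving hz
      rw [(hst' d).tr_re_eq] at h1
      refine (Finset.sum_le_sum fun a _ => ?_).trans (sum_le_hasSum t
        (fun a _ => (ampl_diag_eq_re (s r).split (hpos d) hz a).1) h1)
      have h2 := ampl_diag_eq_re (s r).split (hpos d) hz a
      change ‖ampl (s r).split ((N r d).map Set.univ) ⟨_, hz.mem⟩ a a‖ ≤ _
      rw [h2.2, Complex.norm_real, Real.norm_of_nonneg h2.1, Complex.ofReal_re])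
  have a3 : ∀ p, ∫ d in trunc ⁻¹' A, (σ (r + 1) d : Op K) p p ∂(P (r + 1)) =
      ∫ d in A, ampl (s r).split ((N r d).map Set.univ) (σ r d) p p ∂(P r) := fun p => by
    rw [← h.step r hr A Set.univ hA MeasurableSet.univ p p]
    change _ = ∫ d in rectEvent A Set.univ, _ ∂_
    rw [rectEvent_univ]
  simp only [a3] at a1
  have a4 := a1.unique a2
  have b1 : ∀ d, ∑' p, (σ (r + 1) d : Op K) p p = 1 := fun d => (hst d).tr_eq
  have b2 : ∀ d, ∑' p, ampl (s r).split ((N r d).map Set.univ) (σ r d) p p = 1 := fun d => by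
    have hz := (hst' d).isPosTC
    have h1 := hasSum_ampl_diag (s r).split (hpos d) (N r d).trace_preserving hz
    rw [(hst' d).tr_re_eq] at h1
    have h2 := Complex.hasSum_ofReal.2 h1
    rw [Complex.ofReal_one] at h2
    rw [← h2.tsum_eq]
    exact tsum_congr fun p => (ampl_diag_eq_re (s r).split (hpos d) hz p).2
  simp only [b1, b2, integral_const] at a4
  simpa [Measure.real] using a4

/-- The first `r` data. -/
def initData {r : ℕ} (h : r ≤ R) (ω : Data R l) : Data r l := fun q => ω (Fin.castLE h q)

theorem measurable_initData {r : ℕ} (h : r ≤ R) :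
    Measurable (initData h : Data R l → Data r l) :=
  measurable_pi_iff.2 fun _ => measurable_pi_apply _

theorem IsRun.map_initData [Countable K] [Nonempty K] (hN : MeasurableSteps R s N)
    (h : IsRun R s N τ P σ) {r : ℕ} (hr : r ≤ R) : (P R).map (initData hr) = P r := by
  obtain ⟨k, hk⟩ := Nat.exists_eq_add_of_le' hr
  induction k generalizing r with
  | zero =>
    obtain rfl : R = r := by omega
    exact Measure.map_id
  | succ k ih =>
    have hr' : r + 1 ≤ R := by omega
    rw [← h.map_trunc hN hr', ← ih hr' (by omega), Measure.map_map measurable_trunc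
      (measurable_initData hr')]
    rfl

end one

/-- The product form at the site `u` is preserved by every step at `u` or at a site independent of `u`.
In the second case, the step does not change the trace of the second family relative to the first. -/
theorem IsProductAt.step {r : ℕ} {μ : Measure (Data (r + 1) l)} [IsFiniteMeasure μ] {c : ℝ}
    {f₀ f₁ : Data r l → TC K} {f₀' f₁' : Data (r + 1) l → TC K} [Countable K] [Nonempty K]
    {u v : LocalSite K} (huv : v = u ∨ IsIndepOf u v)
    {Φ : Set (Fin l → ℝ) → Data r l → TC v.L →ₗ[ℂ] TC v.L}
    (hΦ : ∀ Δ, MeasurableSet Δ → ∀ h, IsPosMap (Φ Δ h))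
    (hΦm : ∀ Δ, MeasurableSet Δ → ∀ A i j, Measurable fun h => (Φ Δ h A : Op v.L) i j)
    (h₀ : ∀ h, IsState (f₀' h : Op K)) (h₁ : ∀ h, IsPosTC (f₁' h : Op K))
    (hc : ∀ h, (tr (f₁' h : Op K)).re ≤ c)
    (hm₀ : ∀ p q, Measurable fun h => (f₀' h : Op K) p q)
    (hm₁ : ∀ p q, Measurable fun h => (f₁' h : Op K) p q)
    (hs₀ : IsStep v Φ μ f₀ f₀') (hs₁ : IsStep v Φ μ f₁ f₁')
    (hp : IsProductAt u c (μ.map trunc) f₀ f₁) :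
    IsProductAt u c μ f₀' f₁' ∧ (IsIndepOf u v →
      ∀ᵐ h ∂μ, (tr (f₁' h : Op K)).re = (tr (f₁ (trunc h) : Op K)).re) := by
  have := u.countable_L
  have := u.countable_E
  have := v.countable_L
  have : Nonempty u.L := ⟨(u.split (Classical.arbitrary K)).1⟩
  refine ⟨?_, fun h => (hp.step_indep h hΦ hΦm h₀ h₁ hc hm₀ hm₁ hs₀ hs₁).2⟩
  rcases huv with rfl | h
  · exact hp.step_self hΦ hΦm h₀ h₁ hc hm₀ hm₁ hs₀ hs₁
  · exact (hp.step_indep h hΦ hΦm h₀ h₁ hc hm₀ hm₁ hs₀ hs₁).1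

theorem isPosTC_coe_smul {A : Op K} (hA : IsPosTC A) (g : NNReal) :
    IsPosTC (((g : ℝ) : ℂ) • A) ∧ (tr (((g : ℝ) : ℂ) • A)).re = g * (tr A).re :=
  ⟨hA.smul g.2, by rw [tr_smul_complex, Complex.re_ofReal_mul]⟩

theorem setIntegral_withDensity {α : Type*} [MeasurableSpace α] {ν : Measure α} {g : α → NNReal}
    (hg : Measurable g) (f : α → ℂ) {A : Set α} (hA : MeasurableSet A) :
    ∫ a in A, f a ∂(ν.withDensity fun a => (g a : ℝ≥0∞)) =
      ∫ a in A, ((g a : ℝ) : ℂ) * f a ∂ν := by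
  rw [setIntegral_withDensity_eq_setIntegral_smul hg f hA]
  rfl

/-- Two inputs that differ only at the site `u`: at the steps of sites that are independent of `u`
the likelihood ratio does not change. -/
theorem IsRun.exists_density [Countable K] [Nonempty K] (hN : MeasurableSteps R s N)
    {u : LocalSite K} (hs : ∀ r, r < R → s r = u ∨ IsIndepOf u (s r)) {x₀ x₁ : Op u.L}
    {y : Op u.E} (hx₀ : IsState x₀) (hx₁ : IsState x₁) (hy : IsState y)
    {P₀ P₁ : ∀ r, Measure (Data r l)} {σ₀ σ₁ : ∀ r, Data r l → TC K}
    (h₀ : IsRun R s N (tens u.split x₀ y) P₀ σ₀) (h₁ : IsRun R s N (tens u.split x₁ y) P₁ σ₁)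
    {c : NNReal} (hc : P₁ R ≤ c • P₀ R) {r : ℕ} (hr : r < R) (hu : IsIndepOf u (s r)) :
    ∃ g : Data r l → NNReal, Measurable g ∧ (∀ h, g h ≤ c) ∧
      P₁ (r + 1) = (P₀ (r + 1)).withDensity fun h => (g (trunc h) : ℝ≥0∞) := by
  have hle : ∀ r, r ≤ R → P₁ r ≤ c • P₀ r := fun r hr => by
    rw [← h₀.map_initData hN hr, ← h₁.map_initData hN hr, ← Measure.map_smul]
    exact Measure.map_mono hc (measurable_initData hr)
  have hd : ∀ r, ∃ g : Data r l → NNReal, r ≤ R → Measurable g ∧ (∀ a, g a ≤ c) ∧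
      P₁ r = (P₀ r).withDensity fun a => (g a : ℝ≥0∞) := fun r => by
    by_cases hr : r ≤ R
    · have := h₀.prob r hr
      have := h₁.prob r hr
      obtain ⟨g, hg⟩ := QEst.exists_density (hle r hr)
      exact ⟨g, fun _ => hg⟩
    · exact ⟨0, fun h => absurd h hr⟩
  choose g hg using hd
  -- the second run, relative to the laws of the data in the first one: the trace of `f r` is the
  -- likelihood ratio `g r` of the first `r` data
  let f : ∀ r, Data r l → TC K := fun r h => ((g r h : ℝ) : ℂ) • σ₁ r h
  have hf : ∀ r, r ≤ R → ∀ h, IsPosTC (f r h : Op K) := fun r hr h =>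
    (isPosTC_coe_smul (h₁.state r hr h).isPosTC _).1
  have hftr : ∀ r, r ≤ R → ∀ h, (tr (f r h : Op K)).re = g r h := fun r hr h => by
    have := (isPosTC_coe_smul (h₁.state r hr h).isPosTC (g r h)).2
    rwa [(h₁.state r hr h).tr_re_eq, mul_one] at this
  have hfm : ∀ r, r ≤ R → ∀ p q, Measurable fun h => (f r h : Op K) p q := fun r hr p q =>
    (Complex.measurable_ofReal.comp (hg r hr).1.coe_nnreal_real).mul (h₁.meas r hr p q)
  have hstep : ∀ r, r < R → IsStep (s r) (fun Δ h => (N r h).map Δ) (P₀ (r + 1)) (f r)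
      (f (r + 1)) := fun r hr A Δ hA hΔ p q => by
    have e1 := h₁.step r hr A Δ hA hΔ p q
    change ∫ h in rectEvent A Δ, _ ∂_ = _ at e1
    rw [(hg r hr.le).2.2, (hg (r + 1) hr).2.2,
      setIntegral_withDensity (hg (r + 1) hr).1 _ (measurableSet_rectEvent hA hΔ), setIntegral_withDensity (hg r hr.le).1 _ hA] at e1
    rw [h₀.map_trunc hN hr]
    refine e1.trans (setIntegral_congr_fun hA fun h _ => ?_)
    have : (⟨block (s r).split (f r h : Op K) ((s r).split p).2 ((s r).split q).2,
        block_mem _ (f r h).2 _ _⟩ : TC (s r).L) = ((g r h : ℝ) : ℂ) •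
        ⟨block (s r).split (σ₁ r h : Op K) ((s r).split p).2 ((s r).split q).2,
        block_mem _ (σ₁ r h).2 _ _⟩ := Subtype.ext rfl
    simp only [ampl, Matrix.of_apply]
    rw [this, map_smul]
    rfl
  have hstep₀ : ∀ r, r < R → IsStep (s r) (fun Δ h => (N r h).map Δ) (P₀ (r + 1)) (σ₀ r)
      (σ₀ (r + 1)) := fun r hr A Δ hA hΔ p q => by
    rw [h₀.map_trunc hN hr]
    exact h₀.step r hr A Δ hA hΔ p q
  have hgo : ∀ r (hr : r < R), IsProductAt u c (P₀ r) (σ₀ r) (f r) →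
      IsProductAt u c (P₀ (r + 1)) (σ₀ (r + 1)) (f (r + 1)) ∧ (IsIndepOf u (s r) →
      ∀ᵐ h ∂(P₀ (r + 1)), (tr (f (r + 1) h : Op K)).re = (tr (f r (trunc h) : Op K)).re) :=
      fun r hr hp => by
    have := h₀.prob (r + 1) hr
    rw [← h₀.map_trunc hN hr] at hp
    exact hp.step (hs r hr) (fun Δ hΔ h => (N r h).isPosMap hΔ) (hN r hr)
      (h₀.state (r + 1) hr) (hf (r + 1) hr)
      (fun h => by rw [hftr (r + 1) hr]; exact_mod_cast (hg (r + 1) hr).2.1 h)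
      (h₀.meas (r + 1) hr) (hfm (r + 1) hr) (hstep₀ r hr) (hstep r hr)
  have hprod : ∀ r, r ≤ R → IsProductAt u c (P₀ r) (σ₀ r) (f r) := by
    intro r
    induction r with
    | zero =>
      intro hr
      refine ⟨fun _ => y, fun _ => x₀, fun h => ((g 0 h : ℝ) : ℂ) • x₁, fun _ => hy, fun _ => hx₀,
        fun h => ⟨(isPosTC_coe_smul hx₁.isPosTC _).1, ?_⟩, fun _ _ => measurable_const,
        fun _ _ => measurable_const, fun i j => ?_, Eventually.of_forall fun h => ?_,
        Eventually.of_forall fun h => ?_⟩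
      · rw [(isPosTC_coe_smul hx₁.isPosTC _).2, hx₁.tr_re_eq, mul_one]
        exact_mod_cast (hg 0 hr).2.1 h
      · exact (Complex.measurable_ofReal.comp (hg 0 hr).1.coe_nnreal_real).mul measurable_const
      · exact h₀.init h
      · rw [tens_smul_left, ← h₁.init h]
        rfl
    | succ r ih => exact fun hr => (hgo r hr (ih (by omega))).1
  refine ⟨g r, (hg r hr.le).1, (hg r hr.le).2.1, ?_⟩
  have hae := (hgo r hr (hprod r hr.le)).2 hu
  rw [(hg (r + 1) hr).2.2]
  refine withDensity_congr_ae (hae.mono fun h hh => ?_)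
  rw [hftr (r + 1) hr, hftr r hr.le] at hh
  have hh' : g (r + 1) h = g r (trunc h) := by exact_mod_cast hh
  simp only [hh']

/-- The two laws `μ₁ ≤ c μ₀` of the data have a likelihood ratio for the first `r + 1` data that is
a function of the first `r` data. -/
def RatioStable (μ₀ μ₁ : Measure (Data R l)) (r : ℕ) (hr : r < R) : Prop :=
  ∃ (c : NNReal) (g : Data r l → NNReal), Measurable g ∧ (∀ h, g h ≤ c) ∧
    ∀ f : Data (r + 1) l → ℝ, Measurable f →
      ∫ ω, f (initData hr ω) ∂μ₁ = ∫ ω, (g (initData hr.le ω) : ℝ) * f (initData hr ω) ∂μ₀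

/-- In a local measurement, the steps of the sites that are independent of `u` do not discriminate
between inputs that differ only at `u`. -/
theorem IsLOCC.exists_sites [Countable K] [Nonempty K] {S : Set (LocalSite K)}
    {M : POVM K (Data R l)} (h : IsLOCC S M) : ∃ s : ℕ → LocalSite K, (∀ r, r < R → s r ∈ S) ∧
      ∀ u : LocalSite K, (∀ v ∈ S, v = u ∨ IsIndepOf u v) → ∀ (x₀ x₁ : Op u.L) (y : Op u.E),
        IsState x₀ → IsState x₁ → IsState y → ∀ c : NNReal,
        law M (tens u.split x₁ y) ≤ c • law M (tens u.split x₀ y) →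
        ∀ r (hr : r < R), IsIndepOf u (s r) →
          RatioStable (law M (tens u.split x₀ y)) (law M (tens u.split x₁ y)) r hr := by
  obtain ⟨s, N, hsS, hN, hrun⟩ := h
  refine ⟨s, hsS, fun u hu x₀ x₁ y hx₀ hx₁ hy c hc r hr hind => ?_⟩
  obtain ⟨P₀, σ₀, h₀, hP₀⟩ := hrun _ (hx₀.tens u.split hy)
  obtain ⟨P₁, σ₁, h₁, hP₁⟩ := hrun _ (hx₁.tens u.split hy)
  rw [law_eq_of M (hx₀.tens u.split hy).isPosTC hP₀,
    law_eq_of M (hx₁.tens u.split hy).isPosTC hP₁] at hc ⊢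
  obtain ⟨g, hg, hgc, hP⟩ := h₀.exists_density hN (fun r hr => hu _ (hsS r hr)) hx₀ hx₁ hy h₁ hc hr
    hind
  refine ⟨c, g, hg, hgc, fun f hf => ?_⟩
  have hgm : Measurable fun h : Data (r + 1) l => g (trunc h) := hg.comp measurable_trunc
  rw [← integral_map (measurable_initData hr).aemeasurable hf.aestronglyMeasurable,
    h₁.map_initData hN hr, hP, integral_withDensity_eq_integral_smul hgm,
    ← h₀.map_initData hN hr]
  exact integral_map (measurable_initData hr).aemeasurable (hgm.smul hf).aestronglyMeasurable

end run

/-! ### Martingale differences -/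

section martingale

theorem integrable_of_abs_le {α : Type*} [MeasurableSpace α] {μ : Measure α} [IsFiniteMeasure μ]
    {f : α → ℝ} (hf : Measurable f) {C : ℝ} (hC : ∀ a, |f a| ≤ C) : Integrable f μ :=
  Integrable.of_bound hf.aestronglyMeasurable C (Eventually.of_forall hC)

/-- Conditional expectations of bounded functions, as bounded functions of the condition. -/
theorem exists_condExp_factor {Ω α : Type*} [mΩ : MeasurableSpace Ω] [MeasurableSpace α]
    (μ : Measure Ω) [IsFiniteMeasure μ] {π : Ω → α} (hπ : Measurable π) {f : Ω → ℝ}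
    (hf : Measurable f) {C : ℝ} (hC : ∀ ω, |f ω| ≤ C) (hC0 : 0 ≤ C) :
    ∃ k : α → ℝ, Measurable k ∧ (∀ a, |k a| ≤ C) ∧ ∀ φ : α → ℝ, Measurable φ →
      ∀ D : ℝ, (∀ a, |φ a| ≤ D) → ∫ ω, φ (π ω) * f ω ∂μ = ∫ ω, φ (π ω) * k (π ω) ∂μ := by
  have hle : MeasurableSpace.comap π inferInstance ≤ mΩ := hπ.comap_le
  obtain ⟨k₀, hk₀, hk⟩ := (stronglyMeasurable_condExp (μ := μ) (f := f)
    (m := MeasurableSpace.comap π inferInstance)).exists_eq_measurable_comp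
  have hint := integrable_of_abs_le (μ := μ) hf hC
  have hbd : ∀ᵐ ω ∂μ, |(μ[f | MeasurableSpace.comap π inferInstance]) ω| ≤ C :=
    ae_bdd_abs_condExp_of_ae_bdd_abs (Eventually.of_forall hC)
  refine ⟨fun a => max (-C) (min C (k₀ a)),
    measurable_const.max (measurable_const.min hk₀.measurable), fun a => ?_, fun φ hφ D hD => ?_⟩
  · exact abs_le.2 ⟨le_max_left _ _, max_le (by linarith) (min_le_left _ _)⟩
  · have hφf : Integrable (fun ω => φ (π ω) * f ω) μ :=
      hint.bdd_mul (c := D) (hφ.comp hπ).aestronglyMeasurable (Eventually.of_forall fun _ => hD _)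
    rw [← integral_condExp hle (f := fun ω => φ (π ω) * f ω)]
    refine integral_congr_ae ?_
    have hpull := condExp_mul_of_stronglyMeasurable_left (μ := μ)
      (m := MeasurableSpace.comap π inferInstance) (f := fun ω => φ (π ω)) (g := f)
      (hφ.comp (comap_measurable π)).stronglyMeasurable hφf hint
    filter_upwards [hbd, hpull] with ω h1 h2
    rw [show μ[fun ω => φ (π ω) * f ω | MeasurableSpace.comap π inferInstance] ω = _ from h2]
    have h3 : (μ[f | MeasurableSpace.comap π inferInstance]) ω = k₀ (π ω) := congrFun hk ω
    rw [h3] at h1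
    have h4 : |k₀ (π ω)| ≤ C := h1
    rw [Pi.mul_apply, h3, min_eq_right (abs_le.1 h4).2, max_eq_right (abs_le.1 h4).1]

variable {R l : ℕ}

/-- A step whose transition is the same for both `μ₀` and `μ₁` contributes nothing to the difference
of the expectations: this difference vanishes for the martingale differences of a third measure `μ`
whose likelihood ratio is stable at this step, too. -/
theorem RatioStable.integral_eq {μ₀ μ₁ μ : Measure (Data R l)} [IsFiniteMeasure μ₀]
    [IsFiniteMeasure μ₁] [IsFiniteMeasure μ] {r : ℕ} {hr : r < R} (h₁ : RatioStable μ₀ μ₁ r hr)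
    (h : RatioStable μ₀ μ r hr) (hnull : ∀ B, MeasurableSet B → μ B = 0 → μ₁ B = μ₀ B)
    {f : Data (r + 1) l → ℝ} (hf : Measurable f) {C : ℝ} (hC : ∀ d, |f d| ≤ C) (hC0 : 0 ≤ C)
    (hfμ : ∀ φ : Data r l → ℝ, Measurable φ → ∀ D : ℝ, (∀ d, |φ d| ≤ D) →
      ∫ ω, φ (initData hr.le ω) * f (initData hr ω) ∂μ = 0) :
    ∫ ω, f (initData hr ω) ∂μ₁ = ∫ ω, f (initData hr ω) ∂μ₀ := by
  obtain ⟨c, g, hg, hgc, hg1⟩ := h₁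
  obtain ⟨c', ℓ, hℓ, hℓc, hℓ1⟩ := h
  obtain ⟨k, hk, hkC, hkf⟩ := exists_condExp_factor μ₀ (measurable_initData (R := R) hr.le)
    (hf.comp (measurable_initData hr)) (fun ω => hC _) hC0
  have hkt : Measurable fun d : Data (r + 1) l => k (trunc d) := hk.comp measurable_trunc
  have hginit : ∀ ω, |((g ω : ℝ))| ≤ c := fun ω => by
    rw [NNReal.abs_eq]; exact_mod_cast hgc ω
  have hℓinit : ∀ ω, |((ℓ ω : ℝ))| ≤ c' := fun ω => by
    rw [NNReal.abs_eq]; exact_mod_cast hℓc ω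
  -- by the stability of the ratios, `k` is the conditional expectation of `f` for the three measures;
  -- it vanishes `μ`-almost everywhere, and `μ₀`, `μ₁` agree on the `μ`-null set where it does not
  have e1 : ∫ ω, f (initData hr ω) ∂μ₁ = ∫ ω, k (initData hr.le ω) ∂μ₁ := by
    rw [hg1 f hf, show ∫ ω, k (initData hr.le ω) ∂μ₁ = _ from hg1 _ hkt]
    exact hkf (fun d => (g d : ℝ)) hg.coe_nnreal_real c hginit
  have e0 : ∫ ω, f (initData hr ω) ∂μ₀ = ∫ ω, k (initData hr.le ω) ∂μ₀ := by
    simpa using hkf (fun _ => 1) measurable_const 1 (fun _ => by simp)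
  have e2 : ∫ ω, k (initData hr.le ω) * k (initData hr.le ω) ∂μ = 0 := by
    have a1 := hℓ1 _ (hkt.mul hkt)
    have a2 := hkf (fun d => (ℓ d : ℝ) * k d) (hℓ.coe_nnreal_real.mul hk) (c' * C) (fun d => by
      rw [abs_mul]
      exact mul_le_mul (hℓinit d) (hkC d) (abs_nonneg _) c'.2)
    have a3 := hℓ1 _ (hkt.mul hf)
    have a4 := hfμ k hk C hkC
    refine Eq.trans a1 (Eq.trans ?_ (a3.symm.trans a4))
    refine Eq.trans (integral_congr_ae (Eventually.of_forall fun ω => ?_)) (a2.symm.trans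
      (integral_congr_ae (Eventually.of_forall fun ω => ?_)))
    · exact (mul_assoc _ _ _).symm
    · exact mul_assoc _ _ _
  have hkm : Measurable fun ω : Data R l => k (initData hr.le ω) := hk.comp (measurable_initData _)
  have e3 : ∀ᵐ ω ∂μ, k (initData hr.le ω) = 0 := by
    have := (integral_eq_zero_iff_of_nonneg (fun ω => mul_self_nonneg (k (initData hr.le ω)))
      (integrable_of_abs_le (hkm.mul hkm) (C := C * C) (fun ω => by
        rw [abs_mul]
        exact mul_le_mul (hkC _) (hkC _) (abs_nonneg _) hC0))).1 e2
    exact this.mono fun ω hω => mul_self_eq_zero.1 hω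
  set B : Set (Data R l) := {ω | k (initData hr.le ω) ≠ 0}
  have hB : MeasurableSet B := hkm (measurableSet_singleton 0).compl
  have hμB : μ B = 0 := ae_iff.1 e3
  have hres : μ₁.restrict B = μ₀.restrict B := Measure.ext fun A hA => by
    rw [Measure.restrict_apply hA, Measure.restrict_apply hA]
    exact hnull _ (hA.inter hB) (measure_mono_null Set.inter_subset_right hμB)
  have hind : ∀ ν : Measure (Data R l),
      ∫ ω, k (initData hr.le ω) ∂ν = ∫ ω, k (initData hr.le ω) ∂(ν.restrict B) := fun ν => by
    refine (setIntegral_eq_integral_of_forall_compl_eq_zero fun ω hω => ?_).symm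
    simpa [B] using hω
  rw [e1, e0, hind, hind μ₀, hres]

/-- The decomposition of a bounded function of the data into its mean and the martingale
differences. -/
theorem exists_martingale_decomposition (P : Measure (Data R l)) [IsProbabilityMeasure P]
    {T : Data R l → ℝ} (hT : Measurable T) {C : ℝ} (hC : ∀ ω, |T ω| ≤ C) :
    ∃ (a : ℝ) (D : ∀ r, r < R → Data (r + 1) l → ℝ),
      (∀ r hr, Measurable (D r hr)) ∧ (∀ r hr d, |D r hr d| ≤ 2 * C) ∧
      (∀ r hr, ∀ φ : Data r l → ℝ, Measurable φ → ∀ b : ℝ, (∀ d, |φ d| ≤ b) →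
        ∫ ω, φ (initData hr.le ω) * D r hr (initData hr ω) ∂P = 0) ∧
      ∀ ω, T ω = a + ∑ r : Fin R, D r r.2 (initData r.2 ω) := by
  have hC0 : 0 ≤ C := (abs_nonneg _).trans (hC fun _ _ => 0)
  have hex : ∀ r, ∃ k : Data r l → ℝ, ∀ hr : r ≤ R, (Measurable k ∧ (∀ d, |k d| ≤ C) ∧
      (∀ φ : Data r l → ℝ, Measurable φ → ∀ b : ℝ, (∀ d, |φ d| ≤ b) →
        ∫ ω, φ (initData hr ω) * T ω ∂P = ∫ ω, φ (initData hr ω) * k (initData hr ω) ∂P)) ∧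
      (r = R → ∀ ω, k (initData hr ω) = T ω) := fun r => by
    rcases lt_trichotomy r R with h | rfl | h
    · obtain ⟨k, h1, h2, h3⟩ := exists_condExp_factor P (measurable_initData h.le) hT hC hC0
      exact ⟨k, fun _ => ⟨⟨h1, h2, h3⟩, fun h' => absurd h' h.ne⟩⟩
    · exact ⟨T, fun hr => ⟨⟨hT, hC, fun φ hφ b hb => rfl⟩, fun _ ω => rfl⟩⟩
    · exact ⟨0, fun h' => absurd h' h.not_ge⟩
  choose k hk using hex
  refine ⟨k 0 default, fun r hr d => k (r + 1) d - k r (trunc d), fun r hr => ?_, fun r hr d => ?_,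
    fun r hr φ hφ b hb => ?_, fun ω => ?_⟩
  · exact (hk (r + 1) hr).1.1.sub ((hk r hr.le).1.1.comp measurable_trunc)
  · have h1 := (hk (r + 1) hr).1.2.1 d
    have h2 := (hk r hr.le).1.2.1 (trunc d)
    exact (abs_sub _ _).trans (by linarith)
  · have h1 := (hk (r + 1) hr).1.2.2 (fun d => φ (trunc d)) (hφ.comp measurable_trunc) b
      (fun d => hb _)
    have h2 := (hk r hr.le).1.2.2 φ hφ b hb
    have hb0 : 0 ≤ b := (abs_nonneg _).trans (hb fun _ _ => 0)
    have hi : ∀ {q : ℕ} (hq : q ≤ R), Integrable (fun ω => φ (initData hr.le ω) *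
        k q (initData hq ω)) P := fun hq =>
      integrable_of_abs_le ((hφ.comp (measurable_initData _)).mul
        ((hk _ hq).1.1.comp (measurable_initData _))) (C := b * C) (fun ω => by
          rw [abs_mul]
          exact mul_le_mul (hb _) ((hk _ hq).1.2.1 _) (abs_nonneg _) hb0)
    calc ∫ ω, φ (initData hr.le ω) * (k (r + 1) (initData hr ω) - k r (initData hr.le ω)) ∂P
        = ∫ ω, (φ (initData hr.le ω) * k (r + 1) (initData hr ω) -
            φ (initData hr.le ω) * k r (initData hr.le ω)) ∂P := by simp only [mul_sub]
      _ = 0 := by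
        rw [integral_sub (hi hr) (hi hr.le), ← h2]
        exact sub_eq_zero.2 h1.symm
  -- telescoping
  · let F : ℕ → ℝ := fun r => if hr : r ≤ R then k r (initData hr ω) else 0
    have h1 : ∀ r : Fin R, k (r + 1) (initData r.2 ω) - k r (trunc (initData r.2 ω)) =
        F (r + 1) - F r := fun r => by
      simp only [F, dif_pos r.2.le, dif_pos (show (r : ℕ) + 1 ≤ R from r.2)]
      rfl
    simp only [h1]
    rw [Fin.sum_univ_eq_sum_range (fun r => F (r + 1) - F r) R, Finset.sum_range_sub]
    simp only [F, dif_pos le_rfl, dif_pos (Nat.zero_le R), (hk R le_rfl).2 rfl]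
    rw [Subsingleton.elim (initData (Nat.zero_le R) ω) default]
    ring

end martingale

/-! ### Splitting an estimator into contributions of the sites -/

section moments

variable {Ω : Type} [MeasurableSpace Ω] {ν : Type*} [Fintype ν] {m : ℕ}

theorem integral_affine (μ : Measure Ω) [IsFiniteMeasure μ] {d : ν → Ω → ℝ}
    (hd : ∀ r, Integrable (d r) μ) (a : ℝ) (κ : ν → ℝ) :
    ∫ ω, (a + ∑ r, κ r * d r ω) ∂μ = a * μ.real Set.univ + ∑ r, κ r * ∫ ω, d r ω ∂μ := by
  rw [integral_add (integrable_const _) (integrable_finsetSum _ fun r _ => (hd r).const_mul _),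
    integral_finsetSum _ fun r _ => (hd r).const_mul _]
  simp only [integral_const_mul, integral_const, smul_eq_mul]
  ring

/-- The covariance of linear combinations of orthogonal centered variables. -/
theorem cov_of_orthogonal (P : Measure Ω) [IsProbabilityMeasure P] {d : ν → Fin m → Ω → ℝ}
    (hm : ∀ r i, Measurable (d r i)) {b : ℝ} (hb : ∀ r i ω, |d r i ω| ≤ b)
    (h0 : ∀ r i, ∫ ω, d r i ω ∂P = 0)
    (ho : ∀ r r', r ≠ r' → ∀ i j, ∫ ω, d r i ω * d r' j ω ∂P = 0) (a : Fin m → ℝ) (κ : ν → ℝ)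
    (i j : Fin m) :
    ∫ ω, (a i + ∑ r, κ r * d r i ω) * (a j + ∑ r, κ r * d r j ω) ∂P -
      (∫ ω, (a i + ∑ r, κ r * d r i ω) ∂P) * ∫ ω, (a j + ∑ r, κ r * d r j ω) ∂P =
    ∑ r, κ r ^ 2 * ∫ ω, d r i ω * d r j ω ∂P := by
  classical
  have hi : ∀ r i, Integrable (d r i) P := fun r i => integrable_of_abs_le (hm r i) (hb r i)
  have hii : ∀ r r' i j, Integrable (fun ω => d r i ω * d r' j ω) P := fun r r' i j =>
    integrable_of_abs_le ((hm r i).mul (hm r' j)) (C := b * b) fun ω => by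
      rw [abs_mul]
      exact mul_le_mul (hb _ _ _) (hb _ _ _) (abs_nonneg _) ((abs_nonneg _).trans (hb r i ω))
  have e1 : ∀ ω, (a i + ∑ r, κ r * d r i ω) * (a j + ∑ r, κ r * d r j ω) =
      (a i * a j + ∑ r, (a i * κ r) * d r j ω) + (0 + ∑ r, (a j * κ r) * d r i ω) +
        (0 + ∑ p : ν × ν, (κ p.1 * κ p.2) * (d p.1 i ω * d p.2 j ω)) := fun ω => by
    rw [Fintype.sum_prod_type, add_mul, mul_add, mul_add, Finset.sum_mul_sum, Finset.mul_sum,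
      Finset.sum_mul]
    simp only [zero_add]
    have : ∀ r r', κ r * d r i ω * (κ r' * d r' j ω) =
        κ r * κ r' * (d r i ω * d r' j ω) := fun r r' => by ring
    simp only [this]
    rw [Finset.sum_congr rfl fun r _ => show a i * (κ r * d r j ω) = a i * κ r * d r j ω by ring,
      Finset.sum_congr rfl fun r _ => show κ r * d r i ω * a j = a j * κ r * d r i ω by ring]
    ring
  have haff : ∀ (a : ℝ) (κ : ν → ℝ) (i : Fin m),
      Integrable (fun ω => a + ∑ r, κ r * d r i ω) P := fun a κ i =>
    (integrable_const _).add (integrable_finsetSum _ fun r _ => (hi r i).const_mul _)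
  simp only [e1]
  have haff2 : Integrable (fun ω => 0 + ∑ p : ν × ν, (κ p.1 * κ p.2) * (d p.1 i ω * d p.2 j ω)) P :=
    (integrable_const _).add (integrable_finsetSum _ fun p _ => (hii p.1 p.2 i j).const_mul _)
  have haff3 : Integrable (fun ω => (a i * a j + ∑ r, (a i * κ r) * d r j ω) +
      (0 + ∑ r, (a j * κ r) * d r i ω)) P := (haff _ _ _).add (haff _ _ _)
  rw [integral_add haff3 haff2, integral_add (haff _ _ _) (haff _ _ _), integral_affine P (fun r => hi r j),
    integral_affine P (fun r => hi r i), integral_affine P (fun r => hi r i),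
    integral_affine P (fun r => hi r j),
    integral_affine P (d := fun (p : ν × ν) ω => d p.1 i ω * d p.2 j ω)
      (fun p => hii p.1 p.2 i j), Fintype.sum_prod_type]
  simp only [h0, mul_zero, Finset.sum_const_zero, add_zero, zero_add, probReal_univ,
    mul_one, add_sub_cancel_left]
  refine Finset.sum_congr rfl fun r _ => ?_
  rw [Finset.sum_eq_single r (fun r' _ hr' => by rw [ho r r' hr'.symm, mul_zero]) (by simp), sq]

variable {K : Type} {M : POVM K Ω} {D X : Op K}

/-- The constant does not contribute, because `X` has trace zero. -/
theorem signedInt_affine (hD : IsPosTC D) (h1 : (D - X).PosSemidef) (h2 : (D + X).PosSemidef)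
    (hX : tr X = 0) {d : ν → Ω → ℝ} (hm : ∀ r, Measurable (d r)) {b : ℝ}
    (hb : ∀ r ω, |d r ω| ≤ b) (a : ℝ) (κ : ν → ℝ) :
    signedInt M D X (fun ω => a + ∑ r, κ r * d r ω) = ∑ r, κ r * signedInt M D X (d r) := by
  have h0 := law_real_add_sub (M := M) hD h1 h2 MeasurableSet.univ
  rw [M.effect_univ, trMul_one, hX, Complex.zero_re] at h0
  simp only [signedInt]
  rw [integral_affine _ (fun r => integrable_of_abs_le (hm r) (hb r)),
    integral_affine _ (fun r => integrable_of_abs_le (hm r) (hb r))]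
  simp only [mul_sub, Finset.sum_sub_distrib]
  linear_combination a * h0

end moments

section sites

variable {K : Type} {R l m : ℕ}

/-- The martingale differences at the steps of other sites do not contribute to the derivative with
respect to the state of the site `u`. -/
theorem signedInt_eq_zero_of_ratioStable {M : POVM K (Data R l)} {u : LocalSite K}
    {x D X : Op u.L} {y : Op u.E} (hx : IsState x) (hy : IsState y) (hD : IsPosTC D)
    (h1 : (D - X).PosSemidef) (h2 : (D + X).PosSemidef) (h3 : (D - x).PosSemidef) (hX : tr X = 0)
    (hnull : ∀ E, IsEffect E → (trMul x E).re = 0 → (trMul X E).re = 0) {r : ℕ} {hr : r < R}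
    (hst : ∀ x₀ x₁ : Op u.L, IsState x₀ → IsState x₁ → ∀ c : NNReal,
      law M (tens u.split x₁ y) ≤ c • law M (tens u.split x₀ y) →
      RatioStable (law M (tens u.split x₀ y)) (law M (tens u.split x₁ y)) r hr)
    {f : Data (r + 1) l → ℝ} (hf : Measurable f) {C : ℝ} (hC : ∀ d, |f d| ≤ C) (hC0 : 0 ≤ C)
    (hfμ : ∀ φ : Data r l → ℝ, Measurable φ → ∀ b : ℝ, (∀ d, |φ d| ≤ b) →
      ∫ ω, φ (initData hr.le ω) * f (initData hr ω) ∂(law M (tens u.split x y)) = 0) :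
    signedInt M (tens u.split D y) (tens u.split X y) (fun ω => f (initData hr ω)) = 0 := by
  have hDX := isPosTC_add_of_between hD h1 h2
  set t := (tr D).re with ht
  have htx : 1 ≤ t := by
    have := TC_tr_add (hD.of_le (A := D - x) h3 (by simpa using hx.1)) hx.isPosTC
    rw [sub_add_cancel] at this
    rw [ht, this, Complex.add_re, hx.tr_re_eq]
    linarith [(hD.of_le (A := D - x) h3 (by simpa using hx.1)).tr_re_nonneg]
  have ht0 : 0 < t := by linarith
  have hti : 0 ≤ t⁻¹ := (inv_pos.2 ht0).le
  -- `D` and `D + X` are normalized to states; they differ only at the site `u`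
  have hstate : ∀ A : Op u.L, IsPosTC A → (tr A).re = t → IsState (t⁻¹ • A) := fun A hA hAt => by
    refine isState_iff.2 ⟨hA.smul hti, ?_⟩
    have h4 : tr A = (t : ℂ) := by rw [hA.tr_eq, ← hA.tr_re, hAt]
    rw [tr_rsmul, h4, ← Complex.ofReal_mul, inv_mul_cancel₀ ht0.ne', Complex.ofReal_one]
  have hDXt : (tr (D + X)).re = t := by
    rw [tr_add_of_mem hD.mem (mem_of_between hD h1 h2), hX, add_zero]
  have hx₀ := hstate D hD rfl
  have hx₁ := hstate (D + X) hDX hDXt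
  set x₀ := t⁻¹ • D
  set x₁ := t⁻¹ • (D + X)
  let N := comprPOVM u.split hy M
  have hN : ∀ {z : Op u.L}, IsPosTC z → law M (tens u.split z y) = law N z := fun hz =>
    (law_comprPOVM u.split hz hy M).symm
  have hsm : ∀ A : Op u.L, IsPosTC A → law N A = ENNReal.ofReal t • law N (t⁻¹ • A) := fun A hA => by
    rw [← law_smul N (hA.smul hti) ht0.le, smul_smul, mul_inv_cancel₀ ht0.ne', one_smul]
  have s1 : RatioStable (law N x₀) (law N x₁) r hr := by
    have := hst x₀ x₁ hx₀ hx₁ 2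
    rw [hN hx₀.isPosTC, hN hx₁.isPosTC] at this
    refine this ?_
    have h5 := law_mono N hx₁.isPosTC (hx₀.isPosTC.smul zero_le_two) (by
      have : (2 : ℝ) • x₀ - x₁ = t⁻¹ • (D - X) := by
        simp only [x₀, x₁]
        module
      rw [this]
      exact posSemidef_real_smul h1 hti)
    rw [law_smul N hx₀.isPosTC zero_le_two] at h5
    exact h5.trans_eq (by simp [ENNReal.smul_def])
  have s2 : RatioStable (law N x₀) (law N x) r hr := by
    have := hst x₀ x hx₀ hx t.toNNReal
    rw [hN hx₀.isPosTC, hN hx.isPosTC] at this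
    refine this ((law_mono N hx.isPosTC hD h3).trans ?_)
    rw [hsm D hD]
    exact le_rfl
  have hnull' : ∀ B, MeasurableSet B → law N x B = 0 → law N x₁ B = law N x₀ B := by
    intro B hB h0
    have h6 : (trMul X (N.effect B)).re = 0 := by
      refine hnull _ (N.isEffect hB) ?_
      rw [← law_real_apply N hx.isPosTC hB, Measure.real, h0, ENNReal.toReal_zero]
    have h7 := law_real_add_sub (M := N) hD h1 h2 hB
    rw [h6, hsm D hD, hsm (D + X) hDX, measureReal_ennreal_smul_apply,
      measureReal_ennreal_smul_apply, ← mul_sub, ENNReal.toReal_ofReal ht0.le] at h7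
    have h8 := (mul_eq_zero.1 h7).resolve_left ht0.ne'
    exact (ENNReal.toReal_eq_toReal_iff' (measure_ne_top _ _) (measure_ne_top _ _)).1
      (sub_eq_zero.1 h8)
  rw [hN hx.isPosTC] at hfμ
  have key := RatioStable.integral_eq s1 s2 hnull' hf hC hC0 hfμ
  rw [signedInt, ← tens_add_left, hN hDX, hN hD, hsm D hD, hsm (D + X) hDX, integral_smul_measure,
    integral_smul_measure, key, sub_self]

variable {ι : Type} [Fintype ι]

/-- For a local measurement and a product state, the derivative of the mean and the variance of an
estimator are sums of contributions that are attainable by measurements at the single sites. -/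
theorem IsLOCC.exists_momentPair_eq_sum [Countable K] [Nonempty K] {S : Set (LocalSite K)}
    {M : POVM K (Data R l)} (hM : IsLOCC S M) (site : ι → LocalSite K) (hS : S ⊆ Set.range site)
    (hind : ∀ i j, i ≠ j → IsIndepOf (site i) (site j)) {τ : Op K} (hτ : IsState τ)
    {x : ∀ i, Op (site i).L} {y : ∀ i, Op (site i).E} (hx : ∀ i, IsState (x i))
    (hy : ∀ i, IsState (y i)) (hxy : ∀ i, tens (site i).split (x i) (y i) = τ)
    {X : ∀ i, Fin m → Op (site i).L} {D : ∀ i, Op (site i).L} (hD : ∀ i, IsPosTC (D i))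
    (h1 : ∀ i j, (D i - X i j).PosSemidef) (h2 : ∀ i j, (D i + X i j).PosSemidef)
    (h3 : ∀ i, (D i - x i).PosSemidef) (hX : ∀ i j, tr (X i j) = 0)
    (hnull : ∀ i j E, IsEffect E → (trMul (x i) E).re = 0 → (trMul (X i j) E).re = 0)
    {D' dX : Fin m → Op K} (hdX : ∀ j, dX j = ∑ i, tens (site i).split (X i j) (y i))
    (hD' : ∀ j, IsPosTC (D' j)) (h1' : ∀ j, (D' j - dX j).PosSemidef)
    (h2' : ∀ j, (D' j + dX j).PosSemidef) (T : SimpleFunc (Data R l) (Fin m → ℝ)) :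
    ∃ B W : ι → Matrix (Fin m) (Fin m) ℝ, (∀ i, (B i, W i) ∈ closure (Adm (x i) (X i))) ∧
      momentPair M τ D' dX T = (∑ i, B i, ∑ i, W i) := by
  classical
  obtain ⟨s, hsS, hst⟩ := hM.exists_sites
  have hv : ∀ r : Fin R, ∃ i, site i = s r := fun r => hS (hsS r r.2)
  choose v hv using hv
  have hu : ∀ w, ∀ v' ∈ S, v' = site w ∨ IsIndepOf (site w) v' := fun w v' hv' => by
    obtain ⟨i, rfl⟩ := hS hv'
    by_cases h : w = i
    · exact Or.inl (by rw [h])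
    · exact Or.inr (hind w i h)
  have : IsProbabilityMeasure (law M τ) := isProbabilityMeasure_law M hτ
  obtain ⟨C, hC⟩ := T.exists_forall_norm_le
  have hC' : ∀ i ω, |T ω i| ≤ C := fun i ω => (norm_le_pi_norm (T ω) i).trans (hC ω)
  have hC0 : 0 ≤ C := (norm_nonneg _).trans (hC fun _ _ => 0)
  choose a Δ hΔm hΔb hΔ hΔT using fun i => exists_martingale_decomposition (law M τ)
    ((measurable_pi_apply i).comp T.measurable) (hC' i)
  -- `d r` is the martingale increment at the step `r`, `U w` the sum of the increments at the site `w`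
  let d : Fin R → Fin m → Data R l → ℝ := fun r i ω => Δ i r r.2 (initData r.2 ω)
  have hdm : ∀ r i, Measurable (d r i) := fun r i =>
    (hΔm i r r.2).comp (measurable_initData _)
  have hdb : ∀ r i ω, |d r i ω| ≤ 2 * C := fun r i ω => hΔb i r r.2 _
  have hd0 : ∀ r i, ∫ ω, d r i ω ∂(law M τ) = 0 := fun r i => by
    simpa using hΔ i r r.2 (fun _ => 1) measurable_const 1 (fun _ => by simp)
  have hlt : ∀ r r' : Fin R, r < r' → ∀ i j, ∫ ω, d r i ω * d r' j ω ∂(law M τ) = 0 :=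
    fun r r' h i j => hΔ j r' r'.2
      (fun z => Δ i r r.2 (initData (R := r') h z)) ((hΔm i r r.2).comp (measurable_initData _))
      (2 * C) (fun z => hΔb i r r.2 _)
  have hdo : ∀ r r', r ≠ r' → ∀ i j, ∫ ω, d r i ω * d r' j ω ∂(law M τ) = 0 := fun r r' h i j => by
    rcases lt_or_gt_of_ne h with h | h
    · exact hlt r r' h i j
    · simpa only [mul_comm] using hlt r' r h j i
  have hT : ∀ i ω, T ω i = a i + ∑ r, 1 * d r i ω := fun i ω => by
    simpa [d] using hΔT i ω
  let U : ι → Data R l → Fin m → ℝ := fun w ω i => 0 + ∑ r, (if v r = w then 1 else 0) * d r i ω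
  have hUm : ∀ w, Measurable (U w) := fun w => measurable_pi_iff.2 fun i =>
    (Finset.measurable_fun_sum _ fun r _ => (hdm r i).const_mul _).const_add _
  have hUb : ∀ w ω, ‖U w ω‖ ≤ R * (2 * C) := fun w ω => by
    refine (pi_norm_le_iff_of_nonneg (by positivity)).2 fun i => ?_
    simp only [U, zero_add]
    refine (norm_sum_le _ _).trans ?_
    refine (Finset.sum_le_sum (g := fun _ => 2 * C) fun r _ => ?_).trans (by simp)
    rw [norm_mul]
    refine (mul_le_of_le_one_left (norm_nonneg _) ?_).trans (hdb r i ω)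
    split_ifs <;> simp
  have hτpos : ∀ w, tens (site w).split (D w) (y w) |> IsPosTC := fun w =>
    (hD w).tens _ (hy w).isPosTC
  have hbet := fun w j => tens_between (site w).split (h1 w j) (h2 w j) (hD w).1 (hy w).1
    (by simpa using Matrix.PosSemidef.zero : (y w - y w).PosSemidef)
  have htr : ∀ w j, tr (tens (site w).split (X w j) (y w)) = 0 := fun w j => by
    rw [tr_tens _ (mem_of_between (hD w) (h1 w j) (h2 w j)) (hy w).isPosTC.mem, hX, zero_mul]
  -- the derivative at the site `w` does not see the increments at the steps of the other sites
  have hlam0 : ∀ w r, v r ≠ w → ∀ i j, signedInt M (tens (site w).split (D w) (y w))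
      (tens (site w).split (X w j) (y w)) (d r i) = 0 := fun w r hvr i j => by
    refine signedInt_eq_zero_of_ratioStable (hx w) (hy w) (hD w) (h1 w j) (h2 w j) (h3 w) (hX w j)
      (hnull w j) (hr := r.2) (fun x₀ x₁ hx₀ hx₁ c hc => ?_) (hΔm i r r.2) (hΔb i r r.2)
      (by positivity) (fun φ hφ b hb => by rw [hxy w]; exact hΔ i r r.2 φ hφ b hb)
    exact hst (site w) (hu w) x₀ x₁ (y w) hx₀ hx₁ (hy w) c hc r r.2
      (hv r ▸ hind w (v r) fun h => hvr h.symm)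
  have hlam : ∀ w i j, signedInt M (tens (site w).split (D w) (y w))
      (tens (site w).split (X w j) (y w)) (fun ω => T ω i) =
      signedInt M (tens (site w).split (D w) (y w))
        (tens (site w).split (X w j) (y w)) (fun ω => U w ω i) := fun w i j => by
    simp only [hT]
    rw [signedInt_affine (hτpos w) (hbet w j).1 (hbet w j).2 (htr w j) (fun r => hdm r i)
      (fun r => hdb r i), signedInt_affine (hτpos w) (hbet w j).1 (hbet w j).2 (htr w j)
      (fun r => hdm r i) (fun r => hdb r i)]
    refine Finset.sum_congr rfl fun r _ => ?_
    split_ifs with h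
    · rfl
    · rw [hlam0 w r h, mul_zero, mul_zero]
  let N := fun w => comprPOVM (site w).split (hy w) M
  have hN : ∀ w {z : Op (site w).L}, IsPosTC z → law (N w) z = law M (tens (site w).split z (y w)) :=
    fun w z hz => law_comprPOVM _ hz (hy w) M
  have hNint : ∀ w j f, signedInt (N w) (D w) (X w j) f = signedInt M
      (tens (site w).split (D w) (y w)) (tens (site w).split (X w j) (y w)) f := fun w j f => by
    rw [signedInt, signedInt, hN w (hD w), hN w (isPosTC_add_of_between (hD w) (h1 w j) (h2 w j)),
      tens_add_left]
  refine ⟨fun w => (momentPair (N w) (x w) (fun _ => D w) (X w) (U w)).1,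
    fun w => (momentPair (N w) (x w) (fun _ => D w) (X w) (U w)).2, fun w => ?_, ?_⟩
  · refine momentPair_mem_closure_Adm (hx w) (fun _ => hD w) (h1 w) (h2 w) (hX w) (N w) (hUm w) ?_
      fun j => ?_
    · exact integrable_of_abs_le ((hUm w).norm.pow_const 2) (C := (R * (2 * C)) ^ 2) fun ω => by
        rw [abs_of_nonneg (by positivity)]
        exact pow_le_pow_left₀ (norm_nonneg _) (hUb w ω) 2
    · exact integrable_of_abs_le (hUm w).norm (C := R * (2 * C)) fun ω => by
        rw [abs_of_nonneg (norm_nonneg _)]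
        exact hUb w ω
  · refine Prod.ext ?_ ?_
    · ext i j
      dsimp only
      rw [Matrix.sum_apply]
      simp only [momentPair, Matrix.of_apply, hNint, ← hlam]
      rw [signedInt_simpleFunc (hD' j) (h1' j) (h2' j) T fun t => t i]
      have e1 : ∀ w, signedInt M (tens (site w).split (D w) (y w))
          (tens (site w).split (X w j) (y w)) (fun ω => T ω i) = _ := fun w =>
        signedInt_simpleFunc (hτpos w) (hbet w j).1 (hbet w j).2 T fun t => t i
      simp only [e1]
      rw [Finset.sum_comm]
      refine Finset.sum_congr rfl fun k _ => ?_
      rw [← Finset.mul_sum, hdX, (TrSum.sum_left fun w _ => trSum_of_mem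
        (mem_of_between (hτpos w) (hbet w j).1 (hbet w j).2)
        (M.isEffect (T.measurableSet_fiber _))).2, Complex.re_sum]
    · ext i j
      dsimp only
      rw [Matrix.sum_apply]
      have e2 : ∀ w, law (N w) (x w) = law M τ := fun w => by rw [hN w (hx w).isPosTC, hxy w]
      simp only [momentPair, Matrix.of_apply, e2, hT]
      rw [cov_of_orthogonal (law M τ) hdm hdb hd0 hdo a (fun _ => 1) i j]
      have e3 : ∀ w, _ = _ := fun w =>
        cov_of_orthogonal (law M τ) hdm hdb hd0 hdo (fun _ => 0) (fun r => if v r = w then 1 else 0)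
          i j
      simp only [U, e3]
      rw [Finset.sum_comm]
      refine Finset.sum_congr rfl fun r _ => ?_
      rw [← Finset.sum_mul]
      simp

end sites

/-! ### Estimators with local measurements on independent sites -/

section sites

variable {m : ℕ} {K L : Type} {Θ : Set (Par m)} {θ : Par m}

/-- A positive trace class operator above the state and above all the derivatives, up to sign. -/
theorem DiffModel.exists_bound {σ : Par m → Op L} (h : DiffModel Θ σ) (hopen : IsOpen Θ)
    (hθ : θ ∈ Θ) : ∃ D, IsPosTC D ∧ (∀ j, (D - pd σ j θ).PosSemidef) ∧
      (∀ j, (D + pd σ j θ).PosSemidef) ∧ (D - σ θ).PosSemidef := by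
  classical
  have hA : ∀ j, ∃ A, IsPosTC A ∧ (A - pd σ j θ).PosSemidef ∧ (A + pd σ j θ).PosSemidef := fun j => by
    obtain ⟨r, P, N, hP, hN, e, -⟩ := (h.td θ hθ j).exists_TNle (h.eventually_state hopen hθ j)
    refine ⟨P + N, hP.add hN, ?_, ?_⟩
    · rw [e, show P + N - (P - N) = N + N by abel]
      exact hN.1.add hN.1
    · rw [e, show P + N + (P - N) = P + P by abel]
      exact hP.1.add hP.1
  choose A hA h1 h2 using hA
  have hs := (h.state θ hθ).isPosTC
  have hsum : ∀ s : Finset (Fin m), IsPosTC (∑ i ∈ s, A i) := fun s =>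
    isPosTC_sum fun i _ => hA i
  refine ⟨σ θ + ∑ j, A j, hs.add (hsum _), fun j => ?_, fun j => ?_, ?_⟩
  · rw [← Finset.add_sum_erase _ _ (Finset.mem_univ j), show ∀ a b c d : Op L,
      a + (b + c) - d = a + c + (b - d) from fun _ _ _ _ => by abel]
    exact (hs.add (hsum _)).1.add (h1 j)
  · rw [← Finset.add_sum_erase _ _ (Finset.mem_univ j), show ∀ a b c d : Op L,
      a + (b + c) + d = a + c + (b + d) from fun _ _ _ _ => by abel]
    exact (hs.add (hsum _)).1.add (h2 j)
  · rw [add_sub_cancel_left]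
    exact (hsum _).1

variable {ι : Type} [Fintype ι] {R l : ℕ}

/-- For estimators with local measurements on independent sites, the derivative of the mean and
the variance are limits of sums of contributions that are attainable at the single sites. -/
theorem RegularEst.mem_closure_sum_sites [Countable K] [Nonempty K] {S : Set (LocalSite K)}
    {M : POVM K (Data R l)} (hM : IsLOCC S M) (site : ι → LocalSite K) (hS : S ⊆ Set.range site)
    (hind : ∀ i j, i ≠ j → IsIndepOf (site i) (site j)) {τ : Par m → Op K} {T : Data R l → Par m}
    (h : RegularEst Θ τ M T) (hτ : DiffModel Θ τ) (hopen : IsOpen Θ) (hconv : Convex ℝ Θ)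
    (hT : Measurable T) (hθ : θ ∈ Θ) {σ : ∀ i, Par m → Op (site i).L} {y : ∀ i, Op (site i).E}
    (hσ : ∀ i, DiffModel Θ (σ i)) (hy : ∀ i, IsState (y i))
    (hxy : ∀ i, tens (site i).split (σ i θ) (y i) = τ θ)
    (hpd : ∀ j, pd τ j θ = ∑ i, tens (site i).split (pd (σ i) j θ) (y i)) :
    (biasMat τ M T θ, var τ M T θ) ∈
      closure {p | ∃ q : ι → Matrix (Fin m) (Fin m) ℝ × Matrix (Fin m) (Fin m) ℝ,
        (∀ i, q i ∈ Adm (σ i θ) fun j => pd (σ i) j θ) ∧ p = ∑ i, q i} := by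
  obtain ⟨D', hD', h1', h2', hTD, hpair⟩ := h.exists_momentPair hτ hopen hconv hT hθ
  choose D hD h1 h2 h3 using fun i => (hσ i).exists_bound hopen hθ
  rw [hpair]
  refine closure_minimal ?_ isClosed_closure (momentPair_mem_closure_range (hτ.state θ hθ) hD' h1'
    h2' M (measurable_ofLp_comp hT) (h.integrable_sq hT hθ) hTD)
  rintro _ ⟨s, rfl⟩
  obtain ⟨B, W, hBW, e⟩ := hM.exists_momentPair_eq_sum site hS hind (hτ.state θ hθ)
    (fun i => (hσ i).state θ hθ) hy hxy hD h1 h2 h3 (fun i j => (hσ i).tr_pd hopen hθ j)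
    (fun i j E hE h0 => (hσ i).trMul_pd_eq_zero hopen hθ j hE h0) hpd hD' h1' h2' s
  dsimp only
  rw [e]
  have hq : (fun i => (B i, W i)) ∈ closure (Set.univ.pi fun i => Adm (σ i θ) fun j => pd (σ i) j θ) := by
    rw [closure_pi_set]
    exact fun i _ => hBW i
  have hc : Continuous fun q : ι → Matrix (Fin m) (Fin m) ℝ × Matrix (Fin m) (Fin m) ℝ => ∑ i, q i :=
    continuous_finsetSum _ fun i _ => continuous_apply i
  have := image_closure_subset_closure_image hc (Set.mem_image_of_mem _ hq)
  rw [show (∑ i, B i, ∑ i, W i) = ∑ i, (B i, W i) from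
    Prod.ext (by simp [Prod.fst_sum]) (by simp [Prod.snd_sum])]
  refine closure_mono ?_ this
  rintro _ ⟨q, hq, rfl⟩
  exact ⟨q, fun i => hq i trivial, rfl⟩

end sites

section independence

variable {K : Type}

/-- The change of the local system of the site `s` to `l`. -/
def LocalSite.set (s : LocalSite K) (l : s.L) (p : K) : K := s.split.symm (l, (s.split p).2)

/-- Two sites are independent if changes at one site commute with those at the other one, and
are not seen there. -/
theorem IsIndepOf.of_commute [Nonempty K] {u s : LocalSite K}
    (h1 : ∀ l p, (u.split (s.set l p)).1 = (u.split p).1)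
    (h2 : ∀ a p, (s.split (u.set a p)).1 = (s.split p).1)
    (h3 : ∀ l a p, s.set l (u.set a p) = u.set a (s.set l p)) : IsIndepOf u s := by
  obtain ⟨k⟩ := ‹Nonempty K›
  -- any fixed local state of `u` serves to extend an environment index to an index of the full system
  let g : u.E → K := fun b => u.split.symm ((u.split k).1, b)
  have hg : ∀ p, g (u.split p).2 = u.set (u.split k).1 p := fun p => rfl
  refine ⟨fun l b => (u.split (s.set l (g b))).2, fun b => (s.split (g b)).1,
    fun p => by dsimp only; rw [hg, h2], fun l p => Prod.ext (h1 l p) ?_⟩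
  dsimp only
  rw [hg, h3]
  simp [LocalSite.set]

end independence

/-! ### Collective measurements on product states -/

section concrete

variable {m n : ℕ} {I J K L E : Type} {Θ : Set (Par m)} {θ : Par m}

theorem tens_prodComm (e : K ≃ L × E) (x : Op L) (y : Op E) :
    tens (e.trans (Equiv.prodComm L E)) y x = tens e x y := by
  ext p q
  simp only [tens_apply]
  exact mul_comm _ _

theorem IsState.of_tens {e : K ≃ L × E} {x : Op L} {y : Op E} (hx : IsState x)
    (h : IsState (QEst.tens e x y)) : IsState y := by
  have := IsState.ptr (e.trans (Equiv.prodComm L E)) h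
  rwa [← tens_prodComm, ptr_tens, hx.tr_eq, one_smul] at this

theorem kronecker_eq_tens (A : Op I) (B : Op J) : A ⊗ₖ B = tens (Equiv.refl (I × J)) A B := by
  ext p q
  rfl

theorem tensorPow_kronecker (A : Op I) (B : Op J) (n : ℕ) :
    tensorPow (A ⊗ₖ B) n = tens (aliceAll I J n).split (tensorPow A n) (tensorPow B n) := by
  ext p q
  simp only [tensorPow, Matrix.of_apply, Matrix.kroneckerMap_apply,
    Finset.prod_mul_distrib]
  rfl

theorem isIndepOf_aliceAll_bobAll : IsIndepOf (aliceAll I J n) (bobAll I J n) :=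
  ⟨fun l _ => l, fun b => b, fun _ => rfl, fun _ _ => rfl⟩

theorem isIndepOf_bobAll_aliceAll : IsIndepOf (bobAll I J n) (aliceAll I J n) :=
  ⟨fun l _ => l, fun b => b, fun _ => rfl, fun _ _ => rfl⟩

variable {ρa : Par m → Op I} {ρb : Par m → Op J} {R l : ℕ}
  {M : POVM (Fin n → I × J) (Data R l)} {T : Data R l → Par m}

theorem IsState.nonempty {A : Op I} (h : IsState A) : Nonempty I := by
  by_contra hI
  rw [not_nonempty_iff] at hI
  exact zero_ne_one ((hasSum_empty (f := fun i => A i i)).unique h.2)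

/-- Estimators with LOCC measurements on `n` samples. -/
theorem RegularEst.mem_closure_sumAdm_collective [Countable I] [Countable J]
    (hM : IsLOCC (collectiveSites I J n) M)
    (h : RegularEst Θ (fun η => tensorPow (ρa η ⊗ₖ ρb η) n) M T) (ha : DiffModel Θ ρa)
    (hb : DiffModel Θ ρb) (hopen : IsOpen Θ) (hconv : Convex ℝ Θ) (hT : Measurable T)
    (hθ : θ ∈ Θ) :
    (biasMat (fun η => tensorPow (ρa η ⊗ₖ ρb η) n) M T θ,
      var (fun η => tensorPow (ρa η ⊗ₖ ρb η) n) M T θ) ∈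
      closure (SumAdm (tensorPow (ρa θ) n) (fun j => pd (fun η => tensorPow (ρa η) n) j θ)
        (tensorPow (ρb θ) n) (fun j => pd (fun η => tensorPow (ρb η) n) j θ)) := by
  have han := ha.tensorPow hopen n
  have hbn := hb.tensorPow hopen n
  have hτ := han.tens (aliceAll I J n).split hbn hopen
  have : Nonempty (I × J) := (ha.state θ hθ).nonempty.elim fun i =>
    (hb.state θ hθ).nonempty.elim fun j => ⟨(i, j)⟩
  simp only [tensorPow_kronecker] at h ⊢
  let site : Bool → LocalSite (Fin n → I × J) := fun i => if i then aliceAll I J n else bobAll I J n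
  refine closure_mono ?_ (h.mem_closure_sum_sites hM (site := site) (by
      rintro _ (rfl | rfl)
      exacts [⟨true, rfl⟩, ⟨false, rfl⟩]) (by
      rintro (_ | _) (_ | _) hij
      exacts [absurd rfl hij, isIndepOf_bobAll_aliceAll, isIndepOf_aliceAll_bobAll, absurd rfl hij])
    hτ.1 hopen hconv hT hθ
    (σ := fun i => match i with
      | true => fun η => tensorPow (ρa η) n
      | false => fun η => tensorPow (ρb η) n)
    (y := fun i => match i with
      | true => tensorPow (ρb θ) n
      | false => tensorPow (ρa θ) n) ?_ ?_ ?_ ?_)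
  · rintro _ ⟨q, hq, rfl⟩
    exact ⟨q true, hq true, q false, hq false, by simp⟩
  · rintro (_ | _)
    exacts [hbn, han]
  · rintro (_ | _)
    exacts [han.state θ hθ, hbn.state θ hθ]
  · rintro (_ | _)
    exacts [tens_prodComm _ _ _, rfl]
  · intro j
    rw [hτ.2 θ hθ j, Fintype.sum_bool]
    exact congrArg₂ (· + ·) rfl (tens_prodComm (aliceAll I J n).split _ _).symm

/-! ### The sites of the semi-classical measurements -/

theorem set_aliceOne (k : Fin n) (i : I) (p : Fin n → I × J) :
    (aliceOne I J n k).set i p = Function.update p k (i, (p k).2) := by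
  ext q : 1
  change (Equiv.funSplitAt k (I × J)).symm ((i, (p k).2), fun q => p q) q = _
  by_cases h : q = k <;> simp [Equiv.funSplitAt_symm_apply, h]

theorem set_bobOne (k : Fin n) (i : J) (p : Fin n → I × J) :
    (bobOne I J n k).set i p = Function.update p k ((p k).1, i) := by
  ext q : 1
  change (Equiv.funSplitAt k (I × J)).symm (((p k).1, i), fun q => p q) q = _
  by_cases h : q = k <;> simp [Equiv.funSplitAt_symm_apply, h]

/-- The `2n` sites of the semi-classical measurements. -/
def oneSite (I J : Type) (n : ℕ) : Fin n ⊕ Fin n → LocalSite (Fin n → I × J) :=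
  Sum.elim (aliceOne I J n) (bobOne I J n)

theorem isIndepOf_oneSite [Nonempty (Fin n → I × J)] (u s : Fin n ⊕ Fin n) (h : u ≠ s) :
    IsIndepOf (oneSite I J n u) (oneSite I J n s) := by
  rcases u with u | u <;> rcases s with s | s
  · refine IsIndepOf.of_commute (u := aliceOne I J n u) (s := aliceOne I J n s)
      (fun (l : I) p => ?_) (fun (a : I) p => ?_) fun (l : I) (a : I) p => ?_
    · change ((aliceOne I J n s).set l p u).1 = (p u).1
      rw [set_aliceOne]
      grind
    · change ((aliceOne I J n u).set a p s).1 = (p s).1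
      rw [set_aliceOne]
      grind
    · simp only [set_aliceOne]
      grind
  · refine IsIndepOf.of_commute (u := aliceOne I J n u) (s := bobOne I J n s)
      (fun (l : J) p => ?_) (fun (a : I) p => ?_) fun (l : J) (a : I) p => ?_
    · change ((bobOne I J n s).set l p u).1 = (p u).1
      rw [set_bobOne]
      grind
    · change ((aliceOne I J n u).set a p s).2 = (p s).2
      rw [set_aliceOne]
      grind
    · simp only [set_aliceOne, set_bobOne]
      grind
  · refine IsIndepOf.of_commute (u := bobOne I J n u) (s := aliceOne I J n s)
      (fun (l : I) p => ?_) (fun (a : J) p => ?_) fun (l : I) (a : J) p => ?_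
    · change ((aliceOne I J n s).set l p u).2 = (p u).2
      rw [set_aliceOne]
      grind
    · change ((bobOne I J n u).set a p s).1 = (p s).1
      rw [set_bobOne]
      grind
    · simp only [set_aliceOne, set_bobOne]
      grind
  · refine IsIndepOf.of_commute (u := bobOne I J n u) (s := bobOne I J n s)
      (fun (l : J) p => ?_) (fun (a : J) p => ?_) fun (l : J) (a : J) p => ?_
    · change ((bobOne I J n s).set l p u).2 = (p u).2
      rw [set_bobOne]
      grind
    · change ((bobOne I J n u).set a p s).2 = (p s).2
      rw [set_bobOne]
      grind
    · simp only [set_bobOne]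
      grind

/-- The state of all the systems but `k`, in a product of `n` copies. -/
def restOp (ρ : Op (I × J)) (k : Fin n) : Op ({q : Fin n // q ≠ k} → I × J) :=
  Matrix.of fun p q => ∏ i, ρ (p i) (q i)

/-- A product at the site of Alice's share of the sample `k`, with equal states `ρ` of the other
samples. -/
theorem tens_aliceOne (A : Op I) (B : Op J) (ρ : Op (I × J)) (k : Fin n) :
    tens (aliceOne I J n k).split A (tens (Equiv.refl _) B (restOp ρ k)) =
      Matrix.of fun p q => (∏ i ∈ Finset.univ.erase k, ρ (p i) (q i)) * (A ⊗ₖ B) (p k) (q k) := by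
  ext p q
  rw [Matrix.of_apply, Finset.prod_subtype (p := fun i => i ≠ k) _ (by simp)]
  change A (p k).1 (q k).1 * (B (p k).2 (q k).2 * ∏ i : {q : Fin n // q ≠ k}, ρ (p i) (q i)) =
    _ * (A (p k).1 (q k).1 * B (p k).2 (q k).2)
  ring

/-- A product at the site of Bob's share of the sample `k`, with equal states `ρ` of the other samples. -/
theorem tens_bobOne (A : Op I) (B : Op J) (ρ : Op (I × J)) (k : Fin n) :
    tens (bobOne I J n k).split B (tens (Equiv.refl _) A (restOp ρ k)) =
      Matrix.of fun p q => (∏ i ∈ Finset.univ.erase k, ρ (p i) (q i)) * (A ⊗ₖ B) (p k) (q k) := by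
  ext p q
  rw [Matrix.of_apply, Finset.prod_subtype (p := fun i => i ≠ k) _ (by simp)]
  change B (p k).2 (q k).2 * (A (p k).1 (q k).1 * ∏ i : {q : Fin n // q ≠ k}, ρ (p i) (q i)) =
    _ * (A (p k).1 (q k).1 * B (p k).2 (q k).2)
  ring

theorem tensorPow_eq_erase (ρ : Op K) (k : Fin n) : tensorPow ρ n =
    Matrix.of fun p q => (∏ i ∈ Finset.univ.erase k, ρ (p i) (q i)) * ρ (p k) (q k) := by
  ext p q
  exact (Finset.prod_erase_mul _ _ (Finset.mem_univ k)).symm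

theorem DiffModel.pd_tensorPow_apply {ρ : Par m → Op K} (h : DiffModel Θ ρ) (hθ : θ ∈ Θ)
    (n : ℕ) (j : Fin m) (p q : Fin n → K) : pd (fun η => QEst.tensorPow (ρ η) n) j θ p q =
      ∑ k, (∏ i ∈ Finset.univ.erase k, ρ θ (p i) (q i)) * pd ρ j θ (p k) (q k) := by
  have := HasDerivAt.fun_finsetProd (u := Finset.univ) fun (k : Fin n) _ =>
    (h.td θ hθ j).hasDerivAt_entry (p k) (q k)
  exact this.deriv.trans (by simp)

/-- Estimators with semi-classical measurements on `n` samples: since the contributions of the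
samples can be mixed, they are controlled by measurements on one sample. -/
theorem RegularEst.mem_closure_sumAdm_semiclassical [Countable I] [Countable J]
    (hM : IsLOCC (separateSites I J n) M)
    (h : RegularEst Θ (fun η => tensorPow (ρa η ⊗ₖ ρb η) n) M T) (ha : DiffModel Θ ρa)
    (hb : DiffModel Θ ρb) (hopen : IsOpen Θ) (hconv : Convex ℝ Θ) (hT : Measurable T)
    (hθ : θ ∈ Θ) :
    (biasMat (fun η => tensorPow (ρa η ⊗ₖ ρb η) n) M T θ,
      (n : ℝ) • var (fun η => tensorPow (ρa η ⊗ₖ ρb η) n) M T θ) ∈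
      closure (SumAdm (ρa θ) (fun j => pd ρa j θ) (ρb θ) (fun j => pd ρb j θ)) := by
  obtain ⟨hρ, hpd⟩ := ha.tens (Equiv.refl (I × J)) hb hopen
  simp only [← kronecker_eq_tens] at hρ hpd
  have hτ := hρ.tensorPow hopen n
  have : Nonempty (I × J) := (hρ.state θ hθ).nonempty
  have eA : ∀ k, tens (aliceOne I J n k).split (ρa θ)
      (tens (Equiv.refl _) (ρb θ) (restOp (ρa θ ⊗ₖ ρb θ) k)) = tensorPow (ρa θ ⊗ₖ ρb θ) n := fun k => by
    rw [tens_aliceOne, tensorPow_eq_erase _ k]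
  have eB : ∀ k, tens (bobOne I J n k).split (ρb θ)
      (tens (Equiv.refl _) (ρa θ) (restOp (ρa θ ⊗ₖ ρb θ) k)) = tensorPow (ρa θ ⊗ₖ ρb θ) n := fun k => by
    rw [tens_bobOne, tensorPow_eq_erase _ k]
  have hst := hτ.state θ hθ
  have key := h.mem_closure_sum_sites hM (oneSite I J n) (by
      rintro _ (⟨k, rfl⟩ | ⟨k, rfl⟩)
      exacts [⟨.inl k, rfl⟩, ⟨.inr k, rfl⟩]) isIndepOf_oneSite
    hτ hopen hconv hT hθ
    (σ := fun i => match i with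
      | .inl _ => ρa
      | .inr _ => ρb)
    (y := fun i => match i with
      | .inl k => tens (Equiv.refl _) (ρb θ) (restOp (ρa θ ⊗ₖ ρb θ) k)
      | .inr k => tens (Equiv.refl _) (ρa θ) (restOp (ρa θ ⊗ₖ ρb θ) k)) (by
      rintro (k | k)
      exacts [ha, hb]) (by
      rintro (k | k)
      · exact IsState.of_tens (ha.state θ hθ) ((eA k).symm ▸ hst)
      · exact IsState.of_tens (hb.state θ hθ) ((eB k).symm ▸ hst)) (by
      rintro (k | k)
      exacts [eA k, eB k]) (by
      intro j
      rw [Fintype.sum_sum_type]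
      refine Eq.trans ?_ (congrArg₂ (· + ·)
        (Finset.sum_congr rfl fun k _ => (tens_aliceOne (pd ρa j θ) (ρb θ) _ k).symm)
        (Finset.sum_congr rfl fun k _ => (tens_bobOne (ρa θ) (pd ρb j θ) _ k).symm))
      ext p q
      rw [hρ.pd_tensorPow_apply hθ, Matrix.add_apply, Matrix.sum_apply, Matrix.sum_apply,
        ← Finset.sum_add_distrib]
      refine Finset.sum_congr rfl fun k _ => ?_
      rw [hpd θ hθ, Matrix.of_apply, Matrix.of_apply, ← mul_add]
      rfl)
  have hc : Continuous fun p : Matrix (Fin m) (Fin m) ℝ × Matrix (Fin m) (Fin m) ℝ =>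
    (p.1, (n : ℝ) • p.2) := by fun_prop
  refine closure_mono ?_ (image_closure_subset_closure_image hc (Set.mem_image_of_mem _ key))
  rintro _ ⟨_, ⟨q, hq, rfl⟩, rfl⟩
  refine ⟨_, Adm.sum_mix fun k => hq (.inl k), _, Adm.sum_mix fun k => hq (.inr k), ?_⟩
  simp [Fintype.sum_sum_type, Prod.fst_sum, Prod.snd_sum, smul_add]

end concrete

section marginals

variable {m n : ℕ} {I J K L E : Type} {Θ : Set (Par m)}

/-- The marginal of a differentiable product model, by the partial trace. -/
theorem DiffModel.of_tens (e : K ≃ L × E) {σ : Par m → Op L} {σ' : Par m → Op E}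
    (h : DiffModel Θ fun η => QEst.tens e (σ η) (σ' η)) (hσ' : ∀ η ∈ Θ, IsState (σ' η))
    (hopen : IsOpen Θ) : DiffModel Θ σ :=
  ((h.ptr e hopen).1.congr hopen fun η hη => by
    rw [ptr_tens, (hσ' η hη).tr_eq, one_smul]).1

theorem Dominated.of_tens (e : K ≃ L × E) {σ : Par m → Op L} {σ' : Par m → Op E}
    (hd : Dominated Θ fun η => QEst.tens e (σ η) (σ' η))
    (h : DiffModel Θ fun η => QEst.tens e (σ η) (σ' η)) (hσ' : ∀ η ∈ Θ, IsState (σ' η))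
    (hopen : IsOpen Θ) : Dominated Θ σ :=
  (hd.ptr e h hopen).congr ((h.ptr e hopen).1.congr hopen fun η hη => by
    rw [ptr_tens, (hσ' η hη).tr_eq, one_smul]).2

theorem Dominated.of_tensorPow {ρ : Par m → Op I} (hd : Dominated Θ fun η => QEst.tensorPow (ρ η) (n + 1))
    (h : DiffModel Θ ρ) (hopen : IsOpen Θ) : Dominated Θ ρ := by
  have h' := h.tensorPow hopen (n + 1)
  simp only [tensorPow_succ] at hd h'
  exact hd.of_tens _ h' (fun η hη => isState_tensorPow (h.state η hη) n) hopen

variable {ρa : Par m → Op I} {ρb : Par m → Op J}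

theorem Dominated.marginals (hd : Dominated Θ fun η => ρa η ⊗ₖ ρb η) (ha : DiffModel Θ ρa)
    (hb : DiffModel Θ ρb) (hopen : IsOpen Θ) : Dominated Θ ρa ∧ Dominated Θ ρb := by
  have h := (ha.tens (Equiv.refl (I × J)) hb hopen).1
  simp only [kronecker_eq_tens] at hd
  refine ⟨hd.of_tens _ h hb.state hopen, ?_⟩
  simp only [← tens_prodComm (Equiv.refl (I × J))] at hd h
  exact hd.of_tens _ h ha.state hopen

/-- The marginal models of a regular model are differentiable in trace norm. -/
theorem RegularModel.marginals (hreg : RegularModel Θ fun η => ρa η ⊗ₖ ρb η)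
    (ha : ∀ η ∈ Θ, IsState (ρa η)) (hb : ∀ η ∈ Θ, IsState (ρb η)) (hopen : IsOpen Θ) :
    DiffModel Θ ρa ∧ DiffModel Θ ρb := by
  have h : DiffModel Θ fun η => ρa η ⊗ₖ ρb η :=
    ⟨fun η hη => (ha η hη).tens (Equiv.refl (I × J)) (hb η hη), fun η hη i =>
      hasTD_of_hasPD (σ := fun η => ρa η ⊗ₖ ρb η) (hreg.hasPD η hη i)⟩
  simp only [kronecker_eq_tens] at h
  refine ⟨h.of_tens _ hb hopen, ?_⟩
  simp only [← tens_prodComm (Equiv.refl (I × J))] at h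
  exact h.of_tens _ ha hopen

end marginals

/-! ### Combining estimators of the two marginal models -/

section combine

variable {m n : ℕ} {I J : Type} {Θ : Set (Par m)} {ρa : Par m → Op I} {ρb : Par m → Op J}
  {θ : Par m} {B W G : Matrix (Fin m) (Fin m) ℝ}

/-- The sums of pairs of derivative and variance of estimators of `n` copies of the two marginal
models. -/
abbrev SumAdmPow (ρa : Par m → Op I) (ρb : Par m → Op J) (θ : Par m) (n : ℕ) :
    Set (Matrix (Fin m) (Fin m) ℝ × Matrix (Fin m) (Fin m) ℝ) :=
  SumAdm (tensorPow (ρa θ) n) (fun j => pd (fun η => tensorPow (ρa η) n) j θ)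
    (tensorPow (ρb θ) n) (fun j => pd (fun η => tensorPow (ρb η) n) j θ)

/-- The projector onto the space of those parameters that are identifiable in at least one of the
two marginal models. -/
def jointProj (ρa : Par m → Op I) (ρb : Par m → Op J) (θ : Par m) : Matrix (Fin m) (Fin m) ℝ :=
  pinv (identProj ρa θ + identProj ρb θ) * (identProj ρa θ + identProj ρb θ)

theorem identProj_posSemidef (ρ : Par m → Op I) (θ : Par m) : (identProj ρ θ).PosSemidef := by
  have := Matrix.posSemidef_conjTranspose_mul_self (identProj ρ θ)
  rwa [(identProj_isHermitian (ρ := ρ)).eq, identProj_mul_self] at this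

theorem jointProj_mulVec_eq_zero (v : Fin m → ℝ) :
    jointProj ρa ρb θ *ᵥ v = 0 ↔ identProj ρa θ *ᵥ v = 0 ∧ identProj ρb θ *ᵥ v = 0 :=
  (pinv_mul_mulVec_eq_zero (identProj_isHermitian.add identProj_isHermitian) v).trans
    (posSemidef_add_mulVec_eq_zero (identProj_posSemidef _ _) (identProj_posSemidef _ _) v)

theorem jointProj_isHermitian : (jointProj ρa ρb θ).IsHermitian :=
  (pinv_spec (identProj_isHermitian.add identProj_isHermitian)).2.2.2

theorem jointProj_mul_self : jointProj ρa ρb θ * jointProj ρa ρb θ = jointProj ρa ρb θ :=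
  pinv_mul_self_idem (identProj_isHermitian.add identProj_isHermitian)

/-- Estimators do not react to the directions that are identifiable in neither of the models. -/
theorem sumAdmPow_mul_jointProj (ha : DiffModel Θ ρa) (hb : DiffModel Θ ρb) (hopen : IsOpen Θ)
    (hθ : θ ∈ Θ) (h : (B, W) ∈ closure (SumAdmPow ρa ρb θ n)) : B * jointProj ρa ρb θ = B := by
  have hcl : IsClosed {p : Matrix (Fin m) (Fin m) ℝ × Matrix (Fin m) (Fin m) ℝ |
      p.1 * jointProj ρa ρb θ = p.1} := isClosed_eq (by fun_prop) (by fun_prop)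
  refine closure_minimal ?_ hcl h
  rintro - ⟨⟨B₁, W₁⟩, h₁, ⟨B₂, W₂⟩, h₂, rfl⟩
  have e1 := admPow_mul_identProj ha hopen hθ h₁
  have e2 := admPow_mul_identProj hb hopen hθ h₂
  change (B₁ + B₂) * jointProj ρa ρb θ = B₁ + B₂
  refine mul_eq_of_mulVec jointProj_mul_self fun v hv => ?_
  obtain ⟨h3, h4⟩ := (jointProj_mulVec_eq_zero v).1 hv
  rw [Matrix.add_mulVec, ← e1, ← e2, ← Matrix.mulVec_mulVec, ← Matrix.mulVec_mulVec, h3, h4,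
    Matrix.mulVec_zero, Matrix.mulVec_zero, add_zero]

theorem sumAdmPow_one (ha : DiffModel Θ ρa) (hb : DiffModel Θ ρb) (hopen : IsOpen Θ) (hθ : θ ∈ Θ)
    (h : (B, W) ∈ closure (SumAdm (ρa θ) (fun j => pd ρa j θ) (ρb θ) (fun j => pd ρb j θ))) :
    (B, W) ∈ closure (SumAdmPow ρa ρb θ 1) := by
  refine closure_mono ?_ h
  rintro - ⟨q, h₁, q', h₂, rfl⟩
  exact ⟨q, admPow_one ha hopen hθ h₁, q', admPow_one hb hopen hθ h₂, rfl⟩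

theorem sumAdmPow_average (ha : DiffModel Θ ρa) (hb : DiffModel Θ ρb) (hopen : IsOpen Θ)
    (hθ : θ ∈ Θ) (h : (B, W) ∈ closure (SumAdmPow ρa ρb θ n)) (r q : ℕ) :
    (B, ((q : ℝ) + 1)⁻¹ • W) ∈ closure (SumAdmPow ρa ρb θ (n * (q + 1) + r)) := by
  have hc : Continuous fun p : Matrix (Fin m) (Fin m) ℝ × Matrix (Fin m) (Fin m) ℝ =>
    (p.1, ((q : ℝ) + 1)⁻¹ • p.2) := by fun_prop
  refine closure_mono ?_ (image_closure_subset_closure_image hc (Set.mem_image_of_mem _ h))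
  rintro _ ⟨_, ⟨p, h₁, p', h₂, rfl⟩, rfl⟩
  exact ⟨_, admPow_average ha hopen hθ h₁ r q, _, admPow_average hb hopen hθ h₂ r q,
    Prod.ext rfl (smul_add _ _ _)⟩

/-- The lower bound for `n` copies in terms of any sum of estimators of the marginal models. The
constant `U`, which controls the effect of the bias, does not depend on `n`. -/
theorem exists_marginalInf_le (ha : DiffModel Θ ρa) (hb : DiffModel Θ ρb) (da : Dominated Θ ρa)
    (db : Dominated Θ ρb) (hopen : IsOpen Θ) (hconv : Convex ℝ Θ) (hθ : θ ∈ Θ)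
    (hG : G.PosSemidef) : ∃ U : Matrix (Fin m) (Fin m) ℝ, ∀ n B W, 0 < n →
      (B, W) ∈ closure (SumAdmPow ρa ρb θ n) → ∀ p : ℝ, 0 < p → p < 1 →
      marginalInf Θ ρa ρb G θ n ≤ ((1 / (1 - p) * (G * W).trace + 1 / p * ((n : ℝ)⁻¹ *
        (G * ((jointProj ρa ρb θ - B) * U * (jointProj ρa ρb θ - B)ᵀ)).trace) : ℝ) : EReal) := by
  obtain ⟨U, hU⟩ := exists_adm_identProj ha hopen hθ
  obtain ⟨U', hU'⟩ := exists_adm_identProj hb hopen hθ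
  set Z := pinv (identProj ρa θ + identProj ρb θ) with hZ
  refine ⟨Z * (U + U') * Zᵀ, fun n B W hn h p hp0 hp1 => ?_⟩
  obtain ⟨q, rfl⟩ : ∃ q, n = q + 1 := ⟨n - 1, by omega⟩
  have h1 := admPow_average ha hopen hθ hU 0 q
  have h2 := admPow_average hb hopen hθ hU' 0 q
  rw [one_mul, add_zero] at h1 h2
  have han := ha.tensorPow hopen (q + 1)
  have hbn := hb.tensorPow hopen (q + 1)
  have key := le_trace_of_mem_closure_sumAdm (han.state θ hθ) (hbn.state θ hθ) hG
    identProj_isHermitian identProj_mul_self identProj_isHermitian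
    identProj_mul_self (fun B W => admPow_mul_identProj ha hopen hθ)
    (fun B W => admPow_mul_identProj hb hopen hθ) h1 h2 (c := marginalInf Θ ρa ρb G θ (q + 1))
    (fun V V' hV hV' => sInf_le ⟨V, mem_variances_of_Adm hopen han
      (da.tensorPow ha hopen hconv _) hθ hV, V', mem_variances_of_Adm hopen hbn
      (db.tensorPow hb hopen hconv _) hθ hV', rfl⟩) hp0 hp1 h
  refine key.trans_eq (congrArg _ ?_)
  change (G * ((1 / (1 - p)) • W + (1 / p) • ((jointProj ρa ρb θ - B) * Z *
    (((q : ℝ) + 1)⁻¹ • U + ((q : ℝ) + 1)⁻¹ • U') * ((jointProj ρa ρb θ - B) * Z)ᵀ))).trace = _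
  rw [← smul_add, Matrix.transpose_mul]
  simp only [mul_add, add_mul, Matrix.trace_add, Matrix.mul_smul, Matrix.smul_mul, Matrix.trace_smul,
    smul_eq_mul, mul_assoc, Nat.cast_add, Nat.cast_one]

/-- The two properties of the variance matrices of regular estimators that enter the comparison: they
are approximated by estimators with finitely many outcomes, and their kernel is contained in that of
the transpose of the derivative of the mean. -/
theorem mem_variances_mem_closure {ρ : Par m → Op I} {P V : Matrix (Fin m) (Fin m) ℝ}
    (hm : DiffModel Θ ρ) (hopen : IsOpen Θ) (hconv : Convex ℝ Θ) (hθ : θ ∈ Θ)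
    (hV : V ∈ variances Θ ρ P θ) : (P, V) ∈ closure (Adm (ρ θ) fun j => pd ρ j θ) ∧
      ∀ u, V *ᵥ u = 0 → Pᵀ *ᵥ u = 0 := by
  obtain ⟨l, M, T, hT, h, rfl, rfl⟩ := hV
  obtain ⟨D, hD, h1, h2, hTD, hpair⟩ := h.exists_momentPair hm hopen hconv hT hθ
  refine ⟨?_, fun u => h.biasMat_transpose_mulVec hm hopen hconv hT hθ⟩
  rw [hpair]
  exact momentPair_mem_closure_Adm (hm.state θ hθ) hD h1 h2 (fun j => hm.tr_pd hopen hθ j) M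
    (measurable_ofLp_comp hT) (h.integrable_sq hT hθ) hTD

theorem posSemidef_of_mem_closure_Adm {L : Type} {S : Op L} {X : Fin m → Op L} (hS : IsState S)
    (h : (B, W) ∈ closure (Adm S X)) : W.PosSemidef := by
  refine Matrix.PosSemidef.of_dotProduct_mulVec_nonneg ?_ fun v => ?_
  · have hcl : IsClosed {p : Matrix (Fin m) (Fin m) ℝ × Matrix (Fin m) (Fin m) ℝ | p.2ᴴ = p.2} :=
      isClosed_eq (by fun_prop) (by fun_prop)
    exact closure_minimal (fun p hp => (Adm.posSemidef hS hp).1) hcl h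
  · have hcl : IsClosed {p : Matrix (Fin m) (Fin m) ℝ × Matrix (Fin m) (Fin m) ℝ |
        0 ≤ star v ⬝ᵥ (p.2 *ᵥ v)} := isClosed_le (by fun_prop) (by fun_prop)
    exact closure_minimal (fun p hp => (Adm.posSemidef hS hp).dotProduct_mulVec_nonneg v) hcl h

/-- If the kernel of the variance is contained in that of the projector, then the information about the
identifiable directions is nondegenerate. -/
theorem proj_pinv_mulVec_eq_zero {P V : Matrix (Fin m) (Fin m) ℝ} (hP : P.IsHermitian)
    (hP2 : P * P = P) (hV : V.PosSemidef) (hker : ∀ u, V *ᵥ u = 0 → Pᵀ *ᵥ u = 0)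
    (v : Fin m → ℝ) : (P * pinv V * P) *ᵥ v = 0 ↔ P *ᵥ v = 0 := by
  have hPt : Pᵀ = P := by rw [← real_conjTranspose, hP.eq]
  constructor
  · intro h
    have h1 : (P *ᵥ v) ⬝ᵥ (pinv V *ᵥ (P *ᵥ v)) = 0 := by
      rw [← dotProduct_mulVec_comm hP, Matrix.mulVec_mulVec, Matrix.mulVec_mulVec, h,
        dotProduct_zero]
    have h2 := posSemidef_mulVec_eq_zero (pinv_posSemidef hV) h1
    have h3 : V *ᵥ (P *ᵥ v) = 0 := by
      rw [← pinv_mul_mulVec_eq_zero hV.1, ← mul_pinv_eq hV.1 (pinv_spec hV.1).2.2.2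
        (pinv_mul_self_idem hV.1) fun v => (pinv_mul_mulVec_eq_zero hV.1 v).symm,
        ← Matrix.mulVec_mulVec, h2, Matrix.mulVec_zero]
    have h4 := hker _ h3
    rwa [hPt, Matrix.mulVec_mulVec, hP2] at h4
  · intro h
    rw [← Matrix.mulVec_mulVec, h, Matrix.mulVec_zero]

/-- The generalized inverse of the total information is attained, in the limit, by a sum of
estimators of the marginal models: the optimal linear combination. -/
theorem pinv_mem_closure_sumAdmPow (ha : DiffModel Θ ρa) (hb : DiffModel Θ ρb) (hopen : IsOpen Θ)
    (hconv : Convex ℝ Θ) (hθ : θ ∈ Θ) {V V' : Matrix (Fin m) (Fin m) ℝ}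
    (hV : V ∈ variances Θ (fun η => tensorPow (ρa η) n) (identProj ρa θ) θ)
    (hV' : V' ∈ variances Θ (fun η => tensorPow (ρb η) n) (identProj ρb θ) θ) :
    (identProj ρa θ * pinv V * identProj ρa θ +
        identProj ρb θ * pinv V' * identProj ρb θ).PosSemidef ∧
      (jointProj ρa ρb θ, pinv (identProj ρa θ * pinv V * identProj ρa θ +
        identProj ρb θ * pinv V' * identProj ρb θ)) ∈ closure (SumAdmPow ρa ρb θ n) := by
  have han := ha.tensorPow hopen n
  have hbn := hb.tensorPow hopen n
  obtain ⟨h1, hk⟩ := mem_variances_mem_closure han hopen hconv hθ hV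
  obtain ⟨h2, hk'⟩ := mem_variances_mem_closure hbn hopen hconv hθ hV'
  have hp := posSemidef_of_mem_closure_Adm (han.state θ hθ) h1
  have hp' := posSemidef_of_mem_closure_Adm (hbn.state θ hθ) h2
  have hP := identProj_isHermitian (ρ := ρa) (θ := θ)
  have hP' := identProj_isHermitian (ρ := ρb) (θ := θ)
  have hP2 := identProj_mul_self (ρ := ρa) (θ := θ)
  have hP2' := identProj_mul_self (ρ := ρb) (θ := θ)
  have hE : jointProj ρa ρb θ = _ := rfl
  have hker := jointProj_mulVec_eq_zero (ρa := ρa) (ρb := ρb) (θ := θ)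
  set P := identProj ρa θ
  set P' := identProj ρb θ
  -- the estimator `J⁺ (P V⁺ T + P' V'⁺ T')` with the total information `J` has the derivative `J⁺ J`
  -- and the variance `J⁺ J J⁺ = J⁺`
  have q1 : (P * pinv V * P).PosSemidef := by
    simpa only [hP.eq] using (pinv_posSemidef hp).mul_mul_conjTranspose_same P
  have q2 : (P' * pinv V' * P').PosSemidef := by
    simpa only [hP'.eq] using (pinv_posSemidef hp').mul_mul_conjTranspose_same P'
  set j := P * pinv V * P with hj
  set j' := P' * pinv V' * P' with hj'
  have hJ : (j + j').PosSemidef := q1.add q2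
  have hJE : pinv (j + j') * (j + j') = jointProj ρa ρb θ :=
    pinv_mul_eq hJ.1 jointProj_isHermitian jointProj_mul_self fun v => by
      rw [posSemidef_add_mulVec_eq_zero q1 q2, hker, hj, hj', proj_pinv_mulVec_eq_zero hP hP2 hp hk,
        proj_pinv_mulVec_eq_zero hP' hP2' hp' hk']
  refine ⟨hJ, ?_⟩
  have hc : Continuous fun p : (Matrix (Fin m) (Fin m) ℝ × Matrix (Fin m) (Fin m) ℝ) ×
      (Matrix (Fin m) (Fin m) ℝ × Matrix (Fin m) (Fin m) ℝ) =>
    (pinv (j + j') * P * pinv V * p.1.1 + pinv (j + j') * P' * pinv V' * p.2.1,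
      pinv (j + j') * P * pinv V * p.1.2 * (pinv (j + j') * P * pinv V)ᵀ +
      pinv (j + j') * P' * pinv V' * p.2.2 * (pinv (j + j') * P' * pinv V')ᵀ) := by fun_prop
  have hmem : ((P, V), (P', V')) ∈ closure ((AdmPow ρa θ n) ×ˢ (AdmPow ρb θ n)) := by
    rw [closure_prod_eq]
    exact ⟨h1, h2⟩
  have key := image_closure_subset_closure_image hc (Set.mem_image_of_mem _ hmem)
  have ht : ∀ {P V : Matrix (Fin m) (Fin m) ℝ}, P.IsHermitian → V.IsHermitian →
      pinv (j + j') * P * pinv V * V * (pinv (j + j') * P * pinv V)ᵀ =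
        pinv (j + j') * (P * pinv V * P) * pinv (j + j') := fun {P V} hP hV => by
    have e1 : (pinv (j + j'))ᵀ = pinv (j + j') := by
      rw [← real_conjTranspose, (pinv_isHermitian _).eq]
    have e2 : Pᵀ = P := by rw [← real_conjTranspose, hP.eq]
    have e3 : (pinv V)ᵀ = pinv V := by rw [← real_conjTranspose, (pinv_isHermitian _).eq]
    rw [Matrix.transpose_mul, Matrix.transpose_mul, e1, e2, e3]
    have e4 := (pinv_spec hV).2.1
    calc _ = pinv (j + j') * P * (pinv V * V * pinv V) * P * pinv (j + j') := by
          simp only [mul_assoc]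
      _ = _ := by rw [e4]; simp only [mul_assoc]
  dsimp only at key
  rw [ht hP hp.1, ht hP' hp'.1, ← hj, ← hj', ← add_mul, ← mul_add, (pinv_spec hJ.1).2.1,
    show pinv (j + j') * P * pinv V * P = pinv (j + j') * j by rw [hj]; simp only [mul_assoc],
    show pinv (j + j') * P' * pinv V' * P' = pinv (j + j') * j' by rw [hj']; simp only [mul_assoc],
    ← mul_add, hJE] at key
  refine closure_mono ?_ key
  rintro _ ⟨⟨⟨B₁, W₁⟩, ⟨B₂, W₂⟩⟩, ⟨h₁, h₂⟩, rfl⟩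
  exact ⟨_, Adm.mul h₁ _, _, Adm.mul h₂ _, rfl⟩

end combine

/-! ### The asymptotic bounds -/

section mse

variable {m : ℕ} {I Ω : Type} [MeasurableSpace Ω] {Θ : Set (Par m)} {σ : Par m → Op I}
  {M : POVM I Ω} {T : Ω → Par m} {θ : Par m}

/-- The mean square error is the sum of the variance and of the square of the bias. -/
theorem RegularEst.mse_eq (h : RegularEst Θ σ M T) (hσ : IsState (σ θ)) (hT : Measurable T)
    (hθ : θ ∈ Θ) : mse σ M T θ = var σ M T θ +
      Matrix.vecMulVec (fun i => mean σ M T θ i - θ i) (fun i => mean σ M T θ i - θ i) := by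
  have hTm := measurable_ofLp_comp hT
  have hprob := isProbabilityMeasure_law M hσ
  have hsq := h.integrable_sq hT hθ
  have hint := integrable_norm_of_sq hTm hsq
  set P := law M (σ θ) with hP
  set μ : Fin m → ℝ := fun i => mean σ M T θ i with hμ
  have hcoord : ∀ i, Integrable (fun ω => T ω i) P := fun i => integrable_coord hTm hint i
  have hprod : ∀ i j, Integrable (fun ω => T ω i * T ω j) P := fun i j => by
    refine hsq.mono' (((measurable_pi_apply i).comp hTm).mul
      ((measurable_pi_apply j).comp hTm)).aestronglyMeasurable (Eventually.of_forall fun ω => ?_)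
    rw [norm_mul, pow_two]
    exact mul_le_mul (norm_le_pi_norm (T ω).ofLp i) (norm_le_pi_norm (T ω).ofLp j) (norm_nonneg _)
      (norm_nonneg _)
  have key : ∀ (a : Fin m → ℝ) i j, ∫ ω, (T ω i - a i) * (T ω j - a j) ∂P =
      ∫ ω, T ω i * T ω j ∂P - a j * μ i - a i * μ j + a i * a j := fun a i j => by
    have e : ∀ ω, (T ω i - a i) * (T ω j - a j) =
        T ω i * T ω j - a j * T ω i - a i * T ω j + a i * a j := fun ω => by ring
    simp only [e]
    have i1 := (hcoord i).const_mul (a j)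
    have i2 := (hcoord j).const_mul (a i)
    have i3 : Integrable (fun ω => T ω i * T ω j - a j * T ω i) P := (hprod i j).sub i1
    have i4 : Integrable (fun ω => T ω i * T ω j - a j * T ω i - a i * T ω j) P := i3.sub i2
    rw [integral_add i4 (integrable_const _), integral_sub i3 i2, integral_sub (hprod i j) i1, integral_const_mul,
      integral_const_mul]
    simp [hμ, mean, hP]
  ext i j
  rw [Matrix.add_apply, mse, var, Matrix.of_apply, Matrix.of_apply, Matrix.vecMulVec_apply]
  have e1 := key θ.ofLp i j
  have e2 := key μ i j
  rw [e1, e2]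
  ring

theorem RegularEst.trace_mul_var_le (h : RegularEst Θ σ M T) (hσ : IsState (σ θ))
    (hT : Measurable T) (hθ : θ ∈ Θ) {G : Matrix (Fin m) (Fin m) ℝ} (hG : G.PosSemidef) :
    (G * var σ M T θ).trace ≤ (G * mse σ M T θ).trace := by
  rw [h.mse_eq hσ hT hθ, mul_add, Matrix.trace_add]
  have := trace_mul_nonneg hG (Matrix.posSemidef_vecMulVec_self_star
    fun i => mean σ M T θ i - θ i)
  rw [star_trivial] at this
  linarith

end mse

section bounds

variable {m : ℕ} {I J : Type} {Θ : Set (Par m)} {ρa : Par m → Op I} {ρb : Par m → Op J}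
  {θ : Par m} {G : Matrix (Fin m) (Fin m) ℝ}

theorem marginalInf_nonneg (ha : DiffModel Θ ρa) (hb : DiffModel Θ ρb) (hopen : IsOpen Θ)
    (hconv : Convex ℝ Θ) (hθ : θ ∈ Θ) (hG : G.PosSemidef) (n : ℕ) :
    0 ≤ marginalInf Θ ρa ρb G θ n := by
  refine le_sInf ?_
  rintro _ ⟨V, hV, V', hV', rfl⟩
  exact EReal.coe_nonneg.2 (trace_mul_nonneg hG (pinv_posSemidef
    (pinv_mem_closure_sumAdmPow ha hb hopen hconv hθ hV hV').1))

/-- Optimal estimators for `n` copies can be repeated on blocks of `n` copies. -/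
theorem eventually_mul_marginalInf_lt (ha : DiffModel Θ ρa) (hb : DiffModel Θ ρb)
    (hopen : IsOpen Θ) (hconv : Convex ℝ Θ) (hθ : θ ∈ Θ) (hG : G.PosSemidef) {n : ℕ} (hn : 0 < n)
    {b : ℝ} (h : (n : EReal) * marginalInf Θ ρa ρb G θ n < b) :
    ∀ᶠ N : ℕ in atTop, (N : EReal) * marginalInf Θ ρa ρb G θ N < b := by
  have hn' : (0 : ℝ) < n := Nat.cast_pos.2 hn
  have hlt : marginalInf Θ ρa ρb G θ n < ((b / n : ℝ) : EReal) := by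
    have h0 := marginalInf_nonneg ha hb hopen hconv hθ hG n
    have hcast : (n : EReal) = ((n : ℝ) : EReal) := rfl
    generalize marginalInf Θ ρa ρb G θ n = x at h h0
    induction x with
    | bot => exact absurd h0 (by simp)
    | top =>
      rw [hcast, EReal.coe_mul_top_of_pos hn'] at h
      exact absurd h (by simp)
    | coe x =>
      rw [hcast, ← EReal.coe_mul, EReal.coe_lt_coe_iff] at h
      rw [EReal.coe_lt_coe_iff, lt_div_iff₀ hn']
      linarith
  obtain ⟨_, ⟨V, hV, V', hV', rfl⟩, hlt⟩ := sInf_lt_iff.1 hlt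
  rw [EReal.coe_lt_coe_iff, lt_div_iff₀ hn'] at hlt
  obtain ⟨l, M, T, -, hreg, -⟩ := id hV
  obtain ⟨l', M', T', -, hreg', -⟩ := id hV'
  obtain ⟨k, rfl⟩ : ∃ k, n = k + 1 := ⟨n - 1, by omega⟩
  have da := hreg.dominated.of_tensorPow ha hopen
  have db := hreg'.dominated.of_tensorPow hb hopen
  obtain ⟨hJ, hmem⟩ := pinv_mem_closure_sumAdmPow ha hb hopen hconv hθ hV hV'
  set C := pinv (identProj ρa θ * pinv V * identProj ρa θ +
    identProj ρb θ * pinv V' * identProj ρb θ)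
  set n := k + 1 with hnk
  set t := (G * C).trace with ht
  have ht0 : 0 ≤ t := trace_mul_nonneg hG (pinv_posSemidef hJ)
  obtain ⟨U, hU⟩ := exists_marginalInf_le ha hb da db hopen hconv hθ hG
  -- `N` copies contain `N / n = q + 1` blocks, so that `N a_N ≤ (N / (q + 1)) t → n t`
  have hdiv := Nat.tendsto_div_const_atTop hn.ne'
  have hlim : Tendsto (fun N : ℕ => n * t + n * t / ((N / n : ℕ) : ℝ)) atTop (𝓝 (n * t + 0)) :=
    tendsto_const_nhds.add (tendsto_const_nhds.div_atTop (tendsto_natCast_atTop_atTop.comp hdiv))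
  have hev := hlim.eventually (gt_mem_nhds (by linarith : n * t + 0 < b))
  filter_upwards [hev, eventually_ge_atTop n] with N hN hNn
  obtain ⟨q, hq⟩ : ∃ q, N / n = q + 1 :=
    ⟨N / n - 1, by have := Nat.div_pos hNn hn; omega⟩
  have hNeq : N = n * (q + 1) + N % n := by rw [← hq]; exact (Nat.div_add_mod N n).symm
  have hq0 : (0 : ℝ) < (q : ℝ) + 1 := by positivity
  have hmemN := sumAdmPow_average ha hb hopen hθ hmem (N % n) q
  rw [← hNeq] at hmemN
  have hle : marginalInf Θ ρa ρb G θ N ≤ ((((q : ℝ) + 1)⁻¹ * t : ℝ) : EReal) := by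
    have hc : Tendsto (fun p : ℝ => ((1 / (1 - p) * (((q : ℝ) + 1)⁻¹ * t) : ℝ) : EReal)) (𝓝[>] 0)
        (𝓝 ((1 / (1 - 0) * (((q : ℝ) + 1)⁻¹ * t) : ℝ) : EReal)) := by
      refine (continuous_coe_real_ereal.tendsto _).comp (Tendsto.mono_left ?_ nhdsWithin_le_nhds)
      exact ((tendsto_const_nhds.div (tendsto_const_nhds.sub tendsto_id) (by norm_num)).mul_const _)
    rw [sub_zero, div_one, one_mul] at hc
    refine ge_of_tendsto hc ?_
    filter_upwards [Ioo_mem_nhdsGT (zero_lt_one (α := ℝ))] with p hp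
    refine (hU N _ _ (hn.trans_le hNn) hmemN p hp.1 hp.2).trans_eq ?_
    simp [ht]
  have hN' : (N : ℝ) ≤ n * (q + 1) + n := by
    have h1 := (Nat.mod_lt N hn).le
    have h2 : N ≤ n * (q + 1) + n := by omega
    exact_mod_cast h2
  have hfin : (N : ℝ) * (((q : ℝ) + 1)⁻¹ * t) < b := by
    rw [hq] at hN
    push_cast at hN
    refine lt_of_le_of_lt ?_ hN
    calc (N : ℝ) * (((q : ℝ) + 1)⁻¹ * t) ≤ (n * (q + 1) + n) * (((q : ℝ) + 1)⁻¹ * t) := by gcongr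
      _ = _ := by rw [hnk]; push_cast; field_simp
  calc (N : EReal) * marginalInf Θ ρa ρb G θ N
      ≤ (N : EReal) * ((((q : ℝ) + 1)⁻¹ * t : ℝ) : EReal) :=
        mul_le_mul_of_nonneg_left hle (by positivity)
    _ = (((N : ℝ) * (((q : ℝ) + 1)⁻¹ * t) : ℝ) : EReal) := (EReal.coe_mul _ _).symm
    _ < b := EReal.coe_lt_coe_iff.2 hfin

/-- The limit of the combined bounds of the marginal models is their infimum. -/
theorem tendsto_mul_marginalInf (ha : DiffModel Θ ρa) (hb : DiffModel Θ ρb)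
    (hopen : IsOpen Θ) (hconv : Convex ℝ Θ) (hθ : θ ∈ Θ) (hG : G.PosSemidef) :
    Tendsto (fun n : ℕ => (n : EReal) * marginalInf Θ ρa ρb G θ n) atTop
      (𝓝 (⨅ (n : ℕ) (_ : 0 < n), (n : EReal) * marginalInf Θ ρa ρb G θ n)) := by
  refine tendsto_order.2 ⟨fun b hlt => ?_, fun b hlt => ?_⟩
  · filter_upwards [eventually_gt_atTop 0] with n hn
    exact hlt.trans_le (iInf₂_le n hn)
  · obtain ⟨r, h1, h2⟩ := EReal.lt_iff_exists_real_btwn.1 hlt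
    obtain ⟨n, h3⟩ := iInf_lt_iff.1 h1
    obtain ⟨hn, h4⟩ := iInf_lt_iff.1 h3
    filter_upwards [eventually_mul_marginalInf_lt ha hb hopen hconv hθ hG hn h4] with N hN
    exact hN.trans h2

/-- Passage to the limit in the lower bounds: the terms that come from the bias vanish as `n → ∞`
because `B n → E`, and the factor `1 / (1 - p)` as `p → 0`. -/
theorem le_limsup_of_forall {u : ℕ → EReal} {L : EReal} (hu : Tendsto u atTop (𝓝 L)) {x y : ℕ → ℝ}
    (hxy : ∀ n, x n ≤ y n) {B : ℕ → Matrix (Fin m) (Fin m) ℝ} {E U : Matrix (Fin m) (Fin m) ℝ}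
    (hB : Tendsto B atTop (𝓝 E))
    (h : ∀ p : ℝ, 0 < p → p < 1 → ∀ᶠ n in atTop, u n ≤
      ((1 / (1 - p) * x n + 1 / p * (G * ((E - B n) * U * (E - B n)ᵀ)).trace : ℝ) : EReal)) :
    L ≤ limsup (fun n => (y n : EReal)) atTop := by
  refine EReal.le_of_forall_lt_iff_le.1 fun s hs => ?_
  have hys : ∀ᶠ n in atTop, y n < s :=
    (eventually_lt_of_limsup_lt hs).mono fun n hn => EReal.coe_lt_coe_iff.1 hn
  -- `n → ∞` for fixed `p`, then `p → 0`
  have hp : ∀ p : ℝ, 0 < p → p < 1 → L ≤ ((1 / (1 - p) * s : ℝ) : EReal) := fun p h0 h1 => by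
    have hc : Continuous fun B : Matrix (Fin m) (Fin m) ℝ =>
        1 / (1 - p) * s + 1 / p * (G * ((E - B) * U * (E - B)ᵀ)).trace := by fun_prop
    have hlim := (continuous_coe_real_ereal.comp hc).continuousAt.tendsto.comp hB
    simp only [Function.comp_def, sub_self, zero_mul, mul_zero, Matrix.trace_zero, add_zero] at hlim
    refine le_of_tendsto_of_tendsto hu hlim ?_
    filter_upwards [h p h0 h1, hys] with n hn hns
    refine hn.trans (EReal.coe_le_coe_iff.2 ?_)
    have : 0 ≤ 1 / (1 - p) := by
      have : 0 < 1 - p := by linarith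
      positivity
    have h2 := mul_le_mul_of_nonneg_left ((hxy n).trans hns.le) this
    linarith
  have hc : Tendsto (fun p : ℝ => ((1 / (1 - p) * s : ℝ) : EReal)) (𝓝[>] 0)
      (𝓝 ((1 / (1 - 0) * s : ℝ) : EReal)) := by
    refine (continuous_coe_real_ereal.tendsto _).comp (Tendsto.mono_left ?_ nhdsWithin_le_nhds)
    exact ((tendsto_const_nhds.div (tendsto_const_nhds.sub tendsto_id) (by norm_num)).mul_const _)
  rw [sub_zero, div_one, one_mul] at hc
  refine ge_of_tendsto hc ?_
  filter_upwards [Ioo_mem_nhdsGT (zero_lt_one (α := ℝ))] with p h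
  exact hp p h.1 h.2

/-- Asymptotic unbiasedness forces every parameter to be identifiable. -/
theorem tendsto_jointProj {B : ℕ → Matrix (Fin m) (Fin m) ℝ}
    (hB : ∀ i j, Tendsto (fun n => B n i j) atTop (𝓝 ((1 : Matrix (Fin m) (Fin m) ℝ) i j)))
    (h : ∀ n, B n * jointProj ρa ρb θ = B n) : Tendsto B atTop (𝓝 (jointProj ρa ρb θ)) := by
  have h1 : Tendsto B atTop (𝓝 1) := tendsto_pi_nhds.2 fun i => tendsto_pi_nhds.2 fun j => hB i j
  have h2 := h1.mul_const (jointProj ρa ρb θ)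
  simp only [h, one_mul] at h2
  exact h2

/-- For semi-classical measurements the comparison is with one copy for every `n`. -/
theorem le_semiclassicalLOCCBound [Countable I] [Countable J] (ha : DiffModel Θ ρa)
    (hb : DiffModel Θ ρb) (hopen : IsOpen Θ) (hconv : Convex ℝ Θ) (hθ : θ ∈ Θ)
    (hG : G.PosSemidef) :
    marginalInf Θ ρa ρb G θ 1 ≤ semiclassicalLOCCBound Θ (fun η => ρa η ⊗ₖ ρb η) G θ := by
  have hρ : DiffModel Θ fun η => ρa η ⊗ₖ ρb η := (ha.tens (Equiv.refl (I × J)) hb hopen).1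
  refine le_sInf ?_
  rintro _ ⟨R, l, M, T, hM, hT, hreg, -, hB, rfl⟩
  obtain ⟨da, db⟩ := ((hreg 1).dominated.of_tensorPow (n := 0) hρ hopen).marginals ha hb hopen
  obtain ⟨U, hU⟩ := exists_marginalInf_le ha hb da db hopen hconv hθ hG
  have hmem := fun n => sumAdmPow_one ha hb hopen hθ
    ((hreg n).mem_closure_sumAdm_semiclassical (hM n) ha hb hopen hconv (hT n) hθ)
  refine le_limsup_of_forall tendsto_const_nhds (fun n => mul_le_mul_of_nonneg_left
    ((hreg n).trace_mul_var_le ((hρ.tensorPow hopen n).state θ hθ) (hT n) hθ hG) n.cast_nonneg)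
    (tendsto_jointProj (hB θ hθ) fun n => sumAdmPow_mul_jointProj ha hb hopen hθ (hmem n))
    (U := U) (G := G) fun p h0 h1 => Eventually.of_forall fun n =>
      (hU 1 _ _ one_pos (hmem n) p h0 h1).trans_eq (congrArg _ ?_)
  rw [Matrix.mul_smul, Matrix.trace_smul, smul_eq_mul, Nat.cast_one, inv_one, one_mul]

/-- For collective measurements the comparison is with `n` copies of the marginal models. -/
theorem le_collectiveLOCCBound [Countable I] [Countable J] (ha : DiffModel Θ ρa)
    (hb : DiffModel Θ ρb) (hopen : IsOpen Θ) (hconv : Convex ℝ Θ) (hθ : θ ∈ Θ)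
    (hG : G.PosSemidef) {c : EReal}
    (hc : Tendsto (fun n : ℕ => (n : EReal) * marginalInf Θ ρa ρb G θ n) atTop (𝓝 c)) :
    c ≤ collectiveLOCCBound Θ (fun η => ρa η ⊗ₖ ρb η) G θ := by
  have hρ : DiffModel Θ fun η => ρa η ⊗ₖ ρb η := (ha.tens (Equiv.refl (I × J)) hb hopen).1
  refine le_sInf ?_
  rintro _ ⟨R, l, M, T, hM, hT, hreg, -, hB, rfl⟩
  obtain ⟨da, db⟩ := ((hreg 1).dominated.of_tensorPow (n := 0) hρ hopen).marginals ha hb hopen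
  obtain ⟨U, hU⟩ := exists_marginalInf_le ha hb da db hopen hconv hθ hG
  have hmem := fun n =>
    (hreg n).mem_closure_sumAdm_collective (hM n) ha hb hopen hconv (hT n) hθ
  refine le_limsup_of_forall hc (fun n => mul_le_mul_of_nonneg_left
    ((hreg n).trace_mul_var_le ((hρ.tensorPow hopen n).state θ hθ) (hT n) hθ hG) n.cast_nonneg)
    (tendsto_jointProj (hB θ hθ) fun n => sumAdmPow_mul_jointProj ha hb hopen hθ (hmem n))
    (U := U) (G := G) fun p h0 h1 => ?_
  filter_upwards [eventually_gt_atTop 0] with n hn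
  have hn' : (n : ℝ) ≠ 0 := (Nat.cast_pos.2 hn).ne'
  refine (mul_le_mul_of_nonneg_left (hU n _ _ hn (hmem n) p h0 h1) (by positivity)).trans_eq ?_
  rw [show (n : EReal) = ((n : ℝ) : EReal) from rfl, ← EReal.coe_mul]
  congr 1
  field_simp

end bounds

end QEst

end

theorem mainTheorem4 {I J : Type} [Countable I] [Countable J] {m : ℕ}
    (Θ : Set (QEst.Par m)) (hopen : IsOpen Θ) (hconv : Convex ℝ Θ)
    (ρa : QEst.Par m → QEst.Op I) (ρb : QEst.Par m → QEst.Op J)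
    (ha : ∀ θ ∈ Θ, QEst.IsState (ρa θ)) (hb : ∀ θ ∈ Θ, QEst.IsState (ρb θ))
    (hreg : QEst.RegularModel Θ (fun θ => ρa θ ⊗ₖ ρb θ))
    (θ : QEst.Par m) (hθ : θ ∈ Θ)
    (G : Matrix (Fin m) (Fin m) ℝ) (hG : G.PosSemidef) :
    QEst.marginalInf Θ ρa ρb G θ 1 ≤
        QEst.semiclassicalLOCCBound Θ (fun θ => ρa θ ⊗ₖ ρb θ) G θ ∧
      ∃ c : EReal,
        Tendsto (fun n : ℕ => (n : EReal) * QEst.marginalInf Θ ρa ρb G θ n) atTop (𝓝 c) ∧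
        c ≤ QEst.collectiveLOCCBound Θ (fun θ => ρa θ ⊗ₖ ρb θ) G θ := by
  obtain ⟨ma, mb⟩ := hreg.marginals ha hb hopen
  have hlim := QEst.tendsto_mul_marginalInf ma mb hopen hconv hθ hG
  exact ⟨QEst.le_semiclassicalLOCCBound ma mb hopen hconv hθ hG, _, hlim,
    QEst.le_collectiveLOCCBound ma mb hopen hconv hθ hG hlim⟩
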